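/- **Geometry.** Let $\Omega\subset\mathbb R^2$ be a bounded Lipschitz domain, $\Omega_1$ an open set with $\bar\Omega_1\subset\Omega$ whose boundary $\Gamma=\partial\Omega_1$ is Lipschitz and piecewise $C^2$, and $\Omega_2=\Omega\setminus\bar\Omega_1$. Points near which $\Gamma$ is not $C^2$ are called singular. Fix $\delta_0\in(0,1/2)$, $\alpha_0>0$ and mesh regularity constants $\sigma,\rho$. **Mesh.** Let $\mathcal M$ be a finite Cartesian mesh of $\Omega$ (disjoint open axis-parallel rectangles $K\subset\Omega$ whose closures cover $\bar\Omega$; hanging nodes allowed), $h_K=\mathrm{diam}\,K$, $K_i=K\cap\Omega_i$, $\mathcal M^\Gamma=\{K\in\mathcal M:K\cap\Gamma\ne\emptyset\}$. The ratio of the side lengths of each element is at most $\sigma$, and $h_K\le\rho h_{K'}$ whenever $K,K'$ share an edge of positive length. The set $\Gamma\cap\partial K$ has zero length for every $K$. For each $K\in\mathcal M^\Gamma$, $\Gamma_K=\Gamma\cap K$ is connected, $\Gamma$ crosses $\partial K$ at exactly two points, lying on different open sides, and $K$ contains at most one singular point of $\Gamma$. Below, a vertex or a side of $K$ is said to be in,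 or to meet, $\Omega_i$ if it lies in, or meets, $\bar\Omega_i$. Each $K\in\mathcal M^\Gamma$ is large with respect to both $\Omega_1,\Omega_2$: for $i=1,2$, $|e\cap\bar\Omega_i|\ge\delta_0|e|$ for every side $e$ of $K$ meeting $\Omega_i$; and if $K$ has only one vertex $A$ in $\Omega_i$ and contains a singular point $Q$ (then $K$ is called irregular with respect to $\Omega_i$, otherwise regular), then $\mathrm{dist}(Q,e_j)\ge\frac12\delta_0\min(|e_1|,|e_2|)$ for the two sides $e_1,e_2$ of $K$ ending at $A$. *Interface deviation.* Let $\mathrm{dist}_{\rm H}(S,T)=\sup_{x\in S}\inf_{y\in T}|x-y|$, and let $d(A,PQ)$ be the distance of $A$ to the straight line through $P,Q$. Let $B,C$ be the points of $\Gamma\cap\partial K$. If $K$ is regular with respect to $\Omega_i$, put $\eta^i_K=\mathrm{dist}_{\rm H}(\Gamma_K,[B,C])/\max_A d(A,BC)$, the maximum being over the vertices $A$ of $K$ in $\Omega_i$. If $K$ is irregular with respect to $\Omega_i$, with vertex $A$ and singular point $Q$, let $\Gamma_{1K},\Gamma_{2K}$ be the arcs of $\Gamma$ in $\bar K$ between $Q$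 and $B$, and between $Q$ and $C$, and put $$\eta_K^i=\max\Bigl(\frac{\mathrm{dist}_{\rm H}(\Gamma_{1K},[Q,B])}{d(A,QB)},\frac{\mathrm{dist}_{\rm H}(\Gamma_{2K},[Q,C])}{d(A,QC)}\Bigr).$$ Let $\eta_K=\max(\eta_K^1,\eta_K^2)$. The mesh satisfies the condition (HH): $\eta_K\le\max\bigl(\frac12,\frac{1-\delta_0}{1+\delta_0}\bigr)$ for all $K\in\mathcal M^\Gamma$. **Space and edges.** Let $p\ge1$, let $Q_p(K)$ be the polynomials of degree at most $p$ in each variable, and $\mathbb X_p(\mathcal M)=\{v_1\chi_{\Omega_1}+v_2\chi_{\Omega_2}: v_i|_K\in Q_p(K)\ \forall K\in\mathcal M\}$, with broken gradient $\nabla_hv|_{K_i}=\nabla v_i$. Let $\mathcal E=\mathcal E^{\rm side}\cup\mathcal E^\Gamma\cup\mathcal E^{\rm bdy}$, consisting of the edges $\partial K\cap\partial K'$, the curves $\Gamma_K$ $(K\in\mathcal M^\Gamma)$ and the sets $\partial K\cap\partial\Omega$. Each edge carries a unit normal $n$: fixed arbitrarily on $\mathcal E^{\rm side}$, outer to $\Omega_1$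 on $\mathcal E^\Gamma$, outer to $\Omega$ on $\mathcal E^{\rm bdy}$. With $v_\pm$ the trace from the side of $\pm n$, put $[v]=v_--v_+$ on $\mathcal E^{\rm side}\cup\mathcal E^\Gamma$, $[v]=v_-$ on $\mathcal E^{\rm bdy}$, and $\hat r=\beta_er_-+(1-\beta_e)r_+$, where $\beta_e\in\{0,1\}$ is arbitrary on $\mathcal E^{\rm side}\cup\mathcal E^\Gamma$ and $\beta_e=1$ on $\mathcal E^{\rm bdy}$. Write $(\cdot,\cdot)_{\mathcal M}$ and $\langle\cdot,\cdot\rangle_{\mathcal E}$ for the sums over elements, resp. edges, of the $L^2$ inner products, and $\|\cdot\|_{\mathcal M}$, $\|\cdot\|_{\mathcal E}$ for the corresponding norms. The lifting $\mathsf L(v)\in[\mathbb X_p(\mathcal M)]^2$ is defined by $(r,\mathsf L(v))_{\mathcal M}=\langle\hat r\cdot n,[v]\rangle_{\mathcal E}$ for all $r\in[\mathbb X_p(\mathcal M)]^2$. **Penalty.** Let $a=a_1\chi_{\Omega_1}+a_2\chi_{\Omega_2}$, $a_1,a_2>0$, and $\mathsf T(t)=t+\sqrt{t^2-1}$. For $K\in\mathcal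 M^\Gamma$ put $a_K=\frac{a_1+a_2}2$, $\Theta_K=\mathsf T\bigl(\frac{1+3\eta_K}{1-\eta_K}\bigr)^{4p}$; for $K\subset\Omega_i$ put $a_K=a_i$, $\Theta_K=1$. On $e\in\mathcal E$ let $$\alpha|_e=\alpha_0\,\max\{a_K:e\cap\bar K\ne\emptyset\}\,\max\{\Theta_K:e\cap\bar K\neq\emptyset\}\,h_e^{-1}p^2,$$ with $h_e=\frac{h_K+h_{K'}}2$ on $\partial K\cap\partial K'$ and $h_e=h_K$ on $\Gamma_K$ and on $\partial K\cap\partial\Omega$. Let $\mathcal E^{\rm side}_i$ be the set of edges $\partial K\cap\partial K'$ such that $K$ and $K'$ both meet $\Omega_i$ in the strict sense $K_i\neq\emptyset$, $K_i'\ne\emptyset$, and put $$\langle\alpha[v],[w]\rangle_{\bar{\mathcal E}}=\sum_{i=1}^2\langle\alpha[v_i],[w_i]\rangle_{\mathcal E_i^{\rm side}}+\langle\alpha[v],[w]\rangle_{\mathcal E^\Gamma\cup\mathcal E^{\rm bdy}},$$ $$a_h(v,w)=(a(\nabla_hv-\mathsf L(v)),\nabla_hw-\mathsf L(w))_{\mathcal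 M}+\langle\alpha[v],[w]\rangle_{\bar{\mathcal E}},\qquad \|v\|_{\rm DG}^2=\|a^{1/2}\nabla_hv\|_{\mathcal M}^2+\langle\alpha[v],[v]\rangle_{\bar{\mathcal E}}.$$ **Theorem.** For all $\Omega,\Omega_1,\delta_0,\alpha_0,\sigma,\rho$ as above there is a constant $c_{\mathsf L}>0$, depending only on these (hence independent of $p$, of $a$, of the mesh beyond its regularity constants, and of the choice of normals and fluxes), such that for all such meshes $\mathcal M$, all $a_1,a_2>0$, $p\ge1$, all choices of normals and of the $\beta_e$, and all $v\in\mathbb X_p(\mathcal M)$: the lifting $\mathsf L(v)$ exists, $$\|a^{1/2}\mathsf L(v)\|_{\mathcal M}\le c_{\mathsf L}\,\|\alpha^{1/2}[v]\|_{\mathcal E},\qquad\text{and}\qquad a_h(v,v)\ge(4+c_{\mathsf L}^2)^{-1}\|v\|_{\rm DG}^2 .$$ -/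

import Mathlib

open MeasureTheory

namespace UnfittedLDG

noncomputable section

/-- The plane with its Euclidean norm. -/
abbrev Plane : Type := EuclideanSpace ℝ (Fin 2)

/-! ### Lipschitz and piecewise `C²` boundaries -/

/-- Near `x`, and in rotated coordinates centred at `x`, the set `U` is the strict subgraph of `φ`
(inside the box of half-sides `r` and `s`). -/
def IsGraphChart (U : Set Plane) (x : Plane) (R : Plane ≃ₗᵢ[ℝ] Plane) (r s : ℝ) (φ : ℝ → ℝ) :
    Prop :=
  0 < r ∧ 0 < s ∧ ContinuousOn φ (Set.Ioo (-r) r) ∧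
    ∀ y : Plane, |R (y - x) 0| < r → |R (y - x) 1| < s →
      (y ∈ U ↔ R (y - x) 1 < φ (R (y - x) 0))

/-- Bounded open sets with Lipschitz boundary. -/
structure IsLipschitzDomain (U : Set Plane) : Prop where
  isOpen : IsOpen U
  bounded : Bornology.IsBounded U
  chart : ∀ x ∈ frontier U, ∃ (R : Plane ≃ₗᵢ[ℝ] Plane) (r s : ℝ) (C : NNReal) (φ : ℝ → ℝ),
    IsGraphChart U x R r s φ ∧ LipschitzOnWith C φ (Set.Ioo (-r) r)

/-- Bounded open sets whose boundary is Lipschitz and piecewise `C²`: locally the boundary is the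
graph of a Lipschitz function which is `C²`, up to the base point, on either side of it. -/
structure IsPiecewiseC2Domain (U : Set Plane) : Prop where
  isOpen : IsOpen U
  bounded : Bornology.IsBounded U
  chart : ∀ x ∈ frontier U, ∃ (R : Plane ≃ₗᵢ[ℝ] Plane) (r s : ℝ) (C : NNReal) (φ : ℝ → ℝ),
    IsGraphChart U x R r s φ ∧ LipschitzOnWith C φ (Set.Ioo (-r) r) ∧
      ContDiffOn ℝ 2 φ (Set.Ioc (-r) 0) ∧ ContDiffOn ℝ 2 φ (Set.Ico 0 r)

/-- The singular points of `∂U`: those near which `∂U` is not the graph of a `C²` function. -/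
def singularPoints (U : Set Plane) : Set Plane :=
  {x ∈ frontier U | ¬ ∃ (R : Plane ≃ₗᵢ[ℝ] Plane) (r s : ℝ) (φ : ℝ → ℝ),
    IsGraphChart U x R r s φ ∧ ContDiffOn ℝ 2 φ (Set.Ioo (-r) r)}

/-- `ν` is the unit outer normal to `U` at the boundary point `x`: the blow-up of `U` at `x` is the
half-plane `{z | ⟪z, ν⟫ < 0}`. Such a `ν` is unique if it exists. -/
def IsOuterNormal (U : Set Plane) (x ν : Plane) : Prop :=
  ‖ν‖ = 1 ∧ ∀ ε > 0, ∃ r > 0, ∀ y ∈ Metric.ball x r,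
    (ε * ‖y - x‖ < inner ℝ (y - x) ν → y ∉ U) ∧
    (inner ℝ (y - x) ν < -(ε * ‖y - x‖) → y ∈ U)

open Classical in
/-- The unit outer normal field to `U` (zero at corners, a finite set for the domains used here). -/
def outerNormal (U : Set Plane) (x : Plane) : Plane :=
  if h : ∃ ν, IsOuterNormal U x ν then h.choose else 0

/-! ### Rectangles and the position of the interface in a rectangle -/

/-- An open rectangle with sides parallel to the axes, given by its two extreme corners. -/
structure Rect where
  lo : Fin 2 → ℝ
  hi : Fin 2 → ℝ
  lt : ∀ j, lo j < hi j

namespace Rect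

/-- The open rectangle as a set of points. -/
def carrier (K : Rect) : Set Plane := {x | ∀ j, K.lo j < x j ∧ x j < K.hi j}

/-- Length of the sides parallel to the `j`-th axis. -/
def len (K : Rect) (j : Fin 2) : ℝ := K.hi j - K.lo j

/-- The diameter `h_K`. -/
def diam (K : Rect) : ℝ := Metric.diam K.carrier

/-- The end value of the `j`-th coordinate: the upper one if `s = true`, else the lower one. -/
def endpt (K : Rect) (j : Fin 2) (s : Bool) : ℝ := if s then K.hi j else K.lo j

/-- The four vertices. -/
def vertex (K : Rect) (s : Fin 2 → Bool) : Plane := WithLp.toLp 2 fun j => K.endpt j (s j)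

/-- The four open sides: the `j`-th coordinate is fixed, the other one is strictly inside. -/
def side (K : Rect) (j : Fin 2) (s : Bool) : Set Plane :=
  {x | x j = K.endpt j s ∧ ∀ k, k ≠ j → K.lo k < x k ∧ x k < K.hi k}

end Rect

/-- `Ω₁` and `Ω₂ = Ω \ closure Ω₁`, numbered `0` and `1`. -/
def subdomain (Ω Ω₁ : Set Plane) (i : Fin 2) : Set Plane :=
  if i = 0 then Ω₁ else Ω \ closure Ω₁

/-- `K` is an interface element: the open rectangle meets `Γ = ∂Ω₁`. -/
def IsInterfaceElement (Ω₁ : Set Plane) (K : Rect) : Prop := (K.carrier ∩ frontier Ω₁).Nonempty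

/-- The interface crosses the boundary of `K` exactly twice, at two different open sides,
`Γ ∩ K` being one arc between the two crossing points. -/
def CrossesTwice (Ω₁ : Set Plane) (K : Rect) : Prop :=
  IsConnected (frontier Ω₁ ∩ K.carrier) ∧
  ∃ (j k : Fin 2) (s t : Bool) (B C : Plane), (j, s) ≠ (k, t) ∧
    B ∈ K.side j s ∧ C ∈ K.side k t ∧ frontier Ω₁ ∩ frontier K.carrier = {B, C} ∧
    (K.side j s ∩ Ω₁).Nonempty ∧ (K.side j s \ closure Ω₁).Nonempty ∧
    (K.side k t ∩ Ω₁).Nonempty ∧ (K.side k t \ closure Ω₁).Nonempty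

/-- `K` has only one vertex on the side of `Ω_i`. (Vertices of interface elements never lie on `Γ`;
the closure is taken because they may lie on `∂Ω`.) -/
def OneVertex (Ω Ω₁ : Set Plane) (i : Fin 2) (K : Rect) : Prop :=
  ∃! s : Fin 2 → Bool, K.vertex s ∈ closure (subdomain Ω Ω₁ i)

/-- The interface element `K` is large with respect to `Ω_i`, with constant `δ₀`. -/
def IsLarge (Ω Ω₁ : Set Plane) (δ₀ : ℝ) (i : Fin 2) (K : Rect) : Prop :=
  (∀ j s, (K.side j s ∩ closure (subdomain Ω Ω₁ i)).Nonempty →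
    ENNReal.ofReal δ₀ * μH[1] (K.side j s) ≤
      μH[1] (K.side j s ∩ closure (subdomain Ω Ω₁ i))) ∧
  (OneVertex Ω Ω₁ i K → ∀ Q ∈ singularPoints Ω₁ ∩ K.carrier,
    ∀ s, K.vertex s ∈ closure (subdomain Ω Ω₁ i) →
      ∀ j, δ₀ / 2 * min (K.len 0) (K.len 1) ≤ Metric.infDist Q (K.side j (s j)))

/-- The (irregular) case: only one vertex in `Ω_i`, and a singular point of `Γ` inside `K`. -/
def IsIrregular (Ω Ω₁ : Set Plane) (i : Fin 2) (K : Rect) : Prop :=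
  OneVertex Ω Ω₁ i K ∧ (singularPoints Ω₁ ∩ K.carrier).Nonempty

/-- `max_{x ∈ S} min_{y ∈ T} |x - y|`. -/
def distH (S T : Set Plane) : ℝ := sSup ((fun x => Metric.infDist x T) '' S)

/-- Distance of `A` to the straight line through `P` and `Q`, that is, the height over the base
`PQ` of the triangle with vertices `A`, `P`, `Q`. -/
def lineDist (A P Q : Plane) : ℝ := Metric.infDist A (affineSpan ℝ {P, Q} : Set Plane)

/-- The deviations `dist_H(Γ_K, Γ_K^h) / dist(A, Γ_K^h)`, `A` being the vertex in `Ω_i`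
farthest from the chord, or, in the irregular case, the same ratios for the two arcs between the
singular point `Q` and the crossing points `B` of `Γ` and `∂K`, and their chords. -/
def deviationSet (Ω Ω₁ : Set Plane) (i : Fin 2) (K : Rect) : Set ℝ :=
  {η | ¬ IsIrregular Ω Ω₁ i K ∧ ∃ B C, B ≠ C ∧ frontier Ω₁ ∩ frontier K.carrier = {B, C} ∧
      η = distH (frontier Ω₁ ∩ K.carrier) (segment ℝ B C) /
        sSup {d | ∃ s, K.vertex s ∈ closure (subdomain Ω Ω₁ i) ∧ d = lineDist (K.vertex s) B C}} ∪
  {η | IsIrregular Ω Ω₁ i K ∧ ∃ B ∈ frontier Ω₁ ∩ frontier K.carrier,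
    ∃ Q ∈ singularPoints Ω₁ ∩ K.carrier, ∃ s, K.vertex s ∈ closure (subdomain Ω Ω₁ i) ∧
      η = distH (connectedComponentIn ((frontier Ω₁ ∩ closure K.carrier) \ {Q}) B)
          (segment ℝ Q B) / lineDist (K.vertex s) Q B}

/-- The interface deviation `η_K`, the maximum over both subdomains. -/
def deviation (Ω Ω₁ : Set Plane) (K : Rect) : ℝ :=
  max (sSup (deviationSet Ω Ω₁ 0 K)) (sSup (deviationSet Ω Ω₁ 1 K))

/-! ### Meshes -/

/-- Two different elements share an edge (of positive length). -/
def Adjacent (K K' : Rect) : Prop :=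
  K ≠ K' ∧ 0 < μH[1] (frontier K.carrier ∩ frontier K'.carrier)

/-- Cartesian meshes of `Ω`, hanging nodes allowed, with mesh regularity constants `σ` (aspect
ratio of the elements) and `ρ` (size ratio of elements that share an edge). The interface elements
are large with respect to both subdomains and satisfy the interface-deviation condition. -/
structure IsAdmissibleMesh (Ω Ω₁ : Set Plane) (δ₀ σ ρ : ℝ) (M : Finset Rect) : Prop where
  subset : ∀ K ∈ M, K.carrier ⊆ Ω
  disjoint : ∀ K ∈ M, ∀ K' ∈ M, K ≠ K' → Disjoint K.carrier K'.carrier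
  cover : closure Ω = ⋃ K ∈ M, closure K.carrier
  aspect : ∀ K ∈ M, ∀ j k, K.len j ≤ σ * K.len k
  comparable : ∀ K ∈ M, ∀ K' ∈ M, Adjacent K K' → K.diam ≤ ρ * K'.diam
  /-- The interface is covered, up to finitely many points, by the open elements. -/
  interface_skeleton : ∀ K ∈ M, μH[1] (frontier Ω₁ ∩ frontier K.carrier) = 0
  crosses : ∀ K ∈ M, IsInterfaceElement Ω₁ K → CrossesTwice Ω₁ K
  one_singular : ∀ K ∈ M, (singularPoints Ω₁ ∩ K.carrier).Subsingleton
  large : ∀ K ∈ M, IsInterfaceElement Ω₁ K → ∀ i, IsLarge Ω Ω₁ δ₀ i K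
  deviation_le : ∀ K ∈ M, IsInterfaceElement Ω₁ K →
    deviation Ω Ω₁ K ≤ max (1 / 2) ((1 - δ₀) / (1 + δ₀))

/-- `sides` lists every edge shared by two elements exactly once, as an ordered pair `(K₋, K₊)`:
the chosen normal of the edge points from `K₋` to `K₊`. -/
def IsOrientedSides (M : Finset Rect) (sides : Finset (Rect × Rect)) : Prop :=
  (∀ e ∈ sides, e.1 ∈ M ∧ e.2 ∈ M ∧ Adjacent e.1 e.2) ∧
  ∀ K ∈ M, ∀ K' ∈ M, Adjacent K K' → Xor ((K, K') ∈ sides) ((K', K) ∈ sides)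

/-- The unit normal to `∂K ∩ ∂K'` pointing from `K` to `K'`, for adjacent disjoint rectangles. -/
def sideNormal (e : Rect × Rect) : Plane :=
  WithLp.toLp 2 fun j =>
    if e.1.hi j = e.2.lo j then 1 else if e.1.lo j = e.2.hi j then -1 else 0

/-! ### Piecewise polynomial functions -/

/-- The data of a function `v = v₁ χ_{Ω₁} + v₂ χ_{Ω₂}` with `v_i|_K` a polynomial: `v K i` is the
polynomial `v_i|_K`. -/
abbrev Broken : Type := Rect → Fin 2 → MvPolynomial (Fin 2) ℝ

/-- Value of a polynomial at a point of the plane. -/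
def evalAt (q : MvPolynomial (Fin 2) ℝ) (x : Plane) : ℝ := MvPolynomial.eval (fun j => x j) q

/-- `v ∈ 𝕏_p(M)`: every `v_i|_K` has degree at most `p` in each variable. -/
def InX (M : Finset Rect) (p : ℕ) (v : Broken) : Prop :=
  ∀ K ∈ M, ∀ i j, MvPolynomial.degreeOf j (v K i) ≤ p

/-- The broken gradient `∇_h v`, by components. -/
def grad (v : Broken) : Fin 2 → Broken := fun j K i => MvPolynomial.pderiv j (v K i)

open Classical in
/-- The trace of `v|_K` at a point of `∂K` (off the interface): `v₁|_K` on the side of `Ω₁`,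
`v₂|_K` on the side of `Ω₂`, which here includes the points of `∂Ω`. -/
def traceFrom (Ω₁ : Set Plane) (v : Broken) (K : Rect) (x : Plane) : ℝ :=
  if x ∈ closure Ω₁ then evalAt (v K 0) x else evalAt (v K 1) x

/-! ### The method -/

/-- The function `𝖳(t) = t + √(t² - 1)`. -/
def bigT (t : ℝ) : ℝ := t + Real.sqrt (t ^ 2 - 1)

/-- The data of the method on `Ω`, `Ω₁`, with penalty constant `α₀`: the mesh with its oriented
edges, the flux parameters `β_e` on the edges and on the pieces `Γ_K` of the interface, the
coefficient and the polynomial degree. -/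
structure Scheme (Ω Ω₁ : Set Plane) (α₀ : ℝ) where
  mesh : Finset Rect
  sides : Finset (Rect × Rect)
  βside : Rect × Rect → ℝ
  βint : Rect → ℝ
  a : Fin 2 → ℝ
  p : ℕ

namespace Scheme

variable {Ω Ω₁ : Set Plane} {α₀ : ℝ}

/-- The requirements on the data of the method. -/
structure Admissible (D : Scheme Ω Ω₁ α₀) (δ₀ σ ρ : ℝ) : Prop where
  mesh : IsAdmissibleMesh Ω Ω₁ δ₀ σ ρ D.mesh
  sides : IsOrientedSides D.mesh D.sides
  βside : ∀ e ∈ D.sides, D.βside e = 0 ∨ D.βside e = 1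
  βint : ∀ K ∈ D.mesh, D.βint K = 0 ∨ D.βint K = 1
  a_pos : ∀ i, 0 < D.a i
  one_le_p : 1 ≤ D.p

/-- The edge `∂K ∩ ∂K'` shared by two elements. -/
def sideSet (e : Rect × Rect) : Set Plane := frontier e.1.carrier ∩ frontier e.2.carrier

/-- The piece `Γ_K` of the interface (empty unless `K` is an interface element). -/
def intSet (_ : Scheme Ω Ω₁ α₀) (K : Rect) : Set Plane := frontier Ω₁ ∩ K.carrier

/-- The boundary edge `∂K ∩ ∂Ω`. -/
def bdySet (_ : Scheme Ω Ω₁ α₀) (K : Rect) : Set Plane := frontier K.carrier ∩ frontier Ω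

/-- `(c r, s)_M` for vector fields `r`, `s` and a coefficient `c = c₁ χ_{Ω₁} + c₂ χ_{Ω₂}`. -/
def bulk (D : Scheme Ω Ω₁ α₀) (c : Fin 2 → ℝ) (r s : Fin 2 → Broken) : ℝ :=
  ∑ K ∈ D.mesh, ∑ i, c i * ∫ x in K.carrier ∩ subdomain Ω Ω₁ i,
    ∑ j, evalAt (r j K i) x * evalAt (s j K i) x

/-- The jump `v₋ - v₊` across the edge `e`. -/
def jumpSide (_ : Scheme Ω Ω₁ α₀) (v : Broken) (e : Rect × Rect) (x : Plane) : ℝ :=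
  traceFrom Ω₁ v e.1 x - traceFrom Ω₁ v e.2 x

/-- The jump across `Γ_K`; the normal points out of `Ω₁`, so `v₋` is the trace from `Ω₁`. -/
def jumpInt (_ : Scheme Ω Ω₁ α₀) (v : Broken) (K : Rect) (x : Plane) : ℝ :=
  evalAt (v K 0) x - evalAt (v K 1) x

/-- The numerical flux `β_e r₋ + (1 - β_e) r₊` on an edge, for one component. -/
def fluxSide (D : Scheme Ω Ω₁ α₀) (r : Broken) (e : Rect × Rect) (x : Plane) : ℝ :=
  D.βside e * traceFrom Ω₁ r e.1 x + (1 - D.βside e) * traceFrom Ω₁ r e.2 x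

/-- The numerical flux on `Γ_K`, for one component. -/
def fluxInt (D : Scheme Ω Ω₁ α₀) (r : Broken) (K : Rect) (x : Plane) : ℝ :=
  D.βint K * evalAt (r K 0) x + (1 - D.βint K) * evalAt (r K 1) x

/-- `⟨r̂ · n, [v]⟩` over all edges, interface pieces and boundary edges (where `β_e = 1`). -/
def liftRHS (D : Scheme Ω Ω₁ α₀) (v : Broken) (r : Fin 2 → Broken) : ℝ :=
  (∑ e ∈ D.sides, ∫ x in sideSet e,
      (∑ j, D.fluxSide (r j) e x * sideNormal e j) * D.jumpSide v e x ∂μH[1]) +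
  (∑ K ∈ D.mesh, ∫ x in D.intSet K,
      (∑ j, D.fluxInt (r j) K x * outerNormal Ω₁ x j) * D.jumpInt v K x ∂μH[1]) +
  ∑ K ∈ D.mesh, ∫ x in D.bdySet K,
      (∑ j, traceFrom Ω₁ (r j) K x * outerNormal Ω x j) * traceFrom Ω₁ v K x ∂μH[1]

/-- `l` is the lifting of `v`. -/
def IsLifting (D : Scheme Ω Ω₁ α₀) (v : Broken) (l : Fin 2 → Broken) : Prop :=
  (∀ j, InX D.mesh D.p (l j)) ∧
  ∀ r : Fin 2 → Broken, (∀ j, InX D.mesh D.p (r j)) → D.bulk (fun _ => 1) r l = D.liftRHS v r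

/-- The lifting `𝖫(v)`. -/
def lifting (D : Scheme Ω Ω₁ α₀) (v : Broken) : Fin 2 → Broken :=
  Classical.epsilon fun l => D.IsLifting v l

open Classical in
/-- `a_K`. -/
def aElt (D : Scheme Ω Ω₁ α₀) (K : Rect) : ℝ :=
  if IsInterfaceElement Ω₁ K then (D.a 0 + D.a 1) / 2
  else if K.carrier ⊆ Ω₁ then D.a 0 else D.a 1

open Classical in
/-- `Θ_K`. -/
def thetaElt (D : Scheme Ω Ω₁ α₀) (K : Rect) : ℝ :=
  if IsInterfaceElement Ω₁ K then
    bigT ((1 + 3 * deviation Ω Ω₁ K) / (1 - deviation Ω Ω₁ K)) ^ (4 * D.p)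
  else 1

/-- The maximum of `f K` over the elements `K` with `e ∩ closure K ≠ ∅`. -/
def maxNear (D : Scheme Ω Ω₁ α₀) (f : Rect → ℝ) (e : Set Plane) : ℝ :=
  sSup {t | ∃ K ∈ D.mesh, (e ∩ closure K.carrier).Nonempty ∧ t = f K}

/-- The value of the penalty function `α` on `e`, where the mesh size is `h`. -/
def penalty (D : Scheme Ω Ω₁ α₀) (e : Set Plane) (h : ℝ) : ℝ :=
  α₀ * D.maxNear D.aElt e * D.maxNear D.thetaElt e * h⁻¹ * (D.p : ℝ) ^ 2

/-- `α` on the edge `∂K ∩ ∂K'`. -/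
def αSide (D : Scheme Ω Ω₁ α₀) (e : Rect × Rect) : ℝ :=
  D.penalty (sideSet e) ((e.1.diam + e.2.diam) / 2)

/-- `α` on `Γ_K`. -/
def αInt (D : Scheme Ω Ω₁ α₀) (K : Rect) : ℝ := D.penalty (D.intSet K) K.diam

/-- `α` on `∂K ∩ ∂Ω`. -/
def αBdy (D : Scheme Ω Ω₁ α₀) (K : Rect) : ℝ := D.penalty (D.bdySet K) K.diam

/-- `⟨α [v], [w]⟩` over the interface pieces and the boundary edges. -/
def jumpIntBdy (D : Scheme Ω Ω₁ α₀) (v w : Broken) : ℝ :=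
  (∑ K ∈ D.mesh, D.αInt K * ∫ x in D.intSet K, D.jumpInt v K x * D.jumpInt w K x ∂μH[1]) +
  ∑ K ∈ D.mesh, D.αBdy K *
    ∫ x in D.bdySet K, traceFrom Ω₁ v K x * traceFrom Ω₁ w K x ∂μH[1]

/-- `⟨α [v], [w]⟩_ℰ`. -/
def jumpE (D : Scheme Ω Ω₁ α₀) (v w : Broken) : ℝ :=
  (∑ e ∈ D.sides, D.αSide e *
    ∫ x in sideSet e, D.jumpSide v e x * D.jumpSide w e x ∂μH[1]) + D.jumpIntBdy v w

open Classical in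
/-- `⟨α [v], [w]⟩` over the penalized set of edges: on an edge interior to the union of the
elements that meet `Ω_i`, the jumps of the polynomials `v_i` are penalized on the whole edge. -/
def jumpEbar (D : Scheme Ω Ω₁ α₀) (v w : Broken) : ℝ :=
  (∑ i, ∑ e ∈ D.sides with (e.1.carrier ∩ subdomain Ω Ω₁ i).Nonempty ∧
      (e.2.carrier ∩ subdomain Ω Ω₁ i).Nonempty,
    D.αSide e * ∫ x in sideSet e,
      (evalAt (v e.1 i) x - evalAt (v e.2 i) x) *
        (evalAt (w e.1 i) x - evalAt (w e.2 i) x) ∂μH[1]) + D.jumpIntBdy v w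

/-- The bilinear form `a_h`. -/
def ah (D : Scheme Ω Ω₁ α₀) (v w : Broken) : ℝ :=
  D.bulk D.a (grad v - D.lifting v) (grad w - D.lifting w) + D.jumpEbar v w

/-- `‖v‖_DG²`. -/
def normDGsq (D : Scheme Ω Ω₁ α₀) (v : Broken) : ℝ :=
  D.bulk D.a (grad v) (grad v) + D.jumpEbar v v

end Scheme

end

end UnfittedLDG

open UnfittedLDG

namespace UnfittedLDG

open Polynomial Polynomial.Chebyshev

/-! ### Polynomials in one variable -/

/-! Everything rests on one inequality: for a discrete function `r`, the squared norms of its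
numerical fluxes on all edges, weighted by `1/α`, are bounded by the sum of `a_i⁻¹ ‖r‖²` over the
pieces `K ∩ Ω_i` (`exists_fluxEnergy_le`). Young's inequality turns this into a bound for the
functional that defines the lifting (`exists_liftRHS_le`). That bound makes the functional vanish on
the degenerate directions of the `L²` form, so the lifting exists; testing with `r = a L(v)` bounds
the lifting; splitting the gradient of `v` as `(∇v - L(v)) + L(v)` gives coercivity.

The flux inequality is a sum of trace inequalities on single elements
(`IsLipschitzDomain.exists_trace`): for `q` in `Q_p`, the norm on `∂K ∩ Ω_i` and on `Γ_K` satisfies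
`‖q‖² ≤ A p² h_K⁻¹ Θ_K ‖q‖²` with the norm over `K ∩ Ω_i` on the right. The penalty contains exactly
the reciprocal of this factor, so `p`, `h_K` and `Θ_K` cancel. As `a_K ≥ a_i / 2` wherever phase `i`
is present, the constant does not see the contrast of `a` either.

The set `K ∩ Ω_i` need not be convex, so the trace is taken from a convex subset `S` at a corner `A`
of `K` such that the dilation about `A` with ratio `λ` covers the curves in question. Along rays
from a point a polynomial is a polynomial in the dilation parameter. Interpolation at Chebyshev
points extrapolates it from `[0, 1]` to `λ` with weights whose absolute sum is `T_N(2λ - 1)`, at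
most `bigT (2λ - 1) ^ N`. Enlarging `λ` by the relative amount `N⁻²` costs only a constant and
leaves a margin of order `h_K N⁻²` around the curve, in which a trace inequality by short
translations and Markov's inequality yields the factor `p² / h_K`
(`OnGraph.energy_le_of_expansion`).

In a regular element `S` is cut off by a parallel to the chord. The deviation `η` says that the
interface stays in a band about the chord, and then `λ = (1 + η)/(1 - η)`, for which `2λ - 1 = (1 +
3η)/(1 - η)` is the argument in `Θ_K` (`energy_trace_of_regular`).

In an irregular element the interface consists of two arcs that meet at a singular point `Q`. Away
from the sides at the corner, translations in the direction of the boundary charts stay inside `K ∩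
Ω_i`, and no growth factor arises. Near a side approached by one arc only, the argument for the
regular case applies in a strip. If both arcs approach the side then `η` is bounded below; here the
polynomial is stretched along one axis only, where its degree is `p` rather than `2p`. Two stretches
are needed, and the product of their growth rates is strictly smaller than the rate allowed by
`Θ_K`, with a uniform gap that pays for all small enlargements (`exists_slack`, `energy_trace_fat`).
That the two arcs in the definition of the deviation exhaust `Γ_K` is a topological fact about
locally arc-like sets (`IsLipschitzDomain.mem_component_of_cut`). -/

theorem exists_node_formula (n k : ℕ) {x : ℝ} (hx : 1 ≤ x) :
    ∃ c : ℕ → ℝ,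
      (∀ P : ℝ[X], P.natDegree ≤ n →
        (derivative^[k] P).eval x = ∑ i ∈ Finset.range (n + 1), c i * P.eval (node n i)) ∧
      ∑ i ∈ Finset.range (n + 1), |c i| = (derivative^[k] (T ℝ n)).eval x := by
  by_cases hk : n < k
  · refine ⟨0, fun P hP => ?_, ?_⟩
    · simp [iterate_derivative_eq_zero (hP.trans_lt hk)]
    · rw [iterate_derivative_eq_zero (by simpa [natDegree_T] using hk)]; simp
  push Not at hk
  -- The weights of Lagrange interpolation at the Chebyshev extremal points, differentiated `k`
  -- times: the derivative of a product of linear factors is a sum over subsets of the factors.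
  set c : ℕ → ℝ := fun i =>
    k.factorial * (∏ j ∈ (Finset.range (n + 1)).erase i, (node n i - node n j))⁻¹ *
    ∑ t ∈ ((Finset.range (n + 1)).erase i).powersetCard (n - k), ∏ a ∈ t, (x - node n a) with hc
  have key : ∀ P : ℝ[X], P.natDegree ≤ n →
      (derivative^[k] P).eval x = ∑ i ∈ Finset.range (n + 1), c i * P.eval (node n i) := by
    intro P hP
    have h₁ : P.degree < (Finset.range (n + 1)).card := by
      rw [Finset.card_range]
      exact (degree_le_of_natDegree_le hP).trans_lt (by exact_mod_cast Nat.lt_succ_self n)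
    rw [Lagrange.eval_iterate_derivative_eq_sum (strictAntiOn_node n).injOn h₁
      (show k < _ by simp; omega) x, Finset.mul_sum]
    refine Finset.sum_congr rfl fun i _ => ?_
    have : (Finset.range (n + 1)).card - (k + 1) = n - k := by simp
    rw [hc, this]
    ring
  refine ⟨c, key, ?_⟩
  rw [key _ (by simp [natDegree_T])]
  refine Finset.sum_congr rfl fun i hi => ?_
  have hi' : i ≤ n := by simpa [Nat.lt_succ_iff] using hi
  rw [eval_T_real_node (Finset.mem_Iic.2 hi')]
  have h2 := inv_pos_of_pos (zero_lt_prod_node_sub_node (n := n) hi')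
  rw [mul_inv, ← inv_pow, inv_neg_one] at h2
  -- The signs of the weights alternate: the denominators alternate because the nodes are ordered,
  -- and the numerators are nonnegative because `x` is not to the left of any node. As `T_n` takes
  -- the values `(-1)^i` at the nodes, it turns the formula into the sum of the absolute values.
  have h3 : 0 ≤ c i * (-1) ^ i := by
    have : c i * (-1) ^ i = k.factorial *
        ((-1) ^ i * (∏ j ∈ (Finset.range (n + 1)).erase i, (node n i - node n j))⁻¹) *
        ∑ t ∈ ((Finset.range (n + 1)).erase i).powersetCard (n - k), ∏ a ∈ t, (x - node n a) := by
      rw [hc]; ring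
    rw [this]
    refine mul_nonneg (mul_nonneg (by positivity) h2.le) (Finset.sum_nonneg fun t _ => ?_)
    exact Finset.prod_nonneg fun a _ => by
      have := (node_mem_Icc (n := n) (i := a)).2
      linarith
  rw [← abs_of_nonneg h3, abs_mul (c i), abs_neg_one_pow, mul_one]

theorem one_le_bigT {t : ℝ} (ht : 1 ≤ t) : 1 ≤ bigT t :=
  ht.trans (le_add_of_nonneg_right (Real.sqrt_nonneg _))

theorem bigT_mono {s t : ℝ} (hs : 1 ≤ s) (h : s ≤ t) : bigT s ≤ bigT t :=
  add_le_add h (Real.sqrt_le_sqrt (by nlinarith))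

theorem bigT_le_two_mul {t : ℝ} (ht : 1 ≤ t) : bigT t ≤ 2 * t := by
  have : Real.sqrt (t ^ 2 - 1) ≤ t := by
    rw [Real.sqrt_le_left (by linarith)]; linarith
  unfold bigT; linarith

theorem bigT_cosh {θ : ℝ} (h : 0 ≤ θ) : bigT (Real.cosh θ) = Real.exp θ := by
  have h1 : Real.cosh θ ^ 2 - 1 = Real.sinh θ ^ 2 := by rw [Real.cosh_sq]; ring
  rw [bigT, h1, Real.sqrt_sq (Real.sinh_nonneg_iff.2 h), Real.cosh_add_sinh]

/-- With `x = cosh θ`, the left-hand side is `cosh (n θ) ≤ exp (n θ)`, and `exp θ` is `bigT x`. -/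
theorem eval_T_le_bigT_pow (n : ℕ) {x : ℝ} (hx : 1 ≤ x) : (T ℝ n).eval x ≤ bigT x ^ n := by
  obtain ⟨θ, hθ, rfl⟩ : ∃ θ, 0 ≤ θ ∧ Real.cosh θ = x :=
    ⟨Real.arcosh x, Real.arcosh_nonneg hx, Real.cosh_arcosh hx⟩
  rw [bigT_cosh hθ, T_real_cosh, ← Real.exp_nat_mul, Real.cosh_eq]
  have : Real.exp (-((n : ℤ) * θ)) ≤ Real.exp ((n : ℝ) * θ) := by
    apply Real.exp_le_exp.2
    have : 0 ≤ (n : ℝ) * θ := by positivity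
    push_cast; linarith
  push_cast at *
  linarith

/-- For `t = cosh u` and `1 + s = cosh w` one has `t + s ≤ t (1 + s) ≤ cosh (u + w)`, and `bigT ∘
cosh` is the exponential. This separates a growth rate from the effect of a small enlargement. -/
theorem bigT_add_le {t s : ℝ} (ht : 1 ≤ t) (hs : 0 ≤ s) :
    bigT (t + s) ≤ bigT t * bigT (1 + s) := by
  have h1 : t + s ≤ t * (1 + s) := by nlinarith
  refine (bigT_mono (by linarith) h1).trans ?_
  set a := Real.sqrt (t ^ 2 - 1)
  set b := Real.sqrt ((1 + s) ^ 2 - 1)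
  have ha : a ^ 2 = t ^ 2 - 1 := Real.sq_sqrt (by nlinarith)
  have hb : b ^ 2 = (1 + s) ^ 2 - 1 := Real.sq_sqrt (by nlinarith)
  have ha0 : 0 ≤ a := Real.sqrt_nonneg _
  have hb0 : 0 ≤ b := Real.sqrt_nonneg _
  have h2 : Real.sqrt ((t * (1 + s)) ^ 2 - 1) ≤ t * b + a * (1 + s) := by
    rw [Real.sqrt_le_left (by positivity)]
    have h3 : 0 ≤ t * b * (a * (1 + s)) := by positivity
    have : (t * b + a * (1 + s)) ^ 2 = t ^ 2 * b ^ 2 + a ^ 2 * (1 + s) ^ 2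
      + 2 * (t * b * (a * (1 + s))) := by ring
    rw [this, ha, hb]
    nlinarith [mul_nonneg hs hs, sq_nonneg (t - 1), mul_nonneg (sq_nonneg t) hs,
      mul_nonneg (show 0 ≤ t ^ 2 - 1 by nlinarith) (show 0 ≤ (1 + s) ^ 2 - 1 by nlinarith)]
  have h4 : 0 ≤ a * b := by positivity
  show t * (1 + s) + Real.sqrt ((t * (1 + s)) ^ 2 - 1) ≤ (t + a) * (1 + s + b)
  nlinarith

/-- Near `1` the function grows like a square root. Hence an excess `s` of order `N⁻²` costs only a
constant in a power of order `N`. -/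
theorem bigT_one_add_le {s : ℝ} (hs : 0 ≤ s) : bigT (1 + s) ≤ Real.exp (s + 2 * Real.sqrt s) := by
  have h1 : Real.sqrt ((1 + s) ^ 2 - 1) ≤ s + 2 * Real.sqrt s := by
    rw [Real.sqrt_le_left (by positivity)]
    have := Real.sq_sqrt hs
    have h0 := Real.sqrt_nonneg s
    nlinarith [mul_nonneg hs h0]
  have h0 := Real.sqrt_nonneg s
  have h2 := Real.sqrt_nonneg ((1 + s) ^ 2 - 1)
  have h4 := Real.quadratic_le_exp_of_nonneg (show 0 ≤ s + 2 * Real.sqrt s by positivity)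
  have := Real.sq_sqrt hs
  unfold bigT
  by_cases h5 : Real.sqrt ((1 + s) ^ 2 - 1) ≤ 2 * Real.sqrt s + (s + 2 * Real.sqrt s) ^ 2 / 2
  · linarith
  · exfalso; apply h5
    rw [Real.sqrt_le_left (by positivity)]
    nlinarith [mul_nonneg hs h0, sq_nonneg ((s + 2 * Real.sqrt s) ^ 2 / 2),
      mul_nonneg h0 (sq_nonneg (s + 2 * Real.sqrt s)), mul_nonneg hs hs,
      mul_nonneg h0 (mul_nonneg hs h0)]

/-- Extrapolation from `[0, 1]` to `τ ≥ 1`, with explicit control of the weights. -/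
theorem exists_extrapolation_formula (n : ℕ) {τ : ℝ} (hτ : 1 ≤ τ) :
    ∃ c x : ℕ → ℝ, (∀ i, x i ∈ Set.Icc (0 : ℝ) 1) ∧
      (∀ P : ℝ[X], P.natDegree ≤ n →
        P.eval τ = ∑ i ∈ Finset.range (n + 1), c i * P.eval (x i)) ∧
      ∑ i ∈ Finset.range (n + 1), |c i| ≤ bigT (2 * τ - 1) ^ n := by
  have hτ' : 1 ≤ 2 * τ - 1 := by linarith
  obtain ⟨c, hc, hs⟩ := exists_node_formula n 0 hτ'
  refine ⟨c, fun i => (node n i + 1) / 2, fun i => ?_, fun P hP => ?_, ?_⟩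
  · have := node_mem_Icc (n := n) (i := i)
    constructor <;> linarith [this.1, this.2]
  · have hd : (P.comp (C (1 / 2) * X + C (1 / 2))).natDegree ≤ n := by
      refine natDegree_comp_le.trans ?_
      have : (C (1 / 2 : ℝ) * X + C (1 / 2)).natDegree ≤ 1 := natDegree_linear_le
      nlinarith
    have := hc _ hd
    simp only [Function.iterate_zero, id, eval_comp, eval_add, eval_mul, eval_C, eval_X] at this
    have e : (1 / 2 * (2 * τ - 1) + 1 / 2 : ℝ) = τ := by ring
    rw [e] at this
    rw [this]
    refine Finset.sum_congr rfl fun i _ => ?_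
    congr 2; ring
  · rw [hs]; exact eval_T_le_bigT_pow n hτ'

/-- The derivative at the end point, with explicit control of the weights (Markov). -/
theorem exists_endpoint_derivative_formula (n : ℕ) :
    ∃ c x : ℕ → ℝ, (∀ i, x i ∈ Set.Icc (0 : ℝ) 1) ∧
      (∀ P : ℝ[X], P.natDegree ≤ n →
        (derivative P).eval 1 = ∑ i ∈ Finset.range (n + 1), c i * P.eval (x i)) ∧
      ∑ i ∈ Finset.range (n + 1), |c i| ≤ 2 * (n : ℝ) ^ 2 := by
  obtain ⟨c, hc, hs⟩ := exists_node_formula n 1 le_rfl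
  refine ⟨fun i => 2 * c i, fun i => (node n i + 1) / 2, fun i => ?_, fun P hP => ?_, ?_⟩
  · have := node_mem_Icc (n := n) (i := i)
    constructor <;> linarith [this.1, this.2]
  · have hd : (P.comp (C (1 / 2) * X + C (1 / 2))).natDegree ≤ n := by
      refine natDegree_comp_le.trans ?_
      have : (C (1 / 2 : ℝ) * X + C (1 / 2)).natDegree ≤ 1 := natDegree_linear_le
      nlinarith
    have := hc _ hd
    simp only [Function.iterate_one, derivative_comp, eval_comp, eval_add, eval_mul, eval_C, eval_X,
      derivative_add, derivative_mul, derivative_C, derivative_X] at this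
    have e : (1 / 2 * 1 + 1 / 2 : ℝ) = 1 := by norm_num
    rw [e] at this
    have h2 : (derivative P).eval 1 = 2 * ∑ i ∈ Finset.range (n + 1),
        c i * P.eval (1 / 2 * node n i + 1 / 2) := by
      rw [← this]; simp
    rw [h2, Finset.mul_sum]
    refine Finset.sum_congr rfl fun i _ => ?_
    rw [mul_assoc]; congr 4; ring
  · have h1 : ∑ i ∈ Finset.range (n + 1), |2 * c i| = 2 * ∑ i ∈ Finset.range (n + 1), |c i| := by
      rw [Finset.mul_sum]; exact Finset.sum_congr rfl fun i _ => by rw [abs_mul, abs_two]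
    -- The derivative of `T_n` at `1` is `n U_{n-1}(1) = n²`; the factor `2` comes from the map of
    -- `[0, 1]` onto `[-1, 1]`.
    rw [h1, hs, Function.iterate_one, T_derivative_eq_U]
    have : ((U ℝ ((n : ℤ) - 1)).eval 1 : ℝ) = n := by simp
    rw [eval_mul, this]; simp; nlinarith

end UnfittedLDG

namespace UnfittedLDG
noncomputable section
open Polynomial
open scoped ENNReal

/-! ### `L²` energies of families that are polynomial in a parameter -/

/-- The square of the `L²` norm, as an extended nonnegative number. -/
def energy {α : Type*} [MeasurableSpace α] (μ : Measure α) (f : α → ℝ) : ℝ≥0∞ :=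
  ∫⁻ x, ENNReal.ofReal (f x ^ 2) ∂μ

section Energy

variable {α : Type*} [MeasurableSpace α]

theorem energy_mono_measure {μ ν : Measure α} (h : μ ≤ ν) (f : α → ℝ) : energy μ f ≤ energy ν f :=
  lintegral_mono' h le_rfl

theorem energy_mono_set {μ : Measure α} {S T : Set α} (h : S ⊆ T) (f : α → ℝ) :
    energy (μ.restrict S) f ≤ energy (μ.restrict T) f :=
  energy_mono_measure (Measure.restrict_mono h le_rfl) f

theorem energy_union_le {μ : Measure α} (S T : Set α) (f : α → ℝ) :
    energy (μ.restrict (S ∪ T)) f ≤ energy (μ.restrict S) f + energy (μ.restrict T) f :=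
  lintegral_union_le _ S T

theorem energy_const_mul (μ : Measure α) (s : ℝ) (f : α → ℝ) :
    energy μ (fun x => s * f x) = ENNReal.ofReal (s ^ 2) * energy μ f := by
  unfold energy
  rw [← lintegral_const_mul' _ _ ENNReal.ofReal_ne_top]
  congr 1; ext x
  rw [← ENNReal.ofReal_mul (sq_nonneg s), mul_pow]

theorem energy_sub_le {μ : Measure α} {f g : α → ℝ} (hf : Measurable f) :
    energy μ (fun x => f x - g x) ≤ 2 * (energy μ f + energy μ g) := by
  unfold energy
  rw [← lintegral_add_left (by fun_prop), ← lintegral_const_mul' _ _ (by norm_num)]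
  refine lintegral_mono fun x => ?_
  rw [← ENNReal.ofReal_add (sq_nonneg _) (sq_nonneg _),
    show (2 : ℝ≥0∞) = ENNReal.ofReal 2 by simp, ← ENNReal.ofReal_mul (by norm_num)]
  exact ENNReal.ofReal_le_ofReal (by nlinarith [sq_nonneg (f x + g x)])

/-- The Cauchy–Schwarz inequality with weights `|c i|`: only the sum of the absolute values of the
coefficients matters, not the number of terms. -/
theorem energy_sum_le {μ : Measure α} (s : Finset ℕ) (c : ℕ → ℝ) {Φ : ℕ → α → ℝ}
    (hΦ : ∀ i, Measurable (Φ i)) {M : ℝ≥0∞} (hM : ∀ i, energy μ (Φ i) ≤ M) :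
    energy μ (fun x => ∑ i ∈ s, c i * Φ i x) ≤ ENNReal.ofReal ((∑ i ∈ s, |c i|) ^ 2) * M := by
  have hC : 0 ≤ ∑ i ∈ s, |c i| := Finset.sum_nonneg fun i _ => abs_nonneg _
  calc energy μ (fun x => ∑ i ∈ s, c i * Φ i x)
      ≤ ∫⁻ x, ENNReal.ofReal (∑ i ∈ s, |c i|) *
          ∑ i ∈ s, ENNReal.ofReal |c i| * ENNReal.ofReal (Φ i x ^ 2) ∂μ := by
        refine lintegral_mono fun x => ?_
        have h1 : (∑ i ∈ s, c i * Φ i x) ^ 2 ≤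
            (∑ i ∈ s, |c i|) * ∑ i ∈ s, |c i| * Φ i x ^ 2 := by
          refine Finset.sum_sq_le_sum_mul_sum_of_sq_le_mul s (fun i _ => abs_nonneg _)
            (fun i _ => by positivity) fun i _ => ?_
          rw [mul_pow, ← sq_abs (c i)]; apply le_of_eq; ring
        refine (ENNReal.ofReal_le_ofReal h1).trans ?_
        rw [ENNReal.ofReal_mul hC]
        refine mul_le_mul_right (le_of_eq ?_) _
        rw [ENNReal.ofReal_sum_of_nonneg (fun i _ => by positivity)]
        exact Finset.sum_congr rfl fun i _ => ENNReal.ofReal_mul (abs_nonneg _)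
    _ = ENNReal.ofReal (∑ i ∈ s, |c i|) * ∑ i ∈ s, ENNReal.ofReal |c i| * energy μ (Φ i) := by
        rw [lintegral_const_mul' _ _ ENNReal.ofReal_ne_top, lintegral_finsetSum _ (fun i _ => by
          have := hΦ i; fun_prop)]
        simp_rw [lintegral_const_mul' _ _ ENNReal.ofReal_ne_top]
        rfl
    _ ≤ ENNReal.ofReal (∑ i ∈ s, |c i|) * ∑ i ∈ s, ENNReal.ofReal |c i| * M := by
        gcongr with i; exact hM i
    _ = _ := by
        rw [← Finset.sum_mul, ← ENNReal.ofReal_sum_of_nonneg (fun i _ => abs_nonneg _), ← mul_assoc,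
          ← ENNReal.ofReal_mul hC, sq]

/-- The nodes and weights depend on `N` and `τ` only, not on the point `a`, so the one-dimensional
formula may be used pointwise and then integrated. This lifts extrapolation in a parameter to `L²`
norms with an explicit constant. -/
theorem energy_extrapolate {μ : Measure α} {N : ℕ} {Φ : ℝ → α → ℝ} (hΦ : ∀ s, Measurable (Φ s))
    (hP : ∀ a, ∃ P : ℝ[X], P.natDegree ≤ N ∧ ∀ s, P.eval s = Φ s a) {M : ℝ≥0∞}
    (hM : ∀ s ∈ Set.Icc (0 : ℝ) 1, energy μ (Φ s) ≤ M) {τ : ℝ} (hτ : 1 ≤ τ) :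
    energy μ (Φ τ) ≤ ENNReal.ofReal (bigT (2 * τ - 1) ^ (2 * N)) * M := by
  obtain ⟨c, x, hx, hc, hs⟩ := exists_extrapolation_formula N hτ
  have h1 : Φ τ = fun a => ∑ i ∈ Finset.range (N + 1), c i * Φ (x i) a := by
    ext a
    obtain ⟨P, hP, hPe⟩ := hP a
    simp_rw [← hPe]; exact hc P hP
  rw [h1]
  refine (energy_sum_le _ c (fun i => hΦ (x i)) fun i => hM _ (hx i)).trans ?_
  gcongr
  rw [mul_comm 2 N, pow_mul]
  exact pow_le_pow_left₀ (Finset.sum_nonneg fun i _ => abs_nonneg _) hs 2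

theorem energy_endpoint_derivative {μ : Measure α} {N : ℕ} {Φ : ℝ → α → ℝ}
    (hΦ : ∀ s, Measurable (Φ s)) {D : α → ℝ}
    (hP : ∀ a, ∃ P : ℝ[X], P.natDegree ≤ N ∧ (∀ s, P.eval s = Φ s a) ∧ (derivative P).eval 1 = D a)
    {M : ℝ≥0∞} (hM : ∀ s ∈ Set.Icc (0 : ℝ) 1, energy μ (Φ s) ≤ M) :
    energy μ D ≤ ENNReal.ofReal ((2 * (N : ℝ) ^ 2) ^ 2) * M := by
  obtain ⟨c, x, hx, hc, hs⟩ := exists_endpoint_derivative_formula N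
  have h1 : D = fun a => ∑ i ∈ Finset.range (N + 1), c i * Φ (x i) a := by
    ext a
    obtain ⟨P, hP, hPe, hPd⟩ := hP a
    simp_rw [← hPe, ← hPd]; exact hc P hP
  rw [h1]
  refine (energy_sum_le _ c (fun i => hΦ (x i)) fun i => hM _ (hx i)).trans ?_
  gcongr

end Energy

/-! ### Scalings of the plane -/

/-- The coordinates `j ∈ J` are scaled by `s` about those of `c`. -/
def scaleAbout (J : Finset (Fin 2)) (c : Plane) (s : ℝ) (x : Plane) : Plane :=
  WithLp.toLp 2 fun j => if j ∈ J then c j + s * (x j - c j) else x j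

theorem scaleAbout_apply (J : Finset (Fin 2)) (c : Plane) (s : ℝ) (x : Plane) (j : Fin 2) :
    scaleAbout J c s x j = if j ∈ J then c j + s * (x j - c j) else x j := rfl

theorem scaleAbout_univ (c : Plane) (s : ℝ) (x : Plane) :
    scaleAbout Finset.univ c s x = c + s • (x - c) := by
  ext j; simp [scaleAbout_apply]

theorem continuous_scaleAbout (J : Finset (Fin 2)) (c : Plane) (s : ℝ) :
    Continuous (scaleAbout J c s) := by
  refine (PiLp.continuous_toLp 2 _).comp (continuous_pi fun j => ?_)
  by_cases h : j ∈ J <;> simp only [h, if_true, if_false] <;> fun_prop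

theorem map_scaleAbout (J : Finset (Fin 2)) (c : Plane) {s : ℝ} (hs : 0 < s) :
    ENNReal.ofReal (s ^ J.card) • Measure.map (scaleAbout J c s) volume = volume := by
  classical
  set d : Fin 2 → ℝ := fun j => if j ∈ J then s else 1 with hd
  set b : Fin 2 → ℝ := fun j => if j ∈ J then c j - s * c j else 0 with hb
  have hdet : (Matrix.diagonal d).det = s ^ J.card := by
    rw [Matrix.det_diagonal, hd, Finset.prod_ite_mem]; simp
  have h1 : scaleAbout J c s = (WithLp.toLp 2 ∘ (fun y => y + b)) ∘
      (Matrix.toLin' (Matrix.diagonal d)) ∘ (WithLp.ofLp : Plane → (Fin 2 → ℝ)) := by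
    ext x j
    have h0 : ((WithLp.toLp 2 ∘ fun y => y + b) ∘ (Matrix.toLin' (Matrix.diagonal d)) ∘
        (WithLp.ofLp : Plane → (Fin 2 → ℝ))) x j = d j * x j + b j := by
      show (Matrix.toLin' (Matrix.diagonal d) (WithLp.ofLp x)) j + b j = _
      rw [Matrix.toLin'_apply, Matrix.mulVec_diagonal]
    rw [h0, scaleAbout_apply]
    by_cases h : j ∈ J
    · simp only [h, hd, hb, if_true]; ring
    · simp only [h, hd, hb, if_false]; ring
  have h2 := Real.smul_map_diagonal_volume_pi (D := d) (by rw [hdet]; positivity)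
  rw [hdet, abs_of_pos (by positivity)] at h2
  have h3 : MeasurePreserving (WithLp.toLp 2 ∘ (fun y : Fin 2 → ℝ => y + b)) volume
      (volume : Measure Plane) :=
    (PiLp.volume_preserving_toLp (Fin 2)).comp (measurePreserving_add_right volume b)
  have h4 : Measurable (Matrix.toLin' (Matrix.diagonal d)) :=
    (LinearMap.continuous_of_finiteDimensional _).measurable
  rw [h1, ← Measure.map_map h3.measurable (h4.comp (PiLp.volume_preserving_ofLp (Fin 2)).measurable),
    ← Measure.map_map h4 (PiLp.volume_preserving_ofLp (Fin 2)).measurable,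
    (PiLp.volume_preserving_ofLp (Fin 2)).map_eq, ← Measure.map_smul, h2, h3.map_eq]

theorem setLIntegral_scaleAbout (J : Finset (Fin 2)) (c : Plane) {s : ℝ} (hs : 0 < s)
    {T : Set Plane} (hT : MeasurableSet T) {g : Plane → ℝ≥0∞} (hg : Measurable g) :
    ENNReal.ofReal (s ^ J.card) * ∫⁻ x in scaleAbout J c s ⁻¹' T, g (scaleAbout J c s x) =
      ∫⁻ x in T, g x := by
  rw [← setLIntegral_map hT hg (continuous_scaleAbout J c s).measurable]
  conv_rhs => rw [← map_scaleAbout J c hs]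
  rw [Measure.restrict_smul, lintegral_smul_measure, smul_eq_mul]

/-- `q` is a polynomial of degree at most `N` along the orbits of the scalings `scaleAbout J`. -/
def PolyAlong (J : Finset (Fin 2)) (N : ℕ) (q : Plane → ℝ) : Prop :=
  ∀ c x, ∃ P : ℝ[X], P.natDegree ≤ N ∧ ∀ s, P.eval s = q (scaleAbout J c s x)

/-- The factor `s` in front of `q` compensates the Jacobian: the change of variables produces `s ^
(-|J|)`, and `|J| ≤ 2` with `s ≤ 1`. It also keeps the family polynomial in `s`, of degree one more,
and gives it a harmless value at `s = 0`. -/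
theorem energy_scaled_le (J : Finset (Fin 2)) {q : Plane → ℝ} (hq : Measurable q) (c : Plane)
    {S : Set Plane} (hS : MeasurableSet S)
    (hstar : ∀ s, 0 < s → s ≤ 1 → ∀ x ∈ S, scaleAbout J c s x ∈ S)
    {s : ℝ} (hs : s ∈ Set.Icc (0 : ℝ) 1) :
    energy (volume.restrict S) (fun x => s * q (scaleAbout J c s x)) ≤
      energy (volume.restrict S) q := by
  rcases hs.1.eq_or_lt with rfl | h0
  · simp [energy]
  rw [energy_const_mul]
  have hJ : J.card ≤ 2 := (Finset.card_le_univ J).trans (by simp)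
  calc ENNReal.ofReal (s ^ 2) * energy (volume.restrict S) (fun x => q (scaleAbout J c s x))
      ≤ ENNReal.ofReal (s ^ J.card) *
        energy (volume.restrict (scaleAbout J c s ⁻¹' S)) (fun x => q (scaleAbout J c s x)) :=
        mul_le_mul' (ENNReal.ofReal_le_ofReal (pow_le_pow_of_le_one hs.1 hs.2 hJ))
          (energy_mono_set (fun x hx => hstar s h0 hs.2 x hx) _)
    _ = energy (volume.restrict S) q :=
        setLIntegral_scaleAbout J c h0 hS (g := fun x => ENNReal.ofReal (q x ^ 2)) (by fun_prop)

/-- The `L²` norm of a polynomial over a set which is star-shaped about `c` controls the norm over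
the scaled set. -/
theorem energy_scaleAbout_le {J : Finset (Fin 2)} {N : ℕ} {q : Plane → ℝ} (hq : Measurable q)
    (hp : PolyAlong J N q) (c : Plane) {S T : Set Plane} (hS : MeasurableSet S)
    (hT : MeasurableSet T)
    (hstar : ∀ s, 0 < s → s ≤ 1 → ∀ x ∈ S, scaleAbout J c s x ∈ S) {τ : ℝ} (hτ : 1 ≤ τ)
    (hsub : ∀ x, scaleAbout J c τ x ∈ T → x ∈ S) :
    energy (volume.restrict T) q ≤
      ENNReal.ofReal (bigT (2 * τ - 1) ^ (2 * (N + 1))) * energy (volume.restrict S) q := by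
  have hJ : J.card ≤ 2 := (Finset.card_le_univ J).trans (by simp)
  have hm : ∀ s, Measurable fun x => s * q (scaleAbout J c s x) := fun s =>
    (hq.comp (continuous_scaleAbout J c s).measurable).const_mul s
  calc energy (volume.restrict T) q
      = ENNReal.ofReal (τ ^ J.card) *
        energy (volume.restrict (scaleAbout J c τ ⁻¹' T)) (fun x => q (scaleAbout J c τ x)) :=
        (setLIntegral_scaleAbout J c (by linarith) hT
          (g := fun x => ENNReal.ofReal (q x ^ 2)) (by fun_prop)).symm
    _ ≤ ENNReal.ofReal (τ ^ 2) *
        energy (volume.restrict S) (fun x => q (scaleAbout J c τ x)) :=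
        mul_le_mul' (ENNReal.ofReal_le_ofReal (pow_le_pow_right₀ hτ hJ))
          (energy_mono_set hsub _)
    _ = energy (volume.restrict S) (fun x => τ * q (scaleAbout J c τ x)) :=
        (energy_const_mul _ _ _).symm
    _ ≤ _ := energy_extrapolate (Φ := fun s x => s * q (scaleAbout J c s x)) hm
        (fun a => by
          obtain ⟨P, hP, hPe⟩ := hp c a
          refine ⟨X * P, natDegree_mul_le.trans ?_, fun s => by simp [hPe]⟩
          have : (X : ℝ[X]).natDegree ≤ 1 := natDegree_X_le
          omega)
        (fun s hs => energy_scaled_le J hq c hS hstar hs) hτ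

/-- Markov's inequality in `L²` for the radial derivative. -/
theorem energy_radial_derivative_le {N : ℕ} {q : Plane → ℝ} (hq : ContDiff ℝ 1 q)
    (hp : PolyAlong Finset.univ N q) (c : Plane) {S : Set Plane} (hS : MeasurableSet S)
    (hstar : ∀ s : ℝ, 0 < s → s ≤ 1 → ∀ x ∈ S, c + s • (x - c) ∈ S) :
    energy (volume.restrict S) (fun x => q x + fderiv ℝ q x (x - c)) ≤
      ENNReal.ofReal ((2 * ((N + 1 : ℕ) : ℝ) ^ 2) ^ 2) * energy (volume.restrict S) q := by
  refine energy_endpoint_derivative (Φ := fun s x => s * q (scaleAbout Finset.univ c s x))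
    (fun s => (hq.continuous.measurable.comp
      (continuous_scaleAbout _ c s).measurable).const_mul s) (fun a => ?_)
    (fun s hs => energy_scaled_le _ hq.continuous.measurable c hS
      (by simpa [scaleAbout_univ] using hstar) hs)
  -- At `s = 1` the derivative of `s ↦ s q(c + s (a - c))` is `q a` plus the radial derivative at
  -- `a`, which is the function whose norm is to be bounded.
  obtain ⟨P, hP, hPe⟩ := hp c a
  refine ⟨X * P, natDegree_mul_le.trans ?_, fun s => by simp [hPe], ?_⟩
  · have : (X : ℝ[X]).natDegree ≤ 1 := natDegree_X_le
    omega
  have h1 : HasDerivAt (fun s => P.eval s) ((derivative P).eval 1) 1 := P.hasDerivAt 1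
  have h2 : HasDerivAt (fun s : ℝ => q (c + s • (a - c))) (fderiv ℝ q a (a - c)) 1 := by
    have h3 : HasDerivAt (fun s : ℝ => c + s • (a - c)) (a - c) 1 := by
      simpa using ((hasDerivAt_id (1 : ℝ)).smul_const (a - c)).const_add c
    have h4 : HasFDerivAt q (fderiv ℝ q a) (c + (1 : ℝ) • (a - c)) := by
      have : c + (1 : ℝ) • (a - c) = a := by simp
      rw [this]; exact (hq.differentiable one_ne_zero a).hasFDerivAt
    exact h4.comp_hasDerivAt 1 h3
  have h5 : (fun s => P.eval s) = fun s : ℝ => q (c + s • (a - c)) := by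
    ext s; rw [hPe, scaleAbout_univ]
  rw [h5] at h1
  have h6 : P.eval 1 = q a := by rw [hPe, scaleAbout_univ]; simp
  simp [h1.unique h2, h6]

/-- Markov's inequality in `L²` for a directional derivative, on sets that are star-shaped about
two points. -/
theorem energy_directional_derivative_le {N : ℕ} {q : Plane → ℝ} (hq : ContDiff ℝ 1 q)
    (hp : PolyAlong Finset.univ N q) {S : Set Plane} (hS : MeasurableSet S) (hconv : Convex ℝ S)
    {c w : Plane} (hc : c ∈ S) (hw : c + w ∈ S) :
    energy (volume.restrict S) (fun x => fderiv ℝ q x w) ≤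
      ENNReal.ofReal (16 * ((N : ℝ) + 1) ^ 4) * energy (volume.restrict S) q := by
  have hstar : ∀ c ∈ S, ∀ s : ℝ, 0 < s → s ≤ 1 → ∀ x ∈ S, c + s • (x - c) ∈ S :=
    fun c hc s h0 h1 x hx => hconv.add_smul_sub_mem hc hx ⟨h0.le, h1⟩
  have h1 := energy_radial_derivative_le hq hp c hS (hstar c hc)
  have h2 := energy_radial_derivative_le hq hp (c + w) hS (hstar _ hw)
  -- The radial derivatives about `c` and `c + w` differ by the derivative along `w`; the terms
  -- without derivative cancel.
  have h3 : (fun x => fderiv ℝ q x w) = fun x =>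
      (q x + fderiv ℝ q x (x - c)) - (q x + fderiv ℝ q x (x - (c + w))) := by
    ext x
    have : w = (x - c) - (x - (c + w)) := by abel
    conv_lhs => rw [this, map_sub]
    ring
  have hc1 : Continuous (fderiv ℝ q) := hq.continuous_fderiv one_ne_zero
  rw [h3]
  refine (energy_sub_le (by
    have : Continuous fun x => q x + fderiv ℝ q x (x - c) := by
      have := hq.continuous
      fun_prop
    exact this.measurable)).trans ?_
  refine (mul_le_mul_right (add_le_add h1 h2) 2).trans (le_of_eq ?_)
  have e : (4 : ℝ≥0∞) = ENNReal.ofReal 4 := by simp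
  rw [← two_mul, ← mul_assoc, ← mul_assoc, show (2 * 2 : ℝ≥0∞) = 4 by norm_num, e,
    ← ENNReal.ofReal_mul (by norm_num)]
  congr 2; push_cast; ring

end
end UnfittedLDG

namespace UnfittedLDG
noncomputable section
open Polynomial
open scoped ENNReal NNReal

/-! ### Graphs of Lipschitz functions -/

/-- The point with coordinates `(t, u)` in the frame at `x₀` given by the isometry `R`. -/
def framePoint (x₀ : Plane) (R : Plane ≃ₗᵢ[ℝ] Plane) (t u : ℝ) : Plane :=
  x₀ + R.symm (WithLp.toLp 2 ![t, u])

/-- The second basis vector of the frame. -/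
def frameUp (R : Plane ≃ₗᵢ[ℝ] Plane) : Plane := R.symm (WithLp.toLp 2 ![0, 1])

section Frame

variable (x₀ : Plane) (R : Plane ≃ₗᵢ[ℝ] Plane)

theorem framePoint_add (t u s : ℝ) :
    framePoint x₀ R t (u + s) = framePoint x₀ R t u + s • frameUp R := by
  unfold framePoint frameUp
  rw [add_assoc, ← map_smul, ← map_add]
  congr 2
  ext j; fin_cases j <;> simp

theorem framePoint_coord (y : Plane) :
    framePoint x₀ R (R (y - x₀) 0) (R (y - x₀) 1) = y := by
  unfold framePoint
  have : WithLp.toLp 2 ![R (y - x₀) 0, R (y - x₀) 1] = R (y - x₀) := by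
    ext j; fin_cases j <;> rfl
  rw [this]; simp

theorem coord_framePoint (t u : ℝ) :
    R (framePoint x₀ R t u - x₀) 0 = t ∧ R (framePoint x₀ R t u - x₀) 1 = u := by
  simp [framePoint]

theorem norm_frameUp : ‖frameUp R‖ = 1 := by
  rw [frameUp, LinearIsometryEquiv.norm_map, EuclideanSpace.norm_eq]; simp

theorem continuous_framePoint : Continuous fun p : ℝ × ℝ => framePoint x₀ R p.1 p.2 := by
  unfold framePoint
  refine continuous_const.add (R.symm.continuous.comp ((PiLp.continuous_toLp 2 _).comp ?_))
  refine continuous_pi fun j => ?_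
  fin_cases j
  · exact continuous_fst
  · exact continuous_snd

theorem measurePreserving_framePoint :
    MeasurePreserving (fun p : ℝ × ℝ => framePoint x₀ R p.1 p.2) volume volume := by
  have h1 := (volume_preserving_finTwoArrow ℝ).symm
  have h2 := (PiLp.volume_preserving_toLp (Fin 2)).comp h1
  have h3 := R.symm.measurePreserving.comp h2
  have h4 := (measurePreserving_add_left (volume : Measure Plane) x₀).comp h3
  have e : (fun p : ℝ × ℝ => framePoint x₀ R p.1 p.2) = (fun x => x₀ + x) ∘ R.symm ∘
      WithLp.toLp 2 ∘ MeasurableEquiv.finTwoArrow.symm := rfl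
  rw [e]; exact h4

theorem lipschitzWith_graph {C : ℝ≥0} {ψ : ℝ → ℝ} (hψ : LipschitzWith C ψ) :
    LipschitzWith (1 + C) fun t => framePoint x₀ R t (ψ t) := by
  refine LipschitzWith.of_dist_le_mul fun s t => ?_
  have h1 := hψ.dist_le_mul s t
  rw [Real.dist_eq] at h1
  have h2 : dist (framePoint x₀ R s (ψ s)) (framePoint x₀ R t (ψ t)) ≤
      |s - t| + |ψ s - ψ t| := by
    unfold framePoint
    rw [dist_add_left, LinearIsometryEquiv.dist_map, EuclideanSpace.dist_eq, Real.sqrt_le_left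
      (by positivity)]
    simp only [Fin.sum_univ_two, Real.dist_eq]
    simp only [Matrix.cons_val_zero, Matrix.cons_val_one, sq_abs]
    nlinarith [sq_abs (s - t), sq_abs (ψ s - ψ t), abs_nonneg (s - t), abs_nonneg (ψ s - ψ t),
      mul_nonneg (abs_nonneg (s - t)) (abs_nonneg (ψ s - ψ t))]
  rw [Real.dist_eq] at *
  push_cast
  nlinarith

end Frame

/-- `G` lies on the graph of `ψ` over the first axis of the frame. -/
def OnGraph (x₀ : Plane) (R : Plane ≃ₗᵢ[ℝ] Plane) (C : ℝ≥0) (ψ : ℝ → ℝ) (G : Set Plane) : Prop :=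
  LipschitzWith C ψ ∧ G ⊆ Set.range fun t => framePoint x₀ R t (ψ t)

section OnGraph

variable {x₀ : Plane} {R : Plane ≃ₗᵢ[ℝ] Plane} {C : ℝ≥0} {ψ : ℝ → ℝ} {G : Set Plane}

/-- The parametrization of the graph by its first coordinate is Lipschitz with constant `1 + C`, so
it increases one-dimensional measure by at most this factor. Only this inequality is needed, not the
formula for arc length. -/
theorem OnGraph.restrict_le (h : OnGraph x₀ R C ψ G) (hG : MeasurableSet G) :
    (μH[1] : Measure Plane).restrict G ≤
      ((1 + C : ℝ≥0) : ℝ≥0∞) • (Measure.map (fun t => framePoint x₀ R t (ψ t)) volume).restrict G := by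
  set γ := fun t => framePoint x₀ R t (ψ t)
  have hγ : LipschitzWith (1 + C) γ := lipschitzWith_graph x₀ R h.1
  refine Measure.le_iff.2 fun E hE => ?_
  rw [Measure.smul_apply, Measure.restrict_apply hE, Measure.restrict_apply hE,
    Measure.map_apply hγ.continuous.measurable (hE.inter hG)]
  have h1 : E ∩ G ⊆ γ '' (γ ⁻¹' (E ∩ G)) := fun x hx => by
    obtain ⟨t, rfl⟩ := h.2 hx.2
    exact ⟨t, hx, rfl⟩
  refine (measure_mono h1).trans ?_
  have := hγ.hausdorffMeasure_image_le zero_le_one (γ ⁻¹' (E ∩ G))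
  rwa [hausdorffMeasure_real, ENNReal.rpow_one] at this

theorem OnGraph.lintegral_le (h : OnGraph x₀ R C ψ G) (hG : MeasurableSet G) {f : Plane → ℝ≥0∞}
    (hf : Measurable f) :
    ∫⁻ x in G, f x ∂μH[1] ≤ ((1 + C : ℝ≥0) : ℝ≥0∞) *
      ∫⁻ t in (fun t => framePoint x₀ R t (ψ t)) ⁻¹' G, f (framePoint x₀ R t (ψ t)) := by
  have hm := (lipschitzWith_graph x₀ R h.1).continuous.measurable
  refine (lintegral_mono' (h.restrict_le hG) le_rfl).trans ?_
  rw [lintegral_smul_measure, setLIntegral_map hG hf hm, smul_eq_mul]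

/-- Integration over the set swept by translates of a piece of a graph. -/
theorem lintegral_sweep_le {F : Plane → ℝ≥0∞}
    (hF : Measurable F) {T : Set Plane} (hT : MeasurableSet T) {A J : Set ℝ} (hA : MeasurableSet A)
    (hJ : MeasurableSet J)
    (h : ∀ t ∈ A, ∀ s ∈ J, framePoint x₀ R t (ψ t) + s • frameUp R ∈ T) :
    ∫⁻ t in A, ∫⁻ s in J, F (framePoint x₀ R t (ψ t) + s • frameUp R) ≤ ∫⁻ x in T, F x := by
  have hFT : Measurable (T.indicator F) := hF.indicator hT
  have hmp := measurePreserving_framePoint x₀ R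
  calc ∫⁻ t in A, ∫⁻ s in J, F (framePoint x₀ R t (ψ t) + s • frameUp R)
      ≤ ∫⁻ t in A, ∫⁻ s in J, T.indicator F (framePoint x₀ R t (ψ t + s)) := by
        refine setLIntegral_mono' hA fun t ht => setLIntegral_mono' hJ fun s hs => ?_
        rw [framePoint_add, Set.indicator_of_mem (h t ht s hs)]
    _ ≤ ∫⁻ t, ∫⁻ s, T.indicator F (framePoint x₀ R t (ψ t + s)) :=
        (setLIntegral_le_lintegral _ _).trans
          (lintegral_mono fun t => setLIntegral_le_lintegral _ _)
    _ = ∫⁻ t, ∫⁻ u, T.indicator F (framePoint x₀ R t u) := by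
        -- For fixed `t` the shear that straightens the graph is a translation of the second
        -- coordinate, so no regularity of `ψ` enters.
        refine lintegral_congr fun t => ?_
        exact lintegral_add_left_eq_self (fun u => T.indicator F (framePoint x₀ R t u)) (ψ t)
    _ = ∫⁻ p : ℝ × ℝ, T.indicator F (framePoint x₀ R p.1 p.2) := by
        rw [Measure.volume_eq_prod]
        exact (lintegral_prod (fun p : ℝ × ℝ => T.indicator F (framePoint x₀ R p.1 p.2))
          (hFT.comp hmp.measurable).aemeasurable).symm
    _ = ∫⁻ x, T.indicator F x := hmp.lintegral_comp hFT
    _ = ∫⁻ x in T, F x := lintegral_indicator hT F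

/-- Along the segment, `(1 - s/l) f(s)²` equals `q(x)²` at `s = 0` and vanishes at `s = l`.
Integrating its derivative and applying Young's inequality with parameter `κ` to the mixed term
gives the bound. -/
theorem sq_le_lintegral_line {q : Plane → ℝ} (hq : ContDiff ℝ 1 q) (x m : Plane) {l κ : ℝ}
    (hl : 0 < l) (hκ : 0 < κ) :
    ENNReal.ofReal (q x ^ 2) ≤ ∫⁻ s in Set.Ioc 0 l,
      ENNReal.ofReal ((l⁻¹ + κ) * q (x + s • m) ^ 2 + κ⁻¹ * fderiv ℝ q (x + s • m) m ^ 2) := by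
  set f : ℝ → ℝ := fun s => q (x + s • m) with hf
  set f' : ℝ → ℝ := fun s => fderiv ℝ q (x + s • m) m with hf'
  have hd : ∀ s, HasDerivAt f (f' s) s := fun s => by
    have h3 : HasDerivAt (fun s : ℝ => x + s • m) m s := by
      simpa using ((hasDerivAt_id s).smul_const m).const_add x
    exact (hq.differentiable one_ne_zero _).hasFDerivAt.comp_hasDerivAt s h3
  have hc : Continuous f := by have := hq.continuous; fun_prop
  have hc1 : Continuous (fderiv ℝ q) := hq.continuous_fderiv one_ne_zero
  have hc' : Continuous f' := by fun_prop
  set g : ℝ → ℝ := fun s => (1 - s / l) * f s ^ 2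
  set g' : ℝ → ℝ := fun s => -(1 / l) * f s ^ 2 + (1 - s / l) * (2 * f s * f' s)
  have hg : ∀ s, HasDerivAt g (g' s) s := fun s => by
    have h1 : HasDerivAt (fun s : ℝ => 1 - s / l) (-(1 / l)) s :=
      ((hasDerivAt_id s).div_const l).const_sub 1
    have h2 : HasDerivAt (fun s => f s ^ 2) (2 * f s * f' s) s := by
      simpa using (hd s).fun_pow 2
    exact h1.mul h2
  have hgc : Continuous g' := by fun_prop
  have hint := intervalIntegral.integral_eq_sub_of_hasDerivAt (fun s _ => hg s)
    (hgc.intervalIntegrable 0 l)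
  have hg0 : g 0 = q x ^ 2 := by simp [g, f]
  have hgl : g l = 0 := by simp [g, div_self hl.ne']
  rw [hg0, hgl, zero_sub] at hint
  set h : ℝ → ℝ := fun s => (l⁻¹ + κ) * f s ^ 2 + κ⁻¹ * f' s ^ 2
  have hhc : Continuous h := by fun_prop
  have hle : q x ^ 2 ≤ ∫ s in (0 : ℝ)..l, h s := by
    rw [← neg_neg (q x ^ 2), ← hint, ← intervalIntegral.integral_neg]
    refine intervalIntegral.integral_mono_on hl.le (hgc.neg.intervalIntegrable _ _)
      (hhc.intervalIntegrable _ _) fun s hs => ?_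
    have h1 : 0 ≤ 1 - s / l := by
      rw [sub_nonneg, div_le_one hl]; exact hs.2
    have h2 : 1 - s / l ≤ 1 := by
      have := div_nonneg hs.1 hl.le; linarith
    have h3 : -((1 - s / l) * (2 * f s * f' s)) ≤ κ * f s ^ 2 + κ⁻¹ * f' s ^ 2 := by
      have h4 : |2 * f s * f' s| ≤ κ * f s ^ 2 + κ⁻¹ * f' s ^ 2 := by
        have h5 : κ * κ⁻¹ = 1 := mul_inv_cancel₀ hκ.ne'
        have h6 : 0 < κ⁻¹ := inv_pos.2 hκ
        have e1 : κ⁻¹ * (κ * f s - f' s) ^ 2 =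
            κ * f s ^ 2 - 2 * f s * f' s + κ⁻¹ * f' s ^ 2 := by field_simp; ring
        have e2 : κ⁻¹ * (κ * f s + f' s) ^ 2 =
            κ * f s ^ 2 + 2 * f s * f' s + κ⁻¹ * f' s ^ 2 := by field_simp; ring
        rw [abs_le]
        constructor
        · have := mul_nonneg h6.le (sq_nonneg (κ * f s + f' s)); linarith
        · have := mul_nonneg h6.le (sq_nonneg (κ * f s - f' s)); linarith
      calc -((1 - s / l) * (2 * f s * f' s)) ≤ |(1 - s / l) * (2 * f s * f' s)| := neg_le_abs _
        _ = (1 - s / l) * |2 * f s * f' s| := by rw [abs_mul, abs_of_nonneg h1]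
        _ ≤ 1 * |2 * f s * f' s| := by gcongr
        _ ≤ _ := by rw [one_mul]; exact h4
    show -g' s ≤ h s
    have : (1 : ℝ) / l = l⁻¹ := one_div l
    simp only [g', h, this]
    linarith
  refine (ENNReal.ofReal_le_ofReal hle).trans (le_of_eq ?_)
  rw [intervalIntegral.integral_of_le hl.le, ofReal_integral_eq_lintegral_ofReal]
  · exact (hhc.integrableOn_Icc (a := 0) (b := l)).mono_set Set.Ioc_subset_Icc_self
  · exact Filter.Eventually.of_forall fun s => by positivity

/-- Trace inequality on a piece of a graph, by short translations. -/
theorem OnGraph.energy_le_of_translates (h : OnGraph x₀ R C ψ G) (hG : MeasurableSet G)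
    {q : Plane → ℝ} (hq : ContDiff ℝ 1 q) {l κ : ℝ} (hl : 0 < l) (hκ : 0 < κ) {T : Set Plane}
    (hT : MeasurableSet T)
    (hsub : ∀ x ∈ G, ∀ s ∈ Set.Ioc 0 l, x + s • frameUp R ∈ T) :
    energy (μH[1].restrict G) q ≤ ((1 + C : ℝ≥0) : ℝ≥0∞) *
      (ENNReal.ofReal (l⁻¹ + κ) * energy (volume.restrict T) q +
        ENNReal.ofReal κ⁻¹ * energy (volume.restrict T) fun x => fderiv ℝ q x (frameUp R)) := by
  have hc1 : Continuous (fderiv ℝ q) := hq.continuous_fderiv one_ne_zero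
  have hqc := hq.continuous
  refine (h.lintegral_le hG (f := fun x => ENNReal.ofReal (q x ^ 2)) (by fun_prop)).trans ?_
  gcongr
  have hγ := (lipschitzWith_graph x₀ R h.1).continuous.measurable
  set F : Plane → ℝ≥0∞ := fun x =>
    ENNReal.ofReal ((l⁻¹ + κ) * q x ^ 2 + κ⁻¹ * fderiv ℝ q x (frameUp R) ^ 2) with hF
  have hFm : Measurable F := by
    have : Continuous fun x => (l⁻¹ + κ) * q x ^ 2 + κ⁻¹ * fderiv ℝ q x (frameUp R) ^ 2 := by
      fun_prop
    exact this.measurable.ennreal_ofReal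
  calc _ ≤ ∫⁻ t in (fun t => framePoint x₀ R t (ψ t)) ⁻¹' G, ∫⁻ s in Set.Ioc 0 l,
        F (framePoint x₀ R t (ψ t) + s • frameUp R) :=
        lintegral_mono fun t => sq_le_lintegral_line hq _ _ hl hκ
    _ ≤ ∫⁻ x in T, F x := lintegral_sweep_le hFm hT (hγ hG) measurableSet_Ioc
        fun t ht s hs => hsub _ ht s hs
    _ = _ := by
        unfold energy
        rw [← lintegral_const_mul' _ _ ENNReal.ofReal_ne_top,
          ← lintegral_const_mul' _ _ ENNReal.ofReal_ne_top, ← lintegral_add_left (by fun_prop)]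
        refine lintegral_congr fun x => ?_
        have : 0 < l⁻¹ := inv_pos.2 hl
        have : 0 < κ⁻¹ := inv_pos.2 hκ
        rw [← ENNReal.ofReal_mul (by positivity), ← ENNReal.ofReal_mul (by positivity),
          ← ENNReal.ofReal_add (by positivity) (by positivity)]

end OnGraph

/-! ### The trace inequality for polynomials in one variable -/

theorem exists_antiderivative (Q : ℝ[X]) :
    ∃ Ψ : ℝ[X], derivative Ψ = Q ∧ Ψ.natDegree ≤ Q.natDegree + 1 := by
  refine ⟨∑ i ∈ Finset.range (Q.natDegree + 1), C (Q.coeff i / (i + 1)) * X ^ (i + 1), ?_, ?_⟩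
  · conv_rhs => rw [Q.as_sum_range_C_mul_X_pow]
    rw [derivative_sum]
    refine Finset.sum_congr rfl fun i _ => ?_
    rw [derivative_C_mul_X_pow]
    have : (i : ℝ) + 1 ≠ 0 := by positivity
    simp [div_mul_cancel₀ _ this]
  · refine natDegree_sum_le_of_forall_le _ _ fun i hi => ?_
    refine (natDegree_C_mul_X_pow_le _ _).trans ?_
    have := Finset.mem_range.1 hi
    omega

/-- The value `P(0)²` is the derivative at `1` of a primitive `Ψ` of `P(l - l s)²` of degree at most
`2N + 1`. With `Ψ(0) = 0` the primitive is nondecreasing and nonnegative on `[0, 1]`, so Markov's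
inequality at the end point bounds the derivative by `Ψ(1)`, which is the integral. -/
theorem sq_eval_zero_le (P : ℝ[X]) {N : ℕ} (hP : P.natDegree ≤ N) {l : ℝ} (hl : 0 < l) :
    P.eval 0 ^ 2 ≤ 2 * (2 * N + 1) ^ 2 / l * ∫ s in (0 : ℝ)..l, P.eval s ^ 2 := by
  obtain ⟨Ψ₀, hΨ', hdeg⟩ := exists_antiderivative ((P.comp (C l - C l * X)) ^ 2)
  set Ψ := Ψ₀ - C (Ψ₀.eval 0) with hΨ
  have hd : derivative Ψ = (P.comp (C l - C l * X)) ^ 2 := by simp [hΨ, hΨ']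
  have hN : Ψ.natDegree ≤ 2 * N + 1 := by
    rw [hΨ]
    rw [natDegree_sub_C]
    refine hdeg.trans ?_
    have h1 := natDegree_pow_le (p := P.comp (C l - C l * X)) (n := 2)
    have h2 : (P.comp (C l - C l * X)).natDegree ≤ N := by
      refine natDegree_comp_le.trans ?_
      have : (C l - C l * X).natDegree ≤ 1 :=
        (natDegree_sub_le _ _).trans (by simp [(natDegree_C_mul_le l X).trans])
      nlinarith
    omega
  obtain ⟨c, x, hx, hc, hs⟩ := exists_endpoint_derivative_formula (2 * N + 1)
  have h1 := hc Ψ hN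
  rw [hd] at h1
  have h0 : ((P.comp (C l - C l * X)) ^ 2).eval 1 = P.eval 0 ^ 2 := by simp
  rw [h0] at h1
  have hcont : Continuous fun s => ((P.comp (C l - C l * X)) ^ 2).eval s := Polynomial.continuous _
  have hint : ∀ y, Ψ.eval y = ∫ s in (0 : ℝ)..y, ((P.comp (C l - C l * X)) ^ 2).eval s := by
    intro y
    rw [intervalIntegral.integral_eq_sub_of_hasDerivAt (f := fun s => Ψ.eval s)
      (fun s _ => by rw [← hd]; exact Ψ.hasDerivAt s) (hcont.intervalIntegrable _ _)]
    simp [hΨ]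
  have hpos : ∀ s, 0 ≤ ((P.comp (C l - C l * X)) ^ 2).eval s := fun s => by
    rw [eval_pow]; exact sq_nonneg _
  have hb : ∀ i, |Ψ.eval (x i)| ≤ Ψ.eval 1 := fun i => by
    rw [hint, hint, abs_of_nonneg (intervalIntegral.integral_nonneg (hx i).1 fun s _ => hpos s)]
    exact intervalIntegral.integral_mono_interval le_rfl (hx i).1 (hx i).2
      (Filter.Eventually.of_forall hpos) (hcont.intervalIntegrable _ _)
  have h2 : Ψ.eval 1 = l⁻¹ * ∫ s in (0 : ℝ)..l, P.eval s ^ 2 := by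
    rw [hint]
    have := intervalIntegral.integral_comp_sub_mul (fun s => P.eval s ^ 2) hl.ne' l (a := 0) (b := 1)
    simp only [mul_one, sub_self, mul_zero, sub_zero, smul_eq_mul] at this
    rw [← this]
    simp
  calc P.eval 0 ^ 2 = ∑ i ∈ Finset.range (2 * N + 1 + 1), c i * Ψ.eval (x i) := h1
    _ ≤ ∑ i ∈ Finset.range (2 * N + 1 + 1), |c i| * Ψ.eval 1 := by
        refine Finset.sum_le_sum fun i _ => (le_abs_self _).trans ?_
        rw [abs_mul]
        exact mul_le_mul_of_nonneg_left (hb i) (abs_nonneg _)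
    _ = (∑ i ∈ Finset.range (2 * N + 1 + 1), |c i|) * Ψ.eval 1 := by rw [Finset.sum_mul]
    _ ≤ (2 * ((2 * N + 1 : ℕ) : ℝ) ^ 2) * Ψ.eval 1 :=
        mul_le_mul_of_nonneg_right hs ((abs_nonneg _).trans (hb 0))
    _ = _ := by rw [h2]; push_cast; field_simp

theorem sq_le_lintegral_segment {N : ℕ} {q : Plane → ℝ} (hp : PolyAlong Finset.univ N q)
    (x m : Plane) {l : ℝ} (hl : 0 < l) :
    ENNReal.ofReal (q x ^ 2) ≤ ∫⁻ s in Set.Ioc 0 l,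
      ENNReal.ofReal (2 * (2 * N + 1) ^ 2 / l * q (x + s • m) ^ 2) := by
  obtain ⟨P, hP, hPe⟩ := hp x (x + m)
  have hPe' : ∀ s, q (x + s • m) = P.eval s := fun s => by
    rw [hPe, scaleAbout_univ, add_sub_cancel_left]
  simp_rw [hPe']
  have hx : q x = P.eval 0 := by rw [← hPe']; simp
  rw [hx]
  refine (ENNReal.ofReal_le_ofReal (sq_eval_zero_le P hP hl)).trans (le_of_eq ?_)
  have hc : Continuous fun s => 2 * (2 * (N : ℝ) + 1) ^ 2 / l * P.eval s ^ 2 := by fun_prop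
  rw [← intervalIntegral.integral_const_mul, intervalIntegral.integral_of_le hl.le,
    ofReal_integral_eq_lintegral_ofReal]
  · exact (hc.integrableOn_Icc (a := 0) (b := l)).mono_set Set.Ioc_subset_Icc_self
  · exact Filter.Eventually.of_forall fun s => by positivity

/-- Trace inequality on a piece of a graph for polynomials, by translations up (`ε = 1`) or down
(`ε = -1`). -/
theorem OnGraph.energy_le_of_segments {x₀ : Plane} {R : Plane ≃ₗᵢ[ℝ] Plane} {C : ℝ≥0} {ψ : ℝ → ℝ}
    {G : Set Plane} (h : OnGraph x₀ R C ψ G) (hG : MeasurableSet G) {N : ℕ}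
    {q : Plane → ℝ} (hq : Measurable q) (hp : PolyAlong Finset.univ N q) {l : ℝ} (hl : 0 < l)
    {T : Set Plane} (hT : MeasurableSet T) {ε : ℝ} (hε : ε = 1 ∨ ε = -1)
    (hsub : ∀ x ∈ G, ∀ s ∈ Set.Ioc 0 l, x + s • ε • frameUp R ∈ T) :
    energy (μH[1].restrict G) q ≤ ((1 + C : ℝ≥0) : ℝ≥0∞) *
      (ENNReal.ofReal (2 * (2 * N + 1) ^ 2 / l) * energy (volume.restrict T) q) := by
  refine (h.lintegral_le hG (f := fun x => ENNReal.ofReal (q x ^ 2)) (by fun_prop)).trans ?_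
  gcongr
  have hγ := (lipschitzWith_graph x₀ R h.1).continuous.measurable
  set F : Plane → ℝ≥0∞ := fun x => ENNReal.ofReal (2 * (2 * N + 1) ^ 2 / l * q x ^ 2) with hF
  have hFm : Measurable F := by fun_prop
  have hJ : MeasurableSet ((fun s => ε * s) ⁻¹' Set.Ioc 0 l) :=
    (measurable_const_mul ε) measurableSet_Ioc
  have hmp : MeasurePreserving (fun s : ℝ => ε * s) := by
    rcases hε with rfl | rfl
    · simp only [one_mul]; exact MeasurePreserving.id (volume : Measure ℝ)
    · simpa using Measure.measurePreserving_neg (volume : Measure ℝ)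
  have hee : ε * ε = 1 := by rcases hε with rfl | rfl <;> norm_num
  calc _ ≤ ∫⁻ t in (fun t => framePoint x₀ R t (ψ t)) ⁻¹' G, ∫⁻ s in Set.Ioc 0 l,
        F (framePoint x₀ R t (ψ t) + s • ε • frameUp R) :=
        lintegral_mono fun t => sq_le_lintegral_segment hp _ _ hl
    _ = ∫⁻ t in (fun t => framePoint x₀ R t (ψ t)) ⁻¹' G,
          ∫⁻ s in (fun s => ε * s) ⁻¹' Set.Ioc 0 l,
        F (framePoint x₀ R t (ψ t) + s • frameUp R) := by
        refine lintegral_congr fun t => ?_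
        have hm : Measurable fun s : ℝ => F (framePoint x₀ R t (ψ t) + s • ε • frameUp R) := by
          refine hFm.comp (Continuous.measurable ?_); fun_prop
        rw [← hmp.setLIntegral_comp_preimage measurableSet_Ioc hm]
        refine lintegral_congr fun s => ?_
        rw [smul_smul, mul_comm (ε * s), ← mul_assoc, hee, one_mul]
    _ ≤ ∫⁻ x in T, F x := lintegral_sweep_le hFm hT (hγ hG) hJ
        fun t ht s hs => by
          have := hsub _ ht _ hs
          rwa [smul_smul, mul_comm (ε * s), ← mul_assoc, hee, one_mul] at this
    _ = _ := by
        unfold energy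
        rw [← lintegral_const_mul' _ _ ENNReal.ofReal_ne_top]
        exact lintegral_congr fun x => ENNReal.ofReal_mul (by positivity)

end
end UnfittedLDG

namespace UnfittedLDG
noncomputable section
open scoped ENNReal NNReal

/-! ### Trace inequality from an expanded convex set -/

/-- A relative enlargement of the ratio by `N⁻²` multiplies `bigT` by at most `exp (6 L / N)`, which
remains bounded in the power `2 (N + 1)`. The two surplus factors `bigT (2 lam - 1)` are bounded by
`4 L` each. -/
theorem bigT_expanded_pow_le {N : ℕ} (hN : 1 ≤ N) {lam L : ℝ} (h1 : 1 ≤ lam) (hL : lam ≤ L) :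
    bigT (2 * (lam * (1 + 1 / (N : ℝ) ^ 2)) - 1) ^ (2 * (N + 1)) ≤
      16 * L ^ 2 * Real.exp (24 * L) * bigT (2 * lam - 1) ^ (2 * N) := by
  have hN' : (1 : ℝ) ≤ N := by exact_mod_cast hN
  have hL1 : 1 ≤ L := h1.trans hL
  set s : ℝ := 2 * L / (N : ℝ) ^ 2 with hs
  have hs0 : 0 ≤ s := by positivity
  have ht : 1 ≤ 2 * lam - 1 := by linarith
  have e1 : 2 * (lam * (1 + 1 / (N : ℝ) ^ 2)) - 1 ≤ (2 * lam - 1) + s := by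
    have : lam * (1 / (N : ℝ) ^ 2) ≤ L * (1 / (N : ℝ) ^ 2) := by gcongr
    have e : s = 2 * (L * (1 / (N : ℝ) ^ 2)) := by rw [hs]; ring
    rw [e]; linarith
  have e0 : 1 ≤ 2 * (lam * (1 + 1 / (N : ℝ) ^ 2)) - 1 := by
    have : 0 ≤ lam * (1 / (N : ℝ) ^ 2) := by positivity
    linarith
  have hsq : Real.sqrt s ≤ 2 * L / N := by
    rw [Real.sqrt_le_left (by positivity), hs, div_pow]
    gcongr; nlinarith
  have hsN : s ≤ 2 * L / N := by
    rw [hs]; gcongr; nlinarith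
  have e2 : bigT (1 + s) ≤ Real.exp (6 * L / N) := by
    refine (bigT_one_add_le hs0).trans (Real.exp_le_exp.2 ?_)
    have : 6 * L / N = 2 * L / N + 2 * (2 * L / N) := by ring
    rw [this]; linarith
  have b1 := one_le_bigT ht
  have e3 : bigT (2 * (lam * (1 + 1 / (N : ℝ) ^ 2)) - 1) ≤
      bigT (2 * lam - 1) * Real.exp (6 * L / N) :=
    (bigT_mono e0 e1).trans ((bigT_add_le ht hs0).trans (by gcongr))
  have b0 := one_le_bigT e0
  calc _ ≤ (bigT (2 * lam - 1) * Real.exp (6 * L / N)) ^ (2 * (N + 1)) := by gcongr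
    _ = bigT (2 * lam - 1) ^ 2 * Real.exp (6 * L / N) ^ (2 * (N + 1)) *
        bigT (2 * lam - 1) ^ (2 * N) := by rw [mul_pow, mul_add, pow_add]; ring
    _ ≤ (16 * L ^ 2) * Real.exp (24 * L) * bigT (2 * lam - 1) ^ (2 * N) := by
        gcongr
        · have := bigT_le_two_mul ht
          calc bigT (2 * lam - 1) ^ 2 ≤ (4 * L) ^ 2 := by gcongr; linarith
            _ = _ := by ring
        · rw [← Real.exp_nat_mul]
          apply Real.exp_le_exp.2
          have : (2 * (N + 1) : ℕ) * (6 * L / N) = 12 * L + 12 * L / N := by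
            push_cast; field_simp; ring
          rw [this]
          have : 12 * L / N ≤ 12 * L := div_le_self (by positivity) hN'
          linarith

/-- A dilation with a slightly larger ratio, about a nearby centre, covers a neighbourhood of the
dilation about a boundary point. -/
theorem exists_expansion_centre {S : Set Plane} (hS : IsOpen S) (hconv : Convex ℝ S) {A g : Plane}
    (hA : A ∈ closure S) {r : ℝ} (hr : 0 < r) (hg : Metric.ball g r ⊆ S) {lam κ : ℝ}
    (hlam : 1 ≤ lam) (hκ : 0 < κ) :
    ∃ c ∈ S, ∀ x z : Plane, A + lam⁻¹ • (x - A) ∈ closure S → ‖z‖ < κ * r →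
      c + (lam * (1 + κ))⁻¹ • (x + z - c) ∈ S := by
  set τ := lam * (1 + κ) with hτ
  have hl0 : 0 < lam := by linarith
  have hτ1 : 1 + κ ≤ τ := by rw [hτ]; nlinarith
  have hτ0 : 0 < τ := by linarith
  have hd : 0 < 1 - τ⁻¹ := by
    rw [sub_pos]; exact inv_lt_one_of_one_lt₀ (by linarith)
  -- Chosen so that `(1 - τ⁻¹) μ = κ / (1 + κ)`. The contracted point is then the convex
  -- combination, with weights `1 / (1 + κ)` and `κ / (1 + κ)`, of the given point of the closure of
  -- `S` and of `g + (κ lam)⁻¹ z`, which lies in the ball about `g`.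
  set μ := κ / ((1 + κ) * (1 - τ⁻¹)) with hμ
  have hμ0 : 0 < μ := by positivity
  have hμ1 : μ ≤ 1 := by
    rw [hμ, div_le_one (by positivity)]
    have : τ⁻¹ ≤ (1 + κ)⁻¹ := inv_anti₀ (by linarith) hτ1
    have h3 : (1 + κ) * (1 + κ)⁻¹ = 1 := mul_inv_cancel₀ (by linarith)
    nlinarith
  have hint : interior S = S := hS.interior_eq
  have hgS : g ∈ S := hg (Metric.mem_ball_self hr)
  refine ⟨A + μ • (g - A), ?_, fun x z hx hz => ?_⟩
  · have := hconv.combo_closure_interior_mem_interior hA (hint.symm ▸ hgS) (a := 1 - μ) (b := μ)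
      (by linarith) hμ0 (by ring)
    rw [hint] at this
    convert this using 1
    module
  · set y := A + lam⁻¹ • (x - A) with hy
    set w := g + (κ * lam)⁻¹ • z with hw
    have hwS : w ∈ S := by
      apply hg
      rw [Metric.mem_ball, hw, dist_eq_norm, add_sub_cancel_left, norm_smul, norm_inv,
        Real.norm_of_nonneg (by positivity), inv_mul_lt_iff₀ (by positivity)]
      calc ‖z‖ < κ * r := hz
        _ = κ * 1 * r := by ring
        _ ≤ κ * lam * r := by gcongr
    have := hconv.combo_closure_interior_mem_interior hx (hint.symm ▸ hwS) (a := (1 + κ)⁻¹)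
      (b := κ / (1 + κ)) (by positivity) (by positivity) (by field_simp)
    rw [hint] at this
    have e1 : (1 - τ⁻¹) * μ = κ / (1 + κ) := by
      rw [hμ, ← div_div, mul_div_cancel₀ _ hd.ne']
    have e2 : τ⁻¹ = (1 + κ)⁻¹ * lam⁻¹ := by rw [hτ, mul_inv, mul_comm]
    have e3 : κ / (1 + κ) * (κ * lam)⁻¹ = τ⁻¹ := by rw [hτ]; field_simp
    have key : A + μ • (g - A) + τ⁻¹ • (x + z - (A + μ • (g - A))) =
        (1 + κ)⁻¹ • y + (κ / (1 + κ)) • w := by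
      have h1 : A + μ • (g - A) + τ⁻¹ • (x + z - (A + μ • (g - A))) =
        A + ((1 - τ⁻¹) * μ) • (g - A) + τ⁻¹ • (x - A) + τ⁻¹ • z := by module
      have h2 : (1 + κ)⁻¹ + κ / (1 + κ) = 1 := by field_simp
      rw [h1, e1, hy, hw]
      have h3 : (1 + κ)⁻¹ • (A + lam⁻¹ • (x - A)) + (κ / (1 + κ)) • (g + (κ * lam)⁻¹ • z) =
        ((1 + κ)⁻¹ + κ / (1 + κ)) • A + (κ / (1 + κ)) • (g - A) +
          ((1 + κ)⁻¹ * lam⁻¹) • (x - A) + (κ / (1 + κ) * (κ * lam)⁻¹) • z := by module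
      rw [h3, h2, ← e2, e3, one_smul]
    rw [key]; exact this

/-- The constant in `OnGraph.energy_le_of_expansion`. -/
def expansionConst (C : ℝ≥0) (L : ℝ) : ℝ := (1 + C) * 1027 * (16 * L ^ 2 * Real.exp (24 * L))

/-- The set `T` is the dilation of `S` with ratio `lam (1 + N⁻²)` about a suitable centre, so it
contains `G` together with its translates by vectors shorter than `r N⁻²`. The trace inequality by
translations of length `r N⁻² / 2`, with Markov's inequality on `T` for the derivative, costs a
multiple of `N² / r`; extrapolation from `S` to `T` costs the power of `bigT`. -/
theorem OnGraph.energy_le_of_expansion {x₀ : Plane} {R : Plane ≃ₗᵢ[ℝ] Plane} {C : ℝ≥0} {ψ : ℝ → ℝ}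
    {G : Set Plane} (h : OnGraph x₀ R C ψ G) (hG : MeasurableSet G) {N : ℕ} (hN : 1 ≤ N)
    {q : Plane → ℝ} (hq : ContDiff ℝ 1 q) (hp : PolyAlong Finset.univ N q)
    {S : Set Plane} (hS : IsOpen S) (hconv : Convex ℝ S) {A g : Plane} (hA : A ∈ closure S)
    {r : ℝ} (hr : 0 < r) (hg : Metric.ball g r ⊆ S) {lam L : ℝ} (hlam : 1 ≤ lam) (hL : lam ≤ L)
    (hsub : ∀ x ∈ G, A + lam⁻¹ • (x - A) ∈ closure S) :
    energy (μH[1].restrict G) q ≤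
      ENNReal.ofReal (expansionConst C L * (N : ℝ) ^ 2 / r * bigT (2 * lam - 1) ^ (2 * N)) *
        energy (volume.restrict S) q := by
  have hN' : (1 : ℝ) ≤ N := by exact_mod_cast hN
  set κ : ℝ := 1 / (N : ℝ) ^ 2 with hκ
  have hκ0 : 0 < κ := by positivity
  obtain ⟨c, hcS, hc⟩ := exists_expansion_centre hS hconv hA hr hg hlam hκ0
  set τ := lam * (1 + κ) with hτ
  have hτ1 : 1 ≤ τ := by rw [hτ]; nlinarith
  have hτ0 : 0 < τ := by linarith
  set f : Plane → Plane := fun x => c + τ⁻¹ • (x - c) with hf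
  have hfc : Continuous f := by fun_prop
  set T := f ⁻¹' S with hT
  have hTo : IsOpen T := hS.preimage hfc
  have hTconv : Convex ℝ T := by
    intro x hx y hy a b ha hb hab
    have := hconv hx hy ha hb hab
    show f (a • x + b • y) ∈ S
    convert this using 1
    simp only [hf]
    have : a = 1 - b := by linarith
    rw [this]; module
  set m := frameUp R
  have hm : ‖m‖ = 1 := norm_frameUp R
  -- the energy over the expanded set
  have hE : energy (volume.restrict T) q ≤
      ENNReal.ofReal (16 * L ^ 2 * Real.exp (24 * L) * bigT (2 * lam - 1) ^ (2 * N)) *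
        energy (volume.restrict S) q := by
    refine (energy_scaleAbout_le hq.continuous.measurable hp c hS.measurableSet hTo.measurableSet
      (fun s h0 h1 x hx => ?_) hτ1 fun x hx => ?_).trans ?_
    · rw [scaleAbout_univ]; exact hconv.add_smul_sub_mem hcS hx ⟨h0.le, h1⟩
    · rw [scaleAbout_univ] at hx
      have : f (c + τ • (x - c)) = x := by
        simp only [hf, add_sub_cancel_left, smul_smul, inv_mul_cancel₀ hτ0.ne', one_smul]
        abel
      rw [← this]; exact hx
    · gcongr
      exact bigT_expanded_pow_le hN hlam hL
  -- the energy of the derivative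
  have hD : energy (volume.restrict T) (fun x => fderiv ℝ q x m) ≤
      ENNReal.ofReal (1024 * (N : ℝ) ^ 4 / r ^ 2) * energy (volume.restrict T) q := by
    set c' := c + τ • (g - c) with hc'
    have hfc' : f c' = g := by
      simp only [hf, hc', add_sub_cancel_left, smul_smul, inv_mul_cancel₀ hτ0.ne', one_smul]
      abel
    have h1 : c' ∈ T := by
      show f c' ∈ S
      rw [hfc']; exact hg (Metric.mem_ball_self hr)
    have h2 : c' + (r / 2) • m ∈ T := by
      have : f (c' + (r / 2) • m) = g + (τ⁻¹ * (r / 2)) • m := by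
        rw [← hfc']; simp only [hf]; module
      show f _ ∈ S
      rw [this]
      apply hg
      rw [Metric.mem_ball, dist_eq_norm, add_sub_cancel_left, norm_smul, hm, mul_one,
        Real.norm_of_nonneg (by positivity)]
      have : τ⁻¹ ≤ 1 := inv_le_one_of_one_le₀ hτ1
      nlinarith
    have h3 := energy_directional_derivative_le hq hp hTo.measurableSet hTconv h1 h2
    have h4 : (fun x => fderiv ℝ q x m) = fun x => (2 / r) * fderiv ℝ q x ((r / 2) • m) := by
      ext x
      rw [map_smul, smul_eq_mul]; field_simp
    rw [h4, energy_const_mul]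
    refine (mul_le_mul_right h3 _).trans ?_
    rw [← mul_assoc, ← ENNReal.ofReal_mul (by positivity)]
    gcongr
    have : (N : ℝ) + 1 ≤ 2 * N := by linarith
    calc (2 / r) ^ 2 * (16 * ((N : ℝ) + 1) ^ 4) ≤ (2 / r) ^ 2 * (16 * (2 * N) ^ 4) := by gcongr
      _ = _ := by field_simp; ring
  have hl : 0 < κ * r / 2 := by positivity
  have hκ2 : 0 < (N : ℝ) ^ 2 / r := by positivity
  refine (h.energy_le_of_translates hG hq hl hκ2 hTo.measurableSet fun x hx s hs => ?_).trans ?_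
  · refine hc x (s • m) (hsub x hx) ?_
    rw [norm_smul, hm, mul_one, Real.norm_of_nonneg hs.1.le]
    have := hs.2
    have : 0 < κ * r := by positivity
    linarith
  · calc _ ≤ ((1 + C : ℝ≥0) : ℝ≥0∞) *
        (ENNReal.ofReal ((κ * r / 2)⁻¹ + (N : ℝ) ^ 2 / r) * energy (volume.restrict T) q +
        ENNReal.ofReal ((N : ℝ) ^ 2 / r)⁻¹ * (ENNReal.ofReal (1024 * (N : ℝ) ^ 4 / r ^ 2) *
          energy (volume.restrict T) q)) := by gcongr
      -- In units of `N² / r`: `2` from the reciprocal length of the translations, `1` from the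
      -- parameter of Young's inequality, `1024` from the derivative.
      _ = ENNReal.ofReal ((1 + C) * 1027 * (N : ℝ) ^ 2 / r) * energy (volume.restrict T) q := by
        have e1 : ((1 + C : ℝ≥0) : ℝ≥0∞) = ENNReal.ofReal (1 + C) := by
          rw [ENNReal.ofReal_add zero_le_one C.coe_nonneg, ENNReal.ofReal_coe_nnreal]; simp
        rw [e1, ← mul_assoc, ← ENNReal.ofReal_mul (by positivity), ← add_mul,
          ← ENNReal.ofReal_add (by positivity) (by positivity), ← mul_assoc,
          ← ENNReal.ofReal_mul (by positivity)]
        congr 2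
        rw [hκ]; field_simp; ring
      _ ≤ ENNReal.ofReal ((1 + C) * 1027 * (N : ℝ) ^ 2 / r) *
        (ENNReal.ofReal (16 * L ^ 2 * Real.exp (24 * L) * bigT (2 * lam - 1) ^ (2 * N)) *
        energy (volume.restrict S) q) := by gcongr
      _ = _ := by
        rw [← mul_assoc, ← ENNReal.ofReal_mul (by positivity)]
        congr 2
        unfold expansionConst; ring

/-! ### Evaluation of bivariate polynomials -/

theorem evalAt_contDiff (q : MvPolynomial (Fin 2) ℝ) {n : WithTop ℕ∞} : ContDiff ℝ n (evalAt q) := by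
  unfold evalAt
  induction q using MvPolynomial.induction_on with
  | C a => simpa using contDiff_const
  | add p q hp hq => simpa using hp.add hq
  | mul_X p j hp =>
    simp only [map_mul, MvPolynomial.eval_X]
    refine hp.mul ?_
    exact (EuclideanSpace.proj (𝕜 := ℝ) j).contDiff

theorem evalAt_continuous (q : MvPolynomial (Fin 2) ℝ) : Continuous (evalAt q) :=
  (evalAt_contDiff (n := 0) q).continuous

open Polynomial in
-- The degree along a dilation is `2 p`, but along a stretch of one axis it is `p`. This halving of
-- the exponent is what saves `energy_trace_fat`.
theorem polyAlong_evalAt {q : MvPolynomial (Fin 2) ℝ} {p : ℕ} (hq : ∀ j, q.degreeOf j ≤ p)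
    (J : Finset (Fin 2)) : PolyAlong J (J.card * p) (evalAt q) := by
  classical
  intro c x
  set f : Fin 2 → ℝ[X] := fun j => if j ∈ J then C (c j) + X * C (x j - c j) else C (x j)
  refine ⟨MvPolynomial.eval₂ C f q, ?_, fun s => ?_⟩
  · rw [MvPolynomial.eval₂_eq]
    refine natDegree_sum_le_of_forall_le _ _ fun d hd => ?_
    refine (natDegree_C_mul_le _ _).trans ((natDegree_prod_le _ _).trans ?_)
    have h1 : ∀ j, (f j ^ d j).natDegree ≤ if j ∈ J then p else 0 := by
      intro j
      have hdj : d j ≤ p := (MvPolynomial.degreeOf_le_iff.1 (hq j)) d hd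
      by_cases hj : j ∈ J
      · simp only [f, hj, if_true]
        refine natDegree_pow_le.trans ?_
        have : (C (c j) + X * C (x j - c j)).natDegree ≤ 1 := by
          refine (natDegree_add_le _ _).trans (max_le (by simp) ?_)
          exact natDegree_mul_le.trans (by simp)
        nlinarith
      · simp only [f, hj, if_false, ← C_pow, natDegree_C, le_refl]
    calc ∑ j ∈ d.support, (f j ^ d j).natDegree ≤ ∑ j ∈ d.support, if j ∈ J then p else 0 :=
          Finset.sum_le_sum fun j _ => h1 j
      _ ≤ ∑ j, if j ∈ J then p else 0 :=
          Finset.sum_le_sum_of_subset (Finset.subset_univ _)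
      _ = J.card * p := by rw [Finset.sum_ite_mem]; simp
  · have h2 := MvPolynomial.eval₂_comp_left (evalRingHom s) C f q
    rw [coe_evalRingHom] at h2
    rw [h2]
    unfold evalAt
    rw [MvPolynomial.eval, MvPolynomial.coe_eval₂Hom]
    have e1 : (evalRingHom s).comp C = RingHom.id ℝ := by ext; simp
    rw [e1]
    congr 1
    ext j
    simp only [Function.comp, f, scaleAbout_apply]
    by_cases hj : j ∈ J <;> simp [hj]

end
end UnfittedLDG

namespace UnfittedLDG
noncomputable section
open scoped ENNReal NNReal

/-! ### The outer normal is Borel measurable -/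

/-- For small `t > 0` the point `x + t (ν' - ν)` would lie in `U` by the blow-up for `ν`, and
outside `U` by that for `ν'`. -/
theorem IsOuterNormal.unique {U : Set Plane} {x ν ν' : Plane} (h : IsOuterNormal U x ν)
    (h' : IsOuterNormal U x ν') : ν = ν' := by
  by_contra hne
  have hz : ν' - ν ≠ 0 := sub_ne_zero.2 (Ne.symm hne)
  set z := ν' - ν with hz'
  set k := (1 - inner ℝ ν ν' : ℝ) with hk
  have h1 : inner ℝ z ν' = k := by
    rw [hz', inner_sub_left, real_inner_self_eq_norm_sq, h'.1]; simp [hk]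
  have h2 : inner ℝ z ν = -k := by
    rw [hz', inner_sub_left, real_inner_self_eq_norm_sq, h.1, real_inner_comm]; simp [hk]
  have hk0 : 0 < k := by
    have h3 : inner ℝ z z = 2 * k := by
      conv_lhs => rw [show inner ℝ z z = inner ℝ z ν' - inner ℝ z ν by
        rw [← inner_sub_right]]
      rw [h1, h2]; ring
    have := real_inner_self_pos.2 hz
    linarith
  have hzn : 0 < ‖z‖ := norm_pos_iff.2 hz
  obtain ⟨r, hr, H⟩ := h.2 (k / (2 * ‖z‖)) (by positivity)
  obtain ⟨r', hr', H'⟩ := h'.2 (k / (2 * ‖z‖)) (by positivity)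
  set t := min r r' / (2 * ‖z‖) with ht
  have ht0 : 0 < t := by have := lt_min hr hr'; positivity
  have hn : ‖t • z‖ = min r r' / 2 := by
    rw [norm_smul, Real.norm_of_nonneg ht0.le, ht]; field_simp
  have hm0 := lt_min hr hr'
  have e : x + t • z - x = t • z := by abel
  have key : k / (2 * ‖z‖) * ‖t • z‖ = t * k / 2 := by
    rw [norm_smul, Real.norm_of_nonneg ht0.le]; field_simp
  have A := (H (x + t • z) (by
    rw [Metric.mem_ball, dist_eq_norm, e, hn]; linarith [min_le_left r r'])).2
  have B := (H' (x + t • z) (by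
    rw [Metric.mem_ball, dist_eq_norm, e, hn]; linarith [min_le_right r r'])).1
  rw [e, inner_smul_left, key] at A B
  simp only [conj_trivial] at A B
  have htk : 0 < t * k := by positivity
  exact B (by rw [h1]; linarith) (A (by rw [h2]; linarith))

/-- It suffices to let `ε` and `r` run through reciprocals of integers. In contrapositive form the
condition on the pair of point and normal is closed for each `y`, so the uncountable intersection
over `y` is closed, whatever the set `U`. -/
theorem measurableSet_isOuterNormal (U : Set Plane) :
    MeasurableSet {p : Plane × Plane | IsOuterNormal U p.1 p.2} := by
  have h1 : {p : Plane × Plane | IsOuterNormal U p.1 p.2} = {p | ‖p.2‖ = 1} ∩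
      ⋂ n : ℕ, ⋃ m : ℕ, ⋂ y : Plane, {p : Plane × Plane | 1 / ((m : ℝ) + 1) ≤ ‖y - p.1‖ ∨
        ((y ∈ U → inner ℝ (y - p.1) p.2 ≤ 1 / ((n : ℝ) + 1) * ‖y - p.1‖) ∧
        (y ∉ U → -(1 / ((n : ℝ) + 1) * ‖y - p.1‖) ≤ inner ℝ (y - p.1) p.2))} := by
    ext p
    simp only [Set.mem_ofPred_eq, Set.mem_inter_iff, Set.mem_iInter, Set.mem_iUnion]
    refine and_congr_right fun _ => ⟨fun h n => ?_, fun h ε hε => ?_⟩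
    · obtain ⟨r, hr, H⟩ := h (1 / ((n : ℝ) + 1)) (by positivity)
      obtain ⟨m, hm⟩ := exists_nat_one_div_lt hr
      refine ⟨m, fun y => ?_⟩
      by_cases hy : 1 / ((m : ℝ) + 1) ≤ ‖y - p.1‖
      · exact Or.inl hy
      · right
        have := H y (by rw [Metric.mem_ball, dist_eq_norm]; linarith)
        exact ⟨fun hyU => not_lt.1 fun hlt => this.1 hlt hyU,
          fun hyU => not_lt.1 fun hlt => hyU (this.2 hlt)⟩
    · obtain ⟨n, hn⟩ := exists_nat_one_div_lt hε
      obtain ⟨m, hm⟩ := h n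
      refine ⟨1 / ((m : ℝ) + 1), by positivity, fun y hy => ?_⟩
      rw [Metric.mem_ball, dist_eq_norm] at hy
      have h2 : 1 / ((n : ℝ) + 1) * ‖y - p.1‖ ≤ ε * ‖y - p.1‖ := by gcongr
      rcases hm y with h3 | h3
      · exact absurd h3 (not_le.2 hy)
      · refine ⟨fun hlt hyU => ?_, fun hlt => ?_⟩
        · have := h3.1 hyU; linarith
        · by_contra hyU
          have := h3.2 hyU; linarith
  rw [h1]
  refine (measurableSet_eq_fun (by fun_prop) measurable_const).inter
    (MeasurableSet.iInter fun n => MeasurableSet.iUnion fun m => IsClosed.measurableSet ?_)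
  refine isClosed_iInter fun y => ?_
  refine IsClosed.union (s₁ := {p : Plane × Plane | 1 / ((m : ℝ) + 1) ≤ ‖y - p.1‖})
    (isClosed_le continuous_const (by fun_prop))
    (s₂ := {p : Plane × Plane |
      (y ∈ U → inner ℝ (y - p.1) p.2 ≤ 1 / ((n : ℝ) + 1) * ‖y - p.1‖) ∧
        (y ∉ U → -(1 / ((n : ℝ) + 1) * ‖y - p.1‖) ≤ inner ℝ (y - p.1) p.2)}) ?_
  by_cases hy : y ∈ U
  · simp only [hy, not_true, false_imp_iff, and_true, true_imp_iff]
    exact isClosed_le (by fun_prop) (by fun_prop)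
  · simp only [hy, not_false_iff, false_imp_iff, true_and, true_imp_iff]
    exact isClosed_le (by fun_prop) (by fun_prop)

/-- The graph of the normal field is Borel and, by uniqueness, projects injectively to the first
factor; injective Borel images of Borel sets are Borel (Lusin–Souslin). Measurability makes the flux
integrals additive. -/
theorem measurable_outerNormal (U : Set Plane) : Measurable (outerNormal U) := by
  classical
  set G := {p : Plane × Plane | IsOuterNormal U p.1 p.2}
  have hG : MeasurableSet G := measurableSet_isOuterNormal U
  have himg : ∀ V : Set Plane, MeasurableSet V → MeasurableSet (Prod.fst '' (G ∩ Prod.snd ⁻¹' V)) :=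
    fun V hV => (hG.inter (measurable_snd hV)).image_of_measurable_injOn measurable_fst
      fun a ha b hb hab => Prod.ext hab ((show IsOuterNormal U a.1 a.2 from ha.1).unique
        (by rw [hab]; exact hb.1))
  have hsp : ∀ x ν, IsOuterNormal U x ν → outerNormal U x = ν := fun x ν h => by
    have hex : ∃ ν, IsOuterNormal U x ν := ⟨ν, h⟩
    rw [outerNormal, dif_pos hex]
    exact hex.choose_spec.unique h
  intro V hV
  have h1 : outerNormal U ⁻¹' V = Prod.fst '' (G ∩ Prod.snd ⁻¹' V) ∪
      ((Prod.fst '' (G ∩ Prod.snd ⁻¹' Set.univ))ᶜ ∩ {_x | (0 : Plane) ∈ V}) := by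
    ext x
    simp only [Set.mem_preimage, Set.mem_union, Set.mem_image, Set.mem_inter_iff, Set.mem_compl_iff,
      Set.mem_ofPred_eq, Prod.exists, exists_and_right, exists_eq_right, Set.mem_univ, and_true]
    by_cases hx : ∃ ν, IsOuterNormal U x ν
    · obtain ⟨ν, hν⟩ := hx
      rw [hsp x ν hν]
      constructor
      · exact fun h => Or.inl ⟨ν, hν, h⟩
      · rintro (⟨ν', h, h'⟩ | ⟨h, -⟩)
        · rwa [hν.unique h]
        · exact absurd ⟨ν, hν⟩ h
    · have : outerNormal U x = 0 := by rw [outerNormal, dif_neg hx]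
      rw [this]
      constructor
      · exact fun h => Or.inr ⟨hx, h⟩
      · rintro (⟨ν', h, h'⟩ | ⟨-, h⟩)
        · exact absurd ⟨ν', h⟩ hx
        · exact h
  rw [h1]
  exact (himg V hV).union ((himg _ MeasurableSet.univ).compl.inter (MeasurableSet.const _))

theorem norm_outerNormal_le (U : Set Plane) (x : Plane) : ‖outerNormal U x‖ ≤ 1 := by
  classical
  unfold outerNormal
  split_ifs with h
  · exact h.choose_spec.1.le
  · simp

/-! ### Boundary charts -/

theorem IsPiecewiseC2Domain.isLipschitzDomain {U : Set Plane} (h : IsPiecewiseC2Domain U) :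
    IsLipschitzDomain U where
  isOpen := h.isOpen
  bounded := h.bounded
  chart x hx := by
    obtain ⟨R, r, s, C, φ, h1, h2, -⟩ := h.chart x hx
    exact ⟨R, r, s, C, φ, h1, h2⟩

section Chart

variable {U : Set Plane} {x : Plane} {R : Plane ≃ₗᵢ[ℝ] Plane} {r s : ℝ} {φ : ℝ → ℝ}

theorem continuous_coord (x : Plane) (R : Plane ≃ₗᵢ[ℝ] Plane) (j : Fin 2) :
    Continuous fun y => R (y - x) j := by fun_prop

theorem coord_add_smul_frameUp (x : Plane) (R : Plane ≃ₗᵢ[ℝ] Plane) (y : Plane) (t : ℝ) :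
    R (y + t • frameUp R - x) 0 = R (y - x) 0 ∧ R (y + t • frameUp R - x) 1 = R (y - x) 1 + t := by
  have : R (y + t • frameUp R - x) = R (y - x) + t • WithLp.toLp 2 ![0, 1] := by
    rw [show y + t • frameUp R - x = (y - x) + t • frameUp R by abel, map_add, map_smul, frameUp,
      LinearIsometryEquiv.apply_symm_apply]
  rw [this]; simp

theorem norm_sub_le_coord (x : Plane) (R : Plane ≃ₗᵢ[ℝ] Plane) (y : Plane) :
    ‖y - x‖ ≤ |R (y - x) 0| + |R (y - x) 1| := by
  rw [← R.norm_map, EuclideanSpace.norm_eq, Real.sqrt_le_left (by positivity)]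
  simp only [Fin.sum_univ_two, Real.norm_eq_abs]
  nlinarith [abs_nonneg (R (y - x) 0), abs_nonneg (R (y - x) 1),
    mul_nonneg (abs_nonneg (R (y - x) 0)) (abs_nonneg (R (y - x) 1))]

theorem abs_coord_le (x : Plane) (R : Plane ≃ₗᵢ[ℝ] Plane) (y : Plane) (j : Fin 2) :
    |R (y - x) j| ≤ ‖y - x‖ := by
  rw [← R.norm_map]; exact PiLp.norm_apply_le (R (y - x)) j

theorem IsGraphChart.notMem_closure (h : IsGraphChart U x R r s φ) {y : Plane}
    (h0 : |R (y - x) 0| < r) (h1 : |R (y - x) 1| < s) (hy : φ (R (y - x) 0) < R (y - x) 1) :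
    y ∉ closure U := by
  rw [mem_closure_iff_nhds]
  push Not
  have c0 := continuous_coord x R 0
  have c1 := continuous_coord x R 1
  have hφ : ContinuousAt (fun y => φ (R (y - x) 0)) y :=
    ContinuousAt.comp (f := fun y => R (y - x) 0) (x := y)
      (h.2.2.1.continuousAt (Ioo_mem_nhds (abs_lt.1 h0).1 (abs_lt.1 h0).2)) c0.continuousAt
  refine ⟨{z | |R (z - x) 0| < r ∧ |R (z - x) 1| < s ∧ φ (R (z - x) 0) < R (z - x) 1}, ?_, ?_⟩
  · filter_upwards [(c0.abs.continuousAt (x := y)).eventually_lt continuousAt_const h0,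
      (c1.abs.continuousAt (x := y)).eventually_lt continuousAt_const h1,
      hφ.eventually_lt c1.continuousAt hy] with z a b c using ⟨a, b, c⟩
  · ext z
    simp only [Set.mem_inter_iff, Set.mem_ofPred_eq, Set.mem_empty_iff_false, iff_false]
    rintro ⟨⟨a, b, c⟩, hz⟩
    exact absurd ((h.2.2.2 z a b).1 hz) (not_lt.2 c.le)

theorem IsGraphChart.mem_frontier_iff (hU : IsOpen U) (h : IsGraphChart U x R r s φ) {y : Plane}
    (h0 : |R (y - x) 0| < r) (h1 : |R (y - x) 1| < s) :
    y ∈ frontier U ↔ R (y - x) 1 = φ (R (y - x) 0) := by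
  rw [hU.frontier_eq]
  constructor
  · rintro ⟨hc, hn⟩
    by_contra hne
    rcases lt_or_gt_of_ne hne with hlt | hgt
    · exact hn ((h.2.2.2 y h0 h1).2 hlt)
    · exact h.notMem_closure h0 h1 hgt hc
  · intro he
    refine ⟨?_, fun hy => absurd ((h.2.2.2 y h0 h1).1 hy) (by rw [he]; exact lt_irrefl _)⟩
    rw [Metric.mem_closure_iff]
    intro ε hε
    set t := min (ε / 2) ((s - |R (y - x) 1|) / 2)
    have ht : 0 < t := lt_min (by linarith) (by linarith)
    have hc := coord_add_smul_frameUp x R y (-t)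
    refine ⟨y + (-t) • frameUp R, (h.2.2.2 _ (by rw [hc.1]; exact h0) ?_).2 ?_, ?_⟩
    · rw [hc.2]
      have h2 : t ≤ (s - |R (y - x) 1|) / 2 := min_le_right _ _
      calc |R (y - x) 1 + -t| ≤ |R (y - x) 1| + |-t| := abs_add_le _ _
        _ = |R (y - x) 1| + t := by rw [abs_neg, abs_of_pos ht]
        _ < s := by linarith
    · rw [hc.1, hc.2, he]; linarith
    · rw [dist_eq_norm, show y - (y + (-t) • frameUp R) = t • frameUp R by module, norm_smul,
        norm_frameUp, mul_one, Real.norm_of_nonneg ht.le]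
      have : t ≤ ε / 2 := min_le_left _ _
      linarith

theorem IsGraphChart.apply_zero (hU : IsOpen U) (h : IsGraphChart U x R r s φ)
    (hx : x ∈ frontier U) : φ 0 = 0 := by
  have := (h.mem_frontier_iff hU (y := x) (by simpa using h.1) (by simpa using h.2.1)).1 hx
  simpa using this.symm

end Chart

theorem exists_pos_le_of_finset {ι : Type*} (t : Finset ι) (f : ι → ℝ) (hf : ∀ i ∈ t, 0 < f i) :
    ∃ ρ > 0, ∀ i ∈ t, ρ ≤ f i := by
  classical
  induction t using Finset.induction_on with
  | empty => exact ⟨1, one_pos, by simp⟩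
  | insert a t _ ih =>
    obtain ⟨ρ, hρ, H⟩ := ih fun i hi => hf i (Finset.mem_insert_of_mem hi)
    refine ⟨min ρ (f a), lt_min hρ (hf a (Finset.mem_insert_self a t)), fun i hi => ?_⟩
    rcases Finset.mem_insert.1 hi with rfl | hi
    · exact min_le_right _ _
    · exact (min_le_left _ _).trans (H i hi)

theorem IsLipschitzDomain.isCompact_frontier {U : Set Plane} (hU : IsLipschitzDomain U) :
    IsCompact (frontier U) :=
  Metric.isCompact_of_isClosed_isBounded isClosed_frontier
    (hU.bounded.closure.subset frontier_subset_closure)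

/-- Finitely many graphs cover the boundary, and translations of a uniform size along the charts
lead into the domain, or out of it. -/
structure IsChartCover (U : Set Plane) (t : Finset Plane) (R : Plane → Plane ≃ₗᵢ[ℝ] Plane) (C : ℝ≥0)
    (ψ : Plane → ℝ → ℝ) (B : Plane → Set Plane) (ρ : ℝ) : Prop where
  pos : 0 < ρ
  isOpen : ∀ x, IsOpen (B x)
  cover : frontier U ⊆ ⋃ x ∈ t, B x
  onGraph : ∀ x ∈ t, OnGraph x (R x) C (ψ x) (frontier U ∩ B x)
  down : ∀ x ∈ t, ∀ y ∈ frontier U ∩ B x, ∀ s ∈ Set.Ioc 0 ρ, y + s • (-1 : ℝ) • frameUp (R x) ∈ U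
  up : ∀ x ∈ t, ∀ y ∈ frontier U ∩ B x, ∀ s ∈ Set.Ioc 0 ρ,
    y + s • (1 : ℝ) • frameUp (R x) ∉ closure U

theorem IsLipschitzDomain.exists_chartCover {U : Set Plane} (hU : IsLipschitzDomain U) :
    ∃ t R C ψ B ρ, IsChartCover U t R C ψ B ρ := by
  classical
  have hloc : ∀ x, ∃ (R : Plane ≃ₗᵢ[ℝ] Plane) (C : ℝ≥0) (ψ : ℝ → ℝ) (B : Set Plane) (ρ : ℝ),
      IsOpen B ∧ (x ∈ frontier U → x ∈ B ∧ 0 < ρ ∧ OnGraph x R C ψ (frontier U ∩ B) ∧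
      ∀ y ∈ frontier U ∩ B, ∀ s ∈ Set.Ioc 0 ρ, y + s • (-1 : ℝ) • frameUp R ∈ U ∧
        y + s • (1 : ℝ) • frameUp R ∉ closure U) := by
    intro x
    by_cases hx : x ∈ frontier U
    swap
    · exact ⟨LinearIsometryEquiv.refl ℝ _, 0, 0, ∅, 1, isOpen_empty, fun h => absurd h hx⟩
    obtain ⟨R, r, s, C, φ, hc, hL⟩ := hU.chart x hx
    obtain ⟨ψ, hψ, hE⟩ := hL.extend_real
    have c0 := continuous_coord x R 0
    have c1 := continuous_coord x R 1
    have hr := hc.1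
    have hs := hc.2.1
    -- The box is halved in the vertical direction, so that vertical translations by at most `s / 3`
    -- do not leave the original chart.
    refine ⟨R, C, ψ, {y | |R (y - x) 0| < r ∧ |R (y - x) 1| < s / 2}, s / 3,
      (isOpen_lt c0.abs continuous_const).inter (isOpen_lt c1.abs continuous_const),
      fun _ => ⟨by simp [hr, hs], by linarith, ⟨hψ, ?_⟩, ?_⟩⟩
    · rintro y ⟨hy, h0, h1⟩
      have h2 := (hc.mem_frontier_iff hU.isOpen h0 (by linarith)).1 hy
      rw [hE (abs_lt.1 h0)] at h2
      refine ⟨R (y - x) 0, ?_⟩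
      simp only
      rw [← h2]; exact framePoint_coord x R y
    · rintro y ⟨hy, h0, h1⟩ a ha
      have h2 := (hc.mem_frontier_iff hU.isOpen h0 (by linarith)).1 hy
      have ha2 := ha.2
      have ha1 := ha.1
      rw [abs_lt] at h1
      constructor
      · rw [smul_smul, mul_neg_one]
        have hcc := coord_add_smul_frameUp x R y (-a)
        refine (hc.2.2.2 _ (by rw [hcc.1]; exact h0) ?_).2 ?_
        · rw [hcc.2, abs_lt]; constructor <;> linarith
        · rw [hcc.1, hcc.2, h2]; linarith
      · rw [smul_smul, mul_one]
        have hcc := coord_add_smul_frameUp x R y a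
        refine hc.notMem_closure (by rw [hcc.1]; exact h0) ?_ ?_
        · rw [hcc.2, abs_lt]; constructor <;> linarith
        · rw [hcc.1, hcc.2, h2]; linarith
  choose R C ψ B ρ hB H using hloc
  obtain ⟨t, ht, hcov⟩ := hU.isCompact_frontier.elim_nhds_subcover B
    fun x hx => (hB x).mem_nhds (H x hx).1
  obtain ⟨ρ₀, hρ₀, hle⟩ := exists_pos_le_of_finset t ρ fun x hx => (H x (ht x hx)).2.1
  refine ⟨t, R, t.sup C, ψ, B, ρ₀, hρ₀, hB, hcov, fun x hx => ?_, fun x hx y hy s hs => ?_,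
    fun x hx y hy s hs => ?_⟩
  · have := (H x (ht x hx)).2.2.1
    exact ⟨this.1.weaken (Finset.le_sup hx), this.2⟩
  · exact ((H x (ht x hx)).2.2.2 y hy s ⟨hs.1, hs.2.trans (hle x hx)⟩).1
  · exact ((H x (ht x hx)).2.2.2 y hy s ⟨hs.1, hs.2.trans (hle x hx)⟩).2

theorem OnGraph.measure_lt_top {x₀ : Plane} {R : Plane ≃ₗᵢ[ℝ] Plane} {C : ℝ≥0} {ψ : ℝ → ℝ}
    {G : Set Plane} (h : OnGraph x₀ R C ψ G) (hG : MeasurableSet G) (hb : Bornology.IsBounded G) :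
    μH[1] G < ∞ := by
  have h1 := h.lintegral_le hG (f := 1) measurable_one
  simp only [Pi.one_apply, lintegral_one, Measure.restrict_apply, MeasurableSet.univ,
    Set.univ_inter] at h1
  refine h1.trans_lt (ENNReal.mul_lt_top ENNReal.coe_lt_top ?_)
  obtain ⟨K, hK⟩ := hb.subset_ball x₀
  refine Bornology.IsBounded.measure_lt_top ((Metric.isBounded_ball (x := (0 : ℝ)) (r := K)).subset
    fun t ht => ?_)
  have h2 := hK ht
  rw [Metric.mem_ball, dist_eq_norm] at h2
  rw [mem_ball_zero_iff, Real.norm_eq_abs]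
  have h3 := abs_coord_le x₀ R (framePoint x₀ R t (ψ t)) 0
  rw [(coord_framePoint x₀ R t (ψ t)).1] at h3
  exact h3.trans_lt h2

theorem IsLipschitzDomain.hausdorffMeasure_frontier_lt_top {U : Set Plane}
    (hU : IsLipschitzDomain U) : μH[1] (frontier U) < ∞ := by
  obtain ⟨t, R, C, ψ, B, ρ, h⟩ := hU.exists_chartCover
  have h1 : frontier U ⊆ ⋃ x ∈ t, frontier U ∩ B x := fun y hy => by
    have := h.cover hy
    simp only [Set.mem_iUnion, exists_prop] at this ⊢
    obtain ⟨x, hx, hy'⟩ := this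
    exact ⟨x, hx, hy, hy'⟩
  refine (measure_mono h1).trans_lt ((measure_biUnion_finset_le t _).trans_lt ?_)
  refine ENNReal.sum_lt_top.2 fun x hx => (h.onGraph x hx).measure_lt_top
    (isClosed_frontier.measurableSet.inter (h.isOpen x).measurableSet) ?_
  exact hU.isCompact_frontier.isBounded.subset Set.inter_subset_left

/-! ### Arcs -/

/-- Inside the open set `W`, the set `Γ` is the arc `γ`, with parameter function `τ`. -/
structure IsArcChart (Γ W : Set Plane) (γ : ℝ → Plane) (τ : Plane → ℝ) (r : ℝ) : Prop where
  pos : 0 < r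
  isOpen : IsOpen W
  continuous_param : Continuous τ
  continuousOn : ContinuousOn γ (Set.Ioo (-r) r)
  eq_image : Γ ∩ W = γ '' Set.Ioo (-r) r
  param_arc : ∀ t ∈ Set.Ioo (-r) r, τ (γ t) = t

/-- The box is shrunk until, by continuity of `φ`, the graph over the whole base stays below its top
and above its bottom. The boundary inside the box is then one full arc rather than several pieces.
-/
theorem IsLipschitzDomain.exists_arcChart {U : Set Plane} (hU : IsLipschitzDomain U) {x : Plane}
    (hx : x ∈ frontier U) {O : Set Plane} (hO : O ∈ nhds x) :
    ∃ W γ τ r, IsArcChart (frontier U) W γ τ r ∧ W ⊆ O ∧ γ 0 = x := by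
  obtain ⟨R, r, s, C, φ, hc, -⟩ := hU.chart x hx
  obtain ⟨δ, hδ, hball⟩ := Metric.mem_nhds_iff.1 hO
  have hr := hc.1
  have hs := hc.2.1
  set s' := min s (δ / 2)
  have hs' : 0 < s' := lt_min hs (by linarith)
  have h0 := hc.apply_zero hU.isOpen hx
  have hcont : ContinuousAt φ 0 := hc.2.2.1.continuousAt (Ioo_mem_nhds (by linarith) hr)
  obtain ⟨e, he, hφ⟩ := Metric.continuousAt_iff.1 hcont s' hs'
  set r' := min (min r e) (δ / 2)
  have hr' : 0 < r' := lt_min (lt_min hr he) (by linarith)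
  have hr1 : r' ≤ r := (min_le_left _ _).trans (min_le_left _ _)
  have hr2 : r' ≤ e := (min_le_left _ _).trans (min_le_right _ _)
  have hr3 : r' ≤ δ / 2 := min_le_right _ _
  have hs1 : s' ≤ s := min_le_left _ _
  have hs2 : s' ≤ δ / 2 := min_le_right _ _
  have c0 := continuous_coord x R 0
  have c1 := continuous_coord x R 1
  refine ⟨{y | |R (y - x) 0| < r' ∧ |R (y - x) 1| < s'}, fun t => framePoint x R t (φ t),
    fun y => R (y - x) 0, r', ⟨hr', (isOpen_lt c0.abs continuous_const).inter
      (isOpen_lt c1.abs continuous_const), c0, ?_, ?_, fun t _ => (coord_framePoint x R t _).1⟩,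
      ?_, ?_⟩
  · have h1 : ContinuousOn φ (Set.Ioo (-r') r') :=
      hc.2.2.1.mono (Set.Ioo_subset_Ioo (by linarith) hr1)
    exact (continuous_framePoint x R).comp_continuousOn (continuousOn_id.prodMk h1)
  · ext y
    constructor
    · rintro ⟨hy, h1, h2⟩
      refine ⟨R (y - x) 0, abs_lt.1 h1, ?_⟩
      have h3 := (hc.mem_frontier_iff hU.isOpen (h1.trans_le hr1) (h2.trans_le hs1)).1 hy
      simp only
      rw [← h3]; exact framePoint_coord x R y
    · rintro ⟨t, ht, rfl⟩
      have h1 := coord_framePoint x R t (φ t)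
      have h2 : |R (framePoint x R t (φ t) - x) 0| < r' := by rw [h1.1]; exact abs_lt.2 ht
      have h3 : |R (framePoint x R t (φ t) - x) 1| < s' := by
        rw [h1.2]
        have := hφ (x := t) (by rw [Real.dist_eq, sub_zero]; exact (abs_lt.2 ht).trans_le hr2)
        rwa [Real.dist_eq, h0, sub_zero] at this
      refine ⟨(hc.mem_frontier_iff hU.isOpen (h2.trans_le hr1) (h3.trans_le hs1)).2 ?_, h2, h3⟩
      rw [h1.1, h1.2]
  · rintro y ⟨h1, h2⟩
    apply hball
    rw [Metric.mem_ball, dist_eq_norm]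
    have := norm_sub_le_coord x R y
    linarith
  · show framePoint x R 0 (φ 0) = x
    rw [h0]
    have := framePoint_coord x R x
    simpa using this

end
end UnfittedLDG

namespace UnfittedLDG
noncomputable section
open scoped ENNReal NNReal Topology

/-! ### No compact arc has a single end point -/

theorem IsArcChart.reflect {Γ W : Set Plane} {γ : ℝ → Plane} {τ : Plane → ℝ} {r : ℝ}
    (h : IsArcChart Γ W γ τ r) : IsArcChart Γ W (fun t => γ (-t)) (fun y => -τ y) r where
  pos := h.pos
  isOpen := h.isOpen
  continuous_param := h.continuous_param.neg
  continuousOn := h.continuousOn.comp continuousOn_neg fun t ht => by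
    constructor <;> linarith [ht.1, ht.2]
  eq_image := by
    rw [h.eq_image]
    ext y
    constructor
    · rintro ⟨t, ht, rfl⟩
      exact ⟨-t, ⟨by linarith [ht.2], by linarith [ht.1]⟩, by simp⟩
    · rintro ⟨t, ht, rfl⟩
      exact ⟨-t, ⟨by linarith [ht.2], by linarith [ht.1]⟩, rfl⟩
  param_arc t ht := by
    rw [h.param_arc (-t) ⟨by linarith [ht.2], by linarith [ht.1]⟩, neg_neg]

theorem IsArcChart.mem_left {Γ W : Set Plane} {γ : ℝ → Plane} {τ : Plane → ℝ} {r : ℝ}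
    (h : IsArcChart Γ W γ τ r) {t : ℝ} (ht : t ∈ Set.Ioo (-r) r) : γ t ∈ Γ ∩ W := by
  rw [h.eq_image]; exact Set.mem_image_of_mem _ ht

theorem IsArcChart.isPreconnected_image {Γ W : Set Plane} {γ : ℝ → Plane} {τ : Plane → ℝ} {r : ℝ}
    (h : IsArcChart Γ W γ τ r) {s : Set ℝ} (hs : IsPreconnected s) (hsub : s ⊆ Set.Ioo (-r) r) :
    IsPreconnected (γ '' s) := hs.image _ (h.continuousOn.mono hsub)

/-- `J` is a closed piece of `Z` containing `J₀`, open in `Z` except at its end point `x`. -/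
structure IsEndedPiece (Z J₀ J : Set Plane) (x : Plane) : Prop where
  isClosed : IsClosed J
  subset : J ⊆ Z
  start : J₀ ⊆ J
  nhds : ∀ y ∈ J, y ≠ x → J ∈ 𝓝[Z] y
  notMem_nhds : J ∉ 𝓝[Z] x
  mem_closure : x ∈ closure (J \ {x})

theorem IsEndedPiece.mem {Z J₀ J : Set Plane} {x : Plane} (h : IsEndedPiece Z J₀ J x) : x ∈ J :=
  h.isClosed.closure_subset (closure_mono Set.sdiff_subset h.mem_closure)

/-- At the points of `S` the closed set `J` is also open relative to `Z`, so its intersection with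
`S` is open and closed in `S`. -/
theorem IsPreconnected.subset_or_of_mem_nhdsWithin {S Z J : Set Plane} (hS : IsPreconnected S)
    (hSZ : S ⊆ Z) (hJ : IsClosed J) (hn : ∀ y ∈ S, y ∈ J → J ∈ 𝓝[Z] y) : S ⊆ J ∨ S ⊆ Jᶜ := by
  have h2 : ∀ y ∈ S, y ∈ interior (J ∪ Zᶜ) → y ∈ J := fun y hy hi =>
    (interior_subset hi).resolve_right fun hc => hc (hSZ hy)
  have hcov : S ⊆ interior (J ∪ Zᶜ) ∪ Jᶜ := fun y hy => by
    by_cases hyJ : y ∈ J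
    · left
      rw [mem_interior_iff_mem_nhds]
      have := hn y hy hyJ
      rw [mem_nhdsWithin_iff_eventually] at this
      filter_upwards [this] with z hz
      by_cases hzZ : z ∈ Z
      · exact Or.inl (hz hzZ)
      · exact Or.inr hzZ
    · exact Or.inr hyJ
  have hdis : S ∩ (interior (J ∪ Zᶜ) ∩ Jᶜ) = ∅ := by
    ext y
    simp only [Set.mem_inter_iff, Set.mem_empty_iff_false, iff_false]
    rintro ⟨hy, hi, hc⟩
    exact hc (h2 y hy hi)
  rcases isPreconnected_iff_subset_of_disjoint.1 hS (interior (J ∪ Zᶜ)) Jᶜ isOpen_interior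
    hJ.isOpen_compl hcov hdis with h3 | h3
  · exact Or.inl fun y hy => h2 y hy (h3 hy)
  · exact Or.inr h3

theorem IsEndedPiece.subset_or {Z J₀ J : Set Plane} {x : Plane} (h : IsEndedPiece Z J₀ J x)
    {S : Set Plane} (hS : IsPreconnected S) (hSZ : S ⊆ Z) (hx : x ∉ S) : S ⊆ J ∨ S ⊆ Jᶜ :=
  IsPreconnected.subset_or_of_mem_nhdsWithin hS hSZ h.isClosed fun y hy hyJ =>
    h.nhds y hyJ fun e => hx (e ▸ hy)

/-- The arc from `x` up to parameter `3r/4` is appended. The new piece absorbs the whole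
neighbourhood `|τ| < r/2`, which the old piece did not contain, and as `3r/4 < r` the arc continues
outside the new piece beyond its end point. -/
theorem IsEndedPiece.extend {Z J₀ J W : Set Plane} {x : Plane} {γ : ℝ → Plane} {τ : Plane → ℝ}
    {r t : ℝ} (h : IsEndedPiece Z J₀ J x) (hγ : IsArcChart Z W γ τ r)
    (ht : t ∈ Set.Ioo (-(r / 2)) (r / 2)) (hx : γ t = x) (hl : γ '' Set.Ioo (-r) t ⊆ J)
    (hr : γ '' Set.Ioo t r ⊆ Jᶜ) :
    ∃ J' x', IsEndedPiece Z J₀ J' x' ∧ J ⊆ J' ∧ Z ∩ (W ∩ {z | |τ z| < r / 2}) ⊆ J' ∧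
      ¬ Z ∩ (W ∩ {z | |τ z| < r / 2}) ⊆ J := by
  have hr0 := hγ.pos
  have hIcc : Set.Icc t (3 * r / 4) ⊆ Set.Ioo (-r) r := fun u hu =>
    ⟨by linarith [hu.1, ht.1], by linarith [hu.2]⟩
  have hs : 3 * r / 4 ∈ Set.Ioo (-r) r := ⟨by linarith, by linarith⟩
  have hcs : ContinuousAt γ (3 * r / 4) := hγ.continuousOn.continuousAt (Ioo_mem_nhds hs.1 hs.2)
  have key : ∀ z ∈ Z ∩ W, τ z < 3 * r / 4 → z ∈ J ∪ γ '' Set.Icc t (3 * r / 4) := by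
    intro z hz hτ
    rw [hγ.eq_image] at hz
    obtain ⟨u, hu, rfl⟩ := hz
    rw [hγ.param_arc u hu] at hτ
    rcases lt_or_ge u t with hut | hut
    · exact Or.inl (hl ⟨u, ⟨hu.1, hut⟩, rfl⟩)
    · exact Or.inr ⟨u, ⟨hut, hτ.le⟩, rfl⟩
  refine ⟨J ∪ γ '' Set.Icc t (3 * r / 4), γ (3 * r / 4), ⟨?_, ?_, ?_, ?_, ?_, ?_⟩,
    Set.subset_union_left, ?_, ?_⟩
  · exact h.isClosed.union (isCompact_Icc.image_of_continuousOn (hγ.continuousOn.mono hIcc)).isClosed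
  · refine Set.union_subset h.subset ?_
    rintro _ ⟨u, hu, rfl⟩
    exact (hγ.mem_left (hIcc hu)).1
  · exact h.start.trans Set.subset_union_left
  · intro y hy hne
    by_cases hyJ : y ∈ J ∧ y ≠ x
    · exact Filter.mem_of_superset (h.nhds y hyJ.1 hyJ.2) Set.subset_union_left
    have hy' : ∃ u ∈ Set.Icc t (3 * r / 4), γ u = y := by
      rcases hy with hy | hy
      · have : y = x := by by_contra hc; exact hyJ ⟨hy, hc⟩
        exact ⟨t, ⟨le_rfl, by linarith [ht.2]⟩, by rw [hx, this]⟩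
      · exact hy
    obtain ⟨u, hu, rfl⟩ := hy'
    have hlt : u < 3 * r / 4 := lt_of_le_of_ne hu.2 fun e => hne (by rw [e])
    have hO : W ∩ {z | τ z < 3 * r / 4} ∈ 𝓝 (γ u) :=
      (hγ.isOpen.inter (isOpen_lt hγ.continuous_param continuous_const)).mem_nhds
        ⟨(hγ.mem_left (hIcc hu)).2, by
          show τ (γ u) < _
          rw [hγ.param_arc u (hIcc hu)]; exact hlt⟩
    rw [mem_nhdsWithin_iff_eventually]
    filter_upwards [hO] with z hz hzZ
    exact key z ⟨hzZ, hz.1⟩ hz.2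
  · intro hmem
    rw [mem_nhdsWithin_iff_eventually] at hmem
    have h1 := hcs.eventually hmem
    have h2 : ∀ᶠ u in 𝓝[>] (3 * r / 4), u ∈ Set.Ioo (3 * r / 4) r :=
      Ioo_mem_nhdsGT hs.2
    obtain ⟨u, hu1, hu2⟩ := ((h1.filter_mono nhdsWithin_le_nhds).and h2).exists
    have hu : u ∈ Set.Ioo (-r) r := ⟨by linarith [hu2.1], hu2.2⟩
    rcases hu1 (hγ.mem_left hu).1 with h3 | ⟨u', hu', he⟩
    · exact hr ⟨u, ⟨by linarith [hu2.1, ht.2], hu2.2⟩, rfl⟩ h3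
    · have := congrArg τ he
      rw [hγ.param_arc u hu, hγ.param_arc u' (hIcc hu')] at this
      linarith [hu2.1, hu'.2]
  · rw [mem_closure_iff_frequently]
    have h2 : ∀ᶠ u in 𝓝[<] (3 * r / 4), u ∈ Set.Ioo t (3 * r / 4) :=
      Ioo_mem_nhdsLT (by linarith [ht.2])
    refine Filter.Tendsto.frequently (l₁ := 𝓝[<] (3 * r / 4)) (hcs.tendsto.mono_left nhdsWithin_le_nhds)
      (Filter.Eventually.frequently (h2.mono fun u hu => ?_))
    refine ⟨Or.inr ⟨u, ⟨hu.1.le, hu.2.le⟩, rfl⟩, fun he => ?_⟩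
    have := congrArg τ (Set.mem_singleton_iff.1 he)
    rw [hγ.param_arc u (hIcc ⟨hu.1.le, hu.2.le⟩), hγ.param_arc _ hs] at this
    linarith [hu.2]
  · rintro z ⟨hz, hzW, hzτ⟩
    have : |τ z| < r / 2 := hzτ
    exact key z ⟨hz, hzW⟩ (by linarith [le_abs_self (τ z)])
  · intro hsub
    have hu : (t + r / 2) / 2 ∈ Set.Ioo (-r) r := ⟨by linarith [ht.1], by linarith [ht.2]⟩
    refine hr ⟨(t + r / 2) / 2, ⟨by linarith [ht.2], hu.2⟩, rfl⟩
      (hsub ⟨(hγ.mem_left hu).1, (hγ.mem_left hu).2, ?_⟩)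
    show |τ _| < _
    rw [hγ.param_arc _ hu, abs_lt]
    constructor <;> linarith [ht.1, ht.2]

/-- Each of the two half arcs at the end point lies in `J` or misses it. If both lay in `J`, the end
point would be interior; if both missed it, the end point would be isolated in `J`. So exactly one
lies in `J`, on the left after a reflection, and the piece can be continued to the other side. -/
theorem IsEndedPiece.exists_extension {Z J₀ J W : Set Plane} {x : Plane} {γ : ℝ → Plane}
    {τ : Plane → ℝ} {r : ℝ} (h : IsEndedPiece Z J₀ J x) (hγ : IsArcChart Z W γ τ r)
    (hx : x ∈ W ∩ {z | |τ z| < r / 2}) :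
    ∃ J' x', IsEndedPiece Z J₀ J' x' ∧ J ⊆ J' ∧ Z ∩ (W ∩ {z | |τ z| < r / 2}) ⊆ J' ∧
      ¬ Z ∩ (W ∩ {z | |τ z| < r / 2}) ⊆ J := by
  have hr0 := hγ.pos
  have hxZ : x ∈ Z ∩ W := ⟨h.subset h.mem, hx.1⟩
  have hxτ : |τ x| < r / 2 := hx.2
  rw [hγ.eq_image] at hxZ
  obtain ⟨t, ht, hxt⟩ := hxZ
  have hτ : τ x = t := by rw [← hxt, hγ.param_arc t ht]
  rw [hτ, abs_lt] at hxτ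
  have hne : ∀ u ∈ Set.Ioo (-r) r, γ u = x → u = t := fun u hu he => by
    rw [← hγ.param_arc u hu, he, hτ]
  have hside : ∀ s ⊆ Set.Ioo (-r) r, IsPreconnected s → t ∉ s → γ '' s ⊆ J ∨ γ '' s ⊆ Jᶜ := by
    intro s hs hc hts
    refine h.subset_or (hγ.isPreconnected_image hc hs) ?_ ?_
    · rintro _ ⟨u, hu, rfl⟩; exact (hγ.mem_left (hs hu)).1
    · rintro ⟨u, hu, he⟩; exact hts (hne u (hs hu) he ▸ hu)
  have hsl : Set.Ioo (-r) t ⊆ Set.Ioo (-r) r := Set.Ioo_subset_Ioo le_rfl ht.2.le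
  have hsr : Set.Ioo t r ⊆ Set.Ioo (-r) r := Set.Ioo_subset_Ioo ht.1.le le_rfl
  have hcase : ∀ z ∈ Z ∩ W, z = x ∨ z ∈ γ '' Set.Ioo (-r) t ∨ z ∈ γ '' Set.Ioo t r := by
    intro z hz
    rw [hγ.eq_image] at hz
    obtain ⟨u, hu, rfl⟩ := hz
    rcases lt_trichotomy u t with h1 | h1 | h1
    · exact Or.inr (Or.inl ⟨u, ⟨hu.1, h1⟩, rfl⟩)
    · exact Or.inl (by rw [h1, hxt])
    · exact Or.inr (Or.inr ⟨u, ⟨h1, hu.2⟩, rfl⟩)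
  rcases hside _ hsl isPreconnected_Ioo (fun h' => lt_irrefl _ h'.2) with hl | hl <;>
  rcases hside _ hsr isPreconnected_Ioo (fun h' => lt_irrefl _ h'.1) with hr | hr
  · refine absurd ?_ h.notMem_nhds
    rw [mem_nhdsWithin_iff_eventually]
    filter_upwards [hγ.isOpen.mem_nhds hx.1] with z hz hzZ
    rcases hcase z ⟨hzZ, hz⟩ with rfl | h1 | h1
    · exact h.mem
    · exact hl h1
    · exact hr h1
  · exact h.extend hγ ⟨by linarith, by linarith⟩ hxt hl hr
  · have := h.extend hγ.reflect (t := -t) ⟨by linarith, by linarith⟩ (by simpa using hxt)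
      (fun z hz => ?_) (fun z hz => ?_)
    · simpa only [abs_neg] using this
    · obtain ⟨u, hu, rfl⟩ := hz
      exact hr ⟨-u, ⟨by linarith [hu.2], by linarith [hu.1]⟩, rfl⟩
    · obtain ⟨u, hu, rfl⟩ := hz
      exact hl ⟨-u, ⟨by linarith [hu.2], by linarith [hu.1]⟩, rfl⟩
  · exfalso
    obtain ⟨z, hzW, hzJ, hzx⟩ := mem_closure_iff.1 h.mem_closure W hγ.isOpen hx.1
    rcases hcase z ⟨h.subset hzJ, hzW⟩ with h1 | h1 | h1
    · exact hzx h1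
    · exact hl h1 hzJ
    · exact hr h1 hzJ

/-- Finitely many chart neighbourhoods cover `Z`, and every continuation absorbs one more of them
while losing none, which cannot go on for ever. Near the starting piece `J₀` no end point can occur,
so no chart is required there. -/
theorem not_isEndedPiece {Z J₀ J : Set Plane} {x : Plane} (hZ : IsCompact Z)
    (hc : ∀ y ∈ Z, J₀ ∈ 𝓝[Z] y ∨ ∃ W γ τ r, IsArcChart Z W γ τ r ∧ γ 0 = y) :
    ¬ IsEndedPiece Z J₀ J x := by
  classical
  intro hJ
  have hU : ∀ y, ∃ V : Set Plane, y ∈ Z → V ∈ 𝓝 y ∧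
      ∀ J x, IsEndedPiece Z J₀ J x → x ∈ V → ∃ J' x', IsEndedPiece Z J₀ J' x' ∧ J ⊆ J' ∧
        Z ∩ V ⊆ J' ∧ ¬ Z ∩ V ⊆ J := by
    intro y
    by_cases hy : y ∈ Z
    swap
    · exact ⟨∅, fun h => absurd h hy⟩
    rcases hc y hy with h | ⟨W, γ, τ, r, h, h0⟩
    · obtain ⟨O, hO, hyO, hOJ⟩ := mem_nhdsWithin.1 h
      refine ⟨O, fun _ => ⟨hO.mem_nhds hyO, fun J x hJ hx => absurd ?_ hJ.notMem_nhds⟩⟩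
      exact Filter.mem_of_superset (mem_nhdsWithin.2 ⟨O, hO, hx, hOJ⟩) hJ.start
    · have hr := h.pos
      have h00 : (0 : ℝ) ∈ Set.Ioo (-r) r := ⟨by linarith, hr⟩
      refine ⟨W ∩ {z | |τ z| < r / 2}, fun _ => ⟨?_, fun J x hJ hx => hJ.exists_extension h hx⟩⟩
      refine (h.isOpen.inter (isOpen_lt h.continuous_param.abs continuous_const)).mem_nhds ⟨?_, ?_⟩
      · rw [← h0]; exact (h.mem_left h00).2
      · show |τ y| < _
        rw [← h0, h.param_arc 0 h00, abs_zero]; linarith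
  choose V hV using hU
  obtain ⟨t, ht, hcov⟩ := hZ.elim_nhds_subcover V fun y hy => (hV y hy).1
  have key : ∀ n : ℕ, ∃ J x, IsEndedPiece Z J₀ J x ∧ n ≤ (t.filter fun y => Z ∩ V y ⊆ J).card := by
    intro n
    induction n with
    | zero => exact ⟨J, x, hJ, Nat.zero_le _⟩
    | succ n ih =>
      obtain ⟨J, x, hJ, hn⟩ := ih
      obtain ⟨k, hk, hxk⟩ : ∃ k ∈ t, x ∈ V k := by
        simpa using hcov (hJ.subset hJ.mem)
      obtain ⟨J', x', hJ', hsub, hin, hnot⟩ := (hV k (ht k hk)).2 J x hJ hxk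
      refine ⟨J', x', hJ', lt_of_le_of_lt hn (Finset.card_lt_card ?_)⟩
      refine (Finset.ssubset_iff_of_subset fun y hy => ?_).2 ⟨k, ?_, ?_⟩
      · rw [Finset.mem_filter] at hy ⊢
        exact ⟨hy.1, hy.2.trans hsub⟩
      · exact Finset.mem_filter.2 ⟨hk, hin⟩
      · exact fun hk' => hnot (Finset.mem_filter.1 hk').2
  obtain ⟨J, x, -, hn⟩ := key (t.card + 1)
  exact absurd hn (not_le.2 (Nat.lt_succ_of_le (Finset.card_filter_le _ _)))

/-! ### Cutting the interface at a point -/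

/-- If a connected piece `Γ ∩ O` of a boundary `Γ` accumulates at every point of `F`, then cutting
it at `Q` leaves no component which does not reach `F`. -/
theorem IsLipschitzDomain.mem_component_of_cut {U O F : Set Plane} (hU : IsLipschitzDomain U)
    (hO : IsOpen O) (hconn : IsPreconnected (frontier U ∩ O)) {X : Set Plane}
    (hX : X = (frontier U ∩ O) ∪ F) (hXc : IsCompact X) (hFO : Disjoint F O)
    (hF : (F ∩ closure (frontier U ∩ O)).Nonempty) {Q z : Plane} (hQ : Q ∈ frontier U ∩ O)
    (hz : z ∈ frontier U ∩ O) (hzQ : z ≠ Q) :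
    (connectedComponentIn (X \ {Q}) z ∩ F).Nonempty := by
  by_contra hne
  rw [Set.not_nonempty_iff_eq_empty] at hne
  set E := connectedComponentIn (X \ {Q}) z with hE
  have hzX : z ∈ X \ {Q} := ⟨by rw [hX]; exact Or.inl hz, hzQ⟩
  have hzE : z ∈ E := mem_connectedComponentIn hzX
  have hEX : E ⊆ X \ {Q} := connectedComponentIn_subset _ _
  have hEO : E ⊆ (frontier U ∩ O) \ {Q} := fun y hy => by
    refine ⟨?_, (hEX hy).2⟩
    have := (hEX hy).1
    rw [hX] at this
    refine this.resolve_right fun hf => ?_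
    have : y ∈ E ∩ F := ⟨hy, hf⟩
    rw [hne] at this; exact this
  have hEc : IsPreconnected E := isPreconnected_connectedComponentIn
  have habs : ∀ S : Set Plane, IsPreconnected S → S ⊆ (frontier U ∩ O) \ {Q} →
      (S ∩ E).Nonempty → S ⊆ E := by
    rintro S hS hSs ⟨y, hyS, hyE⟩
    have h1 : S ⊆ connectedComponentIn (X \ {Q}) y :=
      hS.subset_connectedComponentIn hyS fun w hw => ⟨by rw [hX]; exact Or.inl (hSs hw).1, (hSs hw).2⟩
    rwa [← connectedComponentIn_eq (hE ▸ hyE)] at h1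
  -- A limit point of the component other than `Q` belongs to `X \ {Q}` and can be adjoined without
  -- loss of connectedness, so it is in the component already.
  have hcl : closure E ⊆ E ∪ {Q} := by
    intro y hy
    by_cases hyQ : y = Q
    · exact Or.inr hyQ
    left
    have hyX : y ∈ X := hXc.isClosed.closure_subset_iff.2 (fun w hw => (hEX hw).1) hy
    have h1 : IsPreconnected (insert y E) :=
      hEc.subset_closure (Set.subset_insert _ _)
        (Set.insert_subset hy subset_closure)
    exact h1.subset_connectedComponentIn (Set.mem_insert_of_mem _ hzE)
      (Set.insert_subset (show y ∈ X \ {Q} from ⟨hyX, hyQ⟩) hEX) (Set.mem_insert _ _)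
  have hchart : ∀ y ∈ (frontier U ∩ O) \ {Q}, ∃ W γ τ r, IsArcChart (frontier U) W γ τ r ∧
      W ⊆ O \ {Q} ∧ γ 0 = y := fun y hy =>
    hU.exists_arcChart hy.1.1 ((hO.sdiff isClosed_singleton).mem_nhds ⟨hy.1.2, hy.2⟩)
  have hEchart : ∀ y ∈ E, ∃ W γ τ r, IsArcChart (frontier U) W γ τ r ∧ W ⊆ O \ {Q} ∧ γ 0 = y ∧
      frontier U ∩ W ⊆ E := by
    intro y hy
    obtain ⟨W, γ, τ, r, h, hW, h0⟩ := hchart y (hEO hy)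
    have hr := h.pos
    refine ⟨W, γ, τ, r, h, hW, h0, ?_⟩
    rw [h.eq_image]
    refine habs _ (h.isPreconnected_image isPreconnected_Ioo subset_rfl) ?_
      ⟨y, ⟨0, ⟨by linarith, hr⟩, h0⟩, hy⟩
    rw [← h.eq_image]
    exact fun w hw => ⟨⟨hw.1, (hW hw.2).1⟩, (hW hw.2).2⟩
  have hEnhds : ∀ y ∈ E, E ∈ 𝓝[frontier U] y := by
    intro y hy
    obtain ⟨W, γ, τ, r, h, hW, h0, hsub⟩ := hEchart y hy
    have hr := h.pos
    refine mem_nhdsWithin.2 ⟨W, h.isOpen, ?_, fun w hw => hsub ⟨hw.2, hw.1⟩⟩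
    rw [← h0]; exact (h.mem_left ⟨by linarith, hr⟩).2
  have hclopen : ∀ Z : Set Plane, IsClosed Z → (∀ y ∈ Z, Z ∈ 𝓝[frontier U] y) → z ∈ Z →
      frontier U ∩ O ⊆ Z := by
    intro Z hZ hn hzZ
    rcases IsPreconnected.subset_or_of_mem_nhdsWithin hconn Set.inter_subset_left hZ
      (fun y _ hyZ => hn y hyZ) with h1 | h1
    · exact h1
    · exact absurd hzZ (h1 hz)
  have hZcl : IsClosed (E ∪ {Q}) := by
    rw [← closure_subset_iff_isClosed, closure_union, closure_singleton]
    exact Set.union_subset hcl Set.subset_union_right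
  obtain ⟨W, γ, τ, r, h, hW, h0⟩ := hU.exists_arcChart hQ.1 (hO.mem_nhds hQ.2)
  have hr := h.pos
  have hQW : Q ∈ W := by rw [← h0]; exact (h.mem_left ⟨by linarith, hr⟩).2
  have hhalf : ∀ s ⊆ Set.Ioo (-r) r, IsPreconnected s → (0 : ℝ) ∉ s →
      γ '' s ⊆ E ∨ Disjoint (γ '' s) E := by
    intro s hs hc h0s
    by_cases hd : Disjoint (γ '' s) E
    · exact Or.inr hd
    refine Or.inl (habs _ (h.isPreconnected_image hc hs) ?_ (Set.not_disjoint_iff_nonempty_inter.1 hd))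
    rintro _ ⟨u, hu, rfl⟩
    have := h.mem_left (hs hu)
    refine ⟨⟨this.1, hW this.2⟩, fun he => h0s ?_⟩
    have he' := congrArg τ ((Set.mem_singleton_iff.1 he).trans h0.symm)
    rw [h.param_arc u (hs hu), h.param_arc 0 ⟨by linarith, hr⟩] at he'
    exact he' ▸ hu
  have hcase : ∀ w ∈ frontier U ∩ W, w = Q ∨ w ∈ γ '' Set.Ioo (-r) 0 ∨ w ∈ γ '' Set.Ioo 0 r := by
    intro w hw
    rw [h.eq_image] at hw
    obtain ⟨u, hu, rfl⟩ := hw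
    rcases lt_trichotomy u 0 with h1 | h1 | h1
    · exact Or.inr (Or.inl ⟨u, ⟨hu.1, h1⟩, rfl⟩)
    · exact Or.inl (by rw [h1, h0])
    · exact Or.inr (Or.inr ⟨u, ⟨h1, hu.2⟩, rfl⟩)
  -- a component which contains exactly one of the two half arcs at `Q`
  have hone : ∀ γ τ, IsArcChart (frontier U) W γ τ r → γ 0 = Q →
      γ '' Set.Ioo 0 r ⊆ E → Disjoint (γ '' Set.Ioo (-r) 0) E → False := by
    intro γ τ h h0 hr1 hl1
    have hmem : ∀ u ∈ Set.Ico 0 r, γ u ∈ E ∪ {Q} := by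
      intro u hu
      rcases hu.1.eq_or_lt with rfl | hu0
      · exact Or.inr h0
      · exact Or.inl (hr1 ⟨u, ⟨hu0, hu.2⟩, rfl⟩)
    have hI : Set.Icc 0 (r / 2) ⊆ Set.Ioo (-r) r := fun u hu =>
      ⟨by linarith [hu.1], by linarith [hu.2]⟩
    have hs : r / 2 ∈ Set.Ioo (-r) r := ⟨by linarith, by linarith⟩
    have hcs : ContinuousAt γ (r / 2) := h.continuousOn.continuousAt (Ioo_mem_nhds hs.1 hs.2)
    have hnh : ∀ u ∈ Set.Ico 0 (r / 2), γ '' Set.Icc 0 (r / 2) ∈ 𝓝[E ∪ {Q}] (γ u) := by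
      intro u hu
      have huI := hI ⟨hu.1, hu.2.le⟩
      refine mem_nhdsWithin.2 ⟨W ∩ {z | τ z < r / 2},
        h.isOpen.inter (isOpen_lt h.continuous_param continuous_const),
        ⟨(h.mem_left huI).2, by
          show τ (γ u) < _
          rw [h.param_arc u huI]; exact hu.2⟩, ?_⟩
      rintro w ⟨⟨hwW, hwτ⟩, hwZ⟩
      have hwf : w ∈ frontier U ∩ W := by
        rcases hwZ with hw | hw
        · exact ⟨(hEO hw).1.1, hwW⟩
        · rw [Set.mem_singleton_iff.1 hw]; exact ⟨hQ.1, hQW⟩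
      rw [h.eq_image] at hwf
      obtain ⟨v, hv, rfl⟩ := hwf
      have hvτ : τ (γ v) < r / 2 := hwτ
      rw [h.param_arc v hv] at hvτ
      refine ⟨v, ⟨?_, hvτ.le⟩, rfl⟩
      by_contra hv0
      push Not at hv0
      rcases hwZ with hw | hw
      · exact Set.disjoint_left.1 hl1 ⟨v, ⟨hv.1, hv0⟩, rfl⟩ hw
      · have := congrArg τ ((Set.mem_singleton_iff.1 hw).trans h0.symm)
        rw [h.param_arc v hv, h.param_arc 0 ⟨by linarith, hr⟩] at this
        linarith
    -- The piece is the closed half arc that starts at `Q`. Near `Q` it fills `E ∪ {Q}`, because the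
    -- opposite half arc misses `E`; its only end is `γ (r / 2)`, and this is impossible in the
    -- compact set `E ∪ {Q}`.
    refine not_isEndedPiece (Z := E ∪ {Q}) (J₀ := γ '' Set.Icc 0 (r / 2))
      (J := γ '' Set.Icc 0 (r / 2)) (x := γ (r / 2)) ?_ ?_ ⟨?_, ?_, subset_rfl, ?_, ?_, ?_⟩
    · exact hXc.of_isClosed_subset hZcl (Set.union_subset (fun y hy => (hEX hy).1)
        (Set.singleton_subset_iff.2 (by rw [hX]; exact Or.inl hQ)))
    · intro y hy
      rcases hy with hy | hy
      · right
        obtain ⟨W', γ', τ', r', h', hW', h0', hsub⟩ := hEchart y hy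
        refine ⟨W', γ', τ', r', ⟨h'.pos, h'.isOpen, h'.continuous_param, h'.continuousOn, ?_,
          h'.param_arc⟩, h0'⟩
        rw [← h'.eq_image]
        ext w
        constructor
        · rintro ⟨hw | hw, hwW⟩
          · exact ⟨(hEO hw).1.1, hwW⟩
          · exact absurd hw (hW' hwW).2
        · exact fun hw => ⟨Or.inl (hsub hw), hw.2⟩
      · left
        rw [Set.mem_singleton_iff.1 hy, ← h0]
        have := hnh 0 ⟨le_rfl, by linarith⟩
        rwa [h0] at this ⊢
    · exact (isCompact_Icc.image_of_continuousOn (h.continuousOn.mono hI)).isClosed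
    · rintro _ ⟨u, hu, rfl⟩
      exact hmem u ⟨hu.1, by linarith [hu.2]⟩
    · rintro _ ⟨u, hu, rfl⟩ hne
      exact hnh u ⟨hu.1, lt_of_le_of_ne hu.2 fun e => hne (by rw [e])⟩
    · intro hm
      rw [mem_nhdsWithin_iff_eventually] at hm
      have h2 : ∀ᶠ u in 𝓝[>] (r / 2), u ∈ Set.Ioo (r / 2) r := Ioo_mem_nhdsGT (by linarith)
      obtain ⟨u, hu1, hu2⟩ := (((hcs.eventually hm).filter_mono nhdsWithin_le_nhds).and h2).exists
      obtain ⟨v, hv, he⟩ := hu1 (hmem u ⟨by linarith [hu2.1], hu2.2⟩)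
      have := congrArg τ he
      rw [h.param_arc v (hI hv), h.param_arc u ⟨by linarith [hu2.1], hu2.2⟩] at this
      linarith [hv.2, hu2.1]
    · rw [mem_closure_iff_frequently]
      have h2 : ∀ᶠ u in 𝓝[<] (r / 2), u ∈ Set.Ioo 0 (r / 2) := Ioo_mem_nhdsLT (by linarith)
      refine Filter.Tendsto.frequently (l₁ := 𝓝[<] (r / 2)) (hcs.tendsto.mono_left nhdsWithin_le_nhds)
        (Filter.Eventually.frequently (h2.mono fun u hu => ?_))
      refine ⟨⟨u, ⟨hu.1.le, hu.2.le⟩, rfl⟩, fun he => ?_⟩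
      have := congrArg τ (Set.mem_singleton_iff.1 he)
      rw [h.param_arc u (hI ⟨hu.1.le, hu.2.le⟩), h.param_arc _ hs] at this
      linarith [hu.2]
  have hsl : Set.Ioo (-r) 0 ⊆ Set.Ioo (-r) r := Set.Ioo_subset_Ioo le_rfl hr.le
  have hsr : Set.Ioo 0 r ⊆ Set.Ioo (-r) r := Set.Ioo_subset_Ioo (by linarith) le_rfl
  -- Four cases. If `E` contains both half arcs at `Q`, then `E ∪ {Q}` is open and closed in `Γ ∩
  -- O`, hence contains it and, being closed, also a point of `F`, although it lies in `O`. Exactly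
  -- one half arc gives a compact arc with a single end. If it contains none, then `E` itself is
  -- open and closed in `Γ ∩ O` and would contain `Q`.
  rcases hhalf _ hsl isPreconnected_Ioo (fun h' => lt_irrefl _ h'.2) with hl | hl <;>
  rcases hhalf _ hsr isPreconnected_Ioo (fun h' => lt_irrefl _ h'.1) with hr' | hr'
  · have hsub := hclopen (E ∪ {Q}) hZcl (fun y hy => ?_) (Or.inl hzE)
    · obtain ⟨b, hbF, hb⟩ := hF
      have h1 : b ∈ E ∪ {Q} := hZcl.closure_subset_iff.2 hsub hb
      have h2 : b ∈ O := by
        rcases h1 with h1 | h1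
        · exact (hEO h1).1.2
        · rw [Set.mem_singleton_iff.1 h1]; exact hQ.2
      exact Set.disjoint_left.1 hFO hbF h2
    · rcases hy with hy | hy
      · exact Filter.mem_of_superset (hEnhds y hy) Set.subset_union_left
      · rw [Set.mem_singleton_iff.1 hy]
        refine mem_nhdsWithin.2 ⟨W, h.isOpen, hQW, fun w hw => ?_⟩
        rcases hcase w ⟨hw.2, hw.1⟩ with h1 | h1 | h1
        · exact Or.inr h1
        · exact Or.inl (hl h1)
        · exact Or.inl (hr' h1)
  · refine hone (fun t => γ (-t)) (fun y => -τ y) h.reflect (by simpa using h0) ?_ ?_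
    · rintro _ ⟨u, hu, rfl⟩
      exact hl ⟨-u, ⟨by linarith [hu.2], by linarith [hu.1]⟩, rfl⟩
    · rw [Set.disjoint_left] at hr' ⊢
      rintro _ ⟨u, hu, rfl⟩
      exact hr' ⟨-u, ⟨by linarith [hu.2], by linarith [hu.1]⟩, rfl⟩
  · exact hone γ τ h h0 hr' hl
  · have hQE : Q ∉ closure E := by
      rw [mem_closure_iff]
      push Not
      refine ⟨W, h.isOpen, hQW, ?_⟩
      ext w
      simp only [Set.mem_inter_iff, Set.mem_empty_iff_false, iff_false]
      rintro ⟨hw, hwE⟩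
      rcases hcase w ⟨(hEO hwE).1.1, hw⟩ with h1 | h1 | h1
      · exact (hEO hwE).2 h1
      · exact Set.disjoint_left.1 hl h1 hwE
      · exact Set.disjoint_left.1 hr' h1 hwE
    have hEcl : IsClosed E := by
      rw [← closure_subset_iff_isClosed]
      intro y hy
      exact (hcl hy).resolve_right fun he => hQE (Set.mem_singleton_iff.1 he ▸ hy)
    exact (hEO (hclopen E hEcl hEnhds hzE hQ)).2 rfl

end
end UnfittedLDG

namespace UnfittedLDG
noncomputable section
open scoped ENNReal NNReal Topology

/-! ### The two phases -/

/-- The two open sides of the interface `∂Ω₁` in the plane. -/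
def phase (Ω₁ : Set Plane) (i : Fin 2) : Set Plane := if i = 0 then Ω₁ else (closure Ω₁)ᶜ

section Phase

variable {Ω Ω₁ : Set Plane}

theorem isOpen_phase (h : IsOpen Ω₁) (i : Fin 2) : IsOpen (phase Ω₁ i) := by
  unfold phase; split_ifs
  · exact h
  · exact isClosed_closure.isOpen_compl

theorem phase_disjoint {i j : Fin 2} (hij : i ≠ j) : Disjoint (phase Ω₁ i) (phase Ω₁ j) := by
  have : Disjoint Ω₁ (closure Ω₁)ᶜ := disjoint_compl_right.mono_left subset_closure
  fin_cases i <;> fin_cases j <;> simp [phase] at hij ⊢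
  · exact this
  · exact this.symm

theorem exists_mem_phase (h : IsOpen Ω₁) {x : Plane} (hx : x ∉ frontier Ω₁) : ∃ i, x ∈ phase Ω₁ i := by
  rw [h.frontier_eq] at hx
  by_cases h1 : x ∈ closure Ω₁
  · exact ⟨0, by simpa [phase] using not_not.1 fun h2 => hx ⟨h1, h2⟩⟩
  · exact ⟨1, by simpa [phase] using h1⟩

theorem phase_disjoint_frontier (h : IsOpen Ω₁) (i : Fin 2) :
    Disjoint (phase Ω₁ i) (frontier Ω₁) := by
  rw [h.frontier_eq, Set.disjoint_left]
  fin_cases i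
  · exact fun x hx hx' => hx'.2 (by simpa [phase] using hx)
  · exact fun x hx hx' => (by simpa [phase] using hx : x ∉ closure Ω₁) hx'.1

theorem subset_phase_of_isPreconnected (h : IsOpen Ω₁) {S : Set Plane} (hS : IsPreconnected S)
    (hd : Disjoint S (frontier Ω₁)) {i : Fin 2} (hi : (S ∩ phase Ω₁ i).Nonempty) :
    S ⊆ phase Ω₁ i := by
  obtain ⟨j, hij⟩ : ∃ j, i ≠ j := ⟨i + 1, by fin_cases i <;> simp⟩
  have hcov : S ⊆ phase Ω₁ i ∪ phase Ω₁ j := fun x hx => by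
    obtain ⟨k, hk⟩ := exists_mem_phase h (Set.disjoint_left.1 hd hx)
    have : k = i ∨ k = j := by fin_cases i <;> fin_cases j <;> fin_cases k <;> simp_all
    rcases this with rfl | rfl
    · exact Or.inl hk
    · exact Or.inr hk
  rcases isPreconnected_iff_subset_of_disjoint.1 hS _ _ (isOpen_phase h i) (isOpen_phase h j) hcov
    (by rw [(phase_disjoint hij).inter_eq, Set.inter_empty]) with h1 | h1
  · exact h1
  · obtain ⟨x, hx, hxi⟩ := hi
    exact absurd (h1 hx) (Set.disjoint_left.1 (phase_disjoint hij) hxi)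

theorem disjoint_closure_phase (h : IsOpen Ω₁) {i j : Fin 2} (hij : i ≠ j) :
    Disjoint (closure (phase Ω₁ i)) (phase Ω₁ j) :=
  (phase_disjoint hij).closure_left (isOpen_phase h j)

/-- A connected set off the interface lies in the phase of any of its limit points off the
interface. -/
theorem subset_phase_of_mem_closure (h : IsOpen Ω₁) {S : Set Plane} (hS : IsPreconnected S)
    (hd : Disjoint S (frontier Ω₁)) {x : Plane} (hx : x ∈ closure S) {i : Fin 2}
    (hi : x ∈ phase Ω₁ i) : S ⊆ phase Ω₁ i := by
  obtain ⟨y, hy, hyS⟩ := mem_closure_iff.1 hx _ (isOpen_phase h i) hi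
  exact subset_phase_of_isPreconnected h hS hd ⟨y, hyS, hy⟩

theorem mem_phase_of_mem_closure (h : IsOpen Ω₁) {S : Set Plane} {x : Plane} (hx : x ∈ closure S)
    (hf : x ∉ frontier Ω₁) {i : Fin 2} (hS : S ⊆ phase Ω₁ i) : x ∈ phase Ω₁ i := by
  obtain ⟨j, hj⟩ := exists_mem_phase h hf
  by_cases hij : i = j
  · rwa [hij]
  · exact absurd hj (Set.disjoint_left.1 (disjoint_closure_phase h hij) (closure_mono hS hx))

theorem subdomain_eq (hsub : Ω₁ ⊆ Ω) (i : Fin 2) : subdomain Ω Ω₁ i = Ω ∩ phase Ω₁ i := by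
  fin_cases i
  · simpa [subdomain, phase] using hsub
  · simp [subdomain, phase, Set.sdiff_eq]

theorem mem_closure_subdomain_iff (h : IsOpen Ω₁) (hsub : Ω₁ ⊆ Ω) {i : Fin 2} {x : Plane}
    (hx : x ∈ closure Ω) (hf : x ∉ frontier Ω₁) :
    x ∈ closure (subdomain Ω Ω₁ i) ↔ x ∈ phase Ω₁ i := by
  rw [subdomain_eq hsub]
  constructor
  · exact fun hc => mem_phase_of_mem_closure h hc hf Set.inter_subset_right
  · intro hi
    rw [Set.inter_comm]
    exact (isOpen_phase h i).inter_closure ⟨hi, hx⟩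

end Phase

/-! ### Affine functions -/

/-- The affine function with gradient `ν` and constant term `c`. -/
def aff (ν : Plane) (c : ℝ) (x : Plane) : ℝ := inner ℝ ν x + c

theorem aff_lineMap (ν : Plane) (c : ℝ) (x y : Plane) (t : ℝ) :
    aff ν c (x + t • (y - x)) = aff ν c x + t * (aff ν c y - aff ν c x) := by
  simp only [aff, inner_add_right, inner_smul_right, inner_sub_right]; ring

theorem continuous_aff (ν : Plane) (c : ℝ) : Continuous (aff ν c) := by unfold aff; fun_prop

theorem abs_aff_sub_le (ν : Plane) (c : ℝ) (x y : Plane) :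
    |aff ν c x - aff ν c y| ≤ ‖ν‖ * dist x y := by
  rw [aff, aff, add_sub_add_right_eq_sub, ← inner_sub_right, dist_eq_norm]
  exact abs_real_inner_le_norm _ _

theorem convex_aff_gt (ν : Plane) (c a : ℝ) : Convex ℝ {x | a < aff ν c x} := by
  have h : {x | a < aff ν c x} = {x | a - c < innerₗ Plane ν x} := by
    ext x; simp only [Set.mem_ofPred_eq, aff, innerₗ_apply_apply]; constructor <;> intro h <;> linarith
  rw [h]
  exact convex_halfSpace_gt (innerₗ Plane ν).isLinear _

theorem aff_eq_zero_of_segment {ν : Plane} {c : ℝ} {B C : Plane} (hB : aff ν c B = 0)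
    (hC : aff ν c C = 0) {y : Plane} (hy : y ∈ segment ℝ B C) : aff ν c y = 0 := by
  rw [segment_eq_image'] at hy
  obtain ⟨t, -, rfl⟩ := hy
  rw [aff_lineMap, hB, hC]; ring

theorem abs_aff_le_infDist {ν : Plane} {c : ℝ} {B C : Plane} (hB : aff ν c B = 0)
    (hC : aff ν c C = 0) (x : Plane) :
    |aff ν c x| ≤ ‖ν‖ * Metric.infDist x (segment ℝ B C) := by
  have hcomp : IsCompact (segment ℝ B C) := by
    rw [segment_eq_image']
    exact isCompact_Icc.image (by fun_prop)
  obtain ⟨y, hy, he⟩ := hcomp.exists_infDist_eq_dist ⟨B, left_mem_segment ℝ B C⟩ x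
  rw [he]
  simpa [aff_eq_zero_of_segment hB hC hy] using abs_aff_sub_le ν c x y

/-- The foot of the perpendicular from `A` to the zero line of the function is at distance `|aff ν c
A| / ‖ν‖`. For `ν ≠ 0` it lies on the line through `B` and `C`, as these are distinct zeros.
Together with `abs_aff_le_lineDist` it converts the ratios of distances in the deviation into ratios
of values of affine functions. -/
theorem lineDist_mul_norm_le {ν : Plane} {c : ℝ} {B C : Plane} (hB : aff ν c B = 0)
    (hC : aff ν c C = 0) (hBC : B ≠ C) (A : Plane) : lineDist A B C * ‖ν‖ ≤ |aff ν c A| := by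
  rcases eq_or_ne ν 0 with rfl | hν
  · simp
  have hn : 0 < ‖ν‖ := norm_pos_iff.2 hν
  set P := A - (aff ν c A / ‖ν‖ ^ 2) • ν with hP
  have hP0 : aff ν c P = 0 := by
    have : aff ν c P = aff ν c A - aff ν c A / ‖ν‖ ^ 2 * ‖ν‖ ^ 2 := by
      rw [hP]
      simp only [aff, inner_sub_right, inner_smul_right, real_inner_self_eq_norm_sq]; ring
    rw [this]; field_simp; ring
  have e1 : ν 0 * (P 0 - B 0) + ν 1 * (P 1 - B 1) = 0 := by
    have := hP0.trans hB.symm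
    simp only [aff, PiLp.inner_apply, Fin.sum_univ_two, RCLike.inner_apply, conj_trivial] at this
    linarith
  have e2 : ν 0 * (C 0 - B 0) + ν 1 * (C 1 - B 1) = 0 := by
    have := hC.trans hB.symm
    simp only [aff, PiLp.inner_apply, Fin.sum_univ_two, RCLike.inner_apply, conj_trivial] at this
    linarith
  have hd : (P 0 - B 0) * (C 1 - B 1) - (P 1 - B 1) * (C 0 - B 0) = 0 := by
    by_contra hne
    refine hν ?_
    have h0 : ν 0 * ((P 0 - B 0) * (C 1 - B 1) - (P 1 - B 1) * (C 0 - B 0)) = 0 := by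
      linear_combination (C 1 - B 1) * e1 - (P 1 - B 1) * e2
    have h1 : ν 1 * ((P 0 - B 0) * (C 1 - B 1) - (P 1 - B 1) * (C 0 - B 0)) = 0 := by
      linear_combination (P 0 - B 0) * e2 - (C 0 - B 0) * e1
    have h0' := (mul_eq_zero.1 h0).resolve_right hne
    have h1' := (mul_eq_zero.1 h1).resolve_right hne
    ext j; fin_cases j
    · exact h0'
    · exact h1'
  have hpos : 0 < (C 0 - B 0) ^ 2 + (C 1 - B 1) ^ 2 := by
    by_contra hle
    push Not at hle
    refine hBC ?_
    have a0 : C 0 - B 0 = 0 := by nlinarith [sq_nonneg (C 0 - B 0), sq_nonneg (C 1 - B 1)]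
    have a1 : C 1 - B 1 = 0 := by nlinarith [sq_nonneg (C 0 - B 0), sq_nonneg (C 1 - B 1)]
    ext j; fin_cases j
    · show B 0 = C 0
      linarith
    · show B 1 = C 1
      linarith
  set t := ((P 0 - B 0) * (C 0 - B 0) + (P 1 - B 1) * (C 1 - B 1)) /
    ((C 0 - B 0) ^ 2 + (C 1 - B 1) ^ 2) with ht
  have hPl : P = AffineMap.lineMap B C t := by
    ext j
    rw [AffineMap.lineMap_apply_module']
    have ht' : t * ((C 0 - B 0) ^ 2 + (C 1 - B 1) ^ 2) =
        (P 0 - B 0) * (C 0 - B 0) + (P 1 - B 1) * (C 1 - B 1) := by rw [ht]; field_simp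
    fin_cases j
    · show P 0 = t * (C 0 - B 0) + B 0
      refine mul_right_cancel₀ hpos.ne' ?_
      linear_combination (C 1 - B 1) * hd - (C 0 - B 0) * ht'
    · show P 1 = t * (C 1 - B 1) + B 1
      refine mul_right_cancel₀ hpos.ne' ?_
      linear_combination -(C 0 - B 0) * hd - (C 1 - B 1) * ht'
  have h1 : lineDist A B C ≤ dist A P := by
    refine Metric.infDist_le_dist_of_mem ?_
    rw [hPl]; exact AffineMap.lineMap_mem_affineSpan_pair _ _ _
  have h2 : dist A P * ‖ν‖ = |aff ν c A| := by
    rw [dist_eq_norm, hP, sub_sub_cancel, norm_smul, Real.norm_eq_abs, abs_div,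
      abs_of_pos (by positivity : 0 < ‖ν‖ ^ 2)]
    field_simp
  rw [← h2]; gcongr

/-! ### Rectangles -/

namespace Rect

variable (K : Rect)

theorem len_pos (j : Fin 2) : 0 < K.len j := sub_pos.2 (K.lt j)

theorem isOpen_carrier : IsOpen K.carrier := by
  have : K.carrier = ⋂ j, {x : Plane | K.lo j < x j ∧ x j < K.hi j} := by
    ext x; simp [carrier]
  rw [this]
  exact isOpen_iInter_of_finite fun j => isOpen_Ioo.preimage
    (show Continuous fun x : Plane => x j by fun_prop)

theorem convex_carrier : Convex ℝ K.carrier := by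
  intro x hx y hy a b ha hb hab j
  have h1 := hx j
  have h2 := hy j
  simp only [PiLp.add_apply, PiLp.smul_apply, smul_eq_mul]
  obtain rfl : b = 1 - a := by linarith
  rcases ha.eq_or_lt with rfl | ha'
  · simpa using h2
  · constructor <;> nlinarith

theorem isPreconnected_carrier : IsPreconnected K.carrier := K.convex_carrier.isPreconnected

/-- Normalized coordinates with origin at the vertex `s`. -/
def rel (s : Fin 2 → Bool) (j : Fin 2) (x : Plane) : ℝ :=
  (x j - K.endpt j (s j)) / (K.endpt j (!s j) - K.endpt j (s j))

variable {K} in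
theorem abs_endpt_sub (j : Fin 2) (b : Bool) : |K.endpt j (!b) - K.endpt j b| = K.len j := by
  have := K.lt j
  cases b <;> simp [endpt, len]
  · linarith
  · rw [abs_sub_comm]; simp; linarith

theorem endpt_ne (j : Fin 2) (b : Bool) : K.endpt j (!b) - K.endpt j b ≠ 0 := by
  rw [← abs_pos, abs_endpt_sub]; exact K.len_pos j

/-- The point with given normalized coordinates. -/
def ofRel (s : Fin 2 → Bool) (u : Fin 2 → ℝ) : Plane :=
  WithLp.toLp 2 fun j => K.endpt j (s j) + u j * (K.endpt j (!s j) - K.endpt j (s j))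

theorem rel_ofRel (s : Fin 2 → Bool) (u : Fin 2 → ℝ) (j : Fin 2) : K.rel s j (K.ofRel s u) = u j := by
  have := K.endpt_ne j (s j)
  simp only [rel, ofRel]; field_simp; ring

theorem rel_ext {s : Fin 2 → Bool} {x y : Plane} (h : ∀ j, K.rel s j x = K.rel s j y) : x = y := by
  ext j
  have h1 := h j
  have := K.endpt_ne j (s j)
  unfold rel at h1; field_simp at h1; linarith

theorem apply_eq_of_rel_eq {s : Fin 2 → Bool} {j : Fin 2} {x y : Plane}
    (h : K.rel s j x = K.rel s j y) : x j = y j := by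
  have := K.endpt_ne j (s j)
  unfold rel at h; field_simp at h; linarith

theorem rel_lineMap (s : Fin 2 → Bool) (j : Fin 2) (x y : Plane) (t : ℝ) :
    K.rel s j (x + t • (y - x)) = K.rel s j x + t * (K.rel s j y - K.rel s j x) := by
  simp only [rel, PiLp.add_apply, PiLp.smul_apply, PiLp.sub_apply, smul_eq_mul]; ring

theorem continuous_rel (s : Fin 2 → Bool) (j : Fin 2) : Continuous (K.rel s j) := by
  unfold rel; fun_prop

theorem abs_rel_sub (s : Fin 2 → Bool) (j : Fin 2) (x y : Plane) :
    |K.rel s j x - K.rel s j y| = |x j - y j| / K.len j := by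
  rw [rel, rel, ← sub_div, abs_div, abs_endpt_sub]; congr 2; ring

theorem abs_rel_sub_le (s : Fin 2 → Bool) (j : Fin 2) (x y : Plane) :
    |K.rel s j x - K.rel s j y| ≤ dist x y / K.len j := by
  rw [abs_rel_sub]
  have := K.len_pos j
  gcongr
  rw [dist_eq_norm]
  exact PiLp.norm_apply_le (x - y) j

theorem rel_vertex (s s' : Fin 2 → Bool) (j : Fin 2) :
    K.rel s j (K.vertex s') = if s' j = s j then 0 else 1 := by
  have := K.endpt_ne j (s j)
  unfold rel vertex
  split_ifs with h
  · simp [h]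
  · have : s' j = !s j := by cases h1 : s' j <;> cases h2 : s j <;> simp_all
    simp only [this]; exact div_self (K.endpt_ne j (s j))

theorem rel_of_eq_endpt (s : Fin 2 → Bool) {j : Fin 2} {b : Bool} {x : Plane}
    (hx : x j = K.endpt j b) : K.rel s j x = if b = s j then 0 else 1 := by
  have := K.rel_vertex s (fun _ => b) j
  rw [← this, rel, rel, hx, vertex]

theorem apply_eq_of_rel_eq_zero {s : Fin 2 → Bool} {j : Fin 2} {x : Plane} (h : K.rel s j x = 0) :
    x j = K.endpt j (s j) := by
  have := K.endpt_ne j (s j)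
  unfold rel at h
  rcases div_eq_zero_iff.1 h with h | h
  · linarith
  · exact absurd h this

theorem apply_eq_of_rel_eq_one {s : Fin 2 → Bool} {j : Fin 2} {x : Plane} (h : K.rel s j x = 1) :
    x j = K.endpt j (!s j) := by
  have := K.endpt_ne j (s j)
  unfold rel at h; field_simp at h; linarith

theorem rel_mem_Ioo_iff (s : Fin 2 → Bool) (j : Fin 2) (x : Plane) :
    K.rel s j x ∈ Set.Ioo (0 : ℝ) 1 ↔ K.lo j < x j ∧ x j < K.hi j := by
  have hl := K.lt j
  unfold rel endpt
  cases s j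
  · have : 0 < K.hi j - K.lo j := by linarith
    simp only [Bool.not_false, if_true, Bool.false_eq_true, if_false, Set.mem_Ioo]
    rw [div_lt_one this, lt_div_iff₀ this]
    constructor <;> rintro ⟨h1, h2⟩ <;> constructor <;> linarith
  · have : 0 < K.hi j - K.lo j := by linarith
    simp only [Bool.not_true, if_true, Bool.false_eq_true, if_false, Set.mem_Ioo]
    rw [← neg_div_neg_eq, neg_sub, neg_sub, div_lt_one this, lt_div_iff₀ this]
    constructor <;> rintro ⟨h1, h2⟩ <;> constructor <;> linarith

theorem rel_mem_Icc_iff (s : Fin 2 → Bool) (j : Fin 2) (x : Plane) :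
    K.rel s j x ∈ Set.Icc (0 : ℝ) 1 ↔ K.lo j ≤ x j ∧ x j ≤ K.hi j := by
  have hl := K.lt j
  unfold rel endpt
  cases s j
  · have : 0 < K.hi j - K.lo j := by linarith
    simp only [Bool.not_false, if_true, Bool.false_eq_true, if_false, Set.mem_Icc]
    rw [div_le_one this, le_div_iff₀ this]
    constructor <;> rintro ⟨h1, h2⟩ <;> constructor <;> linarith
  · have : 0 < K.hi j - K.lo j := by linarith
    simp only [Bool.not_true, if_true, Bool.false_eq_true, if_false, Set.mem_Icc]
    rw [← neg_div_neg_eq, neg_sub, neg_sub, div_le_one this, le_div_iff₀ this]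
    constructor <;> rintro ⟨h1, h2⟩ <;> constructor <;> linarith

theorem mem_carrier_iff_rel (s : Fin 2 → Bool) {x : Plane} :
    x ∈ K.carrier ↔ ∀ j, K.rel s j x ∈ Set.Ioo (0 : ℝ) 1 :=
  forall_congr' fun j => (K.rel_mem_Ioo_iff s j x).symm

theorem mem_closure_of_rel {s : Fin 2 → Bool} {x : Plane}
    (h : ∀ j, K.rel s j x ∈ Set.Icc (0 : ℝ) 1) : x ∈ closure K.carrier := by
  set g := K.ofRel s fun _ => 1 / 2
  have h1 : Filter.Tendsto (fun t : ℝ => x + t • (g - x)) (𝓝[>] 0) (𝓝 x) := by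
    have : Continuous fun t : ℝ => x + t • (g - x) := by fun_prop
    have h2 := this.tendsto 0
    simp only [zero_smul, add_zero] at h2
    exact h2.mono_left nhdsWithin_le_nhds
  refine mem_closure_of_tendsto h1 ?_
  filter_upwards [Ioo_mem_nhdsGT (zero_lt_one (α := ℝ))] with t ht
  rw [K.mem_carrier_iff_rel s]
  intro j
  rw [rel_lineMap, rel_ofRel]
  have := h j
  constructor <;> nlinarith [this.1, this.2, ht.1, ht.2]

theorem mem_closure_iff_rel (s : Fin 2 → Bool) {x : Plane} :
    x ∈ closure K.carrier ↔ ∀ j, K.rel s j x ∈ Set.Icc (0 : ℝ) 1 := by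
  refine ⟨fun hx j => ?_, K.mem_closure_of_rel⟩
  have hc : IsClosed {x | K.rel s j x ∈ Set.Icc (0 : ℝ) 1} :=
    isClosed_Icc.preimage (K.continuous_rel s j)
  exact hc.closure_subset_iff.2 (fun y hy => Set.Ioo_subset_Icc_self
    ((K.mem_carrier_iff_rel s).1 hy j)) hx

theorem mem_frontier_iff_rel (s : Fin 2 → Bool) {x : Plane} :
    x ∈ frontier K.carrier ↔ (∀ j, K.rel s j x ∈ Set.Icc (0 : ℝ) 1) ∧
      ∃ j, K.rel s j x = 0 ∨ K.rel s j x = 1 := by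
  rw [K.isOpen_carrier.frontier_eq, Set.mem_sdiff, K.mem_closure_iff_rel s, K.mem_carrier_iff_rel s]
  refine and_congr_right fun h => ?_
  rw [not_forall]
  refine exists_congr fun j => ?_
  have := h j
  rw [Set.mem_Ioo, not_and_or, not_lt, not_lt]
  constructor
  · rintro (h1 | h1)
    · exact Or.inl (le_antisymm h1 this.1)
    · exact Or.inr (le_antisymm this.2 h1)
  · rintro (h1 | h1)
    · exact Or.inl h1.le
    · exact Or.inr h1.ge

theorem mem_side_iff_rel (s : Fin 2 → Bool) {j : Fin 2} {b : Bool} {x : Plane} :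
    x ∈ K.side j b ↔ K.rel s j x = (if b = s j then 0 else 1) ∧
      ∀ k, k ≠ j → K.rel s k x ∈ Set.Ioo (0 : ℝ) 1 := by
  refine and_congr ⟨fun h => K.rel_of_eq_endpt s h, fun h => ?_⟩
    (forall_congr' fun k => forall_congr' fun _ => (K.rel_mem_Ioo_iff s k x).symm)
  split_ifs at h with hb
  · rw [hb]; exact K.apply_eq_of_rel_eq_zero h
  · have : b = !s j := by cases b <;> cases h2 : s j <;> simp_all
    rw [this]; exact K.apply_eq_of_rel_eq_one h

theorem side_subset_frontier (j : Fin 2) (b : Bool) : K.side j b ⊆ frontier K.carrier := by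
  intro x hx
  rw [K.mem_side_iff_rel (fun _ => b)] at hx
  rw [K.mem_frontier_iff_rel (fun _ => b)]
  refine ⟨fun k => ?_, j, Or.inl (by simpa using hx.1)⟩
  by_cases hk : k = j
  · subst hk; rw [hx.1]; simp
  · exact Set.Ioo_subset_Icc_self (hx.2 k hk)

theorem vertex_mem_frontier (s : Fin 2 → Bool) : K.vertex s ∈ frontier K.carrier := by
  rw [K.mem_frontier_iff_rel s]
  simp [rel_vertex]

theorem vertex_notMem_side (s : Fin 2 → Bool) (j : Fin 2) (b : Bool) : K.vertex s ∉ K.side j b := by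
  rw [K.mem_side_iff_rel s]
  rintro ⟨-, h⟩
  obtain ⟨k, hk⟩ : ∃ k, k ≠ j := ⟨j + 1, by fin_cases j <;> simp⟩
  simpa [rel_vertex] using h k hk

theorem diam_pos : 0 < K.diam := by
  have hb : Bornology.IsBounded K.carrier := by
    refine (Metric.isBounded_ball (x := K.vertex fun _ => false)
      (r := K.len 0 + K.len 1 + 1)).subset fun x hx => ?_
    rw [Metric.mem_ball, dist_eq_norm]
    have h := norm_sub_le_coord (K.vertex fun _ => false) (LinearIsometryEquiv.refl ℝ _) x
    have h0 := hx 0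
    have h1 := hx 1
    simp only [LinearIsometryEquiv.coe_refl, id, PiLp.sub_apply, vertex, endpt,
      Bool.false_eq_true, if_false] at h
    rw [abs_of_pos (by linarith), abs_of_pos (by linarith)] at h
    simp only [len, vertex, endpt, Bool.false_eq_true, if_false] at h ⊢
    linarith
  set x := K.ofRel (fun _ => false) fun _ => 1 / 2
  set y := K.ofRel (fun _ => false) fun _ => 1 / 3
  have hx : x ∈ K.carrier := by
    rw [K.mem_carrier_iff_rel fun _ => false]; intro j; rw [rel_ofRel]; norm_num
  have hy : y ∈ K.carrier := by
    rw [K.mem_carrier_iff_rel fun _ => false]; intro j; rw [rel_ofRel]; norm_num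
  refine lt_of_lt_of_le (dist_pos.2 fun h => ?_) (Metric.dist_le_diam_of_mem hb hx hy)
  have := congrArg (K.rel (fun _ => false) 0) h
  rw [rel_ofRel, rel_ofRel] at this; norm_num at this

theorem dist_le_len (x y : Plane) (hx : x ∈ closure K.carrier) (hy : y ∈ closure K.carrier) :
    dist x y ≤ K.len 0 + K.len 1 := by
  have h := norm_sub_le_coord y (LinearIsometryEquiv.refl ℝ _) x
  simp only [LinearIsometryEquiv.coe_refl, id, PiLp.sub_apply] at h
  have hc : ∀ j, |x j - y j| ≤ K.len j := fun j => by
    have h1 := (K.rel_mem_Icc_iff (fun _ => false) j x).1 ((K.mem_closure_iff_rel _).1 hx j)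
    have h2 := (K.rel_mem_Icc_iff (fun _ => false) j y).1 ((K.mem_closure_iff_rel _).1 hy j)
    unfold len
    rw [abs_le]; constructor <;> linarith
  rw [dist_eq_norm]
  linarith [hc 0, hc 1]

theorem diam_le_len : K.diam ≤ K.len 0 + K.len 1 :=
  Metric.diam_le_of_forall_dist_le (by linarith [K.len_pos 0, K.len_pos 1])
    fun _ hx _ hy => K.dist_le_len _ _ (subset_closure hx) (subset_closure hy)

theorem isBounded_carrier : Bornology.IsBounded K.carrier :=
  Metric.isBounded_iff.2 ⟨K.len 0 + K.len 1, fun _ hx _ hy =>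
    K.dist_le_len _ _ (subset_closure hx) (subset_closure hy)⟩

theorem dist_le_diam {x y : Plane} (hx : x ∈ closure K.carrier) (hy : y ∈ closure K.carrier) :
    dist x y ≤ K.diam := by
  rw [diam, ← Metric.diam_closure]
  exact Metric.dist_le_diam_of_mem K.isBounded_carrier.closure hx hy

/-- Under an aspect ratio bound, every side is comparable to the diameter. -/
theorem diam_le_mul_len {σ : ℝ} (h : ∀ j k, K.len j ≤ σ * K.len k) (j : Fin 2) :
    K.diam ≤ 2 * σ * K.len j := by
  have h1 := K.diam_le_len
  have h2 := h 0 j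
  have h3 := h 1 j
  linarith

theorem ball_subset_of_rel {σ : ℝ} (hσ : 1 ≤ σ) (h : ∀ j k, K.len j ≤ σ * K.len k)
    (s : Fin 2 → Bool) {τ : Fin 2 → ℝ} {m : ℝ} (hm : 0 < m) (hτ : ∀ j, m ≤ τ j) :
    Metric.ball (K.ofRel s fun j => τ j / 2) (m * K.diam / (4 * σ)) ⊆
      {x | ∀ j, K.rel s j x ∈ Set.Ioo 0 (τ j)} := by
  intro x hx j
  rw [Metric.mem_ball] at hx
  have h1 := K.abs_rel_sub_le s j x (K.ofRel s fun j => τ j / 2)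
  rw [rel_ofRel] at h1
  have hl := K.len_pos j
  have h2 : |K.rel s j x - τ j / 2| < m / 2 := by
    refine h1.trans_lt ?_
    rw [div_lt_iff₀ hl]
    refine hx.trans_le ?_
    rw [div_le_iff₀ (by positivity)]
    have := K.diam_le_mul_len h j
    nlinarith
  have := hτ j
  rw [abs_lt] at h2
  constructor <;> linarith [h2.1, h2.2]

theorem exists_aff_rel (s : Fin 2 → Bool) (c₀ : ℝ) (w : Fin 2 → ℝ) :
    ∃ ν c, ∀ x, aff ν c x = c₀ + ∑ j, w j * K.rel s j x := by
  refine ⟨WithLp.toLp 2 fun j => w j / (K.endpt j (!s j) - K.endpt j (s j)),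
    c₀ - ∑ j, w j * K.endpt j (s j) / (K.endpt j (!s j) - K.endpt j (s j)), fun x => ?_⟩
  simp only [aff, PiLp.inner_apply, RCLike.inner_apply, conj_trivial, rel, Fin.sum_univ_two]
  ring

end Rect

end
end UnfittedLDG

/-! ### Neighbouring corners of a rectangle, and crossings of its sides by the interface -/

namespace UnfittedLDG
noncomputable section
open scoped ENNReal NNReal Topology

theorem fin_two_eq_or {j k : Fin 2} (h : j ≠ k) (l : Fin 2) : l = j ∨ l = k := by omega

theorem sum_fin_two {j k : Fin 2} (h : j ≠ k) (f : Fin 2 → ℝ) : ∑ l, f l = f j + f k := by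
  fin_cases j <;> fin_cases k <;> simp_all [Fin.sum_univ_two, add_comm]

namespace Rect

variable (K : Rect)

/-- The corner next to `s` in direction `k`. -/
def flip (s : Fin 2 → Bool) (k : Fin 2) : Fin 2 → Bool := Function.update s k (!s k)

theorem rel_flip_same (s : Fin 2 → Bool) (k : Fin 2) (x : Plane) :
    K.rel (flip s k) k x = 1 - K.rel s k x := by
  have h := K.endpt_ne k (s k)
  have h' : K.endpt k (s k) - K.endpt k (!s k) ≠ 0 := by
    intro h2; apply h; linarith
  simp only [rel, flip, Function.update_self, Bool.not_not]
  field_simp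
  ring

theorem rel_flip_of_ne (s : Fin 2 → Bool) {j k : Fin 2} (h : j ≠ k) (x : Plane) :
    K.rel (flip s k) j x = K.rel s j x := by
  simp only [rel, flip, Function.update_of_ne h]

theorem dist_eq_of_rel {s : Fin 2 → Bool} {j k : Fin 2} (hjk : j ≠ k) {x y : Plane}
    (h : K.rel s j x = K.rel s j y) : dist x y = |K.rel s k x - K.rel s k y| * K.len k := by
  have h1 := K.apply_eq_of_rel_eq h
  have hl := K.len_pos k
  rw [abs_rel_sub, div_mul_cancel₀ _ hl.ne', EuclideanSpace.dist_eq, sum_fin_two hjk, h1]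
  simp [Real.sqrt_sq_eq_abs, Real.dist_eq]

theorem mem_frontier_of_rel_eq_zero {s : Fin 2 → Bool} {j : Fin 2} {x : Plane}
    (hx : x ∈ closure K.carrier) (h : K.rel s j x = 0) : x ∈ frontier K.carrier :=
  (K.mem_frontier_iff_rel s).2 ⟨(K.mem_closure_iff_rel s).1 hx, j, Or.inl h⟩

theorem mem_closure_of_mem_segment {x y z : Plane} (hx : x ∈ closure K.carrier)
    (hy : y ∈ closure K.carrier) (hz : z ∈ segment ℝ x y) : z ∈ closure K.carrier :=
  K.convex_carrier.closure.segment_subset hx hy hz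

theorem rel_mem_of_mem_segment (s : Fin 2 → Bool) {x y z : Plane}
    (hz : z ∈ segment ℝ x y) : ∃ t ∈ Set.Icc (0 : ℝ) 1,
      ∀ j, K.rel s j z = K.rel s j x + t * (K.rel s j y - K.rel s j x) := by
  rw [segment_eq_image'] at hz
  obtain ⟨t, ht, rfl⟩ := hz
  exact ⟨t, ht, fun j => K.rel_lineMap s j x y t⟩

theorem exists_aff_of_rel (s : Fin 2 → Bool) {j k : Fin 2} (hjk : j ≠ k) (c₀ wj wk : ℝ) {M : ℝ}
    (hj : |wj| ≤ M) (hk : |wk| ≤ M) :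
    ∃ ν c, (∀ x, aff ν c x = c₀ + (wj * K.rel s j x + wk * K.rel s k x)) ∧
      ∀ x y, |aff ν c x - aff ν c y| ≤ M * ∑ l, |x l - y l| / K.len l := by
  obtain ⟨ν, c, h⟩ := K.exists_aff_rel s c₀ fun l => if l = j then wj else wk
  have h' : ∀ x, aff ν c x = c₀ + (wj * K.rel s j x + wk * K.rel s k x) := fun x => by
    rw [h, sum_fin_two hjk]; simp [hjk.symm]
  refine ⟨ν, c, h', fun x y => ?_⟩
  rw [h', h', sum_fin_two hjk, ← K.abs_rel_sub s, ← K.abs_rel_sub s]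
  calc |c₀ + (wj * K.rel s j x + wk * K.rel s k x) - (c₀ + (wj * K.rel s j y + wk * K.rel s k y))|
      = |wj * (K.rel s j x - K.rel s j y) + wk * (K.rel s k x - K.rel s k y)| := by
        congr 1; ring
    _ ≤ |wj| * |K.rel s j x - K.rel s j y| + |wk| * |K.rel s k x - K.rel s k y| := by
        rw [← abs_mul, ← abs_mul]; exact abs_add_le _ _
    _ ≤ M * |K.rel s j x - K.rel s j y| + M * |K.rel s k x - K.rel s k y| := by gcongr
    _ = _ := by ring

end Rect

/-! ### A side crossed by the interface -/

/-- The side of `K` that leaves the corner `s` in direction `k` is crossed by `∂U` at `P` only. -/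
structure IsCrossing (U : Set Plane) (K : Rect) (s : Fin 2 → Bool) (j k : Fin 2) (P : Plane) :
    Prop where
  ne : j ≠ k
  mem : P ∈ frontier U
  rel_zero : K.rel s j P = 0
  rel_mem : K.rel s k P ∈ Set.Ioo (0 : ℝ) 1
  uniq : ∀ z ∈ closure K.carrier, K.rel s j z = 0 → z ∈ frontier U → z = P
  both : ∀ i, ∃ z ∈ closure K.carrier, K.rel s j z = 0 ∧ z ∈ phase U i

section Crossing

variable {U : Set Plane} {K : Rect} {s : Fin 2 → Bool} {j k : Fin 2} {P : Plane}

theorem IsCrossing.flip (h : IsCrossing U K s j k P) : IsCrossing U K (Rect.flip s k) j k P where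
  ne := h.ne
  mem := h.mem
  rel_zero := by rw [K.rel_flip_of_ne s h.ne, h.rel_zero]
  rel_mem := by
    rw [K.rel_flip_same]
    constructor <;> linarith [h.rel_mem.1, h.rel_mem.2]
  uniq z hz h0 hf := h.uniq z hz (by rwa [K.rel_flip_of_ne s h.ne] at h0) hf
  both i := by
    obtain ⟨z, hz, h0, hi⟩ := h.both i
    exact ⟨z, hz, by rwa [K.rel_flip_of_ne s h.ne], hi⟩

/-- Points of one closed side of `K` on the same side of the crossing have the same phase. -/
theorem IsCrossing.mem_phase (h : IsCrossing U K s j k P) (hU : IsOpen U) {x y : Plane} {i : Fin 2}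
    (hx : x ∈ closure K.carrier) (hy : y ∈ closure K.carrier) (hx0 : K.rel s j x = 0)
    (hy0 : K.rel s j y = 0)
    (hlt : (K.rel s k x < K.rel s k P ∧ K.rel s k y < K.rel s k P) ∨
      (K.rel s k P < K.rel s k x ∧ K.rel s k P < K.rel s k y))
    (hxi : x ∈ phase U i) : y ∈ phase U i := by
  refine subset_phase_of_isPreconnected hU (convex_segment x y).isPreconnected ?_
    ⟨x, left_mem_segment ℝ x y, hxi⟩ (right_mem_segment ℝ x y)
  rw [Set.disjoint_left]
  intro z hz hzf
  obtain ⟨t, ht, hr⟩ := K.rel_mem_of_mem_segment s hz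
  have := h.uniq z (K.mem_closure_of_mem_segment hx hy hz) (by rw [hr, hx0, hy0]; ring) hzf
  have h2 := hr k
  rw [this] at h2
  rcases hlt with ⟨h3, h4⟩ | ⟨h3, h4⟩
  · nlinarith [ht.1, ht.2, mul_nonneg ht.1 (sub_nonneg.2 h4.le),
      mul_nonneg (sub_nonneg.2 ht.2) (sub_nonneg.2 h3.le)]
  · nlinarith [ht.1, ht.2, mul_nonneg ht.1 (sub_nonneg.2 h4.le),
      mul_nonneg (sub_nonneg.2 ht.2) (sub_nonneg.2 h3.le)]

theorem Rect.vertex_mem_closure (K : Rect) (s : Fin 2 → Bool) : K.vertex s ∈ closure K.carrier :=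
  frontier_subset_closure (K.vertex_mem_frontier s)

theorem Rect.rel_vertex_self (K : Rect) (s : Fin 2 → Bool) (j : Fin 2) :
    K.rel s j (K.vertex s) = 0 := by simp [Rect.rel_vertex]

theorem Rect.rel_vertex_flip (K : Rect) (s : Fin 2 → Bool) {j k : Fin 2} (h : j ≠ k) :
    K.rel s j (K.vertex (Rect.flip s k)) = 0 ∧ K.rel s k (K.vertex (Rect.flip s k)) = 1 := by
  simp [Rect.rel_vertex, Rect.flip, Function.update_of_ne h]

theorem IsCrossing.vertex_notMem (h : IsCrossing U K s j k P) : K.vertex s ∉ frontier U := by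
  intro hf
  have := h.uniq _ (K.vertex_mem_closure s) (K.rel_vertex_self s j) hf
  have h2 := h.rel_mem.1
  rw [← this, K.rel_vertex_self] at h2
  exact lt_irrefl _ h2

theorem IsCrossing.mem_phase_of_lt (h : IsCrossing U K s j k P) (hU : IsOpen U) {i : Fin 2}
    (hs : K.vertex s ∈ phase U i) {x : Plane} (hx : x ∈ closure K.carrier) (hx0 : K.rel s j x = 0)
    (hlt : K.rel s k x < K.rel s k P) : x ∈ phase U i :=
  h.mem_phase hU (K.vertex_mem_closure s) hx (K.rel_vertex_self s j) hx0
    (Or.inl ⟨by rw [K.rel_vertex_self]; exact h.rel_mem.1, hlt⟩) hs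

theorem IsCrossing.vertex_flip_notMem_phase (h : IsCrossing U K s j k P) (hU : IsOpen U) {i : Fin 2}
    (hs : K.vertex s ∈ phase U i) : K.vertex (Rect.flip s k) ∉ phase U i := by
  intro hf
  obtain ⟨i', hi'⟩ : ∃ i', i ≠ i' := ⟨i + 1, by fin_cases i <;> simp⟩
  obtain ⟨z, hz, hz0, hzi⟩ := h.both i'
  refine Set.disjoint_left.1 (phase_disjoint hi') ?_ hzi
  rcases lt_trichotomy (K.rel s k z) (K.rel s k P) with h1 | h1 | h1
  · exact h.mem_phase_of_lt hU hs hz hz0 h1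
  · exfalso
    have : z = P := K.rel_ext (s := s) fun l => by
      rcases fin_two_eq_or h.ne l with rfl | rfl
      · rw [hz0, h.rel_zero]
      · exact h1
    exact Set.disjoint_left.1 (phase_disjoint_frontier hU i') hzi (this ▸ h.mem)
  · refine h.flip.mem_phase_of_lt hU hf hz (by rwa [K.rel_flip_of_ne s h.ne]) ?_
    rw [K.rel_flip_same, K.rel_flip_same]; linarith

theorem IsCrossing.le_of_mem_phase (h : IsCrossing U K s j k P) (hU : IsOpen U) {i : Fin 2}
    (hs : K.vertex s ∈ phase U i) {x : Plane} (hx : x ∈ closure K.carrier) (hx0 : K.rel s j x = 0)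
    (hxi : x ∈ phase U i) : K.rel s k x < K.rel s k P := by
  by_contra hle
  rcases (not_lt.1 hle).eq_or_lt with h1 | h1
  · have : x = P := K.rel_ext (s := s) fun l => by
      rcases fin_two_eq_or h.ne l with rfl | rfl
      · rw [hx0, h.rel_zero]
      · exact h1.symm
    exact Set.disjoint_left.1 (phase_disjoint_frontier hU i) hxi (this ▸ h.mem)
  · have hv := K.rel_vertex_flip s h.ne
    exact h.vertex_flip_notMem_phase hU hs (h.mem_phase hU hx (K.vertex_mem_closure _) hx0 hv.1
      (Or.inr ⟨h1, by rw [hv.2]; exact h.rel_mem.2⟩) hxi)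

/-- Otherwise some half disc in `K` at the crossing point would miss the interface and lie in a
single phase, whereas the phase changes along the side at `P`. This provides the accumulation point
required for cutting the interface at the kink. -/
theorem IsCrossing.mem_closure (h : IsCrossing U K s j k P) (hU : IsOpen U) :
    P ∈ closure (frontier U ∩ K.carrier) := by
  by_contra hP
  obtain ⟨ε, hε, hball⟩ := Metric.mem_nhds_iff.1 (isClosed_closure.isOpen_compl.mem_nhds hP)
  obtain ⟨i, hi⟩ := exists_mem_phase hU h.vertex_notMem
  have hb0 := h.rel_mem.1
  have hb1 := h.rel_mem.2
  set β := K.rel s k P with hβ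
  have hl := K.len_pos k
  set τ := min (min (β / 2) ((1 - β) / 2)) (ε / (2 * K.len k)) with hτ
  have hτ0 : 0 < τ := lt_min (lt_min (by linarith) (by linarith)) (by positivity)
  have hτ1 : τ ≤ β / 2 := (min_le_left _ _).trans (min_le_left _ _)
  have hτ2 : τ ≤ (1 - β) / 2 := (min_le_left _ _).trans (min_le_right _ _)
  have hτ3 : τ ≤ ε / (2 * K.len k) := min_le_right _ _
  rw [le_div_iff₀ (by positivity)] at hτ3
  set H := Metric.ball P ε ∩ K.carrier
  have hH : IsPreconnected H := ((convex_ball P ε).inter K.convex_carrier).isPreconnected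
  have hHd : Disjoint H (frontier U) := Set.disjoint_left.2 fun z hz hzf =>
    hball hz.1 (subset_closure ⟨hzf, hz.2⟩)
  have hpt : ∀ e : ℝ, |e| ≤ τ → ∃ x ∈ closure H, x ∈ closure K.carrier ∧ K.rel s j x = 0 ∧
      K.rel s k x = β + e := by
    intro e he
    set x := K.ofRel s fun l => if l = j then 0 else β + e with hx
    have hxj : K.rel s j x = 0 := by rw [hx, K.rel_ofRel]; simp
    have hxk : K.rel s k x = β + e := by rw [hx, K.rel_ofRel]; simp [h.ne.symm]
    have he' := abs_le.1 he
    have hxc : x ∈ closure K.carrier := K.mem_closure_of_rel (s := s) fun l => by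
      rcases fin_two_eq_or h.ne l with rfl | rfl
      · rw [hxj]; simp
      · rw [hxk]; constructor <;> linarith
    refine ⟨x, Metric.isOpen_ball.inter_closure ⟨?_, hxc⟩, hxc, hxj, hxk⟩
    rw [Metric.mem_ball, K.dist_eq_of_rel h.ne (hxj.trans h.rel_zero.symm), hxk, ← hβ,
      add_sub_cancel_left]
    nlinarith
  obtain ⟨x, hxH, hx, hxj, hxk⟩ := hpt (-τ) (by rw [abs_neg, abs_of_pos hτ0])
  obtain ⟨y, hyH, hy, hyj, hyk⟩ := hpt τ (by rw [abs_of_pos hτ0])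
  have hHi := subset_phase_of_mem_closure hU hH hHd hxH
    (h.mem_phase_of_lt hU hi hx hxj (by rw [hxk]; linarith))
  have hyi := mem_phase_of_mem_closure hU hyH (fun hf => by
    have := h.uniq y hy hyj hf
    rw [this] at hyk; linarith) hHi
  have := h.le_of_mem_phase hU hi hy hyj hyi
  linarith

/-- The part of the side in the phase of the corner is contained in the segment from the corner to
`P`, whose relative length is the normalized coordinate of `P`. Largeness with respect to the phase
therefore bounds this coordinate from below; from the neighbouring corner it is bounded by `1 - δ₀`.
-/
theorem IsCrossing.le_rel (h : IsCrossing U K s j k P) (hU : IsOpen U) {Ω : Set Plane}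
    (hsub : U ⊆ Ω) (hK : K.carrier ⊆ Ω) {δ₀ : ℝ} {i : Fin 2} (hs : K.vertex s ∈ phase U i)
    (hlarge : IsLarge Ω U δ₀ i K) : δ₀ ≤ K.rel s k P := by
  have hb0 := h.rel_mem.1
  have hb1 := h.rel_mem.2
  set β := K.rel s k P with hβ
  have hl := K.len_pos k
  have hmem : ∀ u : ℝ, ∃ x, K.rel s j x = 0 ∧ K.rel s k x = u := fun u =>
    ⟨K.ofRel s fun l => if l = j then 0 else u, by rw [K.rel_ofRel]; simp,
      by rw [K.rel_ofRel]; simp [h.ne.symm]⟩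
  have hside : ∀ x, x ∈ K.side j (s j) ↔ K.rel s j x = 0 ∧ K.rel s k x ∈ Set.Ioo (0 : ℝ) 1 := by
    intro x
    rw [K.mem_side_iff_rel s]
    simp only [if_true]
    refine and_congr_right fun _ => ⟨fun h' => h' k h.ne.symm, fun h' l hl => ?_⟩
    rwa [(fin_two_eq_or h.ne l).resolve_left hl]
  have hcl : ∀ x ∈ K.side j (s j), x ∈ closure K.carrier := fun x hx =>
    frontier_subset_closure (K.side_subset_frontier j _ hx)
  have hsubseg : ∀ x y : Plane, K.rel s j x = 0 → K.rel s j y = 0 → K.rel s k x = 0 →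
      0 < K.rel s k y → ∀ z, K.rel s j z = 0 → K.rel s k z ∈ Set.Icc 0 (K.rel s k y) →
      z ∈ segment ℝ x y := by
    intro x y hx hy hx0 hy0 z hz hzk
    rw [segment_eq_image']
    refine ⟨K.rel s k z / K.rel s k y, ⟨div_nonneg hzk.1 hy0.le, (div_le_one hy0).2 hzk.2⟩, ?_⟩
    refine K.rel_ext (s := s) fun l => ?_
    rw [K.rel_lineMap]
    rcases fin_two_eq_or h.ne l with rfl | rfl
    · rw [hx, hy, hz]; ring
    · rw [hx0]; field_simp; ring
  -- The closed side is a segment of known Hausdorff measure, and its two end points are null.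
  have hlen : ENNReal.ofReal (K.len k) ≤ μH[1] (K.side j (s j)) := by
    obtain ⟨y, hyj, hyk⟩ := hmem 1
    have h1 : segment ℝ (K.vertex s) y ⊆ K.side j (s j) ∪ {K.vertex s, y} := by
      intro z hz
      obtain ⟨t, ht, hr⟩ := K.rel_mem_of_mem_segment s hz
      have e1 := hr j
      have e2 := hr k
      rw [K.rel_vertex_self] at e1 e2
      rw [hyj] at e1
      rw [hyk] at e2
      simp only [sub_self, mul_zero, add_zero, sub_zero, mul_one, zero_add] at e1 e2
      rcases ht.1.eq_or_lt with h0 | h0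
      · right; left
        refine K.rel_ext (s := s) fun l => ?_
        rw [K.rel_vertex_self]
        rcases fin_two_eq_or h.ne l with rfl | rfl
        · exact e1
        · rw [e2, h0]
      rcases ht.2.eq_or_lt with h0' | h0'
      · right; right
        refine K.rel_ext (s := s) fun l => ?_
        rcases fin_two_eq_or h.ne l with rfl | rfl
        · rw [e1, hyj]
        · rw [e2, hyk, h0']
      · left; exact (hside z).2 ⟨e1, e2 ▸ ⟨h0, h0'⟩⟩
    have h2 : μH[1] (segment ℝ (K.vertex s) y) = ENNReal.ofReal (K.len k) := by
      rw [hausdorffMeasure_segment, edist_dist,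
        K.dist_eq_of_rel h.ne ((K.rel_vertex_self s j).trans hyj.symm), K.rel_vertex_self, hyk]
      simp
    rw [← h2]
    refine (measure_mono h1).trans ((measure_union_le _ _).trans ?_)
    have : μH[1] ({K.vertex s, y} : Set Plane) = 0 :=
      haveI := Measure.nullSingletonClass_hausdorff Plane (d := 1) one_pos
      (Set.toFinite _).measure_zero _
    rw [this, add_zero]
  have hupper : μH[1] (K.side j (s j) ∩ closure (subdomain Ω U i)) ≤
      ENNReal.ofReal (β * K.len k) := by
    have h1 : K.side j (s j) ∩ closure (subdomain Ω U i) ⊆ segment ℝ (K.vertex s) P := by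
      rintro x ⟨hx, hxc⟩
      have hxs := (hside x).1 hx
      refine hsubseg _ _ (K.rel_vertex_self s j) h.rel_zero (K.rel_vertex_self s k) hb0 x hxs.1
        ⟨hxs.2.1.le, ?_⟩
      by_cases hf : x ∈ frontier U
      · rw [h.uniq x (hcl x hx) hxs.1 hf]
      · exact (h.le_of_mem_phase hU hs (hcl x hx) hxs.1 ((mem_closure_subdomain_iff hU hsub
          (closure_mono hK (hcl x hx)) hf).1 hxc)).le
    refine (measure_mono h1).trans (le_of_eq ?_)
    rw [hausdorffMeasure_segment, edist_dist,
        K.dist_eq_of_rel h.ne ((K.rel_vertex_self s j).trans h.rel_zero.symm), K.rel_vertex_self,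
        ← hβ, zero_sub, abs_neg, abs_of_pos hb0]
  have hne : (K.side j (s j) ∩ closure (subdomain Ω U i)).Nonempty := by
    obtain ⟨x, hxj, hxk⟩ := hmem (β / 2)
    have hx : x ∈ K.side j (s j) := (hside x).2 ⟨hxj, by rw [hxk]; constructor <;> linarith⟩
    have hxi := h.mem_phase_of_lt hU hs (hcl x hx) hxj (by rw [hxk]; linarith)
    exact ⟨x, hx, (mem_closure_subdomain_iff hU hsub (closure_mono hK (hcl x hx))
      (Set.disjoint_left.1 (phase_disjoint_frontier hU i) hxi)).2 hxi⟩
  have h1 := (hlarge.1 j (s j) hne).trans hupper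
  have h2 : ENNReal.ofReal δ₀ * ENNReal.ofReal (K.len k) ≤ ENNReal.ofReal (β * K.len k) :=
    (mul_le_mul_right hlen _).trans h1
  rw [← ENNReal.ofReal_mul' hl.le, ENNReal.ofReal_le_ofReal_iff (by positivity)] at h2
  exact le_of_mul_le_mul_right h2 hl

/-- Two points of a closed side that the interface does not meet have the same phase. -/
theorem mem_phase_of_rel_eq (hU : IsOpen U) {e : ℝ}
    (hside : ∀ z ∈ closure K.carrier, K.rel s j z = e → z ∉ frontier U) {x y : Plane} {i : Fin 2}
    (hx : x ∈ closure K.carrier) (hy : y ∈ closure K.carrier) (hxe : K.rel s j x = e)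
    (hye : K.rel s j y = e) (hxi : x ∈ phase U i) : y ∈ phase U i := by
  refine subset_phase_of_isPreconnected hU (convex_segment x y).isPreconnected ?_
    ⟨x, left_mem_segment ℝ x y, hxi⟩ (right_mem_segment ℝ x y)
  rw [Set.disjoint_left]
  intro z hz
  obtain ⟨t, ht, hr⟩ := K.rel_mem_of_mem_segment s hz
  exact hside z (K.mem_closure_of_mem_segment hx hy hz) (by rw [hr, hxe, hye]; ring)

end Crossing

end
end UnfittedLDG

namespace UnfittedLDG
noncomputable section
open scoped ENNReal NNReal Topology

/-! ### Interface elements -/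

section Interface

variable {Ω U : Set Plane} {K : Rect} {s : Fin 2 → Bool} {j k : Fin 2} {B C : Plane}

theorem vertex_notMem_frontier (hc : CrossesTwice U K) (s : Fin 2 → Bool) :
    K.vertex s ∉ frontier U := by
  obtain ⟨-, j, k, b, t, B, C, -, hB, hC, hF, -⟩ := hc
  intro h
  have h1 : K.vertex s ∈ ({B, C} : Set Plane) := hF ▸ ⟨h, K.vertex_mem_frontier s⟩
  rcases h1 with h1 | h1
  · exact K.vertex_notMem_side s j b (h1 ▸ hB)
  · exact K.vertex_notMem_side s k t (Set.mem_singleton_iff.1 h1 ▸ hC)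

theorem isCrossing_of_side {k' : Fin 2} {b t : Bool} (hne : (j, b) ≠ (k', t)) (hB : B ∈ K.side j b)
    (hC : C ∈ K.side k' t) (hF : ∀ z ∈ frontier U, z ∈ frontier K.carrier → z = B ∨ z = C)
    (hBF : B ∈ frontier U) (h0 : (K.side j b ∩ U).Nonempty)
    (h1 : (K.side j b \ closure U).Nonempty) (hs : s j = b) (hjk : j ≠ k) :
    IsCrossing U K s j k B := by
  have hB' := (K.mem_side_iff_rel s).1 hB
  have hC' := (K.mem_side_iff_rel s).1 hC
  simp only [hs, if_true] at hB'
  refine ⟨hjk, hBF, hB'.1, hB'.2 k hjk.symm, fun z hz hz0 hzf => ?_, fun i => ?_⟩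
  · refine (hF z hzf (K.mem_frontier_of_rel_eq_zero hz hz0)).resolve_right fun he => ?_
    rw [he] at hz0
    by_cases hj : j = k'
    · subst hj
      have htb : t ≠ s j := fun h => hne (by rw [h, hs])
      rw [hC'.1, if_neg htb] at hz0
      exact one_ne_zero hz0
    · exact (hC'.2 j hj).1.ne' hz0
  · have hside : ∀ z ∈ K.side j b, z ∈ closure K.carrier ∧ K.rel s j z = 0 := fun z hz =>
      ⟨frontier_subset_closure (K.side_subset_frontier j b hz), by
        have := ((K.mem_side_iff_rel s).1 hz).1
        simpa [hs] using this⟩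
    fin_cases i
    · obtain ⟨z, hz, hzU⟩ := h0
      exact ⟨z, (hside z hz).1, (hside z hz).2, by simpa [phase] using hzU⟩
    · obtain ⟨z, hz, hzU⟩ := h1
      exact ⟨z, (hside z hz).1, (hside z hz).2, by simpa [phase] using hzU⟩

/-- The two crossings lie on two sides with a common corner, or on two opposite sides. -/
theorem CrossesTwice.exists_crossings (hc : CrossesTwice U K) :
    ∃ B C, B ≠ C ∧ frontier U ∩ frontier K.carrier = {B, C} ∧
      ((∃ s j k, IsCrossing U K s j k B ∧ IsCrossing U K s k j C) ∨
        ∃ s j k, IsCrossing U K s j k B ∧ IsCrossing U K (Rect.flip s j) j k C) := by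
  obtain ⟨-, j, k', b, t, B, C, hne, hB, hC, hF, hB0, hB1, hC0, hC1⟩ := hc
  have hBC : B ∈ frontier U ∧ C ∈ frontier U := by
    constructor
    · exact (hF.ge (Set.mem_insert _ _)).1
    · exact (hF.ge (Set.mem_insert_of_mem _ rfl)).1
  have hF' : ∀ z ∈ frontier U, z ∈ frontier K.carrier → z = B ∨ z = C := fun z h1 h2 =>
    hF.le ⟨h1, h2⟩
  have hF'' : ∀ z ∈ frontier U, z ∈ frontier K.carrier → z = C ∨ z = B := fun z h1 h2 =>
    (hF' z h1 h2).symm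
  have hBC' : B ≠ C := by
    rintro rfl
    by_cases hj : j = k'
    · subst hj
      have htb : b ≠ t := fun h => hne (by rw [h])
      have h1 := ((K.mem_side_iff_rel fun _ => b).1 hB).1
      have h2 := ((K.mem_side_iff_rel fun _ => b).1 hC).1
      rw [if_pos rfl] at h1
      rw [if_neg htb.symm, h1] at h2
      exact zero_ne_one h2
    · have h1 := ((K.mem_side_iff_rel fun _ => b).1 hB).1
      have h2 := ((K.mem_side_iff_rel fun _ => b).1 hC).2 j hj
      rw [if_pos rfl] at h1
      exact h2.1.ne' h1
  refine ⟨B, C, hBC', hF, ?_⟩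
  by_cases hj : j = k'
  · subst hj
    right
    have htb : t ≠ b := fun h => hne (by rw [h])
    obtain ⟨k, hk⟩ : ∃ k, j ≠ k := ⟨j + 1, by fin_cases j <;> simp⟩
    refine ⟨fun _ => b, j, k, isCrossing_of_side hne hB hC hF' hBC.1 hB0 hB1 rfl hk,
      isCrossing_of_side hne.symm hC hB hF'' hBC.2 hC0 hC1 ?_ hk⟩
    simp only [Rect.flip, Function.update_self]
    cases b <;> cases t <;> simp_all
  · left
    refine ⟨Function.update (fun _ => t) j b, j, k',
      isCrossing_of_side hne hB hC hF' hBC.1 hB0 hB1 (by simp) hj,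
      isCrossing_of_side hne.symm hC hB hF'' hBC.2 hC0 hC1 (by simp [Ne.symm hj]) (Ne.symm hj)⟩

theorem mem_closed_square (s : Fin 2 → Bool) {x : Plane} (hx : x ∈ closure K.carrier) (j : Fin 2) :
    0 ≤ K.rel s j x ∧ K.rel s j x ≤ 1 := (K.mem_closure_iff_rel s).1 hx j

theorem cases_frontier (hjk : j ≠ k) {x : Plane} (hx : x ∈ frontier K.carrier) :
    K.rel s j x = 0 ∨ K.rel s j x = 1 ∨ K.rel s k x = 0 ∨ K.rel s k x = 1 := by
  obtain ⟨-, l, hl⟩ := (K.mem_frontier_iff_rel s).1 hx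
  rcases fin_two_eq_or hjk l with rfl | rfl <;> tauto

theorem rel_vertex_zero_or_one (s s' : Fin 2 → Bool) (j : Fin 2) :
    K.rel s j (K.vertex s') = 0 ∨ K.rel s j (K.vertex s') = 1 := by
  rw [Rect.rel_vertex]; split_ifs <;> simp

/-- The two sides that do not end at the corner are free of crossings, so each lies in the phase of
its neighbouring vertex, which is separated from the corner by a crossing. -/
theorem frontier_phase_of_corner (hU : IsOpen U) (hB : IsCrossing U K s j k B) (hC : IsCrossing U K s k j C)
    (hF : ∀ z ∈ frontier U, z ∈ frontier K.carrier → z = B ∨ z = C) {i : Fin 2} (hs : K.vertex s ∈ phase U i) {x : Plane}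
    (hx : x ∈ frontier K.carrier) (hxi : x ∈ phase U i) :
    (K.rel s j x = 0 ∧ K.rel s k x < K.rel s k B) ∨
      (K.rel s k x = 0 ∧ K.rel s j x < K.rel s j C) := by
  have hxc := frontier_subset_closure hx
  have hfar : ∀ {j k B C}, IsCrossing U K s j k B → IsCrossing U K s k j C →
      (∀ z ∈ frontier U, z ∈ frontier K.carrier → z = B ∨ z = C) → K.rel s j x ≠ 1 := by
    intro j k B C hB hC hF h1
    refine hC.vertex_flip_notMem_phase hU hs ?_
    refine mem_phase_of_rel_eq hU (j := j) (s := s) (e := 1) (fun z hz hz1 hzf => ?_) hxc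
      (K.vertex_mem_closure _) h1 (K.rel_vertex_flip s hC.ne).2 hxi
    have hzF : z ∈ frontier K.carrier :=
      (K.mem_frontier_iff_rel s).2 ⟨(K.mem_closure_iff_rel s).1 hz, j, Or.inr hz1⟩
    rcases hF z hzf hzF with rfl | rfl
    · rw [hB.rel_zero] at hz1; exact zero_ne_one hz1
    · exact hC.rel_mem.2.ne hz1
  rcases cases_frontier (s := s) hB.ne hx with h | h | h | h
  · exact Or.inl ⟨h, hB.le_of_mem_phase hU hs hxc h hxi⟩
  · exact absurd h (hfar hB hC hF)
  · exact Or.inr ⟨h, hC.le_of_mem_phase hU hs hxc h hxi⟩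
  · exact absurd h (hfar hC hB fun z h1 h2 => (hF z h1 h2).symm)

theorem frontier_phase_off_corner (hU : IsOpen U) (hB : IsCrossing U K s j k B) (hC : IsCrossing U K s k j C) {i i' : Fin 2} (hs : K.vertex s ∈ phase U i) (hi : i ≠ i')
    {x : Plane} (hx : x ∈ frontier K.carrier) (hxi : x ∈ phase U i') :
    (K.rel s k B ≤ K.rel s k x) ∨ (K.rel s j C ≤ K.rel s j x) := by
  have hxc := frontier_subset_closure hx
  by_contra hcon
  push Not at hcon
  refine Set.disjoint_left.1 (phase_disjoint hi) ?_ hxi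
  rcases cases_frontier (s := s) hB.ne hx with h | h | h | h
  · exact hB.mem_phase_of_lt hU hs hxc h hcon.1
  · linarith [hC.rel_mem.2, hcon.2]
  · exact hC.mem_phase_of_lt hU hs hxc h hcon.2
  · linarith [hB.rel_mem.2, hcon.1]

theorem side_phase_of_opposite (hU : IsOpen U) (hB : IsCrossing U K s j k B) (hC : IsCrossing U K (Rect.flip s j) j k C)
    (hF : ∀ z ∈ frontier U, z ∈ frontier K.carrier → z = B ∨ z = C) {e : ℝ} (he : e = 0 ∨ e = 1) {x y : Plane} {i : Fin 2}
    (hx : x ∈ closure K.carrier) (hy : y ∈ closure K.carrier) (hxe : K.rel s k x = e)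
    (hye : K.rel s k y = e) (hxi : x ∈ phase U i) : y ∈ phase U i := by
  refine mem_phase_of_rel_eq hU (fun z hz hz1 hzf => ?_) hx hy hxe hye hxi
  have hzF : z ∈ frontier K.carrier :=
    (K.mem_frontier_iff_rel s).2 ⟨(K.mem_closure_iff_rel s).1 hz, k, by
      rcases he with rfl | rfl
      · exact Or.inl hz1
      · exact Or.inr hz1⟩
  have hCm := hC.rel_mem
  rw [K.rel_flip_of_ne s hB.ne.symm] at hCm
  rcases hF z hzf hzF with rfl | rfl
  · rcases he with rfl | rfl
    · exact hB.rel_mem.1.ne' hz1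
    · exact hB.rel_mem.2.ne hz1
  · rcases he with rfl | rfl
    · exact hCm.1.ne' hz1
    · exact hCm.2.ne hz1

theorem vertex_flip_mem_phase_of_opposite (hU : IsOpen U) (hB : IsCrossing U K s j k B) (hC : IsCrossing U K (Rect.flip s j) j k C)
    (hF : ∀ z ∈ frontier U, z ∈ frontier K.carrier → z = B ∨ z = C) {i : Fin 2} (hs : K.vertex s ∈ phase U i) :
    K.vertex (Rect.flip s j) ∈ phase U i :=
  side_phase_of_opposite hU hB hC hF (Or.inl rfl) (K.vertex_mem_closure s) (K.vertex_mem_closure _)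
    (K.rel_vertex_self s k) (K.rel_vertex_flip s hB.ne.symm).1 hs

theorem frontier_phase_of_opposite (hU : IsOpen U) (hB : IsCrossing U K s j k B) (hC : IsCrossing U K (Rect.flip s j) j k C)
    (hF : ∀ z ∈ frontier U, z ∈ frontier K.carrier → z = B ∨ z = C) {i : Fin 2} (hs : K.vertex s ∈ phase U i) {x : Plane}
    (hx : x ∈ frontier K.carrier) (hxi : x ∈ phase U i) :
    (K.rel s j x = 0 ∧ K.rel s k x < K.rel s k B) ∨
      (K.rel s j x = 1 ∧ K.rel s k x < K.rel s k C) ∨ K.rel s k x = 0 := by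
  have hxc := frontier_subset_closure hx
  have hs' := vertex_flip_mem_phase_of_opposite hU hB hC hF hs
  rcases cases_frontier (s := s) hB.ne hx with h | h | h | h
  · exact Or.inl ⟨h, hB.le_of_mem_phase hU hs hxc h hxi⟩
  · have := hC.le_of_mem_phase hU hs' hxc (by rw [K.rel_flip_same, h, sub_self]) hxi
    rw [K.rel_flip_of_ne s hB.ne.symm, K.rel_flip_of_ne s hB.ne.symm] at this
    exact Or.inr (Or.inl ⟨h, this⟩)
  · exact Or.inr (Or.inr h)
  · exfalso
    exact hB.vertex_flip_notMem_phase hU hs (side_phase_of_opposite hU hB hC hF (Or.inr rfl) hxc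
      (K.vertex_mem_closure _) h (K.rel_vertex_flip s hB.ne).2 hxi)

/-- An affine function that vanishes at both crossings and is positive in the part of `∂K` in the
given phase. -/
theorem exists_chord_function (hU : IsOpen U) (hsub : U ⊆ Ω) (hK : K.carrier ⊆ Ω)
    (hc : CrossesTwice U K) {δ₀ : ℝ} (hδ₀ : 0 < δ₀) (hδ₁ : δ₀ < 1 / 2)
    (hl : ∀ i, IsLarge Ω U δ₀ i K) :
    ∃ B C, B ≠ C ∧ frontier U ∩ frontier K.carrier = {B, C} ∧ ∀ i, (∃ s, K.vertex s ∈ phase U i) ∧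
      ∃ ν c, aff ν c B = 0 ∧ aff ν c C = 0 ∧
        (∀ x y, |aff ν c x - aff ν c y| ≤ 1 / δ₀ * ∑ l, |x l - y l| / K.len l) ∧
        (∀ s, K.vertex s ∈ phase U i → δ₀ ≤ aff ν c (K.vertex s)) ∧
        ∀ x ∈ frontier K.carrier, x ∈ phase U i → 0 ≤ aff ν c x := by
  obtain ⟨B, C, hBC, hF, h⟩ := hc.exists_crossings
  refine ⟨B, C, hBC, hF, fun i => ?_⟩
  have hF' : ∀ z ∈ frontier U, z ∈ frontier K.carrier → z = B ∨ z = C := fun z h1 h2 =>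
    hF.le ⟨h1, h2⟩
  have hd1 : 1 ≤ 1 / δ₀ := by rw [le_div_iff₀ hδ₀]; linarith
  have hlarge : ∀ {s j k P}, IsCrossing U K s j k P → δ₀ ≤ K.rel s k P ∧ K.rel s k P ≤ 1 - δ₀ := by
    intro s j k P hP
    obtain ⟨i₀, hi₀⟩ := exists_mem_phase hU hP.vertex_notMem
    obtain ⟨i₁, hi₁⟩ := exists_mem_phase hU hP.flip.vertex_notMem
    have h1 := hP.le_rel hU hsub hK hi₀ (hl i₀)
    have h2 := hP.flip.le_rel hU hsub hK hi₁ (hl i₁)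
    rw [K.rel_flip_same] at h2
    exact ⟨h1, by linarith⟩
  rcases h with ⟨s, j, k, hB, hC⟩ | ⟨s, j, k, hB, hC⟩
  · have hβ := hlarge hB
    have hγ := hlarge hC
    have hb0 := hB.rel_zero
    have hc0 := hC.rel_zero
    set β := K.rel s k B
    set γ := K.rel s j C
    have hβ0 : 0 < β := by linarith
    have hγ0 : 0 < γ := by linarith
    have hwβ : |1 / β| ≤ 1 / δ₀ := by
      rw [abs_of_pos (by positivity)]; exact one_div_le_one_div_of_le hδ₀ hβ.1
    have hwγ : |1 / γ| ≤ 1 / δ₀ := by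
      rw [abs_of_pos (by positivity)]; exact one_div_le_one_div_of_le hδ₀ hγ.1
    obtain ⟨i₀, hi₀⟩ := exists_mem_phase hU hB.vertex_notMem
    by_cases hi : i = i₀
    · subst hi
      refine ⟨⟨s, hi₀⟩, ?_⟩
      -- The intercept form of the line through the crossings, normalized to the value `1` at the
      -- common corner. For the other phase its negative is used.
      obtain ⟨ν, c, h1, h2⟩ := K.exists_aff_of_rel s hB.ne 1 (-(1 / γ)) (-(1 / β)) (M := 1 / δ₀)
        (by rwa [abs_neg]) (by rwa [abs_neg])
      have key : ∀ x ∈ frontier K.carrier, x ∈ phase U i → 0 ≤ aff ν c x := by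
        intro x hx hxi
        rw [h1]
        rcases frontier_phase_of_corner hU hB hC hF' hi₀ hx hxi with ⟨e1, e2⟩ | ⟨e1, e2⟩
        · rw [e1]
          have : 1 / β * K.rel s k x ≤ 1 := by
            rw [one_div, inv_mul_le_iff₀ hβ0]; linarith
          linarith
        · rw [e1]
          have : 1 / γ * K.rel s j x ≤ 1 := by
            rw [one_div, inv_mul_le_iff₀ hγ0]; linarith
          linarith
      refine ⟨ν, c, ?_, ?_, h2, fun s' hs' => ?_, key⟩
      · rw [h1, hb0]; field_simp; ring
      · rw [h1, hc0]; field_simp; ring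
      · rw [h1]
        rcases frontier_phase_of_corner hU hB hC hF' hi₀ (K.vertex_mem_frontier s') hs' with
          ⟨e1, e2⟩ | ⟨e1, e2⟩
        · have : K.rel s k (K.vertex s') = 0 :=
            (rel_vertex_zero_or_one s s' k).resolve_right (by linarith)
          rw [e1, this]; linarith
        · have : K.rel s j (K.vertex s') = 0 :=
            (rel_vertex_zero_or_one s s' j).resolve_right (by linarith)
          rw [e1, this]; linarith
    · have hv : K.vertex (Rect.flip s k) ∈ phase U i := by
        obtain ⟨i₁, hi₁⟩ := exists_mem_phase hU hB.flip.vertex_notMem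
        have : i₁ ≠ i₀ := fun he => hB.vertex_flip_notMem_phase hU hi₀ (he ▸ hi₁)
        have : i = i₁ := by omega
        rwa [this]
      refine ⟨⟨_, hv⟩, ?_⟩
      obtain ⟨ν, c, h1, h2⟩ := K.exists_aff_of_rel s hB.ne (-1) (1 / γ) (1 / β) hwγ hwβ
      have hone : ∀ {b r : ℝ}, 0 < b → b ≤ r → 1 ≤ 1 / b * r := fun hb hr => by
        rw [one_div, le_inv_mul_iff₀ hb]; linarith
      refine ⟨ν, c, ?_, ?_, h2, fun s' hs' => ?_, fun x hx hxi => ?_⟩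
      · rw [h1, hb0]; field_simp; ring
      · rw [h1, hc0]; field_simp; ring
      · rw [h1]
        -- Largeness with respect to the phase of the corner bounds the intercepts from below,
        -- largeness with respect to the opposite phase bounds them by `1 - δ₀`; the latter makes
        -- the function at least `δ₀` at the remaining vertices.
        have hb : ∀ {b : ℝ}, 0 < b → b ≤ 1 - δ₀ → 1 + δ₀ ≤ 1 / b := fun hb hb' => by
          rw [le_div_iff₀ hb]; nlinarith
        have n1 : 0 ≤ 1 / γ * K.rel s j (K.vertex s') :=
          mul_nonneg (by positivity) (mem_closed_square s (K.vertex_mem_closure s') j).1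
        have n2 : 0 ≤ 1 / β * K.rel s k (K.vertex s') :=
          mul_nonneg (by positivity) (mem_closed_square s (K.vertex_mem_closure s') k).1
        rcases frontier_phase_off_corner hU hB hC hi₀ (Ne.symm hi) (K.vertex_mem_frontier s')
          hs' with e | e
        · have : K.rel s k (K.vertex s') = 1 :=
            (rel_vertex_zero_or_one s s' k).resolve_left (by linarith)
          rw [this] at n2 ⊢
          linarith [hb hβ0 hβ.2]
        · have : K.rel s j (K.vertex s') = 1 :=
            (rel_vertex_zero_or_one s s' j).resolve_left (by linarith)
          rw [this] at n1 ⊢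
          linarith [hb hγ0 hγ.2]
      · rw [h1]
        have n1 : 0 ≤ 1 / γ * K.rel s j x :=
          mul_nonneg (by positivity) (mem_closed_square s (frontier_subset_closure hx) j).1
        have n2 : 0 ≤ 1 / β * K.rel s k x :=
          mul_nonneg (by positivity) (mem_closed_square s (frontier_subset_closure hx) k).1
        rcases frontier_phase_off_corner hU hB hC hi₀ (Ne.symm hi) hx hxi with e | e
        · linarith [hone hβ0 e]
        · linarith [hone hγ0 e]
  · -- choose the corner in the phase `i`
    obtain ⟨s', hs'j, hs'i, hB', hC'⟩ : ∃ s', s' j = s j ∧ K.vertex s' ∈ phase U i ∧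
        IsCrossing U K s' j k B ∧ IsCrossing U K (Rect.flip s' j) j k C := by
      have hcomm : Rect.flip (Rect.flip s k) j = Rect.flip (Rect.flip s j) k := by
        have hjk := hB.ne
        ext l
        rcases fin_two_eq_or hjk l with rfl | rfl
        · simp [Rect.flip, Function.update_of_ne hjk]
        · simp [Rect.flip, Function.update_of_ne hjk.symm]
      obtain ⟨i₀, hi₀⟩ := exists_mem_phase hU hB.vertex_notMem
      by_cases hi : i = i₀
      · exact ⟨s, rfl, hi ▸ hi₀, hB, hC⟩
      · refine ⟨Rect.flip s k, by simp [Rect.flip, Function.update_of_ne hB.ne], ?_, hB.flip, ?_⟩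
        · obtain ⟨i₁, hi₁⟩ := exists_mem_phase hU hB.flip.vertex_notMem
          have : i₁ ≠ i₀ := fun he => hB.vertex_flip_notMem_phase hU hi₀ (he ▸ hi₁)
          have : i = i₁ := by omega
          rwa [this]
        · rw [hcomm]; exact hC.flip
    refine ⟨⟨s', hs'i⟩, ?_⟩
    have hβ := hlarge hB'
    have hγ := hlarge hC'
    rw [K.rel_flip_of_ne s' hB'.ne.symm] at hγ
    have hb0 := hB'.rel_zero
    have hc0 := hC'.rel_zero
    rw [K.rel_flip_same] at hc0
    set β := K.rel s' k B
    set γ := K.rel s' k C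
    have hv := vertex_flip_mem_phase_of_opposite hU hB' hC' hF' hs'i
    -- Crossings on opposite sides: the height of the chord minus the height of the point.
    obtain ⟨ν, c, h1, h2⟩ := K.exists_aff_of_rel s' hB'.ne β (γ - β) (-1) (M := 1 / δ₀)
      (le_trans (abs_le.2 ⟨by linarith, by linarith⟩) hd1) (by simpa using hd1)
    refine ⟨ν, c, ?_, ?_, h2, fun t ht => ?_, fun x hx hxi => ?_⟩
    · rw [h1, hb0]; simp [β]
    · rw [h1, show K.rel s' j C = 1 by linarith]; ring
    · rw [h1]
      rcases frontier_phase_of_opposite hU hB' hC' hF' hs'i (K.vertex_mem_frontier t) ht with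
        ⟨e1, e2⟩ | ⟨e1, e2⟩ | e
      · have : K.rel s' k (K.vertex t) = 0 :=
          (rel_vertex_zero_or_one s' t k).resolve_right (by linarith)
        rw [e1, this]; linarith
      · have : K.rel s' k (K.vertex t) = 0 :=
          (rel_vertex_zero_or_one s' t k).resolve_right (by linarith)
        rw [e1, this]; linarith
      · rw [e]
        rcases rel_vertex_zero_or_one (K := K) s' t j with e' | e' <;> rw [e'] <;> linarith
    · rw [h1]
      have hsq := mem_closed_square s' (frontier_subset_closure hx) j
      rcases frontier_phase_of_opposite hU hB' hC' hF' hs'i hx hxi with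
        ⟨e1, e2⟩ | ⟨e1, e2⟩ | e
      · rw [e1]; linarith
      · rw [e1]; linarith
      · rw [e]; nlinarith

/-- If only one vertex of `K` belongs to a phase, then the two crossings lie on the sides that end
there. -/
theorem exists_corner_of_oneVertex (hU : IsOpen U) (hsub : U ⊆ Ω) (hK : K.carrier ⊆ Ω)
    (hc : CrossesTwice U K) {δ₀ : ℝ} (hl : ∀ i, IsLarge Ω U δ₀ i K) {i : Fin 2}
    (h1 : OneVertex Ω U i K) :
    ∃ (s : Fin 2 → Bool) (P : Fin 2 → Plane), K.vertex s ∈ phase U i ∧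
      frontier U ∩ frontier K.carrier = {P 0, P 1} ∧
      (∀ j k, j ≠ k → IsCrossing U K s j k (P k) ∧ δ₀ ≤ K.rel s k (P k)) ∧
      ∀ x ∈ frontier K.carrier, x ∈ phase U i →
        ∃ j k, j ≠ k ∧ K.rel s j x = 0 ∧ K.rel s k x < K.rel s k (P k) := by
  obtain ⟨B, C, hBC, hF, h⟩ := hc.exists_crossings
  have hF' : ∀ z ∈ frontier U, z ∈ frontier K.carrier → z = B ∨ z = C := fun z h1 h2 =>
    hF.le ⟨h1, h2⟩
  have hvert : ∀ s, K.vertex s ∈ phase U i → K.vertex s ∈ closure (subdomain Ω U i) := fun s hs =>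
    (mem_closure_subdomain_iff hU hsub (closure_mono hK (K.vertex_mem_closure s))
      (vertex_notMem_frontier hc s)).2 hs
  have hflip : ∀ (s : Fin 2 → Bool) {j k : Fin 2}, j ≠ k → Rect.flip s j ≠ Rect.flip s k := by
    intro s j k hjk he
    have := congrFun he j
    simp [Rect.flip, Function.update_of_ne hjk] at this
  have hflip' : ∀ (s : Fin 2 → Bool) (j : Fin 2), s ≠ Rect.flip s j := by
    intro s j he
    have := congrFun he j
    simp [Rect.flip] at this
  rcases h with ⟨s, j, k, hB, hC⟩ | ⟨s, j, k, hB, hC⟩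
  · obtain ⟨i₀, hi₀⟩ := exists_mem_phase hU hB.vertex_notMem
    have hoff : ∀ {j k P}, IsCrossing U K s j k P → i ≠ i₀ → K.vertex (Rect.flip s k) ∈ phase U i := by
      intro j k P hP hi
      obtain ⟨i₁, hi₁⟩ := exists_mem_phase hU hP.flip.vertex_notMem
      have : i₁ ≠ i₀ := fun he => hP.vertex_flip_notMem_phase hU hi₀ (he ▸ hi₁)
      have : i = i₁ := by omega
      rwa [this]
    have hi : i = i₀ := by
      by_contra hi
      exact hflip s hB.ne (h1.unique (hvert _ (hoff hC hi)) (hvert _ (hoff hB hi)))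
    subst hi
    have hjk := hB.ne
    refine ⟨s, fun l => if l = k then B else C, hi₀, ?_, fun j' k' hjk' => ?_, fun x hx hxi => ?_⟩
    · rw [hF]
      fin_cases j <;> fin_cases k <;> simp at hjk ⊢
      exact Set.pair_comm _ _
    · have hcase : (j' = j ∧ k' = k) ∨ (j' = k ∧ k' = j) := by omega
      rcases hcase with ⟨rfl, rfl⟩ | ⟨rfl, rfl⟩
      · simp only [if_true]
        exact ⟨hB, hB.le_rel hU hsub hK hi₀ (hl _)⟩
      · simp only [if_neg hjk]
        exact ⟨hC, hC.le_rel hU hsub hK hi₀ (hl _)⟩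
    · rcases frontier_phase_of_corner hU hB hC hF' hi₀ hx hxi with ⟨e1, e2⟩ | ⟨e1, e2⟩
      · exact ⟨j, k, hjk, e1, by simpa using e2⟩
      · exact ⟨k, j, hjk.symm, e1, by simpa [hjk] using e2⟩
  · exfalso
    obtain ⟨i₀, hi₀⟩ := exists_mem_phase hU hB.vertex_notMem
    by_cases hi : i = i₀
    · subst hi
      exact hflip' s j (h1.unique (hvert _ hi₀)
        (hvert _ (vertex_flip_mem_phase_of_opposite hU hB hC hF' hi₀)))
    · obtain ⟨i₁, hi₁⟩ := exists_mem_phase hU hB.flip.vertex_notMem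
      have : i₁ ≠ i₀ := fun he => hB.vertex_flip_notMem_phase hU hi₀ (he ▸ hi₁)
      obtain rfl : i = i₁ := by omega
      obtain ⟨i₂, hi₂⟩ := exists_mem_phase hU hC.flip.vertex_notMem
      have h3 := vertex_flip_mem_phase_of_opposite hU hB hC hF' hi₀
      have : i₂ ≠ i₀ := fun he => hC.vertex_flip_notMem_phase hU h3 (he ▸ hi₂)
      obtain rfl : i = i₂ := by omega
      have he := h1.unique (hvert _ hi₁) (hvert _ hi₂)
      have := congrFun he j
      simp [Rect.flip, Function.update_of_ne hB.ne] at this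

end Interface

end
end UnfittedLDG

namespace UnfittedLDG
noncomputable section
open scoped ENNReal NNReal Topology

/-! ### What the deviation controls -/

section Deviation

variable {Ω U : Set Plane} {K : Rect}

theorem distH_nonneg (S T : Set Plane) : 0 ≤ distH S T :=
  Real.sSup_nonneg (by rintro _ ⟨x, -, rfl⟩; exact Metric.infDist_nonneg)

theorem infDist_le_distH {S T : Set Plane} (hS : Bornology.IsBounded S) (hT : T.Nonempty)
    {x : Plane} (hx : x ∈ S) : Metric.infDist x T ≤ distH S T := by
  refine le_csSup ?_ ⟨x, hx, rfl⟩
  obtain ⟨y, hy⟩ := hT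
  obtain ⟨R, hR⟩ := hS.subset_ball y
  refine ⟨R, ?_⟩
  rintro _ ⟨z, hz, rfl⟩
  exact (Metric.infDist_le_dist_of_mem hy).trans (Metric.mem_ball.1 (hR hz)).le

theorem deviationSet_nonneg (i : Fin 2) {η : ℝ} (h : η ∈ deviationSet Ω U i K) : 0 ≤ η := by
  rcases h with ⟨-, B, C, -, -, rfl⟩ | ⟨-, B, -, Q, -, s, -, rfl⟩
  · refine div_nonneg (distH_nonneg _ _) (Real.sSup_nonneg ?_)
    rintro _ ⟨s, -, rfl⟩
    exact Metric.infDist_nonneg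
  · exact div_nonneg (distH_nonneg _ _) Metric.infDist_nonneg

theorem deviation_nonneg : 0 ≤ deviation Ω U K :=
  (Real.sSup_nonneg fun _ h => deviationSet_nonneg 0 h).trans (le_max_left _ _)

/-- There are two crossing points, at most one singular point and four vertices, hence finitely many
ratios. Finiteness is needed because the real supremum of an unbounded set is `0` by convention and
would bound nothing. -/
theorem deviationSet_finite {B C : Plane} (hF : frontier U ∩ frontier K.carrier = {B, C})
    (hs : (singularPoints U ∩ K.carrier).Subsingleton) (i : Fin 2) :
    (deviationSet Ω U i K).Finite := by
  refine Set.Finite.union ?_ ?_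
  · refine Set.Finite.subset (((Set.toFinite {B, C}).prod (Set.toFinite {B, C})).image
      fun p : Plane × Plane => distH (frontier U ∩ K.carrier) (segment ℝ p.1 p.2) /
        sSup {d | ∃ s, K.vertex s ∈ closure (subdomain Ω U i) ∧ d = lineDist (K.vertex s) p.1 p.2}) ?_
    rintro _ ⟨-, B', C', -, hF', rfl⟩
    refine ⟨(B', C'), ⟨?_, ?_⟩, rfl⟩
    · rw [← hF, hF']; exact Set.mem_insert _ _
    · rw [← hF, hF']; exact Set.mem_insert_of_mem _ rfl
  · refine Set.Finite.subset (((Set.toFinite {B, C}).prod (hs.finite.prod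
      (Set.finite_univ (α := Fin 2 → Bool)))).image
      fun p : Plane × Plane × (Fin 2 → Bool) =>
        distH (connectedComponentIn ((frontier U ∩ closure K.carrier) \ {p.2.1}) p.1)
          (segment ℝ p.2.1 p.1) / lineDist (K.vertex p.2.2) p.2.1 p.1) ?_
    rintro _ ⟨-, B', hB', Q, hQ, s, -, rfl⟩
    exact ⟨(B', Q, s), ⟨hF ▸ hB', hQ, Set.mem_univ _⟩, rfl⟩

theorem le_deviation {B C : Plane} (hF : frontier U ∩ frontier K.carrier = {B, C})
    (hs : (singularPoints U ∩ K.carrier).Subsingleton) {i : Fin 2} {η : ℝ}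
    (h : η ∈ deviationSet Ω U i K) : η ≤ deviation Ω U K := by
  have h1 : η ≤ sSup (deviationSet Ω U i K) := le_csSup (deviationSet_finite hF hs i).bddAbove h
  fin_cases i
  · exact h1.trans (le_max_left _ _)
  · exact h1.trans (le_max_right _ _)

theorem abs_aff_le_lineDist {ν : Plane} {c : ℝ} {B C : Plane} (hB : aff ν c B = 0)
    (hC : aff ν c C = 0) (A : Plane) : |aff ν c A| ≤ ‖ν‖ * lineDist A B C := by
  have h0 : ∀ y ∈ (affineSpan ℝ {B, C} : Set Plane), aff ν c y = 0 := by
    intro y hy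
    obtain ⟨t, rfl⟩ := mem_affineSpan_pair_iff_exists_lineMap_eq.1 hy
    rw [AffineMap.lineMap_apply_module', add_comm, aff_lineMap, hB, hC]; ring
  by_contra hlt
  push Not at hlt
  have hne : (affineSpan ℝ {B, C} : Set Plane).Nonempty := ⟨B, left_mem_affineSpan_pair ℝ B C⟩
  rcases (norm_nonneg ν).eq_or_lt with hν | hν
  · have := abs_aff_sub_le ν c A B
    rw [hB, sub_zero, ← hν, zero_mul] at this
    rw [← hν, zero_mul] at hlt
    linarith
  · have hlt' : Metric.infDist A (affineSpan ℝ {B, C} : Set Plane) < |aff ν c A| / ‖ν‖ := by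
      rw [lt_div_iff₀ hν, mul_comm]; exact hlt
    obtain ⟨y, hy, hd⟩ := (Metric.infDist_lt_iff hne).1 hlt'
    rw [lt_div_iff₀ hν] at hd
    have := abs_aff_sub_le ν c A y
    rw [h0 y hy, sub_zero] at this
    linarith

/-- The maximum over the finitely many vertices in the phase is attained. Distances to the chord are
proportional to the values of any nonconstant affine function that vanishes at `B` and `C`, so the
deviation compares the function on the interface with its value at this vertex. -/
theorem exists_farthest_vertex {B C : Plane} (hU : IsOpen U) (hsub : U ⊆ Ω) (hK : K.carrier ⊆ Ω)
    (hc : CrossesTwice U K) (hBC : B ≠ C) (hF : frontier U ∩ frontier K.carrier = {B, C})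
    (hsing : (singularPoints U ∩ K.carrier).Subsingleton) {i : Fin 2} (hreg : ¬ IsIrregular Ω U i K)
    (hv : ∃ s, K.vertex s ∈ phase U i) {ν : Plane} {c : ℝ} (hB : aff ν c B = 0)
    (hC : aff ν c C = 0) (hpos : ∀ s, K.vertex s ∈ phase U i → 0 < aff ν c (K.vertex s)) :
    ∃ s, K.vertex s ∈ phase U i ∧
      ∀ x ∈ frontier U ∩ K.carrier, |aff ν c x| ≤ deviation Ω U K * aff ν c (K.vertex s) := by
  have hiff : ∀ s, K.vertex s ∈ closure (subdomain Ω U i) ↔ K.vertex s ∈ phase U i := fun s =>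
    mem_closure_subdomain_iff hU hsub (closure_mono hK (K.vertex_mem_closure s))
      (vertex_notMem_frontier hc s)
  set D := {d | ∃ s, K.vertex s ∈ closure (subdomain Ω U i) ∧ d = lineDist (K.vertex s) B C} with hD
  have hfin : D.Finite := by
    refine (Set.finite_range fun s => lineDist (K.vertex s) B C).subset ?_
    rintro _ ⟨s, -, rfl⟩
    exact ⟨s, rfl⟩
  have hne : D.Nonempty := by
    obtain ⟨s, hs⟩ := hv
    exact ⟨_, s, (hiff s).2 hs, rfl⟩
  obtain ⟨s, hs, he⟩ := hne.csSup_mem hfin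
  rw [hiff] at hs
  refine ⟨s, hs, fun x hx => ?_⟩
  have hA := hpos s hs
  have hA1 := abs_aff_le_lineDist hB hC (K.vertex s)
  have hA2 := lineDist_mul_norm_le hB hC hBC (K.vertex s)
  rw [abs_of_pos hA] at hA1 hA2
  have hL : 0 < lineDist (K.vertex s) B C := by
    by_contra hle
    nlinarith [norm_nonneg ν, mul_nonneg (norm_nonneg ν) (sub_nonneg.2 (not_lt.1 hle))]
  have h1 : distH (frontier U ∩ K.carrier) (segment ℝ B C) / sSup D ≤ deviation Ω U K :=
    le_deviation hF hsing (i := i) (Or.inl ⟨hreg, B, C, hBC, hF, rfl⟩)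
  rw [he, div_le_iff₀ hL] at h1
  have h2 := infDist_le_distH (K.isBounded_carrier.subset Set.inter_subset_right)
    (T := segment ℝ B C) ⟨B, left_mem_segment ℝ B C⟩ hx
  calc |aff ν c x| ≤ ‖ν‖ * Metric.infDist x (segment ℝ B C) := abs_aff_le_infDist hB hC x
    _ ≤ ‖ν‖ * (deviation Ω U K * lineDist (K.vertex s) B C) := by gcongr; exact h2.trans h1
    _ = deviation Ω U K * (lineDist (K.vertex s) B C * ‖ν‖) := by ring
    _ ≤ _ := by have := deviation_nonneg (Ω := Ω) (U := U) (K := K); gcongr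

theorem infDist_le_of_component {B C P Q : Plane} (hF : frontier U ∩ frontier K.carrier = {B, C})
    (hsing : (singularPoints U ∩ K.carrier).Subsingleton) {i : Fin 2} (hirr : IsIrregular Ω U i K)
    (hP : P ∈ frontier U ∩ frontier K.carrier) (hQ : Q ∈ singularPoints U ∩ K.carrier)
    {s : Fin 2 → Bool} (hs : K.vertex s ∈ closure (subdomain Ω U i))
    (hpos : 0 < lineDist (K.vertex s) Q P) {x : Plane}
    (hx : x ∈ connectedComponentIn ((frontier U ∩ closure K.carrier) \ {Q}) P) :
    Metric.infDist x (segment ℝ Q P) ≤ deviation Ω U K * lineDist (K.vertex s) Q P := by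
  have h1 : distH (connectedComponentIn ((frontier U ∩ closure K.carrier) \ {Q}) P)
      (segment ℝ Q P) / lineDist (K.vertex s) Q P ≤ deviation Ω U K :=
    le_deviation hF hsing (i := i) (Or.inr ⟨hirr, P, hP, Q, hQ, s, hs, rfl⟩)
  rw [div_le_iff₀ hpos] at h1
  refine (infDist_le_distH (K.isBounded_carrier.closure.subset fun y hy => ?_)
    ⟨Q, left_mem_segment ℝ Q P⟩ hx).trans h1
  exact (connectedComponentIn_subset _ _ hy).1.2

end Deviation

/-! ### Sets covered by finitely many Lipschitz graphs -/

/-- `E` is covered by at most `m` measurable pieces of `C`-Lipschitz graphs. -/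
def CoveredByGraphs (m : ℕ) (C : ℝ≥0) (E : Set Plane) : Prop :=
  ∃ (ι : Type) (_ : Fintype ι) (x₀ : ι → Plane) (R : ι → Plane ≃ₗᵢ[ℝ] Plane) (ψ : ι → ℝ → ℝ)
    (G : ι → Set Plane), Fintype.card ι ≤ m ∧
      (∀ k, MeasurableSet (G k) ∧ OnGraph (x₀ k) (R k) C (ψ k) (G k)) ∧ E ⊆ ⋃ k, G k

theorem CoveredByGraphs.mono {m : ℕ} {C : ℝ≥0} {E E' : Set Plane} (h : CoveredByGraphs m C E)
    (hE : E' ⊆ E) : CoveredByGraphs m C E' := by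
  obtain ⟨ι, i, x₀, R, ψ, G, h1, h2, h3⟩ := h
  exact ⟨ι, i, x₀, R, ψ, G, h1, h2, hE.trans h3⟩

theorem CoveredByGraphs.union {m n : ℕ} {C C' : ℝ≥0} {E E' : Set Plane}
    (h : CoveredByGraphs m C E) (h' : CoveredByGraphs n C' E') :
    CoveredByGraphs (m + n) (max C C') (E ∪ E') := by
  obtain ⟨ι, i, x₀, R, ψ, G, h1, h2, h3⟩ := h
  obtain ⟨ι', i', x₀', R', ψ', G', h1', h2', h3'⟩ := h'
  refine ⟨ι ⊕ ι', inferInstance, Sum.elim x₀ x₀', Sum.elim R R', Sum.elim ψ ψ', Sum.elim G G',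
    ?_, ?_, ?_⟩
  · rw [Fintype.card_sum]; omega
  · rintro (k | k)
    · exact ⟨(h2 k).1, (h2 k).2.1.weaken (le_max_left _ _), (h2 k).2.2⟩
    · exact ⟨(h2' k).1, (h2' k).2.1.weaken (le_max_right _ _), (h2' k).2.2⟩
  · rintro x (hx | hx)
    · obtain ⟨k, hk⟩ := Set.mem_iUnion.1 (h3 hx)
      exact Set.mem_iUnion.2 ⟨Sum.inl k, hk⟩
    · obtain ⟨k, hk⟩ := Set.mem_iUnion.1 (h3' hx)
      exact Set.mem_iUnion.2 ⟨Sum.inr k, hk⟩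

theorem energy_iUnion_le {ι : Type} [Fintype ι] {μ : Measure Plane} {E : Set Plane}
    {G : ι → Set Plane} (hE : E ⊆ ⋃ k, G k) {q : Plane → ℝ} {M : ℝ≥0∞}
    (h : ∀ k, energy (μ.restrict (G k ∩ E)) q ≤ M) :
    energy (μ.restrict E) q ≤ Fintype.card ι * M := by
  have hE' : E ⊆ ⋃ k, G k ∩ E := fun x hx => by
    obtain ⟨k, hk⟩ := Set.mem_iUnion.1 (hE hx)
    exact Set.mem_iUnion.2 ⟨k, hk, hx⟩
  calc energy (μ.restrict E) q ≤ energy (μ.restrict (⋃ k, G k ∩ E)) q := energy_mono_set hE' q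
    _ ≤ ∑' k, energy (μ.restrict (G k ∩ E)) q := lintegral_iUnion_le _ _
    _ = ∑ k, energy (μ.restrict (G k ∩ E)) q := tsum_fintype _
    _ ≤ ∑ _k : ι, M := Finset.sum_le_sum fun k _ => h k
    _ = Fintype.card ι * M := by simp

theorem CoveredByGraphs.energy_le {m : ℕ} {C : ℝ≥0} {E : Set Plane} (h : CoveredByGraphs m C E)
    (hE : MeasurableSet E) {q : Plane → ℝ} {M : ℝ≥0∞}
    (hM : ∀ x₀ R ψ G, MeasurableSet G → G ⊆ E → OnGraph x₀ R C ψ G →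
      energy (μH[1].restrict G) q ≤ M) :
    energy (μH[1].restrict E) q ≤ m * M := by
  obtain ⟨ι, i, x₀, R, ψ, G, h1, h2, h3⟩ := h
  refine (energy_iUnion_le h3 fun k => hM (x₀ k) (R k) (ψ k) (G k ∩ E) ((h2 k).1.inter hE)
    Set.inter_subset_right ⟨(h2 k).2.1, Set.inter_subset_left.trans (h2 k).2.2⟩).trans ?_
  gcongr

theorem coveredByGraphs_line (j : Fin 2) (e : ℝ) : CoveredByGraphs 1 0 {x : Plane | x j = e} := by
  have hm : MeasurableSet {x : Plane | x j = e} :=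
    (isClosed_singleton.preimage (show Continuous fun x : Plane => x j by fun_prop)).measurableSet
  have hR : ∃ R : Plane ≃ₗᵢ[ℝ] Plane, ∀ x : Plane, R x 1 = x j := by
    fin_cases j
    · exact ⟨LinearIsometryEquiv.piLpCongrLeft 2 ℝ ℝ (Equiv.swap 0 1), fun x => by
        simp [LinearIsometryEquiv.piLpCongrLeft_apply, Equiv.piCongrLeft']⟩
    · exact ⟨LinearIsometryEquiv.refl ℝ _, fun x => rfl⟩
  obtain ⟨R, hR⟩ := hR
  refine ⟨Unit, inferInstance, fun _ => 0, fun _ => R, fun _ _ => e, fun _ => {x | x j = e}, by simp,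
    fun _ => ⟨hm, LipschitzWith.const e, fun x hx => ?_⟩, fun x hx => Set.mem_iUnion.2 ⟨(), hx⟩⟩
  refine ⟨R (x - 0) 0, ?_⟩
  have h1 : R (x - 0) 1 = e := by rw [hR, sub_zero]; exact hx
  have h2 := framePoint_coord 0 R x
  rw [h1] at h2
  exact h2

theorem Rect.coveredByGraphs_frontier (K : Rect) : CoveredByGraphs 4 0 (frontier K.carrier) := by
  have h1 : ∀ j, CoveredByGraphs 2 0 ({x : Plane | x j = K.lo j} ∪ {x : Plane | x j = K.hi j}) :=
    fun j => by simpa using (coveredByGraphs_line j (K.lo j)).union (coveredByGraphs_line j (K.hi j))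
  have h2 := (h1 0).union (h1 1)
  rw [max_self] at h2
  refine h2.mono fun x hx => ?_
  obtain ⟨-, j, hj⟩ := (K.mem_frontier_iff_rel fun _ => false).1 hx
  have h3 : x j = K.lo j ∨ x j = K.hi j := by
    rcases hj with hj | hj
    · left; simpa [Rect.endpt] using K.apply_eq_of_rel_eq_zero hj
    · right; simpa [Rect.endpt] using K.apply_eq_of_rel_eq_one hj
  fin_cases j
  · exact Or.inl h3
  · exact Or.inr h3

theorem IsChartCover.coveredByGraphs {U : Set Plane} {t : Finset Plane}
    {R : Plane → Plane ≃ₗᵢ[ℝ] Plane} {C : ℝ≥0} {ψ : Plane → ℝ → ℝ} {B : Plane → Set Plane} {ρ : ℝ}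
    (h : IsChartCover U t R C ψ B ρ) : CoveredByGraphs t.card C (frontier U) := by
  refine ⟨t, inferInstance, fun x => x, fun x => R x, fun x => ψ x, fun x => frontier U ∩ B x,
    by simp, fun x => ⟨isClosed_frontier.measurableSet.inter (h.isOpen x).measurableSet,
      h.onGraph x x.2⟩, fun y hy => ?_⟩
  have := h.cover hy
  simp only [Set.mem_iUnion, exists_prop] at this
  obtain ⟨x, hx, hyx⟩ := this
  exact Set.mem_iUnion.2 ⟨⟨x, hx⟩, hy, hyx⟩

/-! ### Expansion from a corner of a rectangle -/

theorem Rect.isOpen_box (K : Rect) (s : Fin 2 → Bool) (τ : Fin 2 → ℝ) :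
    IsOpen {x | ∀ j, K.rel s j x ∈ Set.Ioo 0 (τ j)} := by
  have : {x | ∀ j, K.rel s j x ∈ Set.Ioo 0 (τ j)} = ⋂ j, K.rel s j ⁻¹' Set.Ioo 0 (τ j) := by
    ext x; simp
  rw [this]
  exact isOpen_iInter_of_finite fun j => isOpen_Ioo.preimage (K.continuous_rel s j)

theorem Rect.convex_box (K : Rect) (s : Fin 2 → Bool) (I : Fin 2 → Set ℝ)
    (hI : ∀ j, Convex ℝ (I j)) : Convex ℝ {x | ∀ j, K.rel s j x ∈ I j} := by
  intro x hx y hy a b ha hb hab j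
  have h1 : a • x + b • y = x + b • (y - x) := by
    rw [show a = 1 - b by linarith]; module
  rw [h1, K.rel_lineMap]
  have := hI j (hx j) (hy j) ha hb hab
  convert this using 1
  simp only [smul_eq_mul]
  rw [show a = 1 - b by linarith]; ring

theorem Rect.mem_closure_box (K : Rect) (s : Fin 2 → Bool) {τ : Fin 2 → ℝ} (hτ : ∀ j, 0 < τ j)
    {x : Plane} (hx : ∀ j, K.rel s j x ∈ Set.Icc 0 (τ j)) :
    x ∈ closure {x | ∀ j, K.rel s j x ∈ Set.Ioo 0 (τ j)} := by
  set g := K.ofRel s fun j => τ j / 2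
  have h1 : Filter.Tendsto (fun t : ℝ => x + t • (g - x)) (𝓝[>] 0) (𝓝 x) := by
    have : Continuous fun t : ℝ => x + t • (g - x) := by fun_prop
    have h2 := this.tendsto 0
    simp only [zero_smul, add_zero] at h2
    exact h2.mono_left nhdsWithin_le_nhds
  refine mem_closure_of_tendsto h1 ?_
  filter_upwards [Ioo_mem_nhdsGT (zero_lt_one (α := ℝ))] with t ht j
  rw [K.rel_lineMap, K.rel_ofRel]
  have := hx j
  have := hτ j
  constructor <;> nlinarith [(hx j).1, (hx j).2, ht.1, ht.2, mul_pos ht.1 (hτ j)]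

/-- The constant in `CoveredByGraphs.energy_le_of_corner`. -/
def cornerConst (m : ℕ) (C : ℝ≥0) (L σ m₀ : ℝ) : ℝ := m * (expansionConst C L * (16 * σ) / m₀)

theorem expansionConst_nonneg (C : ℝ≥0) (L : ℝ) : 0 ≤ expansionConst C L := by
  unfold expansionConst; positivity

theorem cornerConst_nonneg (m : ℕ) (C : ℝ≥0) (L : ℝ) {σ m₀ : ℝ} (hσ : 1 ≤ σ) (hm : 0 < m₀) :
    0 ≤ cornerConst m C L σ m₀ := by
  have := expansionConst_nonneg C L
  unfold cornerConst; positivity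

/-- The expansion lemma is applied to each graph with the corner as centre of dilation and `N = 2
p`. The box at the corner contains a ball of radius proportional to `h_K`, by the bound on the
aspect ratio, which gives the factor `p² / h_K` and the exponent `4 p`. -/
theorem CoveredByGraphs.energy_le_of_corner {m : ℕ} {C : ℝ≥0} {E : Set Plane}
    (h : CoveredByGraphs m C E) (hE : MeasurableSet E) {K : Rect} {σ : ℝ} (hσ : 1 ≤ σ)
    (hasp : ∀ j k, K.len j ≤ σ * K.len k) {s : Fin 2 → Bool} {τ : Fin 2 → ℝ} {m₀ : ℝ}
    (hm₀ : 0 < m₀) (hτ : ∀ j, m₀ ≤ τ j) {S : Set Plane} (hS : IsOpen S) (hconv : Convex ℝ S)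
    (hbox : {x | ∀ j, K.rel s j x ∈ Set.Ioo 0 (τ j)} ⊆ S) {lam L : ℝ} (hlam : 1 ≤ lam)
    (hL : lam ≤ L) (hsub : ∀ x ∈ E, K.vertex s + lam⁻¹ • (x - K.vertex s) ∈ closure S)
    {p : ℕ} (hp : 1 ≤ p) {q : MvPolynomial (Fin 2) ℝ} (hq : ∀ j, q.degreeOf j ≤ p) :
    energy (μH[1].restrict E) (evalAt q) ≤
      ENNReal.ofReal (cornerConst m C L σ m₀ * (p : ℝ) ^ 2 / K.diam *
        bigT (2 * lam - 1) ^ (4 * p)) * energy (volume.restrict S) (evalAt q) := by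
  have hA : K.vertex s ∈ closure S := closure_mono hbox (K.mem_closure_box s
    (fun j => hm₀.trans_le (hτ j)) fun j => by
      rw [K.rel_vertex_self]; exact ⟨le_rfl, hm₀.le.trans (hτ j)⟩)
  have hball := (K.ball_subset_of_rel hσ hasp s hm₀ hτ).trans hbox
  have hd := K.diam_pos
  have hr : 0 < m₀ * K.diam / (4 * σ) := by positivity
  have hpoly : PolyAlong Finset.univ (2 * p) (evalAt q) := by
    simpa using polyAlong_evalAt hq Finset.univ
  have hEn := expansionConst_nonneg C L
  have hT : (0 : ℝ) ≤ bigT (2 * lam - 1) ^ (4 * p) :=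
    pow_nonneg (zero_le_one.trans (one_le_bigT (by linarith))) _
  refine (h.energy_le hE fun x₀ R ψ G hG hGE hgr => hgr.energy_le_of_expansion hG
    (by omega : 1 ≤ 2 * p) (evalAt_contDiff q) hpoly hS hconv hA hr hball hlam hL
    fun x hx => hsub x (hGE hx)).trans ?_
  rw [← mul_assoc, show (m : ℝ≥0∞) = ENNReal.ofReal m by simp,
    ← ENNReal.ofReal_mul (by positivity)]
  refine mul_le_mul_left (ENNReal.ofReal_le_ofReal (le_of_eq ?_)) _
  rw [show 2 * (2 * p) = 4 * p by ring]
  unfold cornerConst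
  push_cast
  field_simp
  ring

/-! ### Scaling along one axis in a rectangle -/

theorem Rect.rel_scaleAbout (K : Rect) (s : Fin 2 → Bool) {j k : Fin 2} (hjk : j ≠ k) (τ : ℝ)
    (x : Plane) : K.rel s k (scaleAbout {k} (K.vertex s) τ x) = τ * K.rel s k x ∧
      K.rel s j (scaleAbout {k} (K.vertex s) τ x) = K.rel s j x := by
  simp only [rel, scaleAbout_apply, vertex, Finset.mem_singleton, if_true, if_neg hjk, and_true]
  ring

/-- Along one axis the degree is only `p`, so the exponent is `2 (p + 1)` and not `2 (2p + 1)` as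
for a dilation of both axes. -/
theorem Rect.energy_stretch_le (K : Rect) (s : Fin 2 → Bool) {j k : Fin 2} (hjk : j ≠ k)
    {u w y : ℝ} (hu : 0 < u) (huw : u ≤ w) {p : ℕ} {q : MvPolynomial (Fin 2) ℝ}
    (hq : ∀ j, q.degreeOf j ≤ p) :
    energy (volume.restrict {x | K.rel s k x ∈ Set.Ioo 0 w ∧ K.rel s j x ∈ Set.Ioo 0 y}) (evalAt q) ≤
      ENNReal.ofReal (bigT (2 * (w / u) - 1) ^ (2 * (p + 1))) *
        energy (volume.restrict {x | K.rel s k x ∈ Set.Ioo 0 u ∧ K.rel s j x ∈ Set.Ioo 0 y})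
          (evalAt q) := by
  have hm : ∀ w, MeasurableSet {x | K.rel s k x ∈ Set.Ioo 0 w ∧ K.rel s j x ∈ Set.Ioo 0 y} :=
    fun w => ((K.continuous_rel s k).measurable measurableSet_Ioo).inter
      ((K.continuous_rel s j).measurable measurableSet_Ioo)
  have hw : 0 < w := by linarith
  refine energy_scaleAbout_le (J := {k}) (evalAt_continuous q).measurable
    (by simpa using polyAlong_evalAt hq {k}) (K.vertex s) (hm u) (hm w) (fun t h0 h1 x hx => ?_)
    ((one_le_div hu).2 huw) (fun x hx => ?_)
  · have h2 := K.rel_scaleAbout s hjk t x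
    refine ⟨?_, h2.2 ▸ hx.2⟩
    rw [h2.1]
    have h3 : 0 < K.rel s k x := hx.1.1
    have h4 : K.rel s k x < u := hx.1.2
    exact ⟨by positivity, by nlinarith⟩
  · have h2 := K.rel_scaleAbout s hjk (w / u) x
    refine ⟨?_, h2.2 ▸ hx.2⟩
    have h3 : 0 < w / u * K.rel s k x := h2.1 ▸ hx.1.1
    have h4 : w / u * K.rel s k x < w := h2.1 ▸ hx.1.2
    constructor
    · exact (mul_pos_iff_of_pos_left (by positivity)).1 h3
    · rw [div_mul_eq_mul_div, div_lt_iff₀ hu] at h4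
      exact lt_of_mul_lt_mul_left h4 hw.le

end
end UnfittedLDG

namespace UnfittedLDG
noncomputable section
open scoped ENNReal NNReal Topology

/-! ### Room between the two growth rates -/

theorem continuous_bigT : Continuous bigT := by unfold bigT; fun_prop

/-- For `θ = 0` the first factor is `T0 = bigT ((1 + 3η)/(1 - η))`, the second is `Tl = bigT ((1 +
η)/(1 - η))` and the third is `1`. As `Tl + 2 η₀ ≤ T0` and `Tl ≤ 4 / (1 - ηm)`, the product `T0 Tl`
is smaller than `T0²` by a factor bounded away from `1` uniformly for `η ≥ η₀`. A small `θ` perturbs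
each argument by at most `s`, and thus costs at most `bigT (1 + s) ^ 4`, which fits into the gap. -/
theorem exists_slack {η₀ ηm : ℝ} (hη₀ : 0 < η₀) (hηm : ηm < 1) :
    ∃ θ > 0, θ ≤ (1 - ηm) / 2 ∧ θ ≤ 1 / 2 ∧ ∀ η ∈ Set.Icc η₀ ηm,
      bigT (2 * ((1 + η) / (1 - η - θ)) - 1) * bigT (2 * (1 / (1 - η - θ)) - 1) *
        bigT (2 * (1 + θ) - 1) ^ 2 ≤ bigT ((1 + 3 * η) / (1 - η)) ^ 2 := by
  set D := 1 - ηm with hD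
  have hD0 : 0 < D := by linarith
  obtain ⟨s, hs, hsT⟩ : ∃ s > 0, bigT (1 + s) ^ 4 ≤ 1 + η₀ * D / 2 := by
    have h1 : ContinuousAt (fun s => bigT (1 + s) ^ 4) 0 :=
      ((continuous_bigT.comp (continuous_const.add continuous_id)).pow 4).continuousAt
    have h2 : bigT (1 + 0) ^ 4 < 1 + η₀ * D / 2 := by
      have : bigT (1 + 0) = 1 := by simp [bigT]
      rw [this]
      have : 0 < η₀ * D / 2 := by positivity
      linarith
    have h3 := (h1.eventually_lt continuousAt_const h2).filter_mono
      (nhdsWithin_le_nhds (s := Set.Ioi 0))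
    obtain ⟨s, hs, hs'⟩ := (h3.and self_mem_nhdsWithin).exists
    exact ⟨s, hs', hs.le⟩
  set θ := min (min (D / 2) (s * D ^ 2 / 8)) (min (1 / 2) (s / 2)) with hθ
  have hθ0 : 0 < θ := lt_min (lt_min (by linarith) (by positivity)) (lt_min (by norm_num) (by linarith))
  have hθ1 : θ ≤ D / 2 := (min_le_left _ _).trans (min_le_left _ _)
  have hθ2 : θ ≤ s * D ^ 2 / 8 := (min_le_left _ _).trans (min_le_right _ _)
  have hθ3 : θ ≤ 1 / 2 := (min_le_right _ _).trans (min_le_left _ _)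
  have hθ4 : θ ≤ s / 2 := (min_le_right _ _).trans (min_le_right _ _)
  refine ⟨θ, hθ0, hθ1, hθ3, fun η hη => ?_⟩
  have hη0 : 0 < η := hη₀.trans_le hη.1
  have e1 : D ≤ 1 - η := by linarith [hη.2]
  have e2 : D / 2 ≤ 1 - η - θ := by linarith
  have p1 : 0 < 1 - η := by linarith
  have p2 : 0 < 1 - η - θ := by linarith
  have hprod : 4 * θ ≤ s * ((1 - η) * (1 - η - θ)) := by
    have : D * (D / 2) ≤ (1 - η) * (1 - η - θ) := by gcongr
    nlinarith
  have f1 : 2 * ((1 + η) / (1 - η - θ)) - 1 ≤ (1 + 3 * η) / (1 - η) + s := by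
    have : 2 * ((1 + η) / (1 - η - θ)) - 1 - (1 + 3 * η) / (1 - η) =
        2 * (1 + η) * θ / ((1 - η) * (1 - η - θ)) := by field_simp; ring
    have h2 : 2 * (1 + η) * θ / ((1 - η) * (1 - η - θ)) ≤ s := by
      rw [div_le_iff₀ (by positivity)]; nlinarith
    linarith
  have f2 : 2 * (1 / (1 - η - θ)) - 1 ≤ (1 + η) / (1 - η) + s := by
    have : 2 * (1 / (1 - η - θ)) - 1 - (1 + η) / (1 - η) =
        2 * θ / ((1 - η) * (1 - η - θ)) := by field_simp; ring
    have h2 : 2 * θ / ((1 - η) * (1 - η - θ)) ≤ s := by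
      rw [div_le_iff₀ (by positivity)]; nlinarith
    linarith
  have f3 : 2 * (1 + θ) - 1 ≤ 1 + s := by linarith
  have g1 : 1 ≤ 2 * ((1 + η) / (1 - η - θ)) - 1 := by
    have : 1 ≤ (1 + η) / (1 - η - θ) := by rw [le_div_iff₀ p2]; linarith
    linarith
  have g2 : 1 ≤ 2 * (1 / (1 - η - θ)) - 1 := by
    have : 1 ≤ 1 / (1 - η - θ) := by rw [le_div_iff₀ p2]; linarith
    linarith
  have g3 : (1 : ℝ) ≤ (1 + η) / (1 - η) := by rw [le_div_iff₀ p1]; linarith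
  have g4 : (1 : ℝ) ≤ (1 + 3 * η) / (1 - η) := by rw [le_div_iff₀ p1]; linarith
  set T0 := bigT ((1 + 3 * η) / (1 - η))
  set Tl := bigT ((1 + η) / (1 - η)) with hTl
  set Ts := bigT (1 + s)
  have k1 : bigT (2 * ((1 + η) / (1 - η - θ)) - 1) ≤ T0 * Ts :=
    (bigT_mono g1 f1).trans (bigT_add_le g4 hs.le)
  have k2 : bigT (2 * (1 / (1 - η - θ)) - 1) ≤ Tl * Ts :=
    (bigT_mono g2 f2).trans (bigT_add_le g3 hs.le)
  have k3 : bigT (2 * (1 + θ) - 1) ≤ Ts := bigT_mono (by linarith) f3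
  have m0 : 1 ≤ T0 := one_le_bigT g4
  have ml : 1 ≤ Tl := one_le_bigT g3
  have ms : 1 ≤ Ts := one_le_bigT (by linarith)
  have n1 := one_le_bigT g1
  have n2 := one_le_bigT g2
  have n3 := one_le_bigT (show (1 : ℝ) ≤ 2 * (1 + θ) - 1 by linarith)
  have hgap : Tl * Ts ^ 4 ≤ T0 := by
    have h1 : Tl ≤ 4 / D := by
      refine (bigT_le_two_mul g3).trans ?_
      rw [show 2 * ((1 + η) / (1 - η)) = (2 * (1 + η)) / (1 - η) by ring]
      have : η < 1 := by linarith
      gcongr; linarith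
    have h2 : Tl + 2 * η₀ ≤ T0 := by
      have h3 : (1 + 3 * η) / (1 - η) = (1 + η) / (1 - η) + 2 * η / (1 - η) := by
        rw [← add_div]; congr 1; ring
      have h4 : 2 * η₀ ≤ 2 * η / (1 - η) := by
        rw [le_div_iff₀ p1]; nlinarith [hη.1]
      show (1 + η) / (1 - η) + Real.sqrt (((1 + η) / (1 - η)) ^ 2 - 1) + 2 * η₀ ≤
        (1 + 3 * η) / (1 - η) + Real.sqrt (((1 + 3 * η) / (1 - η)) ^ 2 - 1)
      have h5 : Real.sqrt (((1 + η) / (1 - η)) ^ 2 - 1) ≤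
          Real.sqrt (((1 + 3 * η) / (1 - η)) ^ 2 - 1) := by
        apply Real.sqrt_le_sqrt
        have : (1 + η) / (1 - η) ≤ (1 + 3 * η) / (1 - η) := by gcongr; linarith
        nlinarith
      linarith
    calc Tl * Ts ^ 4 ≤ Tl * (1 + η₀ * D / 2) := by gcongr
      _ = Tl + Tl * (η₀ * D / 2) := by ring
      _ ≤ Tl + 4 / D * (η₀ * D / 2) := by gcongr
      _ = Tl + 2 * η₀ := by field_simp; ring
      _ ≤ T0 := h2
  calc _ ≤ T0 * Ts * (Tl * Ts) * Ts ^ 2 := by gcongr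
    _ = T0 * (Tl * Ts ^ 4) := by ring
    _ ≤ T0 * T0 := by gcongr
    _ = T0 ^ 2 := by ring

/-! ### Trace inequalities on one element -/

/-- The hypotheses on an interface element, with an upper bound `ηm` for its deviation. -/
structure IsGoodElement (Ω U : Set Plane) (δ₀ σ ηm : ℝ) (K : Rect) : Prop where
  isOpen : IsOpen U
  subset : U ⊆ Ω
  carrier_subset : K.carrier ⊆ Ω
  crosses : CrossesTwice U K
  large : ∀ i, IsLarge Ω U δ₀ i K
  one_singular : (singularPoints U ∩ K.carrier).Subsingleton
  aspect : ∀ j k, K.len j ≤ σ * K.len k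
  deviation_le : deviation Ω U K ≤ ηm

/-- The constants allowed in the trace inequalities. -/
structure IsGoodParam (δ₀ σ ηm : ℝ) : Prop where
  δ_pos : 0 < δ₀
  δ_lt : δ₀ < 1 / 2
  one_le_σ : 1 ≤ σ
  η_lt : ηm < 1

theorem mem_closure_of_lineMap {S : Set Plane} {y g : Plane}
    (h : ∀ t ∈ Set.Ioo (0 : ℝ) 1, y + t • (g - y) ∈ S) : y ∈ closure S := by
  have h1 : Filter.Tendsto (fun t : ℝ => y + t • (g - y)) (𝓝[>] 0) (𝓝 y) := by
    have : Continuous fun t : ℝ => y + t • (g - y) := by fun_prop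
    have h2 := this.tendsto 0
    simp only [zero_smul, add_zero] at h2
    exact h2.mono_left nhdsWithin_le_nhds
  refine mem_closure_of_tendsto h1 ?_
  filter_upwards [Ioo_mem_nhdsGT (zero_lt_one (α := ℝ))] with t ht using h t ht

theorem Rect.lineMap_mem_carrier (K : Rect) {y g : Plane} (hy : y ∈ closure K.carrier)
    (hg : g ∈ K.carrier) {t : ℝ} (ht : t ∈ Set.Ioo (0 : ℝ) 1) : y + t • (g - y) ∈ K.carrier := by
  rw [K.mem_carrier_iff_rel fun _ => false] at hg ⊢
  rw [K.mem_closure_iff_rel fun _ => false] at hy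
  intro j
  rw [K.rel_lineMap]
  have h1 := hy j
  have h2 := hg j
  constructor <;> nlinarith [h1.1, h1.2, h2.1, h2.2, ht.1, ht.2, mul_pos ht.1 h2.1,
    mul_nonneg (sub_nonneg.2 ht.2.le) h1.1, mul_pos ht.1 (sub_pos.2 h2.2),
    mul_nonneg (sub_nonneg.2 ht.2.le) (sub_nonneg.2 h1.2)]

theorem Rect.vertex_lineMap_mem_closure (K : Rect) (s : Fin 2 → Bool) {x : Plane}
    (hx : x ∈ closure K.carrier) {t : ℝ} (ht : t ∈ Set.Icc (0 : ℝ) 1) :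
    K.vertex s + t • (x - K.vertex s) ∈ closure K.carrier :=
  K.convex_carrier.closure.add_smul_sub_mem (K.vertex_mem_closure s) hx ht

/-- The expansion factor `(1 + η) / (1 - η)`. -/
theorem expansion_factor {η ηm : ℝ} (h0 : 0 ≤ η) (h1 : η ≤ ηm) (hm : ηm < 1) :
    1 ≤ (1 + η) / (1 - η) ∧ (1 + η) / (1 - η) ≤ (1 + ηm) / (1 - ηm) ∧
      ((1 + η) / (1 - η))⁻¹ * (1 + η) = 1 - η ∧
      2 * ((1 + η) / (1 - η)) - 1 = (1 + 3 * η) / (1 - η) := by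
  have p : 0 < 1 - η := by linarith
  have p' : 0 < 1 - ηm := by linarith
  refine ⟨by rw [le_div_iff₀ p]; linarith, ?_, by field_simp, by field_simp; ring⟩
  rw [div_le_div_iff₀ p p']; nlinarith

/-- Let `g` be the chord function of the phase and `A` the farthest vertex. The interface lies in
the band `|g| ≤ η g(A)`, so the convex set `S = K ∩ {g > η g(A)}` is free of it and lies in the
phase of `A`. On the trace `g ≥ -η g(A)`, and the contraction about `A` by `(1 - η)/(1 + η)` maps
the value `-η g(A)` to `η g(A)`; hence the reciprocal dilation of the closure of `S` covers the
trace. -/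
theorem energy_trace_of_regular {m : ℕ} {C : ℝ≥0} {δ₀ σ ηm : ℝ} (hp : IsGoodParam δ₀ σ ηm)
    {Ω U : Set Plane} {K : Rect} (hK : IsGoodElement Ω U δ₀ σ ηm K) {i : Fin 2}
    (hreg : ¬ IsIrregular Ω U i K) {E : Set Plane} (hE : MeasurableSet E)
    (hcov : CoveredByGraphs m C E)
    (hsub : E ⊆ (frontier K.carrier ∩ phase U i) ∪ (frontier U ∩ K.carrier)) {p : ℕ} (hp1 : 1 ≤ p)
    {q : MvPolynomial (Fin 2) ℝ} (hq : ∀ j, q.degreeOf j ≤ p) :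
    energy (μH[1].restrict E) (evalAt q) ≤
      ENNReal.ofReal (cornerConst m C ((1 + ηm) / (1 - ηm)) σ ((1 - ηm) * δ₀ ^ 2 / 2) *
        (p : ℝ) ^ 2 / K.diam *
        bigT ((1 + 3 * deviation Ω U K) / (1 - deviation Ω U K)) ^ (4 * p)) *
      energy (volume.restrict (K.carrier ∩ subdomain Ω U i)) (evalAt q) := by
  obtain ⟨B, C', hBC, hF, H⟩ := exists_chord_function hK.isOpen hK.subset hK.carrier_subset
    hK.crosses hp.δ_pos hp.δ_lt hK.large
  obtain ⟨hv, ν, c, hB, hC, hLip, hpos, hbd⟩ := H i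
  have hδ := hp.δ_pos
  obtain ⟨s, hs, hdev⟩ := exists_farthest_vertex hK.isOpen hK.subset hK.carrier_subset hK.crosses
    hBC hF hK.one_singular hreg hv hB hC fun s hs => hδ.trans_le (hpos s hs)
  have hη0 : 0 ≤ deviation Ω U K := deviation_nonneg
  have hηm := hK.deviation_le
  set η := deviation Ω U K
  have hA := hpos s hs
  set gA := aff ν c (K.vertex s) with hgA
  have hm1 := hp.η_lt
  obtain ⟨l1, l2, l3, l4⟩ := expansion_factor hη0 hηm hm1
  set lam := (1 + η) / (1 - η)
  have hm0 : 0 < (1 - ηm) * δ₀ ^ 2 / 2 := by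
    have : 0 < 1 - ηm := by linarith
    positivity
  have hm1' : (1 - ηm) * δ₀ ^ 2 / 2 ≤ 1 := by nlinarith [hp.δ_lt]
  set S := {x | x ∈ K.carrier ∧ η * gA < aff ν c x} with hS
  have hSo : IsOpen S := K.isOpen_carrier.inter (isOpen_lt continuous_const (continuous_aff ν c))
  have hSc : Convex ℝ S := K.convex_carrier.inter (convex_aff_gt ν c _)
  -- Each normalized coordinate changes the chord function at the rate `1 / δ₀` at most. Over this
  -- box it drops by less than `(1 - ηm) δ₀ ≤ (1 - η) g(A)`, so it stays above `η g(A)`.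
  have hbox : {x | ∀ j, K.rel s j x ∈ Set.Ioo 0 ((1 - ηm) * δ₀ ^ 2 / 2)} ⊆ S := by
    intro x hx
    refine ⟨(K.mem_carrier_iff_rel s).2 fun j => ⟨(hx j).1, (hx j).2.trans_le hm1'⟩, ?_⟩
    have h1 := hLip (K.vertex s) x
    have h2 : ∀ l, |K.vertex s l - x l| / K.len l < (1 - ηm) * δ₀ ^ 2 / 2 := fun l => by
      rw [← K.abs_rel_sub s, K.rel_vertex_self, zero_sub, abs_neg, abs_of_pos (hx l).1]
      exact (hx l).2
    rw [Fin.sum_univ_two] at h1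
    have h3 : 1 / δ₀ * (|K.vertex s 0 - x 0| / K.len 0 + |K.vertex s 1 - x 1| / K.len 1) <
        (1 - ηm) * δ₀ := by
      rw [one_div, inv_mul_lt_iff₀ hδ]
      nlinarith [h2 0, h2 1]
    have h4 := (le_abs_self _).trans h1
    have h5 : (1 - ηm) * δ₀ ≤ (1 - η) * gA := by
      apply mul_le_mul <;> linarith
    nlinarith
  have hg0 : ∃ g ∈ S, True := by
    refine ⟨K.ofRel s fun _ => (1 - ηm) * δ₀ ^ 2 / 2 / 2, hbox fun j => ?_, trivial⟩
    rw [K.rel_ofRel]; constructor <;> linarith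
  obtain ⟨g, hg, -⟩ := hg0
  have hScl : ∀ y ∈ closure K.carrier, η * gA ≤ aff ν c y → y ∈ closure S := by
    intro y hy hay
    refine mem_closure_of_lineMap (g := g) fun t ht => ⟨K.lineMap_mem_carrier hy hg.1 ht, ?_⟩
    rw [aff_lineMap]
    have := hg.2
    nlinarith [ht.1, ht.2]
  have hSd : Disjoint S (frontier U) := by
    rw [Set.disjoint_left]
    intro x hx hxf
    have h1 := hdev x ⟨hxf, hx.1⟩
    have h2 := hx.2
    linarith [le_abs_self (aff ν c x)]
  have hSK : S ⊆ K.carrier ∩ subdomain Ω U i := by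
    have h1 := subset_phase_of_mem_closure hK.isOpen hSc.isPreconnected hSd
      (hScl (K.vertex s) (K.vertex_mem_closure s) (by nlinarith)) hs
    intro x hx
    rw [subdomain_eq hK.subset]
    exact ⟨hx.1, hK.carrier_subset hx.1, h1 hx⟩
  refine (hcov.energy_le_of_corner hE hp.one_le_σ hK.aspect (s := s)
    (τ := fun _ => (1 - ηm) * δ₀ ^ 2 / 2) hm0 (fun _ => le_rfl) hSo hSc hbox l1 l2 ?_ hp1 hq).trans ?_
  · intro x hx
    have hli : lam⁻¹ ∈ Set.Icc (0 : ℝ) 1 :=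
      ⟨inv_nonneg.2 (by linarith), inv_le_one_of_one_le₀ l1⟩
    have hxc : x ∈ closure K.carrier := by
      rcases hsub hx with h | h
      · exact frontier_subset_closure h.1
      · exact subset_closure h.2
    refine hScl _ (K.vertex_lineMap_mem_closure s hxc hli) ?_
    rw [aff_lineMap, ← hgA]
    have hgx : -(η * gA) ≤ aff ν c x := by
      rcases hsub hx with h | h
      · have := hbd x h.1 h.2
        nlinarith
      · exact (abs_le.1 (hdev x h)).1
    have h1 : lam⁻¹ * (-(η * gA) - gA) ≤ lam⁻¹ * (aff ν c x - gA) := by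
      apply mul_le_mul_of_nonneg_left _ hli.1; linarith
    have h2 : lam⁻¹ * (-(η * gA) - gA) = -((1 - η) * gA) := by rw [← l3]; ring
    linarith
  · rw [l4]
    exact mul_le_mul_right (energy_mono_set hSK _) _

/-- Without interface the whole element lies in the phase of any limit point in the trace; no
dilation is needed, and `bigT 1 = 1`. -/
theorem energy_trace_of_empty {m : ℕ} {C : ℝ≥0} {σ : ℝ} (hσ : 1 ≤ σ)
    {Ω U : Set Plane} {K : Rect} (hU : IsOpen U) (hUΩ : U ⊆ Ω) (hKΩ : K.carrier ⊆ Ω)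
    (hasp : ∀ j k, K.len j ≤ σ * K.len k) {i : Fin 2} (hK : Disjoint K.carrier (frontier U))
    {E : Set Plane} (hE : MeasurableSet E) (hcov : CoveredByGraphs m C E)
    (hsub : E ⊆ frontier K.carrier ∩ phase U i) {p : ℕ} (hp1 : 1 ≤ p)
    {q : MvPolynomial (Fin 2) ℝ} (hq : ∀ j, q.degreeOf j ≤ p) :
    energy (μH[1].restrict E) (evalAt q) ≤
      ENNReal.ofReal (cornerConst m C 1 σ 1 * (p : ℝ) ^ 2 / K.diam) *
      energy (volume.restrict (K.carrier ∩ subdomain Ω U i)) (evalAt q) := by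
  rcases E.eq_empty_or_nonempty with rfl | ⟨x, hx⟩
  · simp [energy]
  have hphase : K.carrier ⊆ phase U i := subset_phase_of_mem_closure hU K.isPreconnected_carrier hK
    (frontier_subset_closure (hsub hx).1) (hsub hx).2
  have h := hcov.energy_le_of_corner hE hσ hasp (s := fun _ => false) (τ := fun _ => 1) one_pos
    (fun _ => le_rfl) K.isOpen_carrier K.convex_carrier
    (fun x hx => (K.mem_carrier_iff_rel _).2 hx) le_rfl le_rfl (fun x hx => by
      simpa using frontier_subset_closure (hsub hx).1) hp1 hq
  have h1 : bigT (2 * 1 - 1) = 1 := by norm_num [bigT]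
  rw [h1, one_pow, mul_one] at h
  refine h.trans (mul_le_mul_right (energy_mono_set (fun x hx => ?_) _) _)
  rw [subdomain_eq hUΩ]
  exact ⟨hx, hKΩ hx, hphase hx⟩

end
end UnfittedLDG

/-! ### Trace inequalities near a side in an element with a kink -/

namespace UnfittedLDG
noncomputable section
open scoped ENNReal NNReal Topology

section Near

variable {m : ℕ} {C : ℝ≥0} {δ₀ σ ηm : ℝ} {Ω U : Set Plane} {K : Rect} {i : Fin 2}
  {s : Fin 2 → Bool} {j k : Fin 2}

theorem Rect.forall_rel_iff (hjk : j ≠ k) (P : Fin 2 → Prop) : (∀ l, P l) ↔ P j ∧ P k :=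
  ⟨fun h => ⟨h j, h k⟩, fun h l => by rcases fin_two_eq_or hjk l with rfl | rfl; exacts [h.1, h.2]⟩

/-- The bound near a side when only the arc that starts on this side comes close to it. -/
theorem energy_trace_thin (hp : IsGoodParam δ₀ σ ηm) (hK : IsGoodElement Ω U δ₀ σ ηm K)
    (hs : K.vertex s ∈ phase U i) (hjk : j ≠ k) {b c₁ M cc m₀ η : ℝ} (hM : 0 < M)
    (hb : |b⁻¹| ≤ M) (hc₁ : |c₁| ≤ M) (hη0 : 0 ≤ η) (hηm : η ≤ ηm) (hm₀ : 0 < m₀) (hm1 : m₀ ≤ 1)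
    (hmc : m₀ ≤ cc) (hmM : 2 * M * m₀ ≤ 1 - ηm)
    (hΓ : ∀ x ∈ frontier U ∩ K.carrier, K.rel s j x < cc →
      |1 - (c₁ * K.rel s j x + b⁻¹ * K.rel s k x)| ≤ η)
    {E : Set Plane} (hE : MeasurableSet E) (hcov : CoveredByGraphs m C E)
    (hsub : ∀ x ∈ E, x ∈ closure K.carrier ∧ K.rel s j x ≤ cc ∧
      -η ≤ 1 - (c₁ * K.rel s j x + b⁻¹ * K.rel s k x))
    {p : ℕ} (hp1 : 1 ≤ p) {q : MvPolynomial (Fin 2) ℝ} (hq : ∀ j, q.degreeOf j ≤ p) :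
    energy (μH[1].restrict E) (evalAt q) ≤
      ENNReal.ofReal (cornerConst m C ((1 + ηm) / (1 - ηm)) σ m₀ *
        (p : ℝ) ^ 2 / K.diam * bigT ((1 + 3 * η) / (1 - η)) ^ (4 * p)) *
      energy (volume.restrict (K.carrier ∩ subdomain Ω U i)) (evalAt q) := by
  obtain ⟨l1, l2, l3, l4⟩ := expansion_factor hη0 hηm hp.η_lt
  set lam := (1 + η) / (1 - η)
  obtain ⟨ν, c, hg, -⟩ := K.exists_aff_of_rel s hjk 1 (-c₁) (-b⁻¹) (M := M) (by rwa [abs_neg])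
    (by rwa [abs_neg])
  have hg' : ∀ x, aff ν c x = 1 - (c₁ * K.rel s j x + b⁻¹ * K.rel s k x) := fun x => by
    rw [hg]; ring
  have hcc : 0 < cc := by linarith
  -- As in a regular element, but cut off by a strip along the side, in which the whole interface
  -- obeys the bound for one chord. Contractions to the corner preserve the strip.
  set S := {x | (x ∈ K.carrier ∧ η < aff ν c x) ∧ K.rel s j x < cc} with hS
  have hSo : IsOpen S := (K.isOpen_carrier.inter (isOpen_lt continuous_const
    (continuous_aff ν c))).inter (isOpen_lt (K.continuous_rel s j) continuous_const)
  have hhalf : Convex ℝ {x | K.rel s j x < cc} := by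
    intro x hx y hy a b' ha hb' hab
    have h1 : a • x + b' • y = x + b' • (y - x) := by
      rw [show a = 1 - b' by linarith]; module
    show K.rel s j _ < cc
    rw [h1, K.rel_lineMap]
    have hx' : K.rel s j x < cc := hx
    have hy' : K.rel s j y < cc := hy
    rcases hb'.eq_or_lt with h0 | h0
    · rw [← h0]; linarith
    · nlinarith
  have hSc : Convex ℝ S := (K.convex_carrier.inter (convex_aff_gt ν c _)).inter hhalf
  have hbox : {x | ∀ l, K.rel s l x ∈ Set.Ioo 0 m₀} ⊆ S := by
    intro x hx
    have hxj := hx j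
    have hxk := hx k
    refine ⟨⟨(K.mem_carrier_iff_rel s).2 fun l => ⟨(hx l).1, (hx l).2.trans_le hm1⟩, ?_⟩,
      hxj.2.trans_le hmc⟩
    rw [hg']
    have h1 : c₁ * K.rel s j x ≤ M * K.rel s j x :=
      mul_le_mul_of_nonneg_right ((le_abs_self _).trans hc₁) hxj.1.le
    have h2 : b⁻¹ * K.rel s k x ≤ M * K.rel s k x :=
      mul_le_mul_of_nonneg_right ((le_abs_self _).trans hb) hxk.1.le
    have h3 : M * K.rel s j x < M * m₀ := mul_lt_mul_of_pos_left hxj.2 hM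
    have h4 : M * K.rel s k x < M * m₀ := mul_lt_mul_of_pos_left hxk.2 hM
    linarith
  obtain ⟨g, hgS⟩ : ∃ g, g ∈ S := ⟨K.ofRel s fun _ => m₀ / 2, hbox fun l => by
    rw [K.rel_ofRel]; constructor <;> linarith⟩
  have hScl : ∀ y ∈ closure K.carrier, η ≤ aff ν c y → K.rel s j y ≤ cc → y ∈ closure S := by
    intro y hy hay hyc
    refine mem_closure_of_lineMap (g := g) fun t ht =>
      ⟨⟨K.lineMap_mem_carrier hy hgS.1.1 ht, ?_⟩, ?_⟩
    · rw [aff_lineMap]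
      have := hgS.1.2
      nlinarith [ht.1, ht.2]
    · rw [K.rel_lineMap]
      have := hgS.2
      nlinarith [ht.1, ht.2]
  have hA : aff ν c (K.vertex s) = 1 := by
    rw [hg', K.rel_vertex_self, K.rel_vertex_self]; ring
  have hSd : Disjoint S (frontier U) := by
    rw [Set.disjoint_left]
    intro x hx hxf
    have h1 := hΓ x ⟨hxf, hx.1.1⟩ hx.2
    rw [← hg'] at h1
    linarith [le_abs_self (aff ν c x), hx.1.2]
  have hSK : S ⊆ K.carrier ∩ subdomain Ω U i := by
    have h1 := subset_phase_of_mem_closure hK.isOpen hSc.isPreconnected hSd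
      (hScl (K.vertex s) (K.vertex_mem_closure s) (by rw [hA]; linarith [hp.η_lt])
        (by rw [K.rel_vertex_self]; exact hcc.le)) hs
    intro x hx
    rw [subdomain_eq hK.subset]
    exact ⟨hx.1.1, hK.carrier_subset hx.1.1, h1 hx⟩
  refine (hcov.energy_le_of_corner hE hp.one_le_σ hK.aspect (s := s) (τ := fun _ => m₀) hm₀
    (fun _ => le_rfl) hSo hSc hbox l1 l2 ?_ hp1 hq).trans ?_
  · intro x hx
    obtain ⟨hxc, hx1, hx2⟩ := hsub x hx
    have hli : lam⁻¹ ∈ Set.Icc (0 : ℝ) 1 :=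
      ⟨inv_nonneg.2 (by linarith), inv_le_one_of_one_le₀ l1⟩
    refine hScl _ (K.vertex_lineMap_mem_closure s hxc hli) ?_ ?_
    · rw [aff_lineMap, hA]
      rw [← hg'] at hx2
      have h1 : lam⁻¹ * (-η - 1) ≤ lam⁻¹ * (aff ν c x - 1) := by
        apply mul_le_mul_of_nonneg_left _ hli.1; linarith
      have h2 : lam⁻¹ * (-η - 1) = -(1 - η) := by rw [← l3]; ring
      linarith
    · rw [K.rel_lineMap, K.rel_vertex_self]
      have := (mem_closed_square s hxc j).1
      nlinarith [hli.1, hli.2]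
  · rw [l4]
    exact mul_le_mul_right (energy_mono_set hSK _) _

set_option maxHeartbeats 1000000 in
/-- The bound near a side when both arcs come close to it, for deviations away from zero. -/
theorem energy_trace_fat (hp : IsGoodParam δ₀ σ ηm) (hK : IsGoodElement Ω U δ₀ σ ηm K)
    (hs : K.vertex s ∈ phase U i) (hjk : j ≠ k) {b c c₁ c₂ M θ η : ℝ} (hM : 0 < M)
    (hδb : δ₀ ≤ b) (hb1 : b ≤ 1) (hδc : δ₀ ≤ c) (hMδ : δ₀⁻¹ ≤ M) (hc₁ : |c₁| ≤ M)
    (hη0 : 0 ≤ η) (hηm : η ≤ ηm) (hθ : 0 < θ) (hθ1 : θ ≤ (1 - ηm) / 2)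
    (hslack : bigT (2 * ((1 + η) / (1 - η - θ)) - 1) * bigT (2 * (1 / (1 - η - θ)) - 1) *
        bigT (2 * (1 + θ) - 1) ^ 2 ≤ bigT ((1 + 3 * η) / (1 - η)) ^ 2)
    (hΓ : ∀ x ∈ frontier U ∩ K.carrier, |1 - (c₁ * K.rel s j x + b⁻¹ * K.rel s k x)| ≤ η ∨
      |1 - (c⁻¹ * K.rel s j x + c₂ * K.rel s k x)| ≤ η)
    (hside : ∀ x ∈ closure K.carrier, K.rel s j x = 0 → K.rel s k x < b → x ∈ phase U i)
    {E : Set Plane} (hE : MeasurableSet E) (hcov : CoveredByGraphs m C E)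
    (hsub : ∀ x ∈ E, x ∈ closure K.carrier ∧ K.rel s j x ≤ θ / M ∧ K.rel s k x ≤ b + θ / M)
    {p : ℕ} (hp1 : 1 ≤ p) {q : MvPolynomial (Fin 2) ℝ} (hq : ∀ j, q.degreeOf j ≤ p) :
    energy (μH[1].restrict E) (evalAt q) ≤
      ENNReal.ofReal (cornerConst m C 2 σ (θ / M) * (32768 / (1 - ηm) ^ 4) *
        (p : ℝ) ^ 2 / K.diam * bigT ((1 + 3 * η) / (1 - η)) ^ (4 * p)) *
      energy (volume.restrict (K.carrier ∩ subdomain Ω U i)) (evalAt q) := by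
  have hδ := hp.δ_pos
  have hb0 : 0 < b := by linarith
  have hc0 : 0 < c := by linarith
  have hD : 0 < 1 - ηm := by linarith [hp.η_lt]
  have hp1' : 0 < 1 - η - θ := by linarith
  -- In a strip of this width the terms with the `j`-th coordinate contribute at most `M y₀ = θ` to
  -- either chord function, so both arcs may be treated as level sets of the `k`-th coordinate.
  set y₀ := θ / M with hy₀
  have hy0 : 0 < y₀ := by positivity
  have hMy : M * y₀ = θ := by rw [hy₀]; field_simp
  have hδM : 1 ≤ δ₀ * M := by
    have := mul_le_mul_of_nonneg_left hMδ hδ.le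
    rwa [mul_inv_cancel₀ hδ.ne'] at this
  have hyδ : y₀ ≤ δ₀ * θ := by
    rw [hy₀, div_le_iff₀ hM]; nlinarith
  have hy1 : y₀ ≤ 1 / 4 := by nlinarith [hp.δ_lt]
  set S : ℝ → Set Plane := fun u => {x | K.rel s k x ∈ Set.Ioo 0 u ∧ K.rel s j x ∈ Set.Ioo 0 y₀}
    with hSdef
  set KE := energy (volume.restrict (K.carrier ∩ subdomain Ω U i)) (evalAt q) with hKE
  have hSbox : ∀ u, S u = {x | ∀ l, K.rel s l x ∈ Set.Ioo 0 (if l = k then u else y₀)} := by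
    intro u
    ext x
    rw [Set.mem_ofPred_eq, Set.mem_ofPred_eq, Rect.forall_rel_iff hjk]
    simp only [if_neg hjk, if_true]
    exact and_comm
  -- position of the interface relative to the strip
  have hg1 : ∀ x, 0 < K.rel s j x → K.rel s j x < y₀ → K.rel s k x < (1 - η - θ) * b →
      η < 1 - (c₁ * K.rel s j x + b⁻¹ * K.rel s k x) := by
    intro x h0 h1 h2
    have h3 : c₁ * K.rel s j x ≤ θ := by
      calc c₁ * K.rel s j x ≤ M * K.rel s j x :=
            mul_le_mul_of_nonneg_right ((le_abs_self _).trans hc₁) h0.le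
        _ ≤ M * y₀ := by gcongr
        _ = θ := hMy
    have h4 : b⁻¹ * K.rel s k x < 1 - η - θ := by
      rw [inv_mul_lt_iff₀ hb0]; linarith
    linarith
  have hcx : ∀ x, K.rel s j x < y₀ → c⁻¹ * K.rel s j x < θ := by
    intro x h1
    rw [inv_mul_lt_iff₀ hc0]
    nlinarith
  -- Below height `u` neither arc enters the strip. For `c₂ ≤ 0` the second chord function stays
  -- above `η` in the strip, so the second arc imposes no restriction.
  set u := min ((1 - η - θ) * b) (if 0 < c₂ then (1 - η - θ) / c₂ else (1 - η - θ) * b) with hu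
  have hu0 : 0 < u := by
    refine lt_min (by positivity) ?_
    split_ifs with h <;> positivity
  have hub : u ≤ (1 - η - θ) * b := min_le_left _ _
  have hu2 : ∀ x, 0 < K.rel s k x → K.rel s k x < u → c₂ * K.rel s k x ≤ 1 - η - θ := by
    intro x h0 h1
    by_cases h : 0 < c₂
    · have h2 : u ≤ (1 - η - θ) / c₂ := by
        rw [hu, if_pos h]; exact min_le_right _ _
      have := h1.trans_le h2
      rw [lt_div_iff₀ h] at this
      linarith
    · have : c₂ * K.rel s k x ≤ 0 := mul_nonpos_of_nonpos_of_nonneg (not_lt.1 h) h0.le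
      linarith
  have hin : ∀ w ≤ (1 - η - θ) * b, S w ⊆ K.carrier := by
    intro w hw x hx
    rw [K.mem_carrier_iff_rel s, Rect.forall_rel_iff hjk]
    have h1 : 0 < K.rel s k x := hx.1.1
    have h2 : K.rel s k x < w := hx.1.2
    refine ⟨⟨hx.2.1, by linarith [hx.2.2]⟩, ⟨h1, ?_⟩⟩
    nlinarith
  have hmeasK : S u ⊆ K.carrier ∩ subdomain Ω U i := by
    have hconv : Convex ℝ (S u) := by
      rw [hSbox]
      exact K.convex_box s (fun l => Set.Ioo 0 (if l = k then u else y₀)) fun _ => convex_Ioo _ _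
    have hd : Disjoint (S u) (frontier U) := by
      rw [Set.disjoint_left]
      intro x hx hxf
      have hxK := hin u hub hx
      have a1 := hg1 x hx.2.1 hx.2.2 (lt_of_lt_of_le hx.1.2 hub)
      have a2 := hcx x hx.2.2
      have a3 := hu2 x hx.1.1 hx.1.2
      rcases hΓ x ⟨hxf, hxK⟩ with h | h
      · linarith [le_abs_self (1 - (c₁ * K.rel s j x + b⁻¹ * K.rel s k x))]
      · linarith [le_abs_self (1 - (c⁻¹ * K.rel s j x + c₂ * K.rel s k x))]
    have hcl : K.vertex s ∈ closure (S u) := by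
      rw [hSbox]
      refine K.mem_closure_box s (τ := fun l => if l = k then u else y₀)
        (fun l => by split_ifs <;> assumption) fun l => ?_
      rw [K.rel_vertex_self]
      refine ⟨le_rfl, ?_⟩
      split_ifs
      · exact hu0.le
      · exact hy0.le
    have := subset_phase_of_mem_closure hK.isOpen hconv.isPreconnected hd hcl hs
    intro x hx
    rw [subdomain_eq hK.subset]
    exact ⟨hin u hub hx, hK.carrier_subset (hin u hub hx), this hx⟩
  set X1 := 2 * ((1 + η) / (1 - η - θ)) - 1 with hX1
  set X2 := 2 * (1 / (1 - η - θ)) - 1 with hX2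
  set X3 := 2 * (1 + θ) - 1 with hX3
  have gX1 : 1 ≤ X1 := by
    have : 1 ≤ (1 + η) / (1 - η - θ) := by rw [le_div_iff₀ hp1']; linarith
    linarith
  have gX2 : 1 ≤ X2 := by
    have : 1 ≤ 1 / (1 - η - θ) := by rw [le_div_iff₀ hp1']; linarith
    linarith
  have gX3 : 1 ≤ X3 := by linarith
  have tX1 := one_le_bigT gX1
  have tX2 := one_le_bigT gX2
  have tX3 := one_le_bigT gX3
  -- the strip up to the first arc
  have step1 : energy (volume.restrict (S ((1 - η - θ) * b))) (evalAt q) ≤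
      ENNReal.ofReal (2 * bigT X1 ^ (2 * (p + 1))) * KE := by
    have hone : (1 : ℝ) ≤ bigT X1 ^ (2 * (p + 1)) := one_le_pow₀ tX1
    -- Otherwise the part of the strip below the first arc is free of interface. In this case the
    -- second arc can meet it only between the heights `u = (1 - η - θ) / c₂` and `w = (1 + η) /
    -- c₂`: this layer is bridged by a stretch with ratio `w / u`, while the part `R2` above it
    -- belongs to the phase again.
    by_cases hcase : 0 < c₂ ∧ (1 - η - θ) / c₂ < (1 - η - θ) * b
    swap
    · have : u = (1 - η - θ) * b := by
        rw [hu]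
        split_ifs with h
        · exact min_eq_left (not_lt.1 fun h' => hcase ⟨h, h'⟩)
        · exact min_self _
      rw [← this]
      refine (energy_mono_set hmeasK _).trans ?_
      rw [← hKE]
      conv_lhs => rw [← one_mul KE]
      refine mul_le_mul_left ?_ _
      rw [ENNReal.one_le_ofReal]; linarith
    · obtain ⟨h2, h3⟩ := hcase
      have hueq : u = (1 - η - θ) / c₂ := by
        rw [hu, if_pos h2]; exact min_eq_right h3.le
      set w := (1 + η) / c₂ with hw
      have hwu : w / u = (1 + η) / (1 - η - θ) := by rw [hueq, hw]; field_simp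
      have huw : u ≤ w := by rw [hueq, hw]; gcongr; linarith
      set R2 := {x | (w ≤ K.rel s k x ∧ K.rel s k x < (1 - η - θ) * b) ∧
        K.rel s j x ∈ Set.Ioo 0 y₀} with hR2
      have hR2K : R2 ⊆ K.carrier ∩ subdomain Ω U i := by
        have hRS : R2 ⊆ S ((1 - η - θ) * b) := fun x hx =>
          ⟨⟨lt_of_lt_of_le (by positivity) hx.1.1, hx.1.2⟩, hx.2⟩
        have hconv : Convex ℝ R2 := by
          have h1 : R2 = {x | ∀ l, K.rel s l x ∈
              (if l = k then Set.Ico w ((1 - η - θ) * b) else Set.Ioo 0 y₀)} := by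
            ext x
            rw [Set.mem_ofPred_eq, Set.mem_ofPred_eq, Rect.forall_rel_iff hjk]
            simp only [if_neg hjk, if_true]
            exact and_comm
          rw [h1]
          refine K.convex_box s (fun l => if l = k then Set.Ico w ((1 - η - θ) * b)
            else Set.Ioo 0 y₀) fun l => ?_
          split_ifs
          · exact convex_Ico _ _
          · exact convex_Ioo _ _
        have hd : Disjoint R2 (frontier U) := by
          rw [Set.disjoint_left]
          intro x hx hxf
          have hxK := hin _ le_rfl (hRS hx)
          have a1 := hg1 x hx.2.1 hx.2.2 hx.1.2
          have a2 : 0 < c⁻¹ * K.rel s j x := mul_pos (inv_pos.2 hc0) hx.2.1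
          have a3 : 1 + η ≤ c₂ * K.rel s k x := by
            have := hx.1.1
            rw [hw, div_le_iff₀ h2] at this; linarith
          rcases hΓ x ⟨hxf, hxK⟩ with h | h
          · linarith [le_abs_self (1 - (c₁ * K.rel s j x + b⁻¹ * K.rel s k x))]
          · linarith [neg_abs_le (1 - (c⁻¹ * K.rel s j x + c₂ * K.rel s k x))]
        intro x hx
        have hxK := hin _ le_rfl (hRS hx)
        have hxc := subset_closure hxK
        have hxrel := mem_closed_square s hxc k
        have hxb : K.rel s k x < b := by
          have := hx.1.2
          nlinarith
        set x' := K.ofRel s fun l => if l = k then K.rel s k x else 0 with hx'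
        have hx'k : K.rel s k x' = K.rel s k x := by rw [hx', K.rel_ofRel]; simp
        have hx'j : K.rel s j x' = 0 := by rw [hx', K.rel_ofRel]; simp [hjk]
        have hx'c : x' ∈ closure K.carrier := by
          rw [K.mem_closure_iff_rel s, Rect.forall_rel_iff hjk, hx'k, hx'j]
          exact ⟨by simp, hxrel⟩
        have hcl : x' ∈ closure R2 := by
          refine mem_closure_of_lineMap (g := x) fun t ht => ?_
          have hj' := hx.2
          refine ⟨?_, ?_⟩
          · rw [K.rel_lineMap, hx'k, sub_self, mul_zero, add_zero]; exact hx.1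
          · rw [K.rel_lineMap, hx'j, sub_zero, zero_add]
            exact ⟨mul_pos ht.1 hj'.1, by nlinarith [ht.1, ht.2, hj'.1, hj'.2]⟩
        have := subset_phase_of_mem_closure hK.isOpen hconv.isPreconnected hd hcl
          (hside x' hx'c hx'j (by rw [hx'k]; exact hxb))
        rw [subdomain_eq hK.subset]
        exact ⟨hxK, hK.carrier_subset hxK, this hx⟩
      have hsplit : S ((1 - η - θ) * b) ⊆ S w ∪ R2 := by
        intro x hx
        by_cases h : K.rel s k x < w
        · exact Or.inl ⟨⟨hx.1.1, h⟩, hx.2⟩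
        · exact Or.inr ⟨⟨not_lt.1 h, hx.1.2⟩, hx.2⟩
      calc energy (volume.restrict (S ((1 - η - θ) * b))) (evalAt q)
          ≤ energy (volume.restrict (S w)) (evalAt q) + energy (volume.restrict R2) (evalAt q) :=
            (energy_mono_set hsplit _).trans (energy_union_le _ _ _)
        _ ≤ ENNReal.ofReal (bigT X1 ^ (2 * (p + 1))) * KE +
            ENNReal.ofReal (bigT X1 ^ (2 * (p + 1))) * KE := by
            refine add_le_add ?_ ?_
            · refine (K.energy_stretch_le s hjk hu0 huw hq).trans ?_
              rw [hwu]
              exact mul_le_mul_right (energy_mono_set hmeasK _) _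
            · refine (energy_mono_set hR2K _).trans ?_
              rw [← hKE]
              conv_lhs => rw [← one_mul KE]
              exact mul_le_mul_left (by rwa [ENNReal.one_le_ofReal]) _
        _ = _ := by
            rw [← add_mul, ← ENNReal.ofReal_add (by positivity) (by positivity), ← two_mul (bigT X1 ^ _)]
  -- the strip up to the crossing point
  have step2 : energy (volume.restrict (S b)) (evalAt q) ≤
      ENNReal.ofReal (bigT X2 ^ (2 * (p + 1))) *
        (ENNReal.ofReal (2 * bigT X1 ^ (2 * (p + 1))) * KE) := by
    have h1 := K.energy_stretch_le s hjk (u := (1 - η - θ) * b) (w := b) (y := y₀)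
      (by positivity) (by nlinarith) hq
    rw [show b / ((1 - η - θ) * b) = 1 / (1 - η - θ) by field_simp] at h1
    exact h1.trans (mul_le_mul_right step1 _)
  -- the trace, by a small expansion
  have hSo : IsOpen (S b) := by
    rw [hSbox]; exact K.isOpen_box s _
  have hSc : Convex ℝ (S b) := by
    rw [hSbox]
    exact K.convex_box s (fun l => Set.Ioo 0 (if l = k then b else y₀)) fun _ => convex_Ioo _ _
  have step3 := hcov.energy_le_of_corner hE hp.one_le_σ hK.aspect (s := s)
    (τ := fun l => if l = k then b else y₀) hy0 (fun l => by split_ifs <;> nlinarith) hSo hSc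
    (by rw [hSbox]) (lam := 1 + θ) (L := 2) (by linarith) (by linarith) (fun x hx => by
      obtain ⟨hxc, hx1, hx2⟩ := hsub x hx
      rw [hSbox]
      have h3 : 0 < 1 + θ := by linarith
      have hsq := fun l => mem_closed_square s hxc l
      refine K.mem_closure_box s (τ := fun l => if l = k then b else y₀)
        (fun l => by split_ifs <;> assumption) ?_
      rw [Rect.forall_rel_iff hjk]
      simp only [if_neg hjk, if_true, K.rel_lineMap, K.rel_vertex_self, sub_zero, zero_add]
      refine ⟨⟨mul_nonneg (by positivity) (hsq j).1, ?_⟩,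
        ⟨mul_nonneg (by positivity) (hsq k).1, ?_⟩⟩
      · rw [inv_mul_le_iff₀ h3]; nlinarith
      · rw [inv_mul_le_iff₀ h3]; nlinarith) hp1 hq
  refine step3.trans ((mul_le_mul_right step2 _).trans ?_)
  rw [← mul_assoc, ← mul_assoc, ← ENNReal.ofReal_mul (by
    have := cornerConst_nonneg m C 2 hp.one_le_σ hy0
    have := K.diam_pos
    positivity), ← ENNReal.ofReal_mul (by
    have := cornerConst_nonneg m C 2 hp.one_le_σ hy0
    have := K.diam_pos
    positivity)]
  refine mul_le_mul_left (ENNReal.ofReal_le_ofReal ?_) _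
  have hcc := cornerConst_nonneg m C 2 hp.one_le_σ hy0
  have hd := K.diam_pos
  set T0 := bigT ((1 + 3 * η) / (1 - η))
  have hB1 : bigT X1 ≤ 16 / (1 - ηm) := by
    refine (bigT_le_two_mul gX1).trans ?_
    rw [hX1]
    have : (1 + η) / (1 - η - θ) ≤ 2 / ((1 - ηm) / 2) := by gcongr <;> linarith [hp.η_lt]
    have e : 2 / ((1 - ηm) / 2) = 4 / (1 - ηm) := by field_simp; ring
    rw [e] at this
    have e2 : 16 / (1 - ηm) = 2 * (2 * (4 / (1 - ηm))) := by ring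
    rw [e2]; linarith
  have hB2 : bigT X2 ≤ 8 / (1 - ηm) := by
    refine (bigT_le_two_mul gX2).trans ?_
    rw [hX2]
    have : 1 / (1 - η - θ) ≤ 1 / ((1 - ηm) / 2) := by gcongr; linarith
    have e : 1 / ((1 - ηm) / 2) = 2 / (1 - ηm) := by field_simp
    rw [e] at this
    have e2 : 8 / (1 - ηm) = 2 * (2 * (2 / (1 - ηm))) := by ring
    rw [e2]; linarith
  -- Up to the two surplus factors of each stretch, the three growth factors form the power `2 p` of
  -- the product bounded in `hslack`. The surplus is the constant `32768 = 2 · 16² · 8²` over `(1 -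
  -- ηm)⁴`.
  calc cornerConst m C 2 σ y₀ * (p : ℝ) ^ 2 / K.diam * bigT X3 ^ (4 * p) * bigT X2 ^ (2 * (p + 1)) *
        (2 * bigT X1 ^ (2 * (p + 1)))
      = cornerConst m C 2 σ y₀ * (p : ℝ) ^ 2 / K.diam *
          (2 * bigT X1 ^ 2 * bigT X2 ^ 2) * (bigT X1 * bigT X2 * bigT X3 ^ 2) ^ (2 * p) := by
        rw [mul_pow, mul_pow, ← pow_mul, show 2 * (2 * p) = 4 * p by ring,
          show 2 * (p + 1) = 2 * p + 2 by ring, pow_add, pow_add]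
        ring
    _ ≤ cornerConst m C 2 σ y₀ * (p : ℝ) ^ 2 / K.diam *
          (2 * (16 / (1 - ηm)) ^ 2 * (8 / (1 - ηm)) ^ 2) * (T0 ^ 2) ^ (2 * p) := by
        gcongr
    _ = _ := by
        rw [← pow_mul, show 2 * (2 * p) = 4 * p by ring]
        field_simp
        ring

end Near

end
end UnfittedLDG

/-! ### Position of an interface with a kink -/

namespace UnfittedLDG
noncomputable section
open scoped ENNReal NNReal Topology

section Kinked

variable {δ₀ σ ηm : ℝ} {Ω U : Set Plane} {K : Rect} {i : Fin 2}

/-- Slope of the line through `P` and `Q` in normalized coordinates, if `P` lies on a side. -/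
def arcSlope (K : Rect) (s : Fin 2 → Bool) (j k : Fin 2) (P Q : Plane) : ℝ :=
  (1 - K.rel s k Q / K.rel s k P) / K.rel s j Q

/-- The position of an interface with a kink `Q` in an element with one vertex in the phase `i`. -/
structure IsKinkedCorner (U : Set Plane) (K : Rect) (i : Fin 2) (δ₀ δ₁ η : ℝ)
    (s : Fin 2 → Bool) (P : Fin 2 → Plane) (Q : Plane) : Prop where
  vertex_mem : K.vertex s ∈ phase U i
  crossing : ∀ j k, j ≠ k → IsCrossing U K s j k (P k)
  le_crossing : ∀ j k, j ≠ k → δ₀ ≤ K.rel s k (P k)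
  of_frontier : ∀ x ∈ frontier K.carrier, x ∈ phase U i →
    ∃ j k, j ≠ k ∧ K.rel s j x = 0 ∧ K.rel s k x < K.rel s k (P k)
  kink_mem : Q ∈ K.carrier
  le_kink : ∀ j, δ₁ ≤ K.rel s j Q
  arc : ∀ z ∈ frontier U ∩ K.carrier, ∃ j k, j ≠ k ∧
    |1 - (arcSlope K s j k (P k) Q * K.rel s j z + (K.rel s k (P k))⁻¹ * K.rel s k z)| ≤ η ∧
    Metric.infDist z (segment ℝ Q (P k)) ≤ η * K.diam

theorem IsGoodElement.le_rel_singular (hp : IsGoodParam δ₀ σ ηm)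
    (hK : IsGoodElement Ω U δ₀ σ ηm K) (h1 : OneVertex Ω U i K) {s : Fin 2 → Bool}
    (hs : K.vertex s ∈ closure (subdomain Ω U i)) {Q : Plane}
    (hQ : Q ∈ singularPoints U ∩ K.carrier) (j : Fin 2) : δ₀ / (2 * σ) ≤ K.rel s j Q := by
  have hσ := hp.one_le_σ
  have h := (hK.large i).2 h1 Q hQ s hs j
  have hQr := (K.mem_carrier_iff_rel s).1 hQ.2
  obtain ⟨k, hjk⟩ : ∃ k, j ≠ k := ⟨j + 1, by fin_cases j <;> simp⟩
  -- The orthogonal projection of `Q` to the side, so that the distance in the hypothesis is at most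
  -- a normalized coordinate times the length of `K` in direction `j`.
  set x := K.ofRel s fun l => if l = j then 0 else K.rel s k Q with hx
  have hxj : K.rel s j x = 0 := by rw [hx, K.rel_ofRel]; simp
  have hxk : K.rel s k x = K.rel s k Q := by rw [hx, K.rel_ofRel]; simp [hjk.symm]
  have hxs : x ∈ K.side j (s j) := by
    rw [K.mem_side_iff_rel s]
    refine ⟨by simpa using hxj, fun l hl => ?_⟩
    rcases fin_two_eq_or hjk l with rfl | rfl
    · exact absurd rfl hl
    · rw [hxk]; exact hQr l
  have h2 := h.trans (Metric.infDist_le_dist_of_mem hxs)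
  rw [K.dist_eq_of_rel hjk.symm hxk.symm, hxj, sub_zero, abs_of_pos (hQr j).1] at h2
  have hl := K.len_pos j
  have hmin : K.len j / σ ≤ min (K.len 0) (K.len 1) := by
    refine le_min ?_ ?_ <;> rw [div_le_iff₀ (by linarith), mul_comm] <;> exact hK.aspect _ _
  have h3 : δ₀ / 2 * (K.len j / σ) ≤ K.rel s j Q * K.len j :=
    (mul_le_mul_of_nonneg_left hmin (by linarith [hp.δ_pos])).trans h2
  have h4 : δ₀ / 2 * (K.len j / σ) = δ₀ / (2 * σ) * K.len j := by field_simp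
  rw [h4] at h3
  exact le_of_mul_le_mul_right h3 hl

/-- The arc between the kink and a crossing point is close to its chord. -/
theorem abs_le_of_component {s : Fin 2 → Bool} {j k : Fin 2} {P B C Q : Plane}
    (hF : frontier U ∩ frontier K.carrier = {B, C})
    (hsing : (singularPoints U ∩ K.carrier).Subsingleton) (hirr : IsIrregular Ω U i K)
    (hP : P ∈ frontier U ∩ frontier K.carrier) (hcr : IsCrossing U K s j k P)
    (hQ : Q ∈ singularPoints U ∩ K.carrier)
    (hs : K.vertex s ∈ closure (subdomain Ω U i)) {x : Plane}
    (hx : x ∈ connectedComponentIn ((frontier U ∩ closure K.carrier) \ {Q}) P) :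
    |1 - (arcSlope K s j k P Q * K.rel s j x + (K.rel s k P)⁻¹ * K.rel s k x)| ≤
        deviation Ω U K ∧
      Metric.infDist x (segment ℝ Q P) ≤ deviation Ω U K * K.diam := by
  have hjk := hcr.ne
  have hQr := (K.mem_carrier_iff_rel s).1 hQ.2
  have hb := hcr.rel_mem.1
  -- The affine function that vanishes at `P` and `Q` and equals `1` at the corner: its values
  -- measure the distance to the chord in units of the distance of the corner from the chord, as the
  -- deviation does.
  obtain ⟨ν, c, hg, -⟩ := K.exists_aff_of_rel s hjk 1 (-arcSlope K s j k P Q) (-(K.rel s k P)⁻¹)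
    (le_max_left |-arcSlope K s j k P Q| |-(K.rel s k P)⁻¹|) (le_max_right _ _)
  have hgP : aff ν c P = 0 := by
    rw [hg, hcr.rel_zero]; field_simp; ring
  have hgQ : aff ν c Q = 0 := by
    have := (hQr j).1
    rw [hg, arcSlope]; field_simp; ring
  have hgA : aff ν c (K.vertex s) = 1 := by
    rw [hg, K.rel_vertex_self, K.rel_vertex_self]; ring
  have hQP : Q ≠ P := by
    rintro rfl
    exact (hQr j).1.ne' hcr.rel_zero
  have hA1 := abs_aff_le_lineDist hgQ hgP (K.vertex s)
  have hA2 := lineDist_mul_norm_le hgQ hgP hQP (K.vertex s)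
  rw [hgA, abs_one] at hA1 hA2
  have hL : 0 < lineDist (K.vertex s) Q P := by
    by_contra hle
    nlinarith [norm_nonneg ν, mul_nonneg (norm_nonneg ν) (sub_nonneg.2 (not_lt.1 hle))]
  have h2 := infDist_le_of_component hF hsing hirr hP hQ hs hL hx
  have hη : 0 ≤ deviation Ω U K := deviation_nonneg
  constructor
  · have : 1 - (arcSlope K s j k P Q * K.rel s j x + (K.rel s k P)⁻¹ * K.rel s k x) =
        aff ν c x := by rw [hg]; ring
    rw [this]
    calc |aff ν c x| ≤ ‖ν‖ * Metric.infDist x (segment ℝ Q P) := abs_aff_le_infDist hgQ hgP x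
      _ ≤ ‖ν‖ * (deviation Ω U K * lineDist (K.vertex s) Q P) := by gcongr
      _ = deviation Ω U K * (lineDist (K.vertex s) Q P * ‖ν‖) := by ring
      _ ≤ deviation Ω U K * 1 := by gcongr
      _ = _ := mul_one _
  · refine h2.trans (mul_le_mul_of_nonneg_left ?_ hη)
    exact (Metric.infDist_le_dist_of_mem (left_mem_affineSpan_pair ℝ Q P)).trans
      (K.dist_le_diam (K.vertex_mem_closure s) (subset_closure hQ.2))

/-- The deviation only speaks of the components, in `Γ ∩ closure K` without `Q`, of the two crossing
points. By `IsLipschitzDomain.mem_component_of_cut` every other component would also have to reach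
`∂K`, where there are no further points of `Γ`; so every point of `Γ_K` other than `Q` is
controlled, and `Q` lies on both chords. -/
theorem IsGoodElement.exists_kinkedCorner (hp : IsGoodParam δ₀ σ ηm)
    (hK : IsGoodElement Ω U δ₀ σ ηm K) (hU : IsLipschitzDomain U) (hirr : IsIrregular Ω U i K) :
    ∃ s P Q, IsKinkedCorner U K i δ₀ (δ₀ / (2 * σ)) (deviation Ω U K) s P Q := by
  obtain ⟨s, P, hs, hF, hcr, hfr⟩ := exists_corner_of_oneVertex hK.isOpen hK.subset
    hK.carrier_subset hK.crosses hK.large hirr.1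
  obtain ⟨Q, hQ⟩ := hirr.2
  have hs' : K.vertex s ∈ closure (subdomain Ω U i) :=
    (mem_closure_subdomain_iff hK.isOpen hK.subset (closure_mono hK.carrier_subset
      (K.vertex_mem_closure s)) (vertex_notMem_frontier hK.crosses s)).2 hs
  have hPF : ∀ k, P k ∈ frontier U ∩ frontier K.carrier := fun k => by
    rw [hF]; fin_cases k <;> simp
  refine ⟨s, P, Q, hs, fun j k h => (hcr j k h).1, fun j k h => (hcr j k h).2, hfr, hQ.2,
    hK.le_rel_singular hp hirr.1 hs' hQ, fun z hz => ?_⟩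
  have hother : ∀ k : Fin 2, ∃ j, j ≠ k := fun k => ⟨k + 1, by fin_cases k <;> simp⟩
  have hQf : Q ∈ frontier U := hQ.1.1
  have hX : frontier U ∩ closure K.carrier =
      (frontier U ∩ K.carrier) ∪ (frontier U ∩ frontier K.carrier) := by
    rw [← Set.inter_union_distrib_left, closure_eq_self_union_frontier]
  have key : ∃ k, z ∈ connectedComponentIn ((frontier U ∩ closure K.carrier) \ {Q}) (P k) ∨
      z = Q := by
    by_cases hzQ : z = Q
    · exact ⟨0, Or.inr hzQ⟩
    obtain ⟨j, hj⟩ := hother 0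
    obtain ⟨y, hy, hyF⟩ := hU.mem_component_of_cut K.isOpen_carrier hK.crosses.1.isPreconnected hX
      (hU.isCompact_frontier.inter_right isClosed_closure)
      (by
        rw [Set.disjoint_left]
        intro x hx hx'
        have h := hx.2
        rw [K.isOpen_carrier.frontier_eq] at h
        exact h.2 hx')
      ⟨P 0, hPF 0, (hcr j 0 hj).1.mem_closure hK.isOpen⟩ ⟨hQf, hQ.2⟩ hz hzQ
    obtain ⟨k, rfl⟩ : ∃ k, y = P k := by
      rw [hF] at hyF
      rcases hyF with h | h
      exacts [⟨0, h⟩, ⟨1, h⟩]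
    refine ⟨k, Or.inl ?_⟩
    rw [← connectedComponentIn_eq hy]
    exact mem_connectedComponentIn ⟨⟨hz.1, subset_closure hz.2⟩, hzQ⟩
  obtain ⟨k, hk⟩ := key
  obtain ⟨j, hj⟩ := hother k
  refine ⟨j, k, hj, ?_⟩
  rcases hk with hk | rfl
  · exact abs_le_of_component hF hK.one_singular hirr (hPF k) (hcr j k hj).1 hQ hs' hk
  · have hη : 0 ≤ deviation Ω U K := deviation_nonneg
    have hQr := (K.mem_carrier_iff_rel s).1 hQ.2
    have h1 := (hQr j).1
    have h2 := (hcr j k hj).1.rel_mem.1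
    constructor
    · convert hη using 1
      rw [abs_eq_zero, arcSlope]; field_simp; ring
    · rw [Metric.infDist_zero_of_mem (left_mem_segment ℝ _ _)]
      exact mul_nonneg hη K.diam_pos.le

end Kinked

end
end UnfittedLDG

/-! ### Traces near the sides and away from them in an element with a kink -/

namespace UnfittedLDG
noncomputable section
open scoped ENNReal NNReal Topology

theorem inter_frontier_nonempty_of_isPreconnected {X : Type*} [TopologicalSpace X] {S O : Set X}
    (hO : IsOpen O) (hS : IsPreconnected S) (h1 : (S ∩ O).Nonempty) (h2 : ∃ x ∈ S, x ∉ O) :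
    (S ∩ frontier O).Nonempty := by
  by_contra hne
  have hcov : S ⊆ O ∪ (closure O)ᶜ := fun x hx => by
    by_cases hxO : x ∈ O
    · exact Or.inl hxO
    · exact Or.inr fun hc => hne ⟨x, hx, by rw [hO.frontier_eq]; exact ⟨hc, hxO⟩⟩
  obtain ⟨x, hx, hxO⟩ := h2
  obtain ⟨y, -, hy, hy'⟩ := hS _ _ hO isClosed_closure.isOpen_compl hcov h1
    ⟨x, hx, (hcov hx).resolve_left hxO⟩
  exact hy' (subset_closure hy)

section KinkedTrace

variable {m : ℕ} {C : ℝ≥0} {δ₀ δ₁ σ ηm ρ : ℝ} {Ω U : Set Plane} {K : Rect} {i : Fin 2}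
  {s : Fin 2 → Bool} {P : Fin 2 → Plane} {Q : Plane}

/-- The points on the interface or on the trace of the phase `i` close to one side. -/
def nearSide (U : Set Plane) (K : Rect) (i : Fin 2) (s : Fin 2 → Bool) (j k : Fin 2) (P : Plane)
    (ε : ℝ) : Set Plane :=
  {x | x ∈ frontier U ∩ K.carrier ∧ K.rel s j x ≤ ε ∧ K.rel s k x ≤ K.rel s k P + ε} ∪
    {x | x ∈ frontier K.carrier ∩ phase U i ∧ K.rel s j x = 0 ∧ K.rel s k x < K.rel s k P}

/-- The points of the interface away from the parts of the sides that belong to the phase `i`. -/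
def farFromSides (U : Set Plane) (K : Rect) (s : Fin 2 → Bool) (P : Fin 2 → Plane) (ε : ℝ) :
    Set Plane :=
  {x | x ∈ frontier U ∩ K.carrier ∧
    ∀ j k, j ≠ k → ε < K.rel s j x ∨ K.rel s k (P k) + ε < K.rel s k x}

theorem measurableSet_nearSide (hU : IsOpen U) (j k : Fin 2) (P : Plane) (ε : ℝ) :
    MeasurableSet (nearSide U K i s j k P ε) := by
  have h1 := (K.continuous_rel s j).measurable
  have h2 := (K.continuous_rel s k).measurable
  refine MeasurableSet.union ?_ ?_
  · exact (isClosed_frontier.measurableSet.inter K.isOpen_carrier.measurableSet).inter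
      ((measurableSet_le h1 measurable_const).inter (measurableSet_le h2 measurable_const))
  · exact (isClosed_frontier.measurableSet.inter (isOpen_phase hU i).measurableSet).inter
      ((measurableSet_eq_fun h1 measurable_const).inter (measurableSet_lt h2 measurable_const))

theorem measurableSet_farFromSides (ε : ℝ) : MeasurableSet (farFromSides U K s P ε) := by
  refine (isClosed_frontier.measurableSet.inter K.isOpen_carrier.measurableSet).inter ?_
  have : {x : Plane | ∀ j k : Fin 2, j ≠ k → ε < K.rel s j x ∨ K.rel s k (P k) + ε < K.rel s k x} =
      ⋂ (j : Fin 2) (k : Fin 2) (_ : j ≠ k),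
        ({x | ε < K.rel s j x} ∪ {x | K.rel s k (P k) + ε < K.rel s k x}) := by
    ext x; simp
  change MeasurableSet {x : Plane | ∀ j k : Fin 2, j ≠ k → _ ∨ _}
  rw [this]
  exact MeasurableSet.iInter fun j => MeasurableSet.iInter fun k => MeasurableSet.iInter fun _ =>
    (measurableSet_lt measurable_const (K.continuous_rel s j).measurable).union
      (measurableSet_lt measurable_const (K.continuous_rel s k).measurable)

theorem IsKinkedCorner.subset_union (h : IsKinkedCorner U K i δ₀ δ₁ ηm s P Q) (ε : ℝ) :
    (frontier K.carrier ∩ phase U i) ∪ (frontier U ∩ K.carrier) ⊆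
      farFromSides U K s P ε ∪ (nearSide U K i s 0 1 (P 1) ε ∪ nearSide U K i s 1 0 (P 0) ε) := by
  have hpair : ∀ j k : Fin 2, j ≠ k → nearSide U K i s j k (P k) ε ⊆
      nearSide U K i s 0 1 (P 1) ε ∪ nearSide U K i s 1 0 (P 0) ε := by
    intro j k hjk
    fin_cases j <;> fin_cases k <;> first | exact absurd rfl hjk | skip
    · exact Set.subset_union_left
    · exact Set.subset_union_right
  rintro x (hx | hx)
  · obtain ⟨j, k, hjk, h1, h2⟩ := h.of_frontier x hx.1 hx.2
    exact Or.inr (hpair j k hjk (Or.inr ⟨hx, h1, h2⟩))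
  · by_cases hf : ∀ j k, j ≠ k → ε < K.rel s j x ∨ K.rel s k (P k) + ε < K.rel s k x
    · exact Or.inl ⟨hx, hf⟩
    · push Not at hf
      obtain ⟨j, k, hjk, h1, h2⟩ := hf
      exact Or.inr (hpair j k hjk (Or.inl ⟨hx, h1, h2⟩))

theorem IsKinkedCorner.abs_arcSlope_le (h : IsKinkedCorner U K i δ₀ δ₁ ηm s P Q) (hδ : 0 < δ₀)
    (hδ1 : δ₀ < 1 / 2) (hδ₁ : 0 < δ₁) {j k : Fin 2} (hjk : j ≠ k) :
    |arcSlope K s j k (P k) Q| ≤ 1 / (δ₀ * δ₁) := by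
  have hQ := (K.mem_carrier_iff_rel s).1 h.kink_mem
  have h1 := h.le_kink j
  have h2 := h.le_crossing j k hjk
  have h3 : K.rel s k Q / K.rel s k (P k) ≤ 1 / δ₀ := by
    gcongr; exact (hQ k).2.le
  have h4 : 0 ≤ K.rel s k Q / K.rel s k (P k) := div_nonneg (hQ k).1.le (by linarith)
  have h5 : 1 ≤ 1 / δ₀ := by rw [le_div_iff₀ hδ]; linarith
  rw [arcSlope, abs_div, abs_of_pos (hδ₁.trans_le h1)]
  calc _ ≤ (1 / δ₀) / δ₁ := by
        gcongr
        rw [abs_le]; constructor <;> linarith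
    _ = _ := by field_simp

/-- If the deviation is small then only one arc comes close to a side. -/
theorem IsKinkedCorner.le_deviation_of_fat (h : IsKinkedCorner U K i δ₀ δ₁ ηm s P Q)
    (hδ : δ₁ ≤ δ₀) (hσ : 1 ≤ σ) (hasp : ∀ j k, K.len j ≤ σ * K.len k) (hη : 0 ≤ ηm)
    {j k : Fin 2} (hjk : j ≠ k) {x : Plane} (hxj : K.rel s j x < δ₁ / 2)
    (hx : Metric.infDist x (segment ℝ Q (P j)) ≤ ηm * K.diam) : δ₁ / (4 * σ) ≤ ηm := by
  have hcomp : IsCompact (segment ℝ Q (P j)) := by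
    rw [segment_eq_image']
    exact isCompact_Icc.image (by fun_prop)
  obtain ⟨y, hy, he⟩ := hcomp.exists_infDist_eq_dist ⟨Q, left_mem_segment ℝ Q (P j)⟩ x
  obtain ⟨t, ht, hyt⟩ := K.rel_mem_of_mem_segment s hy
  have h1 := h.le_kink j
  have h2 := hδ.trans (h.le_crossing k j hjk.symm)
  -- Both ends of the chord have `j`-th coordinate at least `δ₁`, hence all of its points do. A
  -- point of this arc that is close to the side is therefore far from the chord.
  have h3 : δ₁ ≤ K.rel s j y := by
    rw [hyt j]
    nlinarith [ht.1, ht.2]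
  have h4 := K.abs_rel_sub_le s j x y
  have hl := K.len_pos j
  rw [← he, le_div_iff₀ hl] at h4
  have h5 := K.diam_le_mul_len hasp j
  have h6 : δ₁ / 2 ≤ |K.rel s j x - K.rel s j y| := by
    rw [abs_sub_comm]
    exact le_trans (by linarith) (le_abs_self _)
  have h7 : δ₁ / 2 * K.len j ≤ ηm * (2 * σ) * K.len j := by
    calc δ₁ / 2 * K.len j ≤ |K.rel s j x - K.rel s j y| * K.len j := by gcongr
      _ ≤ ηm * K.diam := h4.trans hx
      _ ≤ ηm * (2 * σ * K.len j) := by gcongr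
      _ = _ := by ring
  have h8 := le_of_mul_le_mul_right h7 hl
  rw [div_le_iff₀ (by linarith)]; linarith

/-- The bound near a side. -/
theorem IsKinkedCorner.energy_near (hp : IsGoodParam δ₀ σ ηm) (hK : IsGoodElement Ω U δ₀ σ ηm K)
    (h : IsKinkedCorner U K i δ₀ δ₁ (deviation Ω U K) s P Q) (hδ : δ₁ ≤ δ₀) (hδ₁ : 0 < δ₁) {θ : ℝ}
    (hθ : 0 < θ) (hθ1 : θ ≤ (1 - ηm) / 2) (hθ2 : θ ≤ 1 / 2)
    (hslack : ∀ η ∈ Set.Icc (δ₁ / (4 * σ)) ηm,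
      bigT (2 * ((1 + η) / (1 - η - θ)) - 1) * bigT (2 * (1 / (1 - η - θ)) - 1) *
        bigT (2 * (1 + θ) - 1) ^ 2 ≤ bigT ((1 + 3 * η) / (1 - η)) ^ 2)
    {j k : Fin 2} (hjk : j ≠ k) (hcov : CoveredByGraphs m C (frontier K.carrier ∪ frontier U))
    {p : ℕ} (hp1 : 1 ≤ p) {q : MvPolynomial (Fin 2) ℝ} (hq : ∀ j, q.degreeOf j ≤ p) :
    energy (μH[1].restrict (nearSide U K i s j k (P k) (θ * (δ₀ * δ₁)))) (evalAt q) ≤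
      ENNReal.ofReal ((cornerConst m C ((1 + ηm) / (1 - ηm)) σ
          (min (δ₁ / 2) ((1 - ηm) * (δ₀ * δ₁) / 2)) +
          cornerConst m C 2 σ (θ * (δ₀ * δ₁)) * (32768 / (1 - ηm) ^ 4)) *
        (p : ℝ) ^ 2 / K.diam *
        bigT ((1 + 3 * deviation Ω U K) / (1 - deviation Ω U K)) ^ (4 * p)) *
      energy (volume.restrict (K.carrier ∩ subdomain Ω U i)) (evalAt q) := by
  have hη0 : 0 ≤ deviation Ω U K := deviation_nonneg
  have hηm := hK.deviation_le
  set η := deviation Ω U K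
  have hδ0 := hp.δ_pos
  have hδh := hp.δ_lt
  have hσ := hp.one_le_σ
  have hm1 := hp.η_lt
  set M := 1 / (δ₀ * δ₁) with hM
  have hM0 : 0 < M := by positivity
  have hθM : θ * (δ₀ * δ₁) = θ / M := by rw [hM]; field_simp
  have hMi : M * (δ₀ * δ₁) = 1 := by rw [hM]; field_simp
  have hδM : δ₀⁻¹ ≤ M := by
    rw [hM, ← one_div]
    gcongr
    nlinarith
  have hcr := h.crossing j k hjk
  have hb := h.le_crossing j k hjk
  have hc := h.le_crossing k j hjk.symm
  have hc₁ := h.abs_arcSlope_le hδ0 hδh hδ₁ hjk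
  have hE : MeasurableSet (nearSide U K i s j k (P k) (θ * (δ₀ * δ₁))) :=
    measurableSet_nearSide hK.isOpen _ _ _ _
  have hcov' : CoveredByGraphs m C (nearSide U K i s j k (P k) (θ * (δ₀ * δ₁))) :=
    hcov.mono (by
      rintro x (hx | hx)
      · exact Or.inr hx.1.1
      · exact Or.inl hx.1.1)
  have hεle : θ * (δ₀ * δ₁) ≤ δ₁ / 4 := by
    have h1 : θ * δ₀ ≤ 1 / 2 * (1 / 2) := by gcongr
    nlinarith
  have hd := K.diam_pos
  obtain ⟨l1, l2, l3, l4⟩ := expansion_factor hη0 hηm hm1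
  have ht : 1 ≤ bigT ((1 + 3 * η) / (1 - η)) := one_le_bigT (by linarith)
  have hmin : 0 < min (δ₁ / 2) ((1 - ηm) * (δ₀ * δ₁) / 2) := by
    have : 0 < 1 - ηm := by linarith
    exact lt_min (by linarith) (by positivity)
  have n1 := cornerConst_nonneg m C ((1 + ηm) / (1 - ηm)) hσ hmin
  have n2 := cornerConst_nonneg m C 2 hσ (m₀ := θ * (δ₀ * δ₁)) (by positivity)
  -- Either all of the interface near this side obeys the bound for the chord that ends on it, and
  -- the strip argument for one arc applies; or some point close to the side belongs to the other
  -- arc, which forces `η ≥ δ₁ / (4 σ)` and makes the slack available.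
  by_cases hthin : ∀ x ∈ frontier U ∩ K.carrier, K.rel s j x < δ₁ / 2 →
      |1 - (arcSlope K s j k (P k) Q * K.rel s j x + (K.rel s k (P k))⁻¹ * K.rel s k x)| ≤ η
  · refine (energy_trace_thin hp hK h.vertex_mem hjk hM0 (b := K.rel s k (P k)) ?_ hc₁ hη0 hηm hmin
      ((min_le_left _ _).trans (by linarith)) (min_le_left _ _) ?_ hthin hE hcov' ?_ hp1 hq).trans ?_
    · rw [abs_of_pos (inv_pos.2 (by linarith))]
      exact (inv_anti₀ hδ0 hb).trans hδM
    · have h1 := min_le_right (δ₁ / 2) ((1 - ηm) * (δ₀ * δ₁) / 2)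
      calc 2 * M * min (δ₁ / 2) ((1 - ηm) * (δ₀ * δ₁) / 2)
          ≤ 2 * M * ((1 - ηm) * (δ₀ * δ₁) / 2) := by gcongr
        _ = (1 - ηm) * (M * (δ₀ * δ₁)) := by ring
        _ = 1 - ηm := by rw [hMi, mul_one]
    · rintro x (hx | hx)
      · have h1 : K.rel s j x < δ₁ / 2 := by linarith [hx.2.1]
        exact ⟨subset_closure hx.1.2, h1.le, (abs_le.1 (hthin x hx.1 h1)).1⟩
      · refine ⟨frontier_subset_closure hx.1.1, by rw [hx.2.1]; linarith, ?_⟩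
        rw [hx.2.1, mul_zero, zero_add]
        have h1 : (K.rel s k (P k))⁻¹ * K.rel s k x < 1 := by
          rw [inv_mul_lt_iff₀ (by linarith), mul_one]; exact hx.2.2
        linarith
    · refine mul_le_mul_left (ENNReal.ofReal_le_ofReal ?_) _
      gcongr
      exact le_add_of_nonneg_right (by positivity)
  · push Not at hthin
    obtain ⟨x, hx, hxj, hxg⟩ := hthin
    have hη : δ₁ / (4 * σ) ≤ η := by
      obtain ⟨j', k', hjk', h1, h2⟩ := h.arc x hx
      have : j' = k ∧ k' = j := by
        by_contra hne
        have : j' = j ∧ k' = k := by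
          rcases fin_two_eq_or hjk j' with rfl | rfl <;>
            rcases fin_two_eq_or hjk k' with rfl | rfl <;> simp_all
        obtain ⟨rfl, rfl⟩ := this
        linarith
      obtain ⟨rfl, rfl⟩ := this
      exact h.le_deviation_of_fat hδ hσ hK.aspect hη0 hjk hxj h2
    refine (energy_trace_fat (c := K.rel s j (P j)) (c₂ := arcSlope K s k j (P j) Q) hp hK
      h.vertex_mem hjk hM0 hb hcr.rel_mem.2.le hc hδM hc₁ hη0 hηm hθ
      hθ1 (hslack η ⟨hη, hηm⟩) ?_ ?_ hE hcov' ?_ hp1 hq).trans ?_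
    · intro z hz
      obtain ⟨j', k', hjk', h1, -⟩ := h.arc z hz
      rcases fin_two_eq_or hjk j' with rfl | rfl <;>
        rcases fin_two_eq_or hjk k' with rfl | rfl
      · exact absurd rfl hjk'
      · exact Or.inl h1
      · right; rwa [add_comm]
      · exact absurd rfl hjk'
    · exact fun z hz hz0 hzb => hcr.mem_phase_of_lt hK.isOpen h.vertex_mem hz hz0 hzb
    · rw [← hθM]
      have hε : 0 < θ * (δ₀ * δ₁) := by positivity
      rintro z (hz | hz)
      · exact ⟨subset_closure hz.1.2, hz.2⟩
      · exact ⟨frontier_subset_closure hz.1.1, by rw [hz.2.1]; exact hε.le, by linarith [hz.2.2]⟩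
    · rw [← hθM]
      refine mul_le_mul_left (ENNReal.ofReal_le_ofReal ?_) _
      gcongr
      exact le_add_of_nonneg_left n1

/-- The bound away from the sides, by integration along the direction of the charts. -/
theorem IsKinkedCorner.energy_far {η : ℝ} (h : IsKinkedCorner U K i δ₀ δ₁ η s P Q)
    (hU : IsOpen U) (hUΩ : U ⊆ Ω) (hKΩ : K.carrier ⊆ Ω) (hσ : 1 ≤ σ)
    (hasp : ∀ j k, K.len j ≤ σ * K.len k)
    {t : Finset Plane} {R : Plane → Plane ≃ₗᵢ[ℝ] Plane} {ψ : Plane → ℝ → ℝ} {B : Plane → Set Plane}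
    (hc : IsChartCover U t R C ψ B ρ) {H ε : ℝ} (hε : 0 < ε) (hH : K.diam ≤ H)
    {p : ℕ} (hp1 : 1 ≤ p) {q : MvPolynomial (Fin 2) ℝ} (hq : ∀ j, q.degreeOf j ≤ p) :
    energy (μH[1].restrict (farFromSides U K s P ε)) (evalAt q) ≤
      ENNReal.ofReal (t.card * ((1 + C) * (50 / min (ε / (4 * σ)) (ρ / H))) *
        (p : ℝ) ^ 2 / K.diam) *
      energy (volume.restrict (K.carrier ∩ subdomain Ω U i)) (evalAt q) := by
  have hd := K.diam_pos
  have hH0 : 0 < H := hd.trans_le hH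
  have hρ := hc.pos
  -- The translations have length `c h_K`: short enough to move each normalized coordinate by at
  -- most `ε / 2`, and shorter than the uniform size `ρ` of the charts. The latter is the only place
  -- where the bound `H` for the diameters enters.
  set c := min (ε / (4 * σ)) (ρ / H) with hcdef
  have hc0 : 0 < c := lt_min (by positivity) (by positivity)
  have hl : 0 < c * K.diam := by positivity
  have hlρ : c * K.diam ≤ ρ := by
    calc c * K.diam ≤ ρ / H * H := by gcongr; exact min_le_right _ _
      _ = ρ := by field_simp
  have hrel : ∀ j, c * K.diam / K.len j ≤ ε / 2 := by
    intro j
    have h1 := K.diam_le_mul_len hasp j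
    have h2 := K.len_pos j
    rw [div_le_iff₀ h2]
    calc c * K.diam ≤ ε / (4 * σ) * (2 * σ * K.len j) := by gcongr; exact min_le_left _ _
      _ = ε / 2 * K.len j := by field_simp; ring
  have hT : K.carrier ∩ subdomain Ω U i = K.carrier ∩ phase U i := by
    rw [subdomain_eq hUΩ, ← Set.inter_assoc, Set.inter_eq_left.2 hKΩ]
  rw [hT]
  -- The sign selects the direction into the phase `i`: down the chart for `Ω₁`, up for its
  -- exterior.
  obtain ⟨e, he, hsweep⟩ : ∃ e : ℝ, (e = 1 ∨ e = -1) ∧ ∀ x ∈ t, ∀ y ∈ frontier U ∩ B x,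
      ∀ s ∈ Set.Ioc 0 ρ, y + s • e • frameUp (R x) ∈ phase U i := by
    fin_cases i
    · exact ⟨-1, Or.inr rfl, fun x hx y hy s hs => by simpa [phase] using hc.down x hx y hy s hs⟩
    · exact ⟨1, Or.inl rfl, fun x hx y hy s hs => by simpa [phase] using hc.up x hx y hy s hs⟩
  -- A translate that leaves `K` would cross `∂K` at a point of the phase `i`. Such points lie on
  -- the two sides at the corner, before the crossings, and the starting point is more than `ε` away
  -- from them in some coordinate, while the path covers at most `ε / 2`.
  have hseg : ∀ x ∈ t, ∀ y ∈ farFromSides U K s P ε ∩ B x, ∀ r ∈ Set.Ioc 0 (c * K.diam),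
      y + r • e • frameUp (R x) ∈ K.carrier ∩ phase U i := by
    intro x hx y hy r hr
    set f : ℝ → Plane := fun r => y + r • e • frameUp (R x) with hf
    have hfc : Continuous f := by fun_prop
    have hnorm : ‖e • frameUp (R x)‖ = 1 := by
      rw [norm_smul, norm_frameUp]; rcases he with rfl | rfl <;> simp
    have hph : ∀ r ∈ Set.Ioc 0 (c * K.diam), f r ∈ phase U i := fun r hr =>
      hsweep x hx y ⟨hy.1.1.1, hy.2⟩ r ⟨hr.1, hr.2.trans hlρ⟩
    refine ⟨?_, hph r hr⟩
    by_contra hout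
    have hne : (f '' Set.Icc 0 r ∩ frontier K.carrier).Nonempty := by
      refine inter_frontier_nonempty_of_isPreconnected K.isOpen_carrier (isPreconnected_Icc.image f hfc.continuousOn) ?_ ?_
      · exact ⟨y, ⟨0, ⟨le_rfl, hr.1.le⟩, by simp [hf]⟩, hy.1.1.2⟩
      · exact ⟨f r, ⟨r, ⟨hr.1.le, le_rfl⟩, rfl⟩, hout⟩
    obtain ⟨_, ⟨r', hr', rfl⟩, hfr⟩ := hne
    have hr0 : 0 < r' := by
      rcases hr'.1.eq_or_lt with h0 | h0
      · rw [← h0] at hfr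
        have : f 0 ∈ K.carrier := by simpa [hf] using hy.1.1.2
        rw [K.isOpen_carrier.frontier_eq] at hfr
        exact absurd this hfr.2
      · exact h0
    obtain ⟨j, k, hjk, h1, h2⟩ := h.of_frontier _ hfr (hph r' ⟨hr0, hr'.2.trans hr.2⟩)
    have hmove : ∀ l, |K.rel s l (f r') - K.rel s l y| ≤ ε / 2 := by
      intro l
      refine (K.abs_rel_sub_le s l _ _).trans (le_trans ?_ (hrel l))
      have hl := K.len_pos l
      gcongr
      rw [dist_eq_norm, hf, add_sub_cancel_left, norm_smul, hnorm, mul_one,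
        Real.norm_of_nonneg hr0.le]
      exact hr'.2.trans hr.2
    have m1 := (abs_le.1 (hmove j)).1
    have m2 := (abs_le.1 (hmove k)).1
    rcases hy.1.2 j k hjk with h3 | h3 <;> linarith
  have hcovG : farFromSides U K s P ε ⊆ ⋃ x : t, frontier U ∩ B x := fun y hy => by
    have := hc.cover hy.1.1
    simp only [Set.mem_iUnion, exists_prop] at this
    obtain ⟨x, hx, hyx⟩ := this
    exact Set.mem_iUnion.2 ⟨⟨x, hx⟩, hy.1.1, hyx⟩
  have hmeas : MeasurableSet (farFromSides U K s P ε) := measurableSet_farFromSides ε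
  refine (energy_iUnion_le hcovG (M := ENNReal.ofReal ((1 + C) * (50 / c) * (p : ℝ) ^ 2 / K.diam) *
    energy (volume.restrict (K.carrier ∩ phase U i)) (evalAt q)) fun x => ?_).trans ?_
  · have hG := hc.onGraph x x.2
    refine (OnGraph.energy_le_of_segments (N := 2 * p)
      (⟨hG.1, Set.inter_subset_left.trans hG.2⟩ :
        OnGraph x (R x) C (ψ x) (frontier U ∩ B x ∩ farFromSides U K s P ε))
      ((isClosed_frontier.measurableSet.inter (hc.isOpen x).measurableSet).inter hmeas)
      (evalAt_continuous q).measurable (by simpa using polyAlong_evalAt hq Finset.univ) hl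
      (T := K.carrier ∩ phase U i)
      (K.isOpen_carrier.inter (isOpen_phase hU i)).measurableSet he
      fun y hy r hr => hseg x x.2 y ⟨hy.2, hy.1.2⟩ r hr).trans ?_
    rw [← mul_assoc, show ((1 + C : ℝ≥0) : ℝ≥0∞) = ENNReal.ofReal (1 + C) by
      rw [← ENNReal.ofReal_coe_nnreal]; simp,
      ← ENNReal.ofReal_mul (by positivity)]
    refine mul_le_mul_left (ENNReal.ofReal_le_ofReal ?_) _
    have hp' : (1 : ℝ) ≤ p := by exact_mod_cast hp1
    have h5 : 2 * (2 * ((2 * p : ℕ) : ℝ) + 1) ^ 2 ≤ 50 * (p : ℝ) ^ 2 := by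
      push_cast; nlinarith
    calc (1 + (C : ℝ)) * (2 * (2 * ((2 * p : ℕ) : ℝ) + 1) ^ 2 / (c * K.diam))
        ≤ (1 + C) * (50 * (p : ℝ) ^ 2 / (c * K.diam)) := by gcongr
      _ = _ := by field_simp
  · rw [Fintype.card_coe, ← mul_assoc, show (t.card : ℝ≥0∞) = ENNReal.ofReal t.card by simp,
      ← ENNReal.ofReal_mul (by positivity)]
    refine mul_le_mul_left (ENNReal.ofReal_le_ofReal (le_of_eq ?_)) _
    ring

end KinkedTrace

end
end UnfittedLDG

/-! ### The trace inequality on every element -/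

namespace UnfittedLDG
noncomputable section
open scoped ENNReal NNReal Topology

open Classical in
/-- The factor by which the deviation of the interface enters the trace inequality. -/
def deviationFactor (Ω U : Set Plane) (p : ℕ) (K : Rect) : ℝ :=
  if IsInterfaceElement U K then
    bigT ((1 + 3 * deviation Ω U K) / (1 - deviation Ω U K)) ^ (4 * p)
  else 1

/-- The part of `∂K` in the phase `i`, together with the interface inside `K`. -/
def phaseBoundary (U : Set Plane) (K : Rect) (i : Fin 2) : Set Plane :=
  (frontier K.carrier ∩ phase U i) ∪ (frontier U ∩ K.carrier)

theorem measurableSet_phaseBoundary {U : Set Plane} (hU : IsOpen U) (K : Rect) (i : Fin 2) :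
    MeasurableSet (phaseBoundary U K i) :=
  (isClosed_frontier.measurableSet.inter (isOpen_phase hU i).measurableSet).union
    (isClosed_frontier.measurableSet.inter K.isOpen_carrier.measurableSet)

theorem one_le_deviationFactor {Ω U : Set Plane} {K : Rect} (h : IsInterfaceElement U K → deviation Ω U K < 1)
    (p : ℕ) : 1 ≤ deviationFactor Ω U p K := by
  unfold deviationFactor
  split_ifs with hK
  · refine one_le_pow₀ (one_le_bigT ?_)
    have h0 : 0 ≤ deviation Ω U K := deviation_nonneg
    have h1 := h hK
    rw [le_div_iff₀ (by linarith)]; linarith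
  · exact le_rfl

/-- The trace inequality in a kinked element. -/
theorem IsLipschitzDomain.exists_trace_of_irregular {U : Set Plane} (hU : IsLipschitzDomain U)
    {δ₀ σ ηm H : ℝ} (hp : IsGoodParam δ₀ σ ηm) (hH : 0 < H) :
    ∃ A, 0 ≤ A ∧ ∀ (Ω : Set Plane) (K : Rect) (i : Fin 2), IsGoodElement Ω U δ₀ σ ηm K →
      IsIrregular Ω U i K → K.diam ≤ H → ∀ p : ℕ, 1 ≤ p → ∀ q : MvPolynomial (Fin 2) ℝ,
      (∀ j, q.degreeOf j ≤ p) →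
      energy (μH[1].restrict (phaseBoundary U K i)) (evalAt q) ≤
        ENNReal.ofReal (A * (p : ℝ) ^ 2 / K.diam *
          bigT ((1 + 3 * deviation Ω U K) / (1 - deviation Ω U K)) ^ (4 * p)) *
        energy (volume.restrict (K.carrier ∩ subdomain Ω U i)) (evalAt q) := by
  obtain ⟨t, R, C, ψ, B, ρ, hc⟩ := hU.exists_chartCover
  have hδ := hp.δ_pos
  have hσ := hp.one_le_σ
  have hρ := hc.pos
  set δ₁ := δ₀ / (2 * σ) with hδ₁
  have hδ₁0 : 0 < δ₁ := by positivity
  have hδ₁δ : δ₁ ≤ δ₀ := div_le_self hδ.le (by linarith)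
  obtain ⟨θ, hθ, hθ1, hθ2, hslack⟩ := exists_slack (η₀ := δ₁ / (4 * σ)) (by positivity) hp.η_lt
  set ε := θ * (δ₀ * δ₁) with hε
  have hε0 : 0 < ε := by positivity
  have hm1 : 0 < 1 - ηm := by linarith [hp.η_lt]
  set m := 4 + t.card with hm
  set A₁ := cornerConst m (max 0 C) ((1 + ηm) / (1 - ηm)) σ
    (min (δ₁ / 2) ((1 - ηm) * (δ₀ * δ₁) / 2)) +
    cornerConst m (max 0 C) 2 σ ε * (32768 / (1 - ηm) ^ 4) with hA₁
  set A₂ := t.card * ((1 + (C : ℝ)) * (50 / min (ε / (4 * σ)) (ρ / H))) with hA₂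
  have hA₁0 : 0 ≤ A₁ := by
    have n1 := cornerConst_nonneg m (max 0 C) ((1 + ηm) / (1 - ηm)) hσ
      (m₀ := min (δ₁ / 2) ((1 - ηm) * (δ₀ * δ₁) / 2)) (lt_min (by positivity) (by positivity))
    have n2 := cornerConst_nonneg m (max 0 C) 2 hσ hε0
    positivity
  have hA₂0 : 0 ≤ A₂ := by
    have : 0 < min (ε / (4 * σ)) (ρ / H) := lt_min (by positivity) (by positivity)
    positivity
  refine ⟨A₂ + (A₁ + A₁), by positivity, fun Ω K i hK hirr hKH p hp1 q hq => ?_⟩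
  obtain ⟨s, P, Q, h⟩ := hK.exists_kinkedCorner hp hU hirr
  have hcov : CoveredByGraphs m (max 0 C) (frontier K.carrier ∪ frontier U) :=
    K.coveredByGraphs_frontier.union hc.coveredByGraphs
  have hd := K.diam_pos
  have hη0 : 0 ≤ deviation Ω U K := deviation_nonneg
  set T := bigT ((1 + 3 * deviation Ω U K) / (1 - deviation Ω U K)) ^ (4 * p) with hT
  have hT1 : 1 ≤ T := by
    refine one_le_pow₀ (one_le_bigT ?_)
    have := hK.deviation_le
    rw [le_div_iff₀ (by linarith)]; linarith
  have n1 := h.energy_near hp hK hδ₁δ hδ₁0 hθ hθ1 hθ2 hslack (show (0 : Fin 2) ≠ 1 by decide) hcov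
    hp1 hq
  have n2 := h.energy_near hp hK hδ₁δ hδ₁0 hθ hθ1 hθ2 hslack (show (1 : Fin 2) ≠ 0 by decide) hcov
    hp1 hq
  have n3 := h.energy_far hK.isOpen hK.subset hK.carrier_subset hσ hK.aspect hc hε0 hKH hp1 hq
  rw [← hε, ← hA₁, ← hT] at n1 n2
  rw [← hA₂] at n3
  set Y := energy (volume.restrict (K.carrier ∩ subdomain Ω U i)) (evalAt q)
  have n3' : energy (μH[1].restrict (farFromSides U K s P ε)) (evalAt q) ≤
      ENNReal.ofReal (A₂ * (p : ℝ) ^ 2 / K.diam * T) * Y := by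
    refine n3.trans (mul_le_mul_left (ENNReal.ofReal_le_ofReal ?_) _)
    exact le_mul_of_one_le_right (by positivity) hT1
  calc energy (μH[1].restrict (phaseBoundary U K i)) (evalAt q)
      ≤ energy (μH[1].restrict (farFromSides U K s P ε)) (evalAt q) +
        (energy (μH[1].restrict (nearSide U K i s 0 1 (P 1) ε)) (evalAt q) +
        energy (μH[1].restrict (nearSide U K i s 1 0 (P 0) ε)) (evalAt q)) :=
        (energy_mono_set (h.subset_union ε) _).trans ((energy_union_le _ _ _).trans
          (add_le_add_right (energy_union_le _ _ _) _))
    _ ≤ ENNReal.ofReal (A₂ * (p : ℝ) ^ 2 / K.diam * T) * Y +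
        (ENNReal.ofReal (A₁ * (p : ℝ) ^ 2 / K.diam * T) * Y +
        ENNReal.ofReal (A₁ * (p : ℝ) ^ 2 / K.diam * T) * Y) :=
        add_le_add n3' (add_le_add n1 n2)
    _ = _ := by
        rw [← add_mul, ← add_mul, ← ENNReal.ofReal_add (by positivity) (by positivity),
          ← ENNReal.ofReal_add (by positivity) (by positivity)]
        congr 2; ring

/-- The trace inequality, with a constant that depends on the interface and the mesh regularity
only. -/
theorem IsLipschitzDomain.exists_trace {U : Set Plane} (hU : IsLipschitzDomain U)
    {δ₀ σ ηm H : ℝ} (hp : IsGoodParam δ₀ σ ηm) (hH : 0 < H) :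
    ∃ A > 0, ∀ (Ω : Set Plane) (K : Rect) (i : Fin 2), U ⊆ Ω → K.carrier ⊆ Ω →
      (∀ j k, K.len j ≤ σ * K.len k) → (IsInterfaceElement U K → IsGoodElement Ω U δ₀ σ ηm K) →
      K.diam ≤ H → ∀ p : ℕ, 1 ≤ p → ∀ q : MvPolynomial (Fin 2) ℝ, (∀ j, q.degreeOf j ≤ p) →
      energy (μH[1].restrict (phaseBoundary U K i)) (evalAt q) ≤
        ENNReal.ofReal (A * (p : ℝ) ^ 2 / K.diam * deviationFactor Ω U p K) *
        energy (volume.restrict (K.carrier ∩ subdomain Ω U i)) (evalAt q) := by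
  obtain ⟨A₀, hA₀, hirr⟩ := hU.exists_trace_of_irregular hp hH
  obtain ⟨t, R, C, ψ, B, ρ, hc⟩ := hU.exists_chartCover
  have hδ := hp.δ_pos
  have hσ := hp.one_le_σ
  have hm1 : 0 < 1 - ηm := by linarith [hp.η_lt]
  set m := 4 + t.card
  have n1 := cornerConst_nonneg m (max 0 C) ((1 + ηm) / (1 - ηm)) hσ
    (m₀ := (1 - ηm) * δ₀ ^ 2 / 2) (by positivity)
  have n2 := cornerConst_nonneg m (max 0 C) 1 hσ one_pos
  set A₁ := cornerConst m (max 0 C) ((1 + ηm) / (1 - ηm)) σ ((1 - ηm) * δ₀ ^ 2 / 2)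
  set A₂ := cornerConst m (max 0 C) 1 σ 1
  -- The constants of the irregular, the regular and the interface-free case; the summand `1` makes
  -- the sum positive.
  refine ⟨A₀ + A₁ + A₂ + 1, by positivity, fun Ω K i hUΩ hKΩ hasp hgood hKH p hp1 q hq => ?_⟩
  have hcov : CoveredByGraphs m (max 0 C) (frontier K.carrier ∪ frontier U) :=
    K.coveredByGraphs_frontier.union hc.coveredByGraphs
  have hcov' : CoveredByGraphs m (max 0 C) (phaseBoundary U K i) := hcov.mono (by
    rintro x (hx | hx)
    exacts [Or.inl hx.1, Or.inr hx.1])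
  have hE := measurableSet_phaseBoundary hU.isOpen K i
  have hd := K.diam_pos
  by_cases hint : IsInterfaceElement U K
  · have hK := hgood hint
    have hη0 : 0 ≤ deviation Ω U K := deviation_nonneg
    rw [deviationFactor, if_pos hint]
    set T := bigT ((1 + 3 * deviation Ω U K) / (1 - deviation Ω U K)) ^ (4 * p)
    have hT1 : 1 ≤ T := by
      refine one_le_pow₀ (one_le_bigT ?_)
      have := hK.deviation_le
      rw [le_div_iff₀ (by linarith)]; linarith
    by_cases hi : IsIrregular Ω U i K
    · refine (hirr Ω K i hK hi hKH p hp1 q hq).trans (mul_le_mul_left (ENNReal.ofReal_le_ofReal ?_) _)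
      gcongr; linarith
    · refine (energy_trace_of_regular hp hK hi hE hcov' subset_rfl hp1 hq).trans
        (mul_le_mul_left (ENNReal.ofReal_le_ofReal ?_) _)
      gcongr; linarith
  · have hdis : Disjoint K.carrier (frontier U) := by
      rwa [Set.disjoint_iff_inter_eq_empty, ← Set.not_nonempty_iff_eq_empty]
    rw [deviationFactor, if_neg hint, mul_one]
    refine (energy_trace_of_empty hσ hU.isOpen hUΩ hKΩ hasp hdis hE hcov' ?_ hp1 hq).trans
      (mul_le_mul_left (ENNReal.ofReal_le_ofReal ?_) _)
    · rintro x (hx | hx)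
      · exact hx
      · exact absurd hx.1 (Set.disjoint_left.1 hdis hx.2)
    · gcongr; linarith

end
end UnfittedLDG

namespace UnfittedLDG
noncomputable section
open scoped ENNReal NNReal Topology

/-! ### Locally bounded measurable functions -/

/-- Borel functions that are bounded on bounded sets. -/
structure IsLocBdd (f : Plane → ℝ) : Prop where
  measurable : Measurable f
  bdd : ∀ E, Bornology.IsBounded E → ∃ C, ∀ x ∈ E, |f x| ≤ C

namespace IsLocBdd

variable {f g : Plane → ℝ}

theorem of_continuous (hf : Continuous f) : IsLocBdd f := by
  refine ⟨hf.measurable, fun E hE => ?_⟩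
  obtain ⟨C, hC⟩ := (hE.isCompact_closure.image hf).isBounded.exists_norm_le
  exact ⟨C, fun x hx => hC _ ⟨x, subset_closure hx, rfl⟩⟩

theorem const (c : ℝ) : IsLocBdd fun _ => c := of_continuous continuous_const

theorem add (hf : IsLocBdd f) (hg : IsLocBdd g) : IsLocBdd fun x => f x + g x := by
  refine ⟨hf.measurable.add hg.measurable, fun E hE => ?_⟩
  obtain ⟨C, hC⟩ := hf.bdd E hE
  obtain ⟨D, hD⟩ := hg.bdd E hE
  exact ⟨C + D, fun x hx => (abs_add_le _ _).trans (add_le_add (hC x hx) (hD x hx))⟩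

theorem mul (hf : IsLocBdd f) (hg : IsLocBdd g) : IsLocBdd fun x => f x * g x := by
  refine ⟨hf.measurable.mul hg.measurable, fun E hE => ?_⟩
  obtain ⟨C, hC⟩ := hf.bdd E hE
  obtain ⟨D, hD⟩ := hg.bdd E hE
  refine ⟨C * D, fun x hx => ?_⟩
  rw [abs_mul]
  exact mul_le_mul (hC x hx) (hD x hx) (abs_nonneg _) ((abs_nonneg _).trans (hC x hx))

theorem sub (hf : IsLocBdd f) (hg : IsLocBdd g) : IsLocBdd fun x => f x - g x := by
  have := hf.add ((const (-1)).mul hg)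
  simpa [sub_eq_add_neg] using this

theorem sq (hf : IsLocBdd f) : IsLocBdd fun x => f x ^ 2 := by
  simpa [pow_two] using hf.mul hf

theorem sum {ι : Type*} {s : Finset ι} {f : ι → Plane → ℝ} (h : ∀ k ∈ s, IsLocBdd (f k)) :
    IsLocBdd fun x => ∑ k ∈ s, f k x := by
  classical
  induction s using Finset.induction_on with
  | empty => simpa using const 0
  | insert a s ha ih =>
    simp only [Finset.sum_insert ha]
    exact (h a (Finset.mem_insert_self a s)).add
      (ih fun k hk => h k (Finset.mem_insert_of_mem hk))

theorem integrableOn (hf : IsLocBdd f) {μ : Measure Plane} {E : Set Plane}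
    (hE : Bornology.IsBounded E) (hm : MeasurableSet E) (hμ : μ E < ⊤) : IntegrableOn f E μ := by
  obtain ⟨C, hC⟩ := hf.bdd E hE
  refine Measure.integrableOn_of_bounded hμ.ne hf.measurable.aestronglyMeasurable (M := C) ?_
  filter_upwards [ae_restrict_mem hm] with x hx using hC x hx

end IsLocBdd

theorem isLocBdd_evalAt (q : MvPolynomial (Fin 2) ℝ) : IsLocBdd (evalAt q) :=
  .of_continuous (evalAt_continuous q)

theorem isLocBdd_traceFrom (U : Set Plane) (v : Broken) (K : Rect) :
    IsLocBdd (traceFrom U v K) := by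
  classical
  refine ⟨Measurable.ite isClosed_closure.measurableSet (evalAt_continuous _).measurable
    (evalAt_continuous _).measurable, fun E hE => ?_⟩
  obtain ⟨C, hC⟩ := (isLocBdd_evalAt (v K 0)).bdd E hE
  obtain ⟨D, hD⟩ := (isLocBdd_evalAt (v K 1)).bdd E hE
  refine ⟨max C D, fun x hx => ?_⟩
  unfold traceFrom
  split_ifs
  · exact (hC x hx).trans (le_max_left _ _)
  · exact (hD x hx).trans (le_max_right _ _)

theorem abs_outerNormal_le (U : Set Plane) (x : Plane) (j : Fin 2) : |outerNormal U x j| ≤ 1 :=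
  (PiLp.norm_apply_le (outerNormal U x) j).trans (norm_outerNormal_le U x)

theorem isLocBdd_outerNormal (U : Set Plane) (j : Fin 2) :
    IsLocBdd fun x => outerNormal U x j := by
  refine ⟨?_, fun E _ => ⟨1, fun x _ => abs_outerNormal_le U x j⟩⟩
  exact (show Continuous fun x : Plane => x j by fun_prop).measurable.comp
    (measurable_outerNormal U)

theorem abs_sideNormal_le (e : Rect × Rect) (j : Fin 2) : |sideNormal e j| ≤ 1 := by
  unfold sideNormal
  simp only
  split_ifs <;> simp

/-- The energy as a Bochner integral. -/
theorem ofReal_integral_sq {f : Plane → ℝ} (hf : IsLocBdd f) {μ : Measure Plane} {E : Set Plane}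
    (hE : Bornology.IsBounded E) (hm : MeasurableSet E) (hμ : μ E < ⊤) :
    ENNReal.ofReal (∫ x in E, f x ^ 2 ∂μ) = energy (μ.restrict E) f :=
  ofReal_integral_eq_lintegral_ofReal (hf.sq.integrableOn hE hm hμ)
    (Filter.Eventually.of_forall fun _ => sq_nonneg _)

/-! ### Measures of the edges -/

theorem CoveredByGraphs.measure_lt_top {m : ℕ} {C : ℝ≥0} {E : Set Plane}
    (h : CoveredByGraphs m C E) (hE : MeasurableSet E) (hb : Bornology.IsBounded E) :
    μH[1] E < ⊤ := by
  obtain ⟨ι, i, x₀, R, ψ, G, h1, h2, h3⟩ := h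
  have h4 : E ⊆ ⋃ k, G k ∩ E := fun x hx => by
    obtain ⟨k, hk⟩ := Set.mem_iUnion.1 (h3 hx)
    exact Set.mem_iUnion.2 ⟨k, hk, hx⟩
  refine (measure_mono h4).trans_lt ((measure_iUnion_le _).trans_lt ?_)
  rw [tsum_fintype]
  refine ENNReal.sum_lt_top.2 fun k _ => ?_
  exact OnGraph.measure_lt_top (x₀ := x₀ k) (R := R k) (C := C) (ψ := ψ k)
    ⟨(h2 k).2.1, Set.inter_subset_left.trans (h2 k).2.2⟩ ((h2 k).1.inter hE)
    (hb.subset Set.inter_subset_right)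

theorem Rect.isBounded_frontier (K : Rect) : Bornology.IsBounded (frontier K.carrier) :=
  K.isBounded_carrier.closure.subset frontier_subset_closure

theorem Rect.hausdorffMeasure_frontier_lt_top (K : Rect) : μH[1] (frontier K.carrier) < ⊤ :=
  K.coveredByGraphs_frontier.measure_lt_top isClosed_frontier.measurableSet K.isBounded_frontier

/-! ### Overlap of the closed elements of a mesh -/

/-- For each axis, whether `x` lies below the upper face of the rectangle tells which direction
leads from `x` into it. Two closed rectangles with the same answers contain a common open quadrant
near `x`, so they overlap. Hence at most four closed elements share a point, hanging nodes included.
-/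
theorem Rect.eq_of_disjoint_of_mem_closure {M : Finset Rect}
    (hM : ∀ K ∈ M, ∀ K' ∈ M, K ≠ K' → Disjoint K.carrier K'.carrier) {x : Plane} {K K' : Rect}
    (hK : K ∈ M) (hK' : K' ∈ M) (hx : x ∈ closure K.carrier) (hx' : x ∈ closure K'.carrier)
    (h : ∀ j, x j < K.hi j ↔ x j < K'.hi j) : K = K' := by
  by_contra hne
  have hcl : ∀ (K : Rect), x ∈ closure K.carrier → ∀ j, K.lo j ≤ x j ∧ x j ≤ K.hi j := by
    intro K hx j
    have h1 := (K.mem_closure_iff_rel fun _ => false).1 hx j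
    have h2 := K.lt j
    simp only [Rect.rel, Rect.endpt, Bool.false_eq_true, if_false, Bool.not_false, if_true] at h1
    have h3 : 0 < K.hi j - K.lo j := by linarith
    have h4 := h1.1
    have h5 := h1.2
    rw [le_div_iff₀ h3] at h4
    rw [div_le_iff₀ h3] at h5
    constructor <;> linarith
  have hin : ∀ (K : Rect) (j : Fin 2), K.lo j ≤ x j → x j ≤ K.hi j → ∃ ε > 0, ∀ t ∈ Set.Ioo 0 ε,
      K.lo j < x j + (if x j < K.hi j then t else -t) ∧
      x j + (if x j < K.hi j then t else -t) < K.hi j := by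
    intro K j h1 h2
    have h3 := K.lt j
    split_ifs with h
    · exact ⟨K.hi j - x j, by linarith, fun t ht => ⟨by linarith [ht.1], by linarith [ht.2]⟩⟩
    · exact ⟨x j - K.lo j, by linarith, fun t ht => ⟨by linarith [ht.2], by linarith [ht.1]⟩⟩
  choose ε hε hεK using fun j => hin K j (hcl K hx j).1 (hcl K hx j).2
  choose ε' hε' hεK' using fun j => hin K' j (hcl K' hx' j).1 (hcl K' hx' j).2
  choose t ht using fun j => exists_between (lt_min (hε j) (hε' j))
  set y : Plane := WithLp.toLp 2 fun j => x j + if x j < K.hi j then t j else -t j with hy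
  refine Set.disjoint_left.1 (hM K hK K' hK' hne)
    (show y ∈ K.carrier from fun j => ?_) (show y ∈ K'.carrier from fun j => ?_)
  · exact hεK j (t j) ⟨(ht j).1, (ht j).2.trans_le (min_le_left _ _)⟩
  · have := hεK' j (t j) ⟨(ht j).1, (ht j).2.trans_le (min_le_right _ _)⟩
    simp only [← h] at this
    exact this

open Classical in
theorem card_closure_le_four {M : Finset Rect}
    (hM : ∀ K ∈ M, ∀ K' ∈ M, K ≠ K' → Disjoint K.carrier K'.carrier) (x : Plane) :
    (M.filter fun K => x ∈ closure K.carrier).card ≤ 4 := by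
  have h : Set.InjOn (fun (K : Rect) (j : Fin 2) => decide (x j < K.hi j))
      (M.filter fun K => x ∈ closure K.carrier) := by
    intro K hK K' hK' he
    simp only [Finset.coe_filter, Set.mem_ofPred_eq] at hK hK'
    exact Rect.eq_of_disjoint_of_mem_closure hM hK.1 hK'.1 hK.2 hK'.2 fun j => by
      simpa using congrFun he j
  have := Finset.card_le_card_of_injOn _ (t := Finset.univ) (fun _ _ => Finset.mem_univ _) h
  simpa using this

open Classical in
/-- A finite family of sets that covers no point more than `n` times. -/
theorem sum_energy_le_of_multiplicity {ι : Type*} (s : Finset ι) (A : ι → Set Plane)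
    (hA : ∀ k ∈ s, MeasurableSet (A k)) {F : Set Plane} {n : ℕ}
    (hn : ∀ x, (s.filter fun k => x ∈ A k).card ≤ n) {μ : Measure Plane} {f : Plane → ℝ}
    (hf : Measurable f) :
    ∑ k ∈ s, energy (μ.restrict (A k ∩ F)) f ≤ n * energy (μ.restrict F) f := by
  have h1 : ∀ k ∈ s, energy (μ.restrict (A k ∩ F)) f =
      ∫⁻ x in F, (A k).indicator (fun x => ENNReal.ofReal (f x ^ 2)) x ∂μ := fun k hk => by
    rw [energy, lintegral_indicator (hA k hk), Measure.restrict_restrict (hA k hk)]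
  rw [Finset.sum_congr rfl h1, ← lintegral_finsetSum _ fun k hk =>
    Measurable.indicator (by fun_prop) (hA k hk), energy, ← lintegral_const_mul _ (by fun_prop)]
  refine lintegral_mono fun x => ?_
  calc ∑ k ∈ s, (A k).indicator (fun x => ENNReal.ofReal (f x ^ 2)) x
      = ∑ k ∈ s.filter (fun k => x ∈ A k), ENNReal.ofReal (f x ^ 2) := by
        rw [Finset.sum_filter]
        exact Finset.sum_congr rfl fun k _ => by rw [Set.indicator_apply]
    _ = (s.filter fun k => x ∈ A k).card * ENNReal.ofReal (f x ^ 2) := by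
        rw [Finset.sum_const, nsmul_eq_mul]
    _ ≤ _ := by
        gcongr
        exact hn x

end
end UnfittedLDG

namespace UnfittedLDG
noncomputable section
open scoped ENNReal NNReal Topology

/-! ### Admissible meshes -/

/-- The upper bound for the deviations. -/
def deviationBound (δ₀ : ℝ) : ℝ := max (1 / 2) ((1 - δ₀) / (1 + δ₀))

theorem deviationBound_lt_one {δ₀ : ℝ} (h : 0 < δ₀) : deviationBound δ₀ < 1 :=
  max_lt (by norm_num) (by rw [div_lt_one (by linarith)]; linarith)

theorem isGoodParam {δ₀ : ℝ} (h : δ₀ ∈ Set.Ioo (0 : ℝ) (1 / 2)) (σ : ℝ) :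
    IsGoodParam δ₀ (max σ 1) (deviationBound δ₀) :=
  ⟨h.1, h.2, le_max_right _ _, deviationBound_lt_one h.1⟩

section Mesh

variable {Ω U : Set Plane} {δ₀ σ ρ : ℝ} {M : Finset Rect}

theorem IsAdmissibleMesh.aspect_max (h : IsAdmissibleMesh Ω U δ₀ σ ρ M) {K : Rect} (hK : K ∈ M)
    (j k : Fin 2) : K.len j ≤ max σ 1 * K.len k :=
  (h.aspect K hK j k).trans (mul_le_mul_of_nonneg_right (le_max_left _ _) (K.len_pos k).le)

theorem IsAdmissibleMesh.isGoodElement (h : IsAdmissibleMesh Ω U δ₀ σ ρ M) (hU : IsOpen U)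
    (hUΩ : U ⊆ Ω) {K : Rect} (hK : K ∈ M) (hint : IsInterfaceElement U K) :
    IsGoodElement Ω U δ₀ (max σ 1) (deviationBound δ₀) K :=
  ⟨hU, hUΩ, h.subset K hK, h.crosses K hK hint, h.large K hK hint, h.one_singular K hK,
    h.aspect_max hK, h.deviation_le K hK hint⟩

theorem IsAdmissibleMesh.one_le_deviationFactor (h : IsAdmissibleMesh Ω U δ₀ σ ρ M) (hδ : 0 < δ₀)
    {K : Rect} (hK : K ∈ M) (p : ℕ) : 1 ≤ deviationFactor Ω U p K :=
  UnfittedLDG.one_le_deviationFactor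
    (fun hint => (h.deviation_le K hK hint).trans_lt (deviationBound_lt_one hδ)) p

end Mesh

theorem energy_eq_zero_of_null {μ : Measure Plane} {E : Set Plane} (h : μ E = 0) (f : Plane → ℝ) :
    energy (μ.restrict E) f = 0 := by
  rw [energy, Measure.restrict_eq_zero.2 h, lintegral_zero_measure]

theorem energy_congr_on {μ : Measure Plane} {E : Set Plane} (hE : MeasurableSet E) {f g : Plane → ℝ}
    (h : ∀ x ∈ E, f x = g x) : energy (μ.restrict E) f = energy (μ.restrict E) g :=
  setLIntegral_congr_fun hE fun x hx => by simp only [h x hx]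

theorem traceFrom_of_mem_phase {U : Set Plane} (v : Broken) (K : Rect) {i : Fin 2} {x : Plane}
    (hx : x ∈ phase U i) : traceFrom U v K x = evalAt (v K i) x := by
  unfold traceFrom
  fin_cases i
  · rw [if_pos (subset_closure (by simpa [phase] using hx))]; rfl
  · rw [if_neg (by simpa [phase] using hx)]; rfl

/-- The trace consists of the traces in the two phases. -/
theorem energy_le_sum_phase {U : Set Plane} (hU : IsOpen U) {E : Set Plane} (hE : MeasurableSet E)
    (h0 : μH[1] (frontier U ∩ E) = 0) {f : Plane → ℝ} {g : Fin 2 → Plane → ℝ}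
    (h : ∀ i, ∀ x ∈ E, x ∈ phase U i → f x = g i x) :
    energy (μH[1].restrict E) f ≤ ∑ i, energy (μH[1].restrict (E ∩ phase U i)) (g i) := by
  have hsub : E ⊆ (frontier U ∩ E) ∪ ((E ∩ phase U 0) ∪ (E ∩ phase U 1)) := by
    intro x hx
    by_cases hf : x ∈ frontier U
    · exact Or.inl ⟨hf, hx⟩
    · obtain ⟨i, hi⟩ := exists_mem_phase hU hf
      fin_cases i
      · exact Or.inr (Or.inl ⟨hx, hi⟩)
      · exact Or.inr (Or.inr ⟨hx, hi⟩)
  calc energy (μH[1].restrict E) f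
      ≤ energy (μH[1].restrict (frontier U ∩ E)) f +
        (energy (μH[1].restrict (E ∩ phase U 0)) f + energy (μH[1].restrict (E ∩ phase U 1)) f) :=
        (energy_mono_set hsub _).trans ((energy_union_le _ _ _).trans
          (add_le_add_right (energy_union_le _ _ _) _))
    _ = ∑ i, energy (μH[1].restrict (E ∩ phase U i)) (g i) := by
        rw [energy_eq_zero_of_null h0, zero_add, Fin.sum_univ_two]
        congr 1 <;>
          exact energy_congr_on (hE.inter (isOpen_phase hU _).measurableSet)
            fun x hx => h _ x hx.1 hx.2

/-! ### The penalty function -/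

namespace Scheme

variable {Ω Ω₁ : Set Plane} {α₀ : ℝ} {D : Scheme Ω Ω₁ α₀} {δ₀ σ ρ : ℝ}

theorem thetaElt_eq (D : Scheme Ω Ω₁ α₀) (K : Rect) :
    D.thetaElt K = deviationFactor Ω Ω₁ D.p K := rfl

theorem le_maxNear {f : Rect → ℝ} {e : Set Plane} {K : Rect} (hK : K ∈ D.mesh)
    (he : (e ∩ closure K.carrier).Nonempty) : f K ≤ D.maxNear f e := by
  refine le_csSup (Set.Finite.bddAbove ?_) ⟨K, hK, he, rfl⟩
  refine (D.mesh.finite_toSet.image f).subset ?_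
  rintro _ ⟨K, hK, -, rfl⟩
  exact ⟨K, hK, rfl⟩

theorem Admissible.aElt_pos (hD : D.Admissible δ₀ σ ρ) (K : Rect) : 0 < D.aElt K := by
  have h0 := hD.a_pos 0
  have h1 := hD.a_pos 1
  unfold aElt
  split_ifs <;> linarith

/-- On an interface element the mean of the two coefficients is at least half of either; on any
other element that touches phase `i` the coefficient is `a_i` itself. This makes all constants
independent of the contrast. -/
theorem Admissible.half_le_aElt (hD : D.Admissible δ₀ σ ρ) (hU : IsOpen Ω₁) {K : Rect} {i : Fin 2}
    (h : IsInterfaceElement Ω₁ K ∨ (closure K.carrier ∩ phase Ω₁ i).Nonempty) :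
    D.a i / 2 ≤ D.aElt K := by
  have h0 := hD.a_pos 0
  have h1 := hD.a_pos 1
  unfold aElt
  by_cases hint : IsInterfaceElement Ω₁ K
  · rw [if_pos hint]
    fin_cases i <;> simp only [Fin.zero_eta, Fin.mk_one] <;> linarith
  · rw [if_neg hint]
    have hdis : Disjoint K.carrier (frontier Ω₁) := by
      rwa [Set.disjoint_iff_inter_eq_empty, ← Set.not_nonempty_iff_eq_empty]
    obtain ⟨x, hx, hxi⟩ := h.resolve_left hint
    have hK := subset_phase_of_mem_closure hU K.isPreconnected_carrier hdis hx hxi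
    fin_cases i
    · rw [if_pos (by simpa [phase] using hK)]
      simp only [Fin.zero_eta]; linarith
    · rw [if_neg]
      · simp only [Fin.mk_one]; linarith
      · intro hK'
        obtain ⟨y, hy⟩ : (K.carrier).Nonempty := closure_nonempty_iff.1 ⟨x, hx⟩
        exact (by simpa [phase] using hK hy : y ∉ closure Ω₁) (subset_closure (hK' hy))

/-- The penalty takes maxima over all elements that touch the edge, so it dominates the expression
formed with any one of them. Each trace on an edge can thus be estimated on its own element. -/
theorem Admissible.le_penalty (hD : D.Admissible δ₀ σ ρ) (hδ : 0 < δ₀) (hα : 0 < α₀) {K : Rect}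
    (hK : K ∈ D.mesh) {e : Set Plane} (he : (e ∩ closure K.carrier).Nonempty) {h b a : ℝ}
    (h0 : 0 < h) (hh : h ≤ b * K.diam) (ha0 : 0 ≤ a) (ha : a ≤ D.aElt K) :
    α₀ * a * deviationFactor Ω Ω₁ D.p K * (b * K.diam)⁻¹ * (D.p : ℝ) ^ 2 ≤ D.penalty e h := by
  have h1 : a ≤ D.maxNear D.aElt e := ha.trans (le_maxNear hK he)
  have h2 : deviationFactor Ω Ω₁ D.p K ≤ D.maxNear D.thetaElt e :=
    D.thetaElt_eq K ▸ le_maxNear hK he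
  have h3 := hD.mesh.one_le_deviationFactor hδ hK D.p
  have hp := hD.one_le_p
  unfold penalty
  have : 0 ≤ D.maxNear D.aElt e := ha0.trans h1
  have : 0 ≤ D.maxNear D.thetaElt e := by linarith
  have : (0 : ℝ) ≤ (b * K.diam)⁻¹ := inv_nonneg.2 (h0.le.trans hh)
  gcongr

theorem Admissible.penalty_pos (hD : D.Admissible δ₀ σ ρ) (hδ : 0 < δ₀) (hα : 0 < α₀) {K : Rect}
    (hK : K ∈ D.mesh) {e : Set Plane} (he : (e ∩ closure K.carrier).Nonempty) {h : ℝ}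
    (h0 : 0 < h) : 0 < D.penalty e h := by
  have hd := K.diam_pos
  refine lt_of_lt_of_le ?_ (hD.le_penalty hδ hα hK he h0 (b := h / K.diam)
    (by field_simp; exact le_rfl) (hD.aElt_pos K).le le_rfl)
  have h3 := hD.mesh.one_le_deviationFactor hδ hK D.p
  have hp : 0 < D.p := hD.one_le_p
  have := hD.aElt_pos K
  positivity

/-- The reciprocal penalty near the element `K`, in the phase `i`. -/
def weight (D : Scheme Ω Ω₁ α₀) (b : ℝ) (K : Rect) (i : Fin 2) : ℝ :=
  2 * b / α₀ * K.diam / (D.a i * deviationFactor Ω Ω₁ D.p K * (D.p : ℝ) ^ 2)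

theorem Admissible.inv_penalty_le (hD : D.Admissible δ₀ σ ρ) (hδ : 0 < δ₀) (hα : 0 < α₀)
    {K : Rect} (hK : K ∈ D.mesh) {e : Set Plane} (he : (e ∩ closure K.carrier).Nonempty) {h b : ℝ}
    (h0 : 0 < h) (hb : 0 < b) (hh : h ≤ b * K.diam) {i : Fin 2} (ha : D.a i / 2 ≤ D.aElt K) :
    (D.penalty e h)⁻¹ ≤ D.weight b K i := by
  have hd := K.diam_pos
  have h3 := hD.mesh.one_le_deviationFactor hδ hK D.p
  have hp : 0 < D.p := hD.one_le_p
  have hai := hD.a_pos i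
  have h4 := hD.le_penalty hδ hα hK he h0 hh (by positivity) ha
  refine (inv_anti₀ (by positivity) h4).trans (le_of_eq ?_)
  rw [weight]; field_simp

end Scheme

end
end UnfittedLDG

/-! ### Summation over the mesh: fluxes against energies of the elements -/

namespace UnfittedLDG
noncomputable section
open scoped ENNReal NNReal Topology

theorem Adjacent.symm {K K' : Rect} (h : Adjacent K K') : Adjacent K' K :=
  ⟨h.1.symm, by rw [Set.inter_comm]; exact h.2⟩

namespace Scheme

variable {Ω Ω₁ : Set Plane} {α₀ : ℝ} {D : Scheme Ω Ω₁ α₀} {δ₀ σ ρ : ℝ}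

theorem measurableSet_sideSet (e : Rect × Rect) : MeasurableSet (sideSet e) :=
  (isClosed_frontier.inter isClosed_frontier).measurableSet

theorem measurableSet_intSet (D : Scheme Ω Ω₁ α₀) (K : Rect) : MeasurableSet (D.intSet K) :=
  isClosed_frontier.measurableSet.inter K.isOpen_carrier.measurableSet

theorem measurableSet_bdySet (D : Scheme Ω Ω₁ α₀) (K : Rect) : MeasurableSet (D.bdySet K) :=
  (isClosed_frontier.inter isClosed_frontier).measurableSet

/-- Comparison of the mesh size on a side with the two elements. -/
theorem Admissible.side_size_le (hD : D.Admissible δ₀ σ ρ) {e : Rect × Rect} (he : e ∈ D.sides) :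
    (e.1.diam + e.2.diam) / 2 ≤ (1 + |ρ|) * e.1.diam ∧
      (e.1.diam + e.2.diam) / 2 ≤ (1 + |ρ|) * e.2.diam := by
  obtain ⟨h1, h2, h3⟩ := hD.sides.1 e he
  have d1 := e.1.diam_pos
  have d2 := e.2.diam_pos
  have c1 := hD.mesh.comparable _ h1 _ h2 h3
  have c2 := hD.mesh.comparable _ h2 _ h1 h3.symm
  have r := le_abs_self ρ
  have r0 := abs_nonneg ρ
  constructor <;> nlinarith

theorem Admissible.sideSet_nonempty (hD : D.Admissible δ₀ σ ρ) {e : Rect × Rect}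
    (he : e ∈ D.sides) : (sideSet e).Nonempty :=
  nonempty_of_measure_ne_zero (hD.sides.1 e he).2.2.2.ne'

/-- One edge, seen from one element. -/
theorem Admissible.inv_penalty_mul_energy_le (hD : D.Admissible δ₀ σ ρ) (hU : IsOpen Ω₁)
    (hδ : 0 < δ₀) (hα : 0 < α₀) {K : Rect} (hK : K ∈ D.mesh) {e : Set Plane}
    (he : e ⊆ frontier K.carrier) (hem : MeasurableSet e) {h : ℝ} (h0 : 0 < h)
    (hh : h ≤ (1 + |ρ|) * K.diam) (r : Broken) :
    ENNReal.ofReal (D.penalty e h)⁻¹ * energy (μH[1].restrict e) (traceFrom Ω₁ r K) ≤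
      ∑ i, ENNReal.ofReal (D.weight (1 + |ρ|) K i) *
        energy (μH[1].restrict (e ∩ (frontier K.carrier ∩ phase Ω₁ i))) (evalAt (r K i)) := by
  -- On the interface itself `traceFrom` picks a phase by convention; these points are negligible on
  -- the boundaries of elements.
  have hnull : μH[1] (frontier Ω₁ ∩ e) = 0 :=
    measure_mono_null (Set.inter_subset_inter_right _ he) (hD.mesh.interface_skeleton K hK)
  refine (mul_le_mul_right (energy_le_sum_phase hU hem hnull
    (g := fun i => evalAt (r K i)) fun i x _ hx => traceFrom_of_mem_phase r K hx) _).trans ?_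
  rw [Finset.mul_sum]
  refine Finset.sum_le_sum fun i _ => ?_
  rw [← Set.inter_assoc, Set.inter_eq_left.2 he]
  -- The penalty is comparable to `a_i` only if phase `i` is present at the edge; otherwise that
  -- phase contributes nothing.
  rcases (e ∩ phase Ω₁ i).eq_empty_or_nonempty with h1 | ⟨x, hx, hxi⟩
  · rw [h1, energy_eq_zero_of_null measure_empty]; simp
  · have hxK : x ∈ closure K.carrier := frontier_subset_closure (he hx)
    refine mul_le_mul_left (ENNReal.ofReal_le_ofReal ?_) _
    exact hD.inv_penalty_le hδ hα hK ⟨x, hx, hxK⟩ h0 (by positivity) hh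
      (hD.half_le_aElt hU (Or.inr ⟨x, hxK, hxi⟩))

open Classical in
/-- All sides of one element. -/
theorem Admissible.sum_sides_le (hD : D.Admissible δ₀ σ ρ) (hU : IsOpen Ω₁)
    (hδ : 0 < δ₀) (hα : 0 < α₀) {K : Rect} (hK : K ∈ D.mesh) {S : Finset (Rect × Rect)}
    (hS : ∀ e ∈ S, sideSet e ⊆ frontier K.carrier ∧
      (e.1.diam + e.2.diam) / 2 ≤ (1 + |ρ|) * K.diam)
    (hn : ∀ x, (S.filter fun e => x ∈ sideSet e).card ≤ 4) (r : Broken) :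
    ∑ e ∈ S, ENNReal.ofReal (D.αSide e)⁻¹ *
        energy (μH[1].restrict (sideSet e)) (traceFrom Ω₁ r K) ≤
      4 * ∑ i, ENNReal.ofReal (D.weight (1 + |ρ|) K i) *
        energy (μH[1].restrict (frontier K.carrier ∩ phase Ω₁ i)) (evalAt (r K i)) := by
  calc _ ≤ ∑ e ∈ S, ∑ i, ENNReal.ofReal (D.weight (1 + |ρ|) K i) *
        energy (μH[1].restrict (sideSet e ∩ (frontier K.carrier ∩ phase Ω₁ i)))
          (evalAt (r K i)) := by
        refine Finset.sum_le_sum fun e he => ?_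
        have d1 := e.1.diam_pos
        have d2 := e.2.diam_pos
        exact hD.inv_penalty_mul_energy_le hU hδ hα hK (hS e he).1 (measurableSet_sideSet e)
          (by positivity) (hS e he).2 r
    _ = ∑ i, ENNReal.ofReal (D.weight (1 + |ρ|) K i) * ∑ e ∈ S,
        energy (μH[1].restrict (sideSet e ∩ (frontier K.carrier ∩ phase Ω₁ i)))
          (evalAt (r K i)) := by
        rw [Finset.sum_comm]
        exact Finset.sum_congr rfl fun i _ => by rw [Finset.mul_sum]
    _ ≤ ∑ i, ENNReal.ofReal (D.weight (1 + |ρ|) K i) * (4 *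
        energy (μH[1].restrict (frontier K.carrier ∩ phase Ω₁ i)) (evalAt (r K i))) := by
        refine Finset.sum_le_sum fun i _ => mul_le_mul_right ?_ _
        exact_mod_cast sum_energy_le_of_multiplicity S sideSet
          (fun e _ => measurableSet_sideSet e) hn (evalAt_continuous _).measurable
    _ = _ := by
        rw [Finset.mul_sum]
        exact Finset.sum_congr rfl fun i _ => by ring

theorem energy_le_add_of_sq_le {μ : Measure Plane} {f g h : Plane → ℝ} (hg : Measurable g)
    (hle : ∀ x, f x ^ 2 ≤ g x ^ 2 + h x ^ 2) : energy μ f ≤ energy μ g + energy μ h := by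
  rw [energy, energy, energy, ← lintegral_add_left (by fun_prop)]
  refine lintegral_mono fun x => ?_
  rw [← ENNReal.ofReal_add (sq_nonneg _) (sq_nonneg _)]
  exact ENNReal.ofReal_le_ofReal (hle x)

/-- The flux is one of the two traces, so the choice of `β` leaves no mark on the constants. -/
theorem sq_combination_le {β : ℝ} (hβ : β = 0 ∨ β = 1) (a b : ℝ) :
    (β * a + (1 - β) * b) ^ 2 ≤ a ^ 2 + b ^ 2 := by
  rcases hβ with rfl | rfl <;> nlinarith [sq_nonneg a, sq_nonneg b]

open Classical in
theorem Admissible.multiplicity_le (hD : D.Admissible δ₀ σ ρ) (K : Rect) (x : Plane) :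
    ((D.sides.filter fun e => e.1 = K).filter fun e => x ∈ sideSet e).card ≤ 4 ∧
    ((D.sides.filter fun e => e.2 = K).filter fun e => x ∈ sideSet e).card ≤ 4 := by
  constructor
  · refine le_trans (Finset.card_le_card_of_injOn Prod.snd ?_ ?_)
      (card_closure_le_four hD.mesh.disjoint x)
    · intro e he
      simp only [Finset.coe_filter, Finset.mem_filter, Set.mem_ofPred_eq] at he ⊢
      exact ⟨(hD.sides.1 e he.1.1).2.1, frontier_subset_closure he.2.2⟩
    · intro e he e' he' h
      simp only [Finset.coe_filter, Finset.mem_filter, Set.mem_ofPred_eq] at he he'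
      exact Prod.ext (he.1.2.trans he'.1.2.symm) h
  · refine le_trans (Finset.card_le_card_of_injOn Prod.fst ?_ ?_)
      (card_closure_le_four hD.mesh.disjoint x)
    · intro e he
      simp only [Finset.coe_filter, Finset.mem_filter, Set.mem_ofPred_eq] at he ⊢
      exact ⟨(hD.sides.1 e he.1.1).1, frontier_subset_closure he.2.1⟩
    · intro e he e' he' h
      simp only [Finset.coe_filter, Finset.mem_filter, Set.mem_ofPred_eq] at he he'
      exact Prod.ext h (he.1.2.trans he'.1.2.symm)

/-- The fluxes on the sides. -/
theorem Admissible.energy_fluxSide_le (hD : D.Admissible δ₀ σ ρ) (hU : IsOpen Ω₁)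
    (hδ : 0 < δ₀) (hα : 0 < α₀) (r : Broken) :
    ∑ e ∈ D.sides, ENNReal.ofReal (D.αSide e)⁻¹ *
        energy (μH[1].restrict (sideSet e)) (D.fluxSide r e) ≤
      8 * ∑ K ∈ D.mesh, ∑ i, ENNReal.ofReal (D.weight (1 + |ρ|) K i) *
        energy (μH[1].restrict (frontier K.carrier ∩ phase Ω₁ i)) (evalAt (r K i)) := by
  classical
  set G : Rect → Rect × Rect → ℝ≥0∞ := fun K e => ENNReal.ofReal (D.αSide e)⁻¹ *
    energy (μH[1].restrict (sideSet e)) (traceFrom Ω₁ r K) with hG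
  set Y : Rect → ℝ≥0∞ := fun K => ∑ i, ENNReal.ofReal (D.weight (1 + |ρ|) K i) *
    energy (μH[1].restrict (frontier K.carrier ∩ phase Ω₁ i)) (evalAt (r K i)) with hY
  have h1 : ∑ e ∈ D.sides, G e.1 e ≤ ∑ K ∈ D.mesh, 4 * Y K := by
    rw [← Finset.sum_fiberwise_of_maps_to (g := Prod.fst) (t := D.mesh)
      fun e he => (hD.sides.1 e he).1]
    refine Finset.sum_le_sum fun K hK => ?_
    refine le_trans (le_of_eq (Finset.sum_congr rfl fun e he => ?_)) (hD.sum_sides_le hU hδ hα hK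
      (S := D.sides.filter fun e => e.1 = K) (fun e he => ?_) (fun x => (hD.multiplicity_le K x).1) r)
    · rw [(Finset.mem_filter.1 he).2]
    · obtain ⟨he', rfl⟩ := Finset.mem_filter.1 he
      exact ⟨Set.inter_subset_left, (hD.side_size_le he').1⟩
  have h2 : ∑ e ∈ D.sides, G e.2 e ≤ ∑ K ∈ D.mesh, 4 * Y K := by
    rw [← Finset.sum_fiberwise_of_maps_to (g := Prod.snd) (t := D.mesh)
      fun e he => (hD.sides.1 e he).2.1]
    refine Finset.sum_le_sum fun K hK => ?_
    refine le_trans (le_of_eq (Finset.sum_congr rfl fun e he => ?_)) (hD.sum_sides_le hU hδ hα hK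
      (S := D.sides.filter fun e => e.2 = K) (fun e he => ?_) (fun x => (hD.multiplicity_le K x).2) r)
    · rw [(Finset.mem_filter.1 he).2]
    · obtain ⟨he', rfl⟩ := Finset.mem_filter.1 he
      exact ⟨Set.inter_subset_right, (hD.side_size_le he').2⟩
  calc _ ≤ ∑ e ∈ D.sides, (G e.1 e + G e.2 e) := by
        refine Finset.sum_le_sum fun e he => ?_
        rw [hG, ← mul_add]
        exact mul_le_mul_right (energy_le_add_of_sq_le (isLocBdd_traceFrom _ _ _).measurable
          fun x => sq_combination_le (hD.βside e he) _ _) _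
    _ ≤ ∑ K ∈ D.mesh, 4 * Y K + ∑ K ∈ D.mesh, 4 * Y K := by
        rw [Finset.sum_add_distrib]; exact add_le_add h1 h2
    _ = _ := by rw [← Finset.mul_sum, ← add_mul]; norm_num

/-- All the fluxes, by the traces of one function. -/
def fluxEnergy (D : Scheme Ω Ω₁ α₀) (r : Broken) : ℝ≥0∞ :=
  ∑ e ∈ D.sides, ENNReal.ofReal (D.αSide e)⁻¹ *
      energy (μH[1].restrict (sideSet e)) (D.fluxSide r e) +
    ∑ K ∈ D.mesh, ENNReal.ofReal (D.αInt K)⁻¹ *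
      energy (μH[1].restrict (D.intSet K)) (D.fluxInt r K) +
    ∑ K ∈ D.mesh, ENNReal.ofReal (D.αBdy K)⁻¹ *
      energy (μH[1].restrict (D.bdySet K)) (traceFrom Ω₁ r K)

theorem Admissible.fluxEnergy_le_trace (hD : D.Admissible δ₀ σ ρ) (hU : IsOpen Ω₁)
    (hδ : 0 < δ₀) (hα : 0 < α₀) (r : Broken) :
    D.fluxEnergy r ≤ 10 * ∑ K ∈ D.mesh, ∑ i, ENNReal.ofReal (D.weight (1 + |ρ|) K i) *
        energy (μH[1].restrict (phaseBoundary Ω₁ K i)) (evalAt (r K i)) := by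
  set Z := ∑ K ∈ D.mesh, ∑ i, ENNReal.ofReal (D.weight (1 + |ρ|) K i) *
        energy (μH[1].restrict (phaseBoundary Ω₁ K i)) (evalAt (r K i)) with hZ
  have hdiam : ∀ K : Rect, K.diam ≤ (1 + |ρ|) * K.diam := fun K => by
    nlinarith [K.diam_pos, abs_nonneg ρ]
  have hmono : ∀ K i, energy (μH[1].restrict (frontier K.carrier ∩ phase Ω₁ i)) (evalAt (r K i)) ≤
      energy (μH[1].restrict (phaseBoundary Ω₁ K i)) (evalAt (r K i)) :=
    fun K i => energy_mono_set Set.subset_union_left _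
  have h1 : ∑ e ∈ D.sides, ENNReal.ofReal (D.αSide e)⁻¹ *
      energy (μH[1].restrict (sideSet e)) (D.fluxSide r e) ≤ 8 * Z :=
    (hD.energy_fluxSide_le hU hδ hα r).trans (mul_le_mul_right (Finset.sum_le_sum fun K _ =>
      Finset.sum_le_sum fun i _ => mul_le_mul_right (hmono K i) _) _)
  have h2 : ∑ K ∈ D.mesh, ENNReal.ofReal (D.αInt K)⁻¹ *
      energy (μH[1].restrict (D.intSet K)) (D.fluxInt r K) ≤ Z := by
    refine Finset.sum_le_sum fun K hK => ?_
    rcases (D.intSet K).eq_empty_or_nonempty with h0 | ⟨x, hx⟩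
    · rw [h0, energy_eq_zero_of_null measure_empty]; simp
    · have hint : IsInterfaceElement Ω₁ K := ⟨x, hx.2, hx.1⟩
      have hw : ∀ i, (D.αInt K)⁻¹ ≤ D.weight (1 + |ρ|) K i := fun i =>
        hD.inv_penalty_le hδ hα hK ⟨x, hx, subset_closure hx.2⟩ K.diam_pos (by positivity)
          (hdiam K) (hD.half_le_aElt hU (Or.inl hint))
      refine (mul_le_mul_right (energy_le_add_of_sq_le (evalAt_continuous (r K 0)).measurable
          (h := evalAt (r K 1)) fun x => sq_combination_le (hD.βint K hK) _ _) _).trans ?_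
      rw [mul_add, Fin.sum_univ_two]
      exact add_le_add (mul_le_mul' (ENNReal.ofReal_le_ofReal (hw 0))
        (energy_mono_set Set.subset_union_right _)) (mul_le_mul' (ENNReal.ofReal_le_ofReal (hw 1))
        (energy_mono_set Set.subset_union_right _))
  have h3 : ∑ K ∈ D.mesh, ENNReal.ofReal (D.αBdy K)⁻¹ *
      energy (μH[1].restrict (D.bdySet K)) (traceFrom Ω₁ r K) ≤ Z := by
    refine Finset.sum_le_sum fun K hK => ?_
    refine (hD.inv_penalty_mul_energy_le hU hδ hα hK (e := D.bdySet K) Set.inter_subset_left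
      (D.measurableSet_bdySet K) K.diam_pos (hdiam K) r).trans ?_
    exact Finset.sum_le_sum fun i _ => mul_le_mul_right
      ((energy_mono_set Set.inter_subset_right _).trans (hmono K i)) _
  calc D.fluxEnergy r ≤ 8 * Z + Z + Z := add_le_add (add_le_add h1 h2) h3
    _ = 10 * Z := by ring

/-- The sum of the energies over the phases of the elements, with weights `1 / a_i`. -/
def inverseEnergy (D : Scheme Ω Ω₁ α₀) (r : Broken) : ℝ≥0∞ :=
  ∑ K ∈ D.mesh, ∑ i, ENNReal.ofReal (D.a i)⁻¹ *
    energy (volume.restrict (K.carrier ∩ subdomain Ω Ω₁ i)) (evalAt (r K i))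

end Scheme

/-- The fluxes are controlled by the energy inside the elements. -/
theorem exists_fluxEnergy_le {Ω Ω₁ : Set Plane} (hΩ : Bornology.IsBounded Ω)
    (hΩ₁ : IsLipschitzDomain Ω₁) (hsub : Ω₁ ⊆ Ω) {δ₀ : ℝ} (hδ₀ : δ₀ ∈ Set.Ioo (0 : ℝ) (1 / 2))
    {α₀ : ℝ} (hα₀ : 0 < α₀) (σ ρ : ℝ) :
    ∃ A > 0, ∀ D : Scheme Ω Ω₁ α₀, D.Admissible δ₀ σ ρ → ∀ r : Broken, InX D.mesh D.p r →
      D.fluxEnergy r ≤ ENNReal.ofReal A * D.inverseEnergy r := by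
  -- All elements lie in `Ω`, which bounds their diameters; adding `1` keeps the bound positive.
  obtain ⟨A, hA, htr⟩ := hΩ₁.exists_trace (isGoodParam hδ₀ σ) (H := Metric.diam Ω + 1)
    (by have := Metric.diam_nonneg (s := Ω); linarith)
  refine ⟨10 * (2 * (1 + |ρ|) / α₀ * A), by positivity, fun D hD r hr => ?_⟩
  refine (hD.fluxEnergy_le_trace hΩ₁.isOpen hδ₀.1 hα₀ r).trans ?_
  rw [ENNReal.ofReal_mul (by norm_num), show ENNReal.ofReal 10 = 10 by norm_num, mul_assoc]
  refine mul_le_mul_right ?_ _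
  rw [Scheme.inverseEnergy, Finset.mul_sum]
  refine Finset.sum_le_sum fun K hK => ?_
  rw [Finset.mul_sum]
  refine Finset.sum_le_sum fun i _ => ?_
  have hKΩ := hD.mesh.subset K hK
  have hKH : K.diam ≤ Metric.diam Ω + 1 := by
    have := Metric.diam_mono hKΩ hΩ
    unfold Rect.diam; linarith
  refine (mul_le_mul_right (htr Ω K i hsub hKΩ (hD.mesh.aspect_max hK)
    (fun hint => hD.mesh.isGoodElement hΩ₁.isOpen hsub hK hint) hKH D.p hD.one_le_p (r K i)
    (hr K hK i)) _).trans ?_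
  have hd := K.diam_pos
  have h3 := hD.mesh.one_le_deviationFactor hδ₀.1 hK D.p
  have hp : 0 < D.p := hD.one_le_p
  have hai := hD.a_pos i
  rw [← mul_assoc, ← mul_assoc, ← ENNReal.ofReal_mul (by unfold Scheme.weight; positivity),
    ← ENNReal.ofReal_mul (by positivity)]
  -- The penalty is designed for this identity: the deviation factor, `p²` and the diameter in the
  -- weight cancel those in the trace inequality, and `1 / a_i` times a fixed constant is left.
  refine mul_le_mul_left (ENNReal.ofReal_le_ofReal (le_of_eq ?_)) _
  unfold Scheme.weight
  field_simp

end
end UnfittedLDG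

/-! ### The right-hand side of the definition of the lifting -/

namespace UnfittedLDG
noncomputable section
open scoped ENNReal NNReal Topology

/-- Young's inequality for one edge. -/
theorem setIntegral_flux_le {μ : Measure Plane} {E : Set Plane} (hE : Bornology.IsBounded E)
    (hm : MeasurableSet E) (hμ : μ E < ⊤) {f n : Fin 2 → Plane → ℝ} {g : Plane → ℝ}
    (hf : ∀ j, IsLocBdd (f j)) (hn : ∀ j, IsLocBdd (n j)) (hn1 : ∀ j x, |n j x| ≤ 1)
    (hg : IsLocBdd g) {c α : ℝ} (hc : 0 < c) (hα : E.Nonempty → 0 < α) :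
    ∫ x in E, (∑ j, f j x * n j x) * g x ∂μ ≤
      ∑ j, c⁻¹ * (α⁻¹ * ∫ x in E, f j x ^ 2 ∂μ) + c / 2 * (α * ∫ x in E, g x * g x ∂μ) := by
  -- For an empty edge the maxima in the penalty are taken over no elements and vanish by
  -- convention, so positivity of `α` is available on nonempty edges only.
  rcases E.eq_empty_or_nonempty with rfl | hne
  · simp
  have hα := hα hne
  have i1 : IntegrableOn (fun x => (∑ j, f j x * n j x) * g x) E μ :=
    ((IsLocBdd.sum fun j _ => (hf j).mul (hn j)).mul hg).integrableOn hE hm hμ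
  have i2 : ∀ j, IntegrableOn (fun x => f j x ^ 2) E μ := fun j => (hf j).sq.integrableOn hE hm hμ
  have i3 : IntegrableOn (fun x => g x * g x) E μ := (hg.mul hg).integrableOn hE hm hμ
  have h1 : ∫ x in E, (∑ j, f j x * n j x) * g x ∂μ ≤
      ∫ x in E, (c * α)⁻¹ * f 0 x ^ 2 + (c * α)⁻¹ * f 1 x ^ 2 + c * α / 2 * (g x * g x) ∂μ := by
    refine setIntegral_mono i1 ((((i2 0).const_mul _).add ((i2 1).const_mul _)).add
      (i3.const_mul _)) fun x => ?_
    simp only [Fin.sum_univ_two]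
    set lam := c * α with hlam
    have hl : 0 < lam := by positivity
    have b : ∀ j, (f j x * n j x) ^ 2 ≤ f j x ^ 2 := fun j => by
      rw [mul_pow]
      have := (sq_le_one_iff_abs_le_one _).2 (hn1 j x)
      nlinarith [sq_nonneg (f j x)]
    have b0 := b 0
    have b1 := b 1
    set u := f 0 x * n 0 x
    set w := f 1 x * n 1 x
    have key : (u + w) * g x ≤ lam⁻¹ * (u ^ 2 + w ^ 2) + lam / 2 * (g x * g x) := by
      have h2 : 0 ≤ (2 * lam)⁻¹ * ((u + w) - lam * g x) ^ 2 + (2 * lam)⁻¹ * (u - w) ^ 2 := by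
        positivity
      have h3 : (2 * lam)⁻¹ * ((u + w) - lam * g x) ^ 2 + (2 * lam)⁻¹ * (u - w) ^ 2 =
          lam⁻¹ * (u ^ 2 + w ^ 2) + lam / 2 * (g x * g x) - (u + w) * g x := by
        field_simp; ring
      linarith
    have h4 : lam⁻¹ * (u ^ 2 + w ^ 2) ≤ lam⁻¹ * (f 0 x ^ 2 + f 1 x ^ 2) := by gcongr
    linarith
  refine h1.trans (le_of_eq ?_)
  rw [integral_add (f := fun x => (c * α)⁻¹ * f 0 x ^ 2 + (c * α)⁻¹ * f 1 x ^ 2) (((i2 0).const_mul _).add ((i2 1).const_mul _)) (i3.const_mul _),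
    integral_add ((i2 0).const_mul _) ((i2 1).const_mul _), integral_const_mul, integral_const_mul,
    integral_const_mul, Fin.sum_univ_two, mul_inv]
  ring

namespace Scheme

variable {Ω Ω₁ : Set Plane} {α₀ : ℝ} {D : Scheme Ω Ω₁ α₀} {δ₀ σ ρ : ℝ}

theorem isLocBdd_fluxSide (D : Scheme Ω Ω₁ α₀) (r : Broken) (e : Rect × Rect) :
    IsLocBdd (D.fluxSide r e) :=
  ((IsLocBdd.const _).mul (isLocBdd_traceFrom _ _ _)).add
    ((IsLocBdd.const _).mul (isLocBdd_traceFrom _ _ _))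

theorem isLocBdd_fluxInt (D : Scheme Ω Ω₁ α₀) (r : Broken) (K : Rect) :
    IsLocBdd (D.fluxInt r K) :=
  ((IsLocBdd.const _).mul (isLocBdd_evalAt _)).add ((IsLocBdd.const _).mul (isLocBdd_evalAt _))

theorem isLocBdd_jumpSide (D : Scheme Ω Ω₁ α₀) (v : Broken) (e : Rect × Rect) :
    IsLocBdd (D.jumpSide v e) :=
  (isLocBdd_traceFrom _ _ _).sub (isLocBdd_traceFrom _ _ _)

theorem isLocBdd_jumpInt (D : Scheme Ω Ω₁ α₀) (v : Broken) (K : Rect) :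
    IsLocBdd (D.jumpInt v K) :=
  (isLocBdd_evalAt _).sub (isLocBdd_evalAt _)

theorem isBounded_sideSet (e : Rect × Rect) : Bornology.IsBounded (sideSet e) :=
  e.1.isBounded_frontier.subset Set.inter_subset_left

theorem measure_sideSet_lt_top (e : Rect × Rect) : μH[1] (sideSet e) < ⊤ :=
  (measure_mono Set.inter_subset_left).trans_lt e.1.hausdorffMeasure_frontier_lt_top

theorem isBounded_intSet (D : Scheme Ω Ω₁ α₀) (K : Rect) : Bornology.IsBounded (D.intSet K) :=
  K.isBounded_carrier.subset Set.inter_subset_right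

theorem measure_intSet_lt_top (D : Scheme Ω Ω₁ α₀) (h : IsLipschitzDomain Ω₁) (K : Rect) :
    μH[1] (D.intSet K) < ⊤ :=
  (measure_mono Set.inter_subset_left).trans_lt h.hausdorffMeasure_frontier_lt_top

theorem isBounded_bdySet (D : Scheme Ω Ω₁ α₀) (K : Rect) : Bornology.IsBounded (D.bdySet K) :=
  K.isBounded_frontier.subset Set.inter_subset_left

theorem measure_bdySet_lt_top (D : Scheme Ω Ω₁ α₀) (K : Rect) : μH[1] (D.bdySet K) < ⊤ :=
  (measure_mono Set.inter_subset_left).trans_lt K.hausdorffMeasure_frontier_lt_top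

theorem isBounded_piece (Ω Ω₁ : Set Plane) (K : Rect) (i : Fin 2) :
    Bornology.IsBounded (K.carrier ∩ subdomain Ω Ω₁ i) :=
  K.isBounded_carrier.subset Set.inter_subset_left

theorem volume_piece_lt_top (Ω Ω₁ : Set Plane) (K : Rect) (i : Fin 2) :
    volume (K.carrier ∩ subdomain Ω Ω₁ i) < ⊤ := (isBounded_piece Ω Ω₁ K i).measure_lt_top

theorem measurableSet_piece {Ω Ω₁ : Set Plane} (hΩ : IsOpen Ω) (h : IsOpen Ω₁) (hsub : Ω₁ ⊆ Ω)
    (K : Rect) (i : Fin 2) : MeasurableSet (K.carrier ∩ subdomain Ω Ω₁ i) := by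
  rw [subdomain_eq hsub]
  exact (K.isOpen_carrier.inter (hΩ.inter (isOpen_phase h i))).measurableSet

theorem Admissible.penalty_nonneg (hD : D.Admissible δ₀ σ ρ) (hδ : 0 < δ₀) (hα : 0 < α₀)
    (e : Set Plane) {h : ℝ} (h0 : 0 ≤ h) : 0 ≤ D.penalty e h := by
  have h1 : 0 ≤ D.maxNear D.aElt e := Real.sSup_nonneg (by
    rintro _ ⟨K, -, -, rfl⟩; exact (hD.aElt_pos K).le)
  have h2 : 0 ≤ D.maxNear D.thetaElt e := Real.sSup_nonneg (by
    rintro _ ⟨K, hK, -, rfl⟩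
    rw [thetaElt_eq]
    exact zero_le_one.trans (hD.mesh.one_le_deviationFactor hδ hK D.p))
  unfold penalty
  positivity

theorem Admissible.αSide_nonneg (hD : D.Admissible δ₀ σ ρ) (hδ : 0 < δ₀) (hα : 0 < α₀)
    (e : Rect × Rect) : 0 ≤ D.αSide e :=
  hD.penalty_nonneg hδ hα _ (by have := e.1.diam_pos; have := e.2.diam_pos; positivity)

theorem Admissible.αSide_pos (hD : D.Admissible δ₀ σ ρ) (hδ : 0 < δ₀) (hα : 0 < α₀)
    {e : Rect × Rect} (he : e ∈ D.sides) : 0 < D.αSide e := by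
  obtain ⟨x, hx⟩ := hD.sideSet_nonempty he
  exact hD.penalty_pos hδ hα (hD.sides.1 e he).1 ⟨x, hx, frontier_subset_closure hx.1⟩
    (by have := e.1.diam_pos; have := e.2.diam_pos; positivity)

theorem Admissible.αInt_pos (hD : D.Admissible δ₀ σ ρ) (hδ : 0 < δ₀) (hα : 0 < α₀)
    {K : Rect} (hK : K ∈ D.mesh) (h : (D.intSet K).Nonempty) : 0 < D.αInt K := by
  obtain ⟨x, hx⟩ := h
  exact hD.penalty_pos hδ hα hK ⟨x, hx, subset_closure hx.2⟩ K.diam_pos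

theorem Admissible.αBdy_pos (hD : D.Admissible δ₀ σ ρ) (hδ : 0 < δ₀) (hα : 0 < α₀)
    {K : Rect} (hK : K ∈ D.mesh) (h : (D.bdySet K).Nonempty) : 0 < D.αBdy K := by
  obtain ⟨x, hx⟩ := h
  exact hD.penalty_pos hδ hα hK ⟨x, hx, frontier_subset_closure hx.1⟩ K.diam_pos

/-- The weighted norm of the fluxes of `r`, squared. -/
def fluxNormSq (D : Scheme Ω Ω₁ α₀) (r : Broken) : ℝ :=
  ∑ e ∈ D.sides, (D.αSide e)⁻¹ * (∫ x in sideSet e, D.fluxSide r e x ^ 2 ∂μH[1]) +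
    ∑ K ∈ D.mesh, (D.αInt K)⁻¹ * (∫ x in D.intSet K, D.fluxInt r K x ^ 2 ∂μH[1]) +
    ∑ K ∈ D.mesh, (D.αBdy K)⁻¹ * (∫ x in D.bdySet K, traceFrom Ω₁ r K x ^ 2 ∂μH[1])

/-- The sum over the phases of the elements of the squared norms of `r`, with weights `1 / a_i`. -/
def inverseNormSq (D : Scheme Ω Ω₁ α₀) (r : Broken) : ℝ :=
  ∑ K ∈ D.mesh, ∑ i, (D.a i)⁻¹ *
    ∫ x in K.carrier ∩ subdomain Ω Ω₁ i, evalAt (r K i) x ^ 2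

theorem Admissible.ofReal_fluxNormSq (hD : D.Admissible δ₀ σ ρ) (hδ : 0 < δ₀) (hα : 0 < α₀)
    (hΩ₁ : IsLipschitzDomain Ω₁) (r : Broken) :
    ENNReal.ofReal (D.fluxNormSq r) = D.fluxEnergy r := by
  have n1 : ∀ e ∈ D.sides,
      0 ≤ (D.αSide e)⁻¹ * (∫ x in sideSet e, D.fluxSide r e x ^ 2 ∂μH[1]) := fun e _ =>
    mul_nonneg (inv_nonneg.2 (hD.αSide_nonneg hδ hα e)) (integral_nonneg fun _ => sq_nonneg _)
  have n2 : ∀ K ∈ D.mesh,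
      0 ≤ (D.αInt K)⁻¹ * (∫ x in D.intSet K, D.fluxInt r K x ^ 2 ∂μH[1]) := fun K _ =>
    mul_nonneg (inv_nonneg.2 (hD.penalty_nonneg hδ hα _ K.diam_pos.le))
      (integral_nonneg fun _ => sq_nonneg _)
  have n3 : ∀ K ∈ D.mesh,
      0 ≤ (D.αBdy K)⁻¹ * (∫ x in D.bdySet K, traceFrom Ω₁ r K x ^ 2 ∂μH[1]) := fun K _ =>
    mul_nonneg (inv_nonneg.2 (hD.penalty_nonneg hδ hα _ K.diam_pos.le))
      (integral_nonneg fun _ => sq_nonneg _)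
  rw [fluxNormSq, fluxEnergy, ENNReal.ofReal_add (add_nonneg (Finset.sum_nonneg n1)
    (Finset.sum_nonneg n2)) (Finset.sum_nonneg n3), ENNReal.ofReal_add (Finset.sum_nonneg n1)
    (Finset.sum_nonneg n2), ENNReal.ofReal_sum_of_nonneg n1, ENNReal.ofReal_sum_of_nonneg n2,
    ENNReal.ofReal_sum_of_nonneg n3]
  congr 1
  · congr 1
    · refine Finset.sum_congr rfl fun e _ => ?_
      rw [ENNReal.ofReal_mul (inv_nonneg.2 (hD.αSide_nonneg hδ hα e)),
        ofReal_integral_sq (D.isLocBdd_fluxSide r e) (isBounded_sideSet e)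
          (measurableSet_sideSet e) (measure_sideSet_lt_top e)]
    · refine Finset.sum_congr rfl fun K _ => ?_
      rw [ENNReal.ofReal_mul (show 0 ≤ (D.αInt K)⁻¹ from
          inv_nonneg.2 (hD.penalty_nonneg hδ hα _ K.diam_pos.le)),
        ofReal_integral_sq (D.isLocBdd_fluxInt r K) (D.isBounded_intSet K)
          (D.measurableSet_intSet K) (D.measure_intSet_lt_top hΩ₁ K)]
  · refine Finset.sum_congr rfl fun K _ => ?_
    rw [ENNReal.ofReal_mul (show 0 ≤ (D.αBdy K)⁻¹ from
        inv_nonneg.2 (hD.penalty_nonneg hδ hα _ K.diam_pos.le)),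
      ofReal_integral_sq (isLocBdd_traceFrom _ r K) (D.isBounded_bdySet K)
        (D.measurableSet_bdySet K) (D.measure_bdySet_lt_top K)]

theorem Admissible.inverseNormSq_nonneg (hD : D.Admissible δ₀ σ ρ) (r : Broken) :
    0 ≤ D.inverseNormSq r :=
  Finset.sum_nonneg fun _ _ => Finset.sum_nonneg fun i _ =>
    mul_nonneg (inv_nonneg.2 (hD.a_pos i).le) (integral_nonneg fun _ => sq_nonneg _)

theorem Admissible.ofReal_inverseNormSq (hD : D.Admissible δ₀ σ ρ) (hΩ : IsOpen Ω)
    (hΩ₁ : IsOpen Ω₁) (hsub : Ω₁ ⊆ Ω) (r : Broken) :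
    ENNReal.ofReal (D.inverseNormSq r) = D.inverseEnergy r := by
  have n : ∀ K i, 0 ≤ (D.a i)⁻¹ * ∫ x in K.carrier ∩ subdomain Ω Ω₁ i, evalAt (r K i) x ^ 2 :=
    fun K i => mul_nonneg (inv_nonneg.2 (hD.a_pos i).le) (integral_nonneg fun _ => sq_nonneg _)
  rw [inverseNormSq, inverseEnergy, ENNReal.ofReal_sum_of_nonneg fun K _ =>
    Finset.sum_nonneg fun i _ => n K i]
  refine Finset.sum_congr rfl fun K _ => ?_
  rw [ENNReal.ofReal_sum_of_nonneg fun i _ => n K i]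
  refine Finset.sum_congr rfl fun i _ => ?_
  rw [ENNReal.ofReal_mul (inv_nonneg.2 (hD.a_pos i).le), ofReal_integral_sq (isLocBdd_evalAt _)
    (isBounded_piece Ω Ω₁ K i) (measurableSet_piece hΩ hΩ₁ hsub K i) (volume_piece_lt_top Ω Ω₁ K i)]

/-- The right-hand side of the definition of the lifting, by Young's inequality. -/
theorem Admissible.liftRHS_le_fluxNormSq (hD : D.Admissible δ₀ σ ρ) (hδ : 0 < δ₀) (hα : 0 < α₀)
    (hΩ₁ : IsLipschitzDomain Ω₁) (v : Broken) (r : Fin 2 → Broken) {c : ℝ} (hc : 0 < c) :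
    D.liftRHS v r ≤ c⁻¹ * ∑ j, D.fluxNormSq (r j) + c / 2 * D.jumpE v v := by
  have h1 : ∀ e ∈ D.sides, ∫ x in sideSet e,
      (∑ j, D.fluxSide (r j) e x * sideNormal e j) * D.jumpSide v e x ∂μH[1] ≤
      ∑ j, c⁻¹ * ((D.αSide e)⁻¹ * ∫ x in sideSet e, D.fluxSide (r j) e x ^ 2 ∂μH[1]) +
        c / 2 * (D.αSide e * ∫ x in sideSet e, D.jumpSide v e x * D.jumpSide v e x ∂μH[1]) :=
    fun e he => setIntegral_flux_le (n := fun j _ => sideNormal e j)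
      (isBounded_sideSet e) (measurableSet_sideSet e)
      (measure_sideSet_lt_top e) (fun j => D.isLocBdd_fluxSide (r j) e)
      (fun j => IsLocBdd.const _) (fun j _ => abs_sideNormal_le e j) (D.isLocBdd_jumpSide v e) hc
      fun _ => hD.αSide_pos hδ hα he
  have h2 : ∀ K ∈ D.mesh, ∫ x in D.intSet K,
      (∑ j, D.fluxInt (r j) K x * outerNormal Ω₁ x j) * D.jumpInt v K x ∂μH[1] ≤
      ∑ j, c⁻¹ * ((D.αInt K)⁻¹ * ∫ x in D.intSet K, D.fluxInt (r j) K x ^ 2 ∂μH[1]) +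
        c / 2 * (D.αInt K * ∫ x in D.intSet K, D.jumpInt v K x * D.jumpInt v K x ∂μH[1]) :=
    fun K hK => setIntegral_flux_le (n := fun j x => outerNormal Ω₁ x j)
      (D.isBounded_intSet K) (D.measurableSet_intSet K)
      (D.measure_intSet_lt_top hΩ₁ K) (fun j => D.isLocBdd_fluxInt (r j) K)
      (fun j => isLocBdd_outerNormal Ω₁ j) (fun j x => abs_outerNormal_le Ω₁ x j)
      (D.isLocBdd_jumpInt v K) hc fun h => hD.αInt_pos hδ hα hK h
  have h3 : ∀ K ∈ D.mesh, ∫ x in D.bdySet K,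
      (∑ j, traceFrom Ω₁ (r j) K x * outerNormal Ω x j) * traceFrom Ω₁ v K x ∂μH[1] ≤
      ∑ j, c⁻¹ * ((D.αBdy K)⁻¹ * ∫ x in D.bdySet K, traceFrom Ω₁ (r j) K x ^ 2 ∂μH[1]) +
        c / 2 * (D.αBdy K * ∫ x in D.bdySet K, traceFrom Ω₁ v K x * traceFrom Ω₁ v K x ∂μH[1]) :=
    fun K hK => setIntegral_flux_le (n := fun j x => outerNormal Ω x j)
      (D.isBounded_bdySet K) (D.measurableSet_bdySet K)
      (D.measure_bdySet_lt_top K) (fun j => isLocBdd_traceFrom _ (r j) K)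
      (fun j => isLocBdd_outerNormal Ω j) (fun j x => abs_outerNormal_le Ω x j)
      (isLocBdd_traceFrom _ v K) hc fun h => hD.αBdy_pos hδ hα hK h
  refine (add_le_add (add_le_add (Finset.sum_le_sum h1) (Finset.sum_le_sum h2))
    (Finset.sum_le_sum h3)).trans (le_of_eq ?_)
  simp only [Fin.sum_univ_two, Finset.sum_add_distrib]
  simp only [← Finset.mul_sum, fluxNormSq, jumpE, jumpIntBdy]
  ring

end Scheme

/-- The right-hand side of the definition of the lifting is bounded. -/
theorem exists_liftRHS_le {Ω Ω₁ : Set Plane} (hΩ : IsLipschitzDomain Ω)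
    (hΩ₁ : IsLipschitzDomain Ω₁) (hsub : Ω₁ ⊆ Ω) {δ₀ : ℝ} (hδ₀ : δ₀ ∈ Set.Ioo (0 : ℝ) (1 / 2))
    {α₀ : ℝ} (hα₀ : 0 < α₀) (σ ρ : ℝ) :
    ∃ A > 0, ∀ D : Scheme Ω Ω₁ α₀, D.Admissible δ₀ σ ρ → ∀ v : Broken, ∀ r : Fin 2 → Broken,
      (∀ j, InX D.mesh D.p (r j)) →
      D.liftRHS v r ≤ 1 / 2 * ∑ j, D.inverseNormSq (r j) + A / 2 * D.jumpE v v := by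
  obtain ⟨A, hA, h⟩ := exists_fluxEnergy_le hΩ.bounded hΩ₁ hsub hδ₀ hα₀ σ ρ
  -- Young's inequality with parameter `2 A` turns the flux bound into exactly half of the weighted
  -- energy of `r`; this half is absorbed when the lifting itself is the test function.
  refine ⟨2 * A, by positivity, fun D hD v r hr => ?_⟩
  have h1 : ∀ j, D.fluxNormSq (r j) ≤ A * D.inverseNormSq (r j) := fun j => by
    have h2 := h D hD (r j) (hr j)
    rw [← hD.ofReal_fluxNormSq hδ₀.1 hα₀ hΩ₁, ← hD.ofReal_inverseNormSq hΩ.isOpen hΩ₁.isOpen hsub,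
      ← ENNReal.ofReal_mul hA.le] at h2
    exact (ENNReal.ofReal_le_ofReal_iff (mul_nonneg hA.le (hD.inverseNormSq_nonneg _))).1 h2
  refine (hD.liftRHS_le_fluxNormSq hδ₀.1 hα₀ hΩ₁ v r (c := 2 * A) (by positivity)).trans
    (add_le_add_left ?_ _)
  calc (2 * A)⁻¹ * ∑ j, D.fluxNormSq (r j) ≤ (2 * A)⁻¹ * ∑ j, A * D.inverseNormSq (r j) := by
        gcongr with j
        exact h1 j
    _ = _ := by rw [← Finset.mul_sum]; field_simp

end
end UnfittedLDG

namespace UnfittedLDG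
noncomputable section
open scoped ENNReal NNReal Topology

/-! ### Linearity of the forms -/

theorem evalAt_add (p q : MvPolynomial (Fin 2) ℝ) (x : Plane) :
    evalAt (p + q) x = evalAt p x + evalAt q x := by simp [evalAt]

theorem evalAt_smul (t : ℝ) (q : MvPolynomial (Fin 2) ℝ) (x : Plane) :
    evalAt (t • q) x = t * evalAt q x := by simp [evalAt, MvPolynomial.smul_eval]

theorem traceFrom_add (U : Set Plane) (v w : Broken) (K : Rect) (x : Plane) :
    traceFrom U (v + w) K x = traceFrom U v K x + traceFrom U w K x := by
  unfold traceFrom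
  split_ifs <;> exact evalAt_add _ _ _

theorem traceFrom_smul (U : Set Plane) (t : ℝ) (v : Broken) (K : Rect) (x : Plane) :
    traceFrom U (t • v) K x = t * traceFrom U v K x := by
  unfold traceFrom
  split_ifs <;> exact evalAt_smul _ _ _

theorem setIntegral_flux_add {μ : Measure Plane} {E : Set Plane} (hE : Bornology.IsBounded E)
    (hm : MeasurableSet E) (hμ : μ E < ⊤) {f f' n : Fin 2 → Plane → ℝ} {g : Plane → ℝ}
    (hf : ∀ j, IsLocBdd (f j)) (hf' : ∀ j, IsLocBdd (f' j)) (hn : ∀ j, IsLocBdd (n j))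
    (hg : IsLocBdd g) :
    ∫ x in E, (∑ j, (f j x + f' j x) * n j x) * g x ∂μ =
      ∫ x in E, (∑ j, f j x * n j x) * g x ∂μ + ∫ x in E, (∑ j, f' j x * n j x) * g x ∂μ := by
  rw [← integral_add
    (((IsLocBdd.sum fun j _ => (hf j).mul (hn j)).mul hg).integrableOn hE hm hμ)
    (((IsLocBdd.sum fun j _ => (hf' j).mul (hn j)).mul hg).integrableOn hE hm hμ)]
  congr 1
  ext x
  rw [← add_mul, ← Finset.sum_add_distrib]
  simp only [add_mul]

theorem setIntegral_flux_smul {μ : Measure Plane} {E : Set Plane} (t : ℝ)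
    {f n : Fin 2 → Plane → ℝ} {g : Plane → ℝ} :
    ∫ x in E, (∑ j, t * f j x * n j x) * g x ∂μ =
      t * ∫ x in E, (∑ j, f j x * n j x) * g x ∂μ := by
  rw [← integral_const_mul]
  congr 1
  ext x
  rw [← mul_assoc, Finset.mul_sum]
  simp only [mul_assoc]

/-- A functional on a finite-dimensional space that vanishes on the isotropic vectors of a bilinear
form is represented by this form. -/
theorem exists_represents {V : Type*} [AddCommGroup V] [Module ℝ V] [FiniteDimensional ℝ V]
    (B : V →ₗ[ℝ] V →ₗ[ℝ] ℝ) (φ : V →ₗ[ℝ] ℝ) (h : ∀ x, B x x = 0 → φ x = 0) :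
    ∃ l, ∀ r, B r l = φ r := by
  have h1 : φ ∈ (LinearMap.ker B).dualAnnihilator := by
    rw [Submodule.mem_dualAnnihilator]
    intro x hx
    exact h x (by rw [LinearMap.mem_ker.1 hx]; rfl)
  rw [← LinearMap.range_dualMap_eq_dualAnnihilator_ker] at h1
  obtain ⟨ψ, hψ⟩ := h1
  refine ⟨(Module.evalEquiv ℝ V).symm ψ, fun r => ?_⟩
  rw [← hψ, LinearMap.dualMap_apply, Module.apply_evalEquiv_symm_apply]

namespace Scheme

variable {Ω Ω₁ : Set Plane} {α₀ : ℝ} {D : Scheme Ω Ω₁ α₀} {δ₀ σ ρ : ℝ}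

theorem fluxSide_add (D : Scheme Ω Ω₁ α₀) (r s : Broken) (e : Rect × Rect) (x : Plane) :
    D.fluxSide (r + s) e x = D.fluxSide r e x + D.fluxSide s e x := by
  simp only [fluxSide, traceFrom_add]; ring

theorem fluxSide_smul (D : Scheme Ω Ω₁ α₀) (t : ℝ) (r : Broken) (e : Rect × Rect) (x : Plane) :
    D.fluxSide (t • r) e x = t * D.fluxSide r e x := by
  simp only [fluxSide, traceFrom_smul]; ring

theorem fluxInt_add (D : Scheme Ω Ω₁ α₀) (r s : Broken) (K : Rect) (x : Plane) :
    D.fluxInt (r + s) K x = D.fluxInt r K x + D.fluxInt s K x := by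
  simp only [fluxInt, Pi.add_apply, evalAt_add]; ring

theorem fluxInt_smul (D : Scheme Ω Ω₁ α₀) (t : ℝ) (r : Broken) (K : Rect) (x : Plane) :
    D.fluxInt (t • r) K x = t * D.fluxInt r K x := by
  simp only [fluxInt, Pi.smul_apply, evalAt_smul]; ring

theorem liftRHS_add (D : Scheme Ω Ω₁ α₀) (hΩ₁ : IsLipschitzDomain Ω₁) (v : Broken)
    (r s : Fin 2 → Broken) : D.liftRHS v (r + s) = D.liftRHS v r + D.liftRHS v s := by
  have h1 : ∀ e ∈ D.sides, ∫ x in sideSet e,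
      (∑ j, D.fluxSide ((r + s) j) e x * sideNormal e j) * D.jumpSide v e x ∂μH[1] =
      ∫ x in sideSet e, (∑ j, D.fluxSide (r j) e x * sideNormal e j) * D.jumpSide v e x ∂μH[1] +
      ∫ x in sideSet e,
        (∑ j, D.fluxSide (s j) e x * sideNormal e j) * D.jumpSide v e x ∂μH[1] := fun e _ => by
    simp only [Pi.add_apply, fluxSide_add]
    exact setIntegral_flux_add (n := fun j _ => sideNormal e j) (isBounded_sideSet e)
      (measurableSet_sideSet e) (measure_sideSet_lt_top e) (fun j => D.isLocBdd_fluxSide (r j) e)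
      (fun j => D.isLocBdd_fluxSide (s j) e) (fun j => IsLocBdd.const _) (D.isLocBdd_jumpSide v e)
  have h2 : ∀ K ∈ D.mesh, ∫ x in D.intSet K,
      (∑ j, D.fluxInt ((r + s) j) K x * outerNormal Ω₁ x j) * D.jumpInt v K x ∂μH[1] =
      ∫ x in D.intSet K,
        (∑ j, D.fluxInt (r j) K x * outerNormal Ω₁ x j) * D.jumpInt v K x ∂μH[1] +
      ∫ x in D.intSet K,
        (∑ j, D.fluxInt (s j) K x * outerNormal Ω₁ x j) * D.jumpInt v K x ∂μH[1] := fun K _ => by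
    simp only [Pi.add_apply, fluxInt_add]
    exact setIntegral_flux_add (n := fun j x => outerNormal Ω₁ x j) (D.isBounded_intSet K)
      (D.measurableSet_intSet K) (D.measure_intSet_lt_top hΩ₁ K)
      (fun j => D.isLocBdd_fluxInt (r j) K) (fun j => D.isLocBdd_fluxInt (s j) K)
      (fun j => isLocBdd_outerNormal Ω₁ j) (D.isLocBdd_jumpInt v K)
  have h3 : ∀ K ∈ D.mesh, ∫ x in D.bdySet K,
      (∑ j, traceFrom Ω₁ ((r + s) j) K x * outerNormal Ω x j) * traceFrom Ω₁ v K x ∂μH[1] =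
      ∫ x in D.bdySet K,
        (∑ j, traceFrom Ω₁ (r j) K x * outerNormal Ω x j) * traceFrom Ω₁ v K x ∂μH[1] +
      ∫ x in D.bdySet K,
        (∑ j, traceFrom Ω₁ (s j) K x * outerNormal Ω x j) * traceFrom Ω₁ v K x ∂μH[1] :=
      fun K _ => by
    simp only [Pi.add_apply, traceFrom_add]
    exact setIntegral_flux_add (n := fun j x => outerNormal Ω x j) (D.isBounded_bdySet K)
      (D.measurableSet_bdySet K) (D.measure_bdySet_lt_top K)
      (fun j => isLocBdd_traceFrom _ (r j) K) (fun j => isLocBdd_traceFrom _ (s j) K)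
      (fun j => isLocBdd_outerNormal Ω j) (isLocBdd_traceFrom _ v K)
  unfold liftRHS
  rw [Finset.sum_congr rfl h1, Finset.sum_congr rfl h2, Finset.sum_congr rfl h3,
    Finset.sum_add_distrib, Finset.sum_add_distrib, Finset.sum_add_distrib]
  ring

theorem liftRHS_smul (D : Scheme Ω Ω₁ α₀) (v : Broken) (t : ℝ) (r : Fin 2 → Broken) :
    D.liftRHS v (t • r) = t * D.liftRHS v r := by
  unfold liftRHS
  simp only [fluxSide_smul, fluxInt_smul, traceFrom_smul,
    show ∀ j, (t • r) j = t • r j from fun _ => rfl, setIntegral_flux_smul]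
  simp only [mul_add, Finset.mul_sum]

theorem liftRHS_congr (hD : D.Admissible δ₀ σ ρ) (v : Broken) {r s : Fin 2 → Broken}
    (h : ∀ j, ∀ K ∈ D.mesh, ∀ i, r j K i = s j K i) : D.liftRHS v r = D.liftRHS v s := by
  have ht : ∀ j, ∀ K ∈ D.mesh, traceFrom Ω₁ (r j) K = traceFrom Ω₁ (s j) K := fun j K hK => by
    ext x; simp only [traceFrom, h j K hK]
  unfold liftRHS
  congr 1
  · congr 1
    · refine Finset.sum_congr rfl fun e he => ?_
      obtain ⟨h1, h2, -⟩ := hD.sides.1 e he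
      simp only [fluxSide, ht _ _ h1, ht _ _ h2]
    · refine Finset.sum_congr rfl fun K hK => ?_
      simp only [fluxInt, h _ K hK]
  · refine Finset.sum_congr rfl fun K hK => ?_
    simp only [ht _ K hK]

theorem bulk_comm (D : Scheme Ω Ω₁ α₀) (c : Fin 2 → ℝ) (r s : Fin 2 → Broken) :
    D.bulk c r s = D.bulk c s r := by
  unfold bulk
  refine Finset.sum_congr rfl fun K _ => Finset.sum_congr rfl fun i _ => ?_
  congr 2
  ext x
  exact Finset.sum_congr rfl fun j _ => mul_comm _ _

theorem bulk_congr (D : Scheme Ω Ω₁ α₀) (c : Fin 2 → ℝ) {r r' : Fin 2 → Broken}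
    (s : Fin 2 → Broken) (h : ∀ j, ∀ K ∈ D.mesh, ∀ i, r j K i = r' j K i) :
    D.bulk c r s = D.bulk c r' s := by
  unfold bulk
  refine Finset.sum_congr rfl fun K hK => ?_
  simp only [h _ K hK]

theorem integrableOn_bulk (hΩ : IsOpen Ω) (hΩ₁ : IsOpen Ω₁) (hsub : Ω₁ ⊆ Ω)
    (r s : Fin 2 → Broken) (K : Rect) (i : Fin 2) :
    IntegrableOn (fun x => ∑ j, evalAt (r j K i) x * evalAt (s j K i) x)
      (K.carrier ∩ subdomain Ω Ω₁ i) :=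
  (IsLocBdd.sum fun _ _ => (isLocBdd_evalAt _).mul (isLocBdd_evalAt _)).integrableOn
    (isBounded_piece Ω Ω₁ K i) (measurableSet_piece hΩ hΩ₁ hsub K i) (volume_piece_lt_top Ω Ω₁ K i)

theorem bulk_add_left (D : Scheme Ω Ω₁ α₀) (hΩ : IsOpen Ω) (hΩ₁ : IsOpen Ω₁) (hsub : Ω₁ ⊆ Ω)
    (c : Fin 2 → ℝ) (r r' s : Fin 2 → Broken) :
    D.bulk c (r + r') s = D.bulk c r s + D.bulk c r' s := by
  unfold bulk
  rw [← Finset.sum_add_distrib]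
  refine Finset.sum_congr rfl fun K _ => ?_
  rw [← Finset.sum_add_distrib]
  refine Finset.sum_congr rfl fun i _ => ?_
  rw [← mul_add, ← integral_add (integrableOn_bulk hΩ hΩ₁ hsub r s K i)
    (integrableOn_bulk hΩ hΩ₁ hsub r' s K i)]
  simp only [← Finset.sum_add_distrib, Pi.add_apply, evalAt_add, add_mul]

theorem bulk_smul_left (D : Scheme Ω Ω₁ α₀) (c : Fin 2 → ℝ) (t : ℝ) (r s : Fin 2 → Broken) :
    D.bulk c (t • r) s = t * D.bulk c r s := by
  unfold bulk
  rw [Finset.mul_sum]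
  refine Finset.sum_congr rfl fun K _ => ?_
  rw [Finset.mul_sum]
  refine Finset.sum_congr rfl fun i _ => ?_
  rw [mul_left_comm]
  congr 1
  rw [← integral_const_mul]
  simp only [Finset.mul_sum, Pi.smul_apply, evalAt_smul, mul_assoc]

theorem bulk_nonneg (D : Scheme Ω Ω₁ α₀) {c : Fin 2 → ℝ} (hc : ∀ i, 0 ≤ c i)
    (r : Fin 2 → Broken) : 0 ≤ D.bulk c r r :=
  Finset.sum_nonneg fun _ _ => Finset.sum_nonneg fun i _ => mul_nonneg (hc i)
    (integral_nonneg fun _ => Finset.sum_nonneg fun _ _ => mul_self_nonneg _)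

theorem sum_inverseNormSq (D : Scheme Ω Ω₁ α₀) (hΩ : IsOpen Ω) (hΩ₁ : IsOpen Ω₁) (hsub : Ω₁ ⊆ Ω)
    (r : Fin 2 → Broken) :
    ∑ j, D.inverseNormSq (r j) = D.bulk (fun i => (D.a i)⁻¹) r r := by
  unfold inverseNormSq bulk
  rw [Finset.sum_comm]
  refine Finset.sum_congr rfl fun K _ => ?_
  rw [Finset.sum_comm]
  refine Finset.sum_congr rfl fun i _ => ?_
  rw [integral_finsetSum _ fun j _ => ((isLocBdd_evalAt _).mul (isLocBdd_evalAt _)).integrableOn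
    (isBounded_piece Ω Ω₁ K i) (measurableSet_piece hΩ hΩ₁ hsub K i)
    (volume_piece_lt_top Ω Ω₁ K i), Finset.mul_sum]
  simp only [pow_two]

/-- A vector that is isotropic for the unweighted form is so for the weighted form. -/
theorem bulk_eq_zero (D : Scheme Ω Ω₁ α₀) {r : Fin 2 → Broken}
    (h : D.bulk (fun _ => 1) r r = 0) (c : Fin 2 → ℝ) : D.bulk c r r = 0 := by
  have hn : ∀ K i, 0 ≤ (1 : ℝ) * ∫ x in K.carrier ∩ subdomain Ω Ω₁ i,
      ∑ j, evalAt (r j K i) x * evalAt (r j K i) x := fun K i => mul_nonneg zero_le_one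
    (integral_nonneg fun _ => Finset.sum_nonneg fun _ _ => mul_self_nonneg _)
  unfold bulk at h ⊢
  rw [Finset.sum_eq_zero_iff_of_nonneg fun K _ => Finset.sum_nonneg fun i _ => hn K i] at h
  refine Finset.sum_eq_zero fun K hK => Finset.sum_eq_zero fun i _ => ?_
  have h1 := (Finset.sum_eq_zero_iff_of_nonneg fun i _ => hn K i).1 (h K hK) i (Finset.mem_univ i)
  rw [one_mul] at h1
  rw [h1, mul_zero]

/-! ### Existence of the lifting -/

/-- Coefficients of the discrete vector fields, a finite-dimensional space. -/
abbrev Fields (D : Scheme Ω Ω₁ α₀) : Type :=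
  Fin 2 → {K // K ∈ D.mesh} → Fin 2 → MvPolynomial.restrictDegree (Fin 2) ℝ D.p

open Classical in
/-- The discrete vector field with given coefficients. -/
def ofFields (D : Scheme Ω Ω₁ α₀) : D.Fields →ₗ[ℝ] (Fin 2 → Broken) where
  toFun x j K i := if h : K ∈ D.mesh then (x j ⟨K, h⟩ i : MvPolynomial (Fin 2) ℝ) else 0
  map_add' x y := by
    ext1 j; ext1 K; ext1 i
    by_cases h : K ∈ D.mesh <;> simp [h]
  map_smul' t x := by
    ext1 j; ext1 K; ext1 i
    by_cases h : K ∈ D.mesh <;> simp [h]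

theorem mem_restrictDegree_iff {q : MvPolynomial (Fin 2) ℝ} {p : ℕ} :
    q ∈ MvPolynomial.restrictDegree (Fin 2) ℝ p ↔ ∀ j, q.degreeOf j ≤ p := by
  rw [MvPolynomial.mem_restrictDegree]
  simp only [MvPolynomial.degreeOf_le_iff]
  exact ⟨fun h j s hs => h s hs j, fun h s hs j => h j s hs⟩

theorem inX_ofFields (D : Scheme Ω Ω₁ α₀) (x : D.Fields) (j : Fin 2) :
    InX D.mesh D.p (D.ofFields x j) := by
  intro K hK i
  have h : D.ofFields x j K i = (x j ⟨K, hK⟩ i : MvPolynomial (Fin 2) ℝ) := dif_pos hK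
  rw [h]
  exact mem_restrictDegree_iff.1 (x j ⟨K, hK⟩ i).2

theorem exists_ofFields (D : Scheme Ω Ω₁ α₀) {r : Fin 2 → Broken} (hr : ∀ j, InX D.mesh D.p (r j)) :
    ∃ x : D.Fields, ∀ j, ∀ K ∈ D.mesh, ∀ i, D.ofFields x j K i = r j K i :=
  ⟨fun j K i => ⟨r j K.1 i, mem_restrictDegree_iff.2 (hr j K.1 K.2 i)⟩, fun _ _ hK _ => dif_pos hK⟩

/-- A polynomial `v_i|_K` leaves no trace in the `L²` form when `K` does not meet `Ω_i`, so the form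
is only semidefinite on the coefficients. Along multiples `t r` of an isotropic vector the quadratic
term of the bound vanishes, and a linear function of `t` that is bounded above is zero. So the
functional vanishes on all isotropic vectors, and `exists_represents` applies. -/
theorem Admissible.exists_isLifting (hD : D.Admissible δ₀ σ ρ) (hΩ : IsLipschitzDomain Ω)
    (hΩ₁ : IsLipschitzDomain Ω₁) (hsub : Ω₁ ⊆ Ω) {A : ℝ} (v : Broken)
    (hA : ∀ r : Fin 2 → Broken, (∀ j, InX D.mesh D.p (r j)) →
      D.liftRHS v r ≤ 1 / 2 * ∑ j, D.inverseNormSq (r j) + A / 2 * D.jumpE v v) :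
    ∃ l, D.IsLifting v l := by
  have addl := D.bulk_add_left hΩ.isOpen hΩ₁.isOpen hsub fun _ => 1
  let B : D.Fields →ₗ[ℝ] D.Fields →ₗ[ℝ] ℝ := LinearMap.mk₂ ℝ
    (fun x y => D.bulk (fun _ => 1) (D.ofFields x) (D.ofFields y))
    (fun x x' y => by rw [map_add, addl]) (fun t x y => by rw [map_smul, bulk_smul_left]; rfl)
    (fun x y y' => by rw [map_add, bulk_comm, addl, bulk_comm, D.bulk_comm _ (D.ofFields y')])
    (fun t x y => by rw [map_smul, bulk_comm, bulk_smul_left, bulk_comm]; rfl)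
  let φ : D.Fields →ₗ[ℝ] ℝ :=
    { toFun := fun x => D.liftRHS v (D.ofFields x)
      map_add' := fun x y => by rw [map_add, D.liftRHS_add hΩ₁]
      map_smul' := fun t x => by rw [map_smul, liftRHS_smul]; rfl }
  have hφ : ∀ x, B x x = 0 → φ x = 0 := by
    intro x hx
    by_contra hne
    have h1 : ∀ t : ℝ, t * φ x ≤ A / 2 * D.jumpE v v := fun t => by
      have h2 := hA (D.ofFields (t • x)) (D.inX_ofFields _)
      have h3 : D.bulk (fun _ => 1) (D.ofFields (t • x)) (D.ofFields (t • x)) = 0 := by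
        rw [map_smul, bulk_smul_left, bulk_comm, bulk_smul_left]
        rw [show D.bulk (fun _ => 1) (D.ofFields x) (D.ofFields x) = 0 from hx]; ring
      rw [D.sum_inverseNormSq hΩ.isOpen hΩ₁.isOpen hsub, D.bulk_eq_zero h3, mul_zero, zero_add,
        map_smul, liftRHS_smul] at h2
      exact h2
    have h4 := h1 ((A / 2 * D.jumpE v v + 1) / φ x)
    rw [div_mul_cancel₀ _ hne] at h4
    linarith
  obtain ⟨l, hl⟩ := exists_represents B φ hφ
  refine ⟨D.ofFields l, D.inX_ofFields l, fun r hr => ?_⟩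
  obtain ⟨x, hx⟩ := D.exists_ofFields hr
  rw [← D.bulk_congr _ _ hx, ← liftRHS_congr hD v hx]
  exact hl x

/-- The lifting is bounded by the jumps. -/
theorem Admissible.bulk_lifting_le (hD : D.Admissible δ₀ σ ρ) (hΩ : IsLipschitzDomain Ω)
    (hΩ₁ : IsLipschitzDomain Ω₁) (hsub : Ω₁ ⊆ Ω) {A : ℝ} {v : Broken}
    (hA : ∀ r : Fin 2 → Broken, (∀ j, InX D.mesh D.p (r j)) →
      D.liftRHS v r ≤ 1 / 2 * ∑ j, D.inverseNormSq (r j) + A / 2 * D.jumpE v v)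
    {l : Fin 2 → Broken} (hl : D.IsLifting v l) : D.bulk D.a l l ≤ A * D.jumpE v v := by
  -- The test field `a L(v)` is admissible because `a` is constant on each phase. Both the left-hand
  -- side and the weighted energy of this field equal `‖a^{1/2} L(v)‖²`.
  set r : Fin 2 → Broken := fun j K i => D.a i • l j K i with hr
  have hrX : ∀ j, InX D.mesh D.p (r j) := fun j K hK i =>
    mem_restrictDegree_iff.1 (Submodule.smul_mem _ _ (mem_restrictDegree_iff.2 (hl.1 j K hK i)))
  have h1 : D.bulk (fun _ => 1) r l = D.bulk D.a l l := by
    unfold bulk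
    refine Finset.sum_congr rfl fun K _ => Finset.sum_congr rfl fun i _ => ?_
    rw [one_mul, ← integral_const_mul]
    simp only [hr, evalAt_smul, Finset.mul_sum, mul_assoc]
  have h2 : D.bulk (fun i => (D.a i)⁻¹) r r = D.bulk D.a l l := by
    unfold bulk
    refine Finset.sum_congr rfl fun K _ => Finset.sum_congr rfl fun i _ => ?_
    rw [← integral_const_mul, ← integral_const_mul]
    congr 1
    ext x
    rw [Finset.mul_sum, Finset.mul_sum]
    refine Finset.sum_congr rfl fun j _ => ?_
    have := (hD.a_pos i).ne'
    simp only [hr, evalAt_smul]; field_simp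
  have h3 := hA r hrX
  rw [← hl.2 r hrX, h1, D.sum_inverseNormSq hΩ.isOpen hΩ₁.isOpen hsub, h2] at h3
  linarith

/-! ### Coercivity -/

open Classical in
/-- On a side, the jumps of the traces are jumps of the polynomials of the two phases. -/
theorem Admissible.integral_jumpSide_le (hD : D.Admissible δ₀ σ ρ) (hΩ₁ : IsOpen Ω₁)
    (hsub : Ω₁ ⊆ Ω) (v : Broken) {e : Rect × Rect} (he : e ∈ D.sides) :
    ∫ x in sideSet e, D.jumpSide v e x * D.jumpSide v e x ∂μH[1] ≤
      ∑ i, if (e.1.carrier ∩ subdomain Ω Ω₁ i).Nonempty ∧ (e.2.carrier ∩ subdomain Ω Ω₁ i).Nonempty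
        then ∫ x in sideSet e, (evalAt (v e.1 i) x - evalAt (v e.2 i) x) *
          (evalAt (v e.1 i) x - evalAt (v e.2 i) x) ∂μH[1] else 0 := by
  obtain ⟨h1, h2, -⟩ := hD.sides.1 e he
  have hb := isBounded_sideSet e
  have hm := measurableSet_sideSet e
  have hf := measure_sideSet_lt_top e
  simp only [← pow_two]
  have hnn : ∀ i, 0 ≤ (if (e.1.carrier ∩ subdomain Ω Ω₁ i).Nonempty ∧
      (e.2.carrier ∩ subdomain Ω Ω₁ i).Nonempty
        then ∫ x in sideSet e, (evalAt (v e.1 i) x - evalAt (v e.2 i) x) ^ 2 ∂μH[1] else 0) := by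
    intro i
    split_ifs
    exacts [integral_nonneg fun _ => sq_nonneg _, le_rfl]
  rw [← ENNReal.ofReal_le_ofReal_iff (Finset.sum_nonneg fun i _ => hnn i),
    ENNReal.ofReal_sum_of_nonneg fun i _ => hnn i,
    ofReal_integral_sq (D.isLocBdd_jumpSide v e) hb hm hf]
  refine (energy_le_sum_phase hΩ₁ hm (measure_mono_null (Set.inter_subset_inter_right _
    Set.inter_subset_left) (hD.mesh.interface_skeleton _ h1))
    (g := fun i x => evalAt (v e.1 i) x - evalAt (v e.2 i) x) fun i x _ hx => ?_).trans
    (Finset.sum_le_sum fun i _ => ?_)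
  · simp only [jumpSide, traceFrom_of_mem_phase v _ hx]
  · rcases (sideSet e ∩ phase Ω₁ i).eq_empty_or_nonempty with h0 | ⟨x, hx, hxi⟩
    · rw [h0, energy_eq_zero_of_null measure_empty]; exact zero_le
    · have hne : ∀ K ∈ D.mesh, x ∈ frontier K.carrier →
          (K.carrier ∩ subdomain Ω Ω₁ i).Nonempty := fun K hK hxK => by
        obtain ⟨y, hy, hyK⟩ := mem_closure_iff.1 (frontier_subset_closure hxK) _
          (isOpen_phase hΩ₁ i) hxi
        rw [subdomain_eq hsub]
        exact ⟨y, hyK, hD.mesh.subset K hK hyK, hy⟩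
      rw [if_pos ⟨hne _ h1 hx.1, hne _ h2 hx.2⟩,
        ofReal_integral_sq ((isLocBdd_evalAt _).sub (isLocBdd_evalAt _)) hb hm hf]
      exact energy_mono_set Set.inter_subset_left _

theorem Admissible.jumpE_le_jumpEbar (hD : D.Admissible δ₀ σ ρ) (hδ : 0 < δ₀) (hα : 0 < α₀)
    (hΩ₁ : IsOpen Ω₁) (hsub : Ω₁ ⊆ Ω) (v : Broken) : D.jumpE v v ≤ D.jumpEbar v v := by
  unfold jumpE jumpEbar
  refine add_le_add_left ?_ _
  simp only [Finset.sum_filter]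
  rw [Finset.sum_comm]
  refine Finset.sum_le_sum fun e he => ?_
  refine (mul_le_mul_of_nonneg_left (hD.integral_jumpSide_le hΩ₁ hsub v he)
    (hD.αSide_nonneg hδ hα e)).trans (le_of_eq ?_)
  rw [Finset.mul_sum]
  exact Finset.sum_congr rfl fun i _ => by rw [mul_ite, mul_zero]

theorem Admissible.jumpE_nonneg (hD : D.Admissible δ₀ σ ρ) (hδ : 0 < δ₀) (hα : 0 < α₀)
    (v : Broken) : 0 ≤ D.jumpE v v := by
  unfold jumpE jumpIntBdy
  refine add_nonneg (Finset.sum_nonneg fun e _ => mul_nonneg (hD.αSide_nonneg hδ hα e)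
    (integral_nonneg fun _ => mul_self_nonneg _)) (add_nonneg ?_ ?_) <;>
  exact Finset.sum_nonneg fun K _ => mul_nonneg (hD.penalty_nonneg hδ hα _ K.diam_pos.le)
    (integral_nonneg fun _ => mul_self_nonneg _)

/-- With `X = ‖a^{1/2}(∇v - L)‖²`, `Z = ‖a^{1/2} L‖²` and `J` the jump term, Young's inequality with
`s = 3 + c²` gives `‖a^{1/2} ∇v‖² ≤ (1 + s) X + (1 + s⁻¹) Z`. As `Z ≤ c² J ≤ s J`, the DG norm
squared is at most `(4 + c²) X + (c² + 2) J`. -/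
theorem Admissible.coercive (hD : D.Admissible δ₀ σ ρ) (hδ : 0 < δ₀) (hα : 0 < α₀)
    (hΩ : IsOpen Ω) (hΩ₁ : IsOpen Ω₁) (hsub : Ω₁ ⊆ Ω) {v : Broken} {c : ℝ}
    (h : D.bulk D.a (D.lifting v) (D.lifting v) ≤ c ^ 2 * D.jumpE v v) :
    (4 + c ^ 2)⁻¹ * D.normDGsq v ≤ D.ah v v := by
  have hJ0 := hD.jumpE_nonneg hδ hα v
  have hJ := hD.jumpE_le_jumpEbar hδ hα hΩ₁ hsub v
  unfold ah normDGsq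
  set l := D.lifting v
  set u := grad v - l with hu
  have hg : grad v = u + l := by rw [hu]; abel
  have addl := D.bulk_add_left hΩ hΩ₁ hsub D.a
  set s := 3 + c ^ 2 with hs
  have hs3 : 3 ≤ s := by nlinarith [sq_nonneg c]
  have e1 : D.bulk D.a (grad v) (grad v) =
      D.bulk D.a u u + 2 * D.bulk D.a u l + D.bulk D.a l l := by
    rw [hg, addl, D.bulk_comm _ u, D.bulk_comm _ l, addl, addl, D.bulk_comm _ l u]; ring
  have e2 : 0 ≤ s ^ 2 * D.bulk D.a u u - 2 * s * D.bulk D.a u l + D.bulk D.a l l := by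
    -- Young's inequality for the mixed term, from the square of `s u - l`.
    have h0 := D.bulk_nonneg (fun i => (hD.a_pos i).le) (s • u + (-1 : ℝ) • l)
    rw [addl, bulk_smul_left, bulk_smul_left, D.bulk_comm _ u, D.bulk_comm _ l, addl, addl,
      bulk_smul_left, bulk_smul_left, bulk_smul_left, bulk_smul_left, D.bulk_comm _ l u] at h0
    linarith
  have hu0 := D.bulk_nonneg (fun i => (hD.a_pos i).le) u
  set X := D.bulk D.a u u
  set Y := D.bulk D.a u l
  set Z := D.bulk D.a l l
  set J := D.jumpEbar v v
  have hZ : Z ≤ c ^ 2 * J := h.trans (mul_le_mul_of_nonneg_left hJ (sq_nonneg c))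
  have hJ1 : 0 ≤ J := hJ0.trans hJ
  rw [e1, inv_mul_le_iff₀ (by positivity)]
  have e3 : 2 * Y ≤ s * X + s⁻¹ * Z := by
    have : 0 ≤ s⁻¹ * (s ^ 2 * X - 2 * s * Y + Z) := by positivity
    have e4 : s⁻¹ * (s ^ 2 * X - 2 * s * Y + Z) = s * X - 2 * Y + s⁻¹ * Z := by
      field_simp
    linarith
  have e5 : s⁻¹ * Z ≤ J := by
    rw [inv_mul_le_iff₀ (by linarith)]
    nlinarith
  nlinarith

end Scheme

end
end UnfittedLDG

theorem theorem2p1 (Ω Ω₁ : Set Plane) (hΩ : IsLipschitzDomain Ω) (hΩ₁ : IsPiecewiseC2Domain Ω₁)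
    (hsub : closure Ω₁ ⊆ Ω) (δ₀ : ℝ) (hδ₀ : δ₀ ∈ Set.Ioo (0 : ℝ) (1 / 2))
    (α₀ : ℝ) (hα₀ : 0 < α₀) (σ ρ : ℝ) :
    ∃ cL : ℝ, 0 < cL ∧ ∀ D : Scheme Ω Ω₁ α₀, D.Admissible δ₀ σ ρ →
      ∀ v : Broken, InX D.mesh D.p v →
        D.IsLifting v (D.lifting v) ∧
        Real.sqrt (D.bulk D.a (D.lifting v) (D.lifting v)) ≤ cL * Real.sqrt (D.jumpE v v) ∧
        (4 + cL ^ 2)⁻¹ * D.normDGsq v ≤ D.ah v v := by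
  have hL := hΩ₁.isLipschitzDomain
  have hsub' : Ω₁ ⊆ Ω := subset_closure.trans hsub
  obtain ⟨A, hA, h⟩ := exists_liftRHS_le hΩ hL hsub' hδ₀ hα₀ σ ρ
  -- The bound for the lifting is obtained for squares, with constant `A`, which was fixed before
  -- the scheme.
  refine ⟨Real.sqrt A, Real.sqrt_pos.2 hA, fun D hD v _ => ?_⟩
  have hlift : D.IsLifting v (D.lifting v) :=
    Classical.epsilon_spec (hD.exists_isLifting hΩ hL hsub' v (h D hD v))
  have hb := hD.bulk_lifting_le hΩ hL hsub' (h D hD v) hlift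
  refine ⟨hlift, ?_, hD.coercive hδ₀.1 hα₀ hΩ.isOpen hL.isOpen hsub' ?_⟩
  · rw [← Real.sqrt_mul hA.le]
    exact Real.sqrt_le_sqrt hb
  · rwa [Real.sq_sqrt hA.le]
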